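/- Let $M$ be a smooth (Hausdorff, second countable, finite-dimensional) manifold, $n\ge 0$, and let $q_V\colon V\to M$, $A_1,\dots,A_n\to M$, $C_1,\dots,C_n\to M$ be smooth real vector bundles of finite rank. Put $\mathcal A=A_1[1]\oplus\dots\oplus A_n[n]$ and $\underline C=C_1[1]\oplus\dots\oplus C_n[n]$, and let $(\underline D,V,\mathcal A,M)$ be the decomposed graded double vector bundle with core $\underline C$: $\underline D=D_1[1]\oplus\dots\oplus D_n[n]\to V$, where $D_i=V\times_M A_i\times_M C_i=q_V^!(A_i\oplus C_i)$. *Conventions.* The functions on $\mathcal A$ and $\underline D$ are the graded commutative algebras $C^\infty(\mathcal A)=\Gamma(\underline S(\mathcal A^*))$ over $C^\infty(M)$ and $C^\infty(\underline D)=\Gamma_V(\underline S(\underline D^*))$ over $C^\infty(V)$, where sections of $A_i^*$ and of $D_i^*$ have degree $i$; $\pi_{\mathcal A}^\star\colon C^\infty(\mathcal A)\to C^\infty(\underline D)$ is the pullback along the projection $\underline D\to\mathcal A$. A *homological vector field*, or *split Lie $n$-algebroid structure*, is a derivation $Q$ of degree $1$ with $Q^2=0$. The vector field $Q_{\underline D}$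 determines the anchor $\rho_D\colon D_1\to TV$, the bundle maps $\partial\colon D_i\to D_{i-1}$ (the $1$-brackets) and the multibrackets on $\Gamma_V(\underline D)$, as iterated graded commutators of $Q_{\underline D}$ with contractions by sections. A section $\delta\in\Gamma_V(D_i)$ is *linear* if it is of the form $\delta(v)=(a(m),\varphi_m(v))$ for $v\in V_m$, with $a\in\Gamma(A_i)$ and $\varphi_m\colon V_m\to (C_i)_m$ linear, and it is a *core section* if $\delta(v)=(0,c(m))$ with $c\in\Gamma(C_i)$. A *VB-Lie $n$-algebroid structure* on $(\underline D,V,\mathcal A,M)$ is a homological vector field $Q_{\underline D}$ on $\underline D$ such that 1. the anchor $\rho_D\colon D_1\to TV$ is a morphism of double vector bundles $(D_1,V,A_1,M)\to(TV,V,TM,M)$ over $\mathrm{id}_V$; 2. for all $i$, $\partial\colon D_i\to D_{i-1}$ is a morphism of double vector bundles $(D_i,V,A_i,M)\to(D_{i-1},V,A_{i-1},M)$ over $\mathrm{id}_V$; 3. the $j$-bracket of $j$ linear sections is linear, the $j$-bracket of $j-1$ linear sections and one core section is a core section, and the $j$-bracket of $j-k$ linear sections and $k$ core sections vanishes if $j\ge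 k\ge 2$. Let $\mathcal E=V[0]\oplus C_1[1]\oplus\dots\oplus C_n[n]$ and $\mathcal E^*=V^*[0]\oplus C_1^*[-1]\oplus\dots\oplus C_n^*[-n]$; thus sections of $C_j$ have degree $-j$ and sections of $C_j^*$ have degree $j$. For a homological vector field $Q_{\mathcal A}$ on $\mathcal A$, a *representation up to homotopy* of $(\mathcal A,Q_{\mathcal A})$ on $\mathcal E$ (with $n+1$ terms) is an $\mathbb R$-linear operator $\mathcal D$ of degree $1$ on $C^\infty(\mathcal A)\otimes_{C^\infty(M)}\Gamma(\mathcal E)$ with $\mathcal D(\xi\eta)=Q_{\mathcal A}(\xi)\eta+(-1)^{|\xi|}\xi\,\mathcal D\eta$ and $\mathcal D^2=0$; similarly on $\mathcal E^*$. The dual of $\mathcal D$ is the representation up to homotopy $\mathcal D^*$ on $\mathcal E^*$ with $Q_{\mathcal A}\langle\psi,\eta\rangle=\langle\mathcal D^*\psi,\eta\rangle+(-1)^{|\psi|}\langle\psi,\mathcal D\eta\rangle$. Let $\mathrm{lin}\colon C^\infty(\mathcal A)\otimes\Gamma(\mathcal E^*)\to C^\infty(\underline D)$ be the inclusion of the linear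 functions, $\mathrm{lin}(\xi\otimes\psi)=\pi_{\mathcal A}^\star(\xi)\,\ell_\psi$ for $\psi\in\Gamma(V^*)$, where $\ell_\psi\in C^\infty(V)$ is the fibrewise linear function defined by $\psi$, and $\mathrm{lin}(\xi\otimes\gamma)=\pi_{\mathcal A}^\star(\xi)\,q_V^!\gamma$ for $\gamma\in\Gamma(C_i^*)$. **Theorem.** (a) For every VB-Lie $n$-algebroid structure $Q_{\underline D}$ on $(\underline D,V,\mathcal A,M)$ there is a unique homological vector field $Q_{\mathcal A}$ on $\mathcal A$ with $Q_{\underline D}\circ\pi_{\mathcal A}^\star=\pi_{\mathcal A}^\star\circ Q_{\mathcal A}$. (b) For every homological vector field $Q_{\mathcal A}$ on $\mathcal A$ there is a bijection between the VB-Lie $n$-algebroid structures $Q_{\underline D}$ on $(\underline D,V,\mathcal A,M)$ with $Q_{\underline D}\circ\pi_{\mathcal A}^\star=\pi_{\mathcal A}^\star\circ Q_{\mathcal A}$ and the $(n+1)$-term representations up to homotopy $\mathcal D$ of $(\mathcal A,Q_{\mathcal A})$ on $V[0]\oplus C_1[1]\oplus\dots\oplus C_n[n]$. It is given by restricting $Q_{\underline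 D}$ to the linear functions: $\mathcal D$ has a dual $\mathcal D^*$ with $Q_{\underline D}\circ\mathrm{lin}=\mathrm{lin}\circ\mathcal D^*$; in particular $\mathcal D^*\psi=Q_{\underline D}(\ell_\psi)$ for $\psi\in\Gamma(V^*)$ and $\mathcal D^*\gamma=Q_{\underline D}(\gamma)$ for $\gamma\in\Gamma(C_i^*)$. -/

import Mathlib

open scoped Manifold ContDiff Bundle TensorProduct
open Bundle

noncomputable section

/-! ## Graded symmetric algebras over a commutative ring -/

namespace GSym

variable {ι : Type*} [DecidableEq ι] (R : Type*) [CommRing R] (N : ι → Type*)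
  [∀ i, AddCommGroup (N i)] [∀ i, Module R (N i)] (d : ι → ℕ)

/-- The generator of the tensor algebra of `⨁ i, N i` given by `a : N i`. -/
def tgen (i : ι) (a : N i) : TensorAlgebra R (Π i, N i) :=
  TensorAlgebra.ι R (Pi.single i a)

/-- Graded commutativity `a b = (-1)^{|a||b|} b a` of the generators, where the elements of `N i`
have degree `d i`. -/
inductive Rel : TensorAlgebra R (Π i, N i) → TensorAlgebra R (Π i, N i) → Prop
  | swap (i j : ι) (a : N i) (b : N j) :
      Rel (tgen R N i a * tgen R N j b) ((-1 : R) ^ (d i * d j) • (tgen R N j b * tgen R N i a))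

end GSym

/-- The graded symmetric algebra over `R` of the graded module `⨁ i, N i` (`i` in a finite index
type), the elements of `N i` being of degree `d i`.  (In the presence of `1/2 ∈ R` the relations
imply `a * a = 0` for `a` of odd degree.) -/
def GSym {ι : Type*} [DecidableEq ι] (R : Type*) [CommRing R] (N : ι → Type*)
    [∀ i, AddCommGroup (N i)] [∀ i, Module R (N i)] (d : ι → ℕ) : Type _ :=
  RingQuot (GSym.Rel R N d)

namespace GSym

variable {ι : Type*} [DecidableEq ι] (R : Type*) [CommRing R] (N : ι → Type*)
  [∀ i, AddCommGroup (N i)] [∀ i, Module R (N i)] (d : ι → ℕ)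

instance : Ring (GSym R N d) := inferInstanceAs (Ring (RingQuot (Rel R N d)))

instance instAlg : Algebra R (GSym R N d) := inferInstanceAs (Algebra R (RingQuot (Rel R N d)))

section Real

variable [Algebra ℝ R] [∀ i, Module ℝ (N i)] [∀ i, IsScalarTower ℝ R (N i)]

instance instAlgReal : Algebra ℝ (GSym R N d) :=
  inferInstanceAs (Algebra ℝ (RingQuot (Rel R N d)))

instance : IsScalarTower ℝ R (GSym R N d) :=
  inferInstanceAs (IsScalarTower ℝ R (RingQuot (Rel R N d)))

end Real

variable {N}

/-- The inclusion of `N i` into the graded symmetric algebra. -/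
def gen (i : ι) : N i →ₗ[R] GSym R N d :=
  (RingQuot.mkAlgHom R (Rel R N d)).toLinearMap ∘ₗ
    (TensorAlgebra.ι R (M := Π i, N i)) ∘ₗ LinearMap.single R N i

variable {R} in
/-- The universal property: linear maps `f i : N i → T` into an `R`-algebra whose values commute in
the graded sense extend to the graded symmetric algebra. -/
def lift [Fintype ι] {T : Type*} [Ring T] [Algebra R T] (f : ∀ i, N i →ₗ[R] T)
    (hf : ∀ i j a b, f i a * f j b = (-1 : R) ^ (d i * d j) • (f j b * f i a)) :
    GSym R N d →ₐ[R] T :=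
  RingQuot.liftAlgHom R ⟨TensorAlgebra.lift R (∑ i, f i ∘ₗ LinearMap.proj i), by
    have key : ∀ i a, TensorAlgebra.lift R (∑ i, f i ∘ₗ LinearMap.proj i) (tgen R N i a)
        = f i a := by
      intro i a
      simp only [tgen, TensorAlgebra.lift_ι_apply, LinearMap.sum_apply, LinearMap.comp_apply,
        LinearMap.proj_apply]
      rw [Finset.sum_eq_single i]
      · simp
      · intro j _ hj
        simp [Pi.single_eq_of_ne hj]
      · simp
    rintro _ _ ⟨i, j, a, b⟩
    simp only [map_mul, map_smul, key, hf i j a b]⟩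

theorem lift_gen [Fintype ι] {T : Type*} [Ring T] [Algebra R T] (f : ∀ i, N i →ₗ[R] T)
    (hf : ∀ i j a b, f i a * f j b = (-1 : R) ^ (d i * d j) • (f j b * f i a)) (i : ι) (a : N i) :
    lift d f hf (gen R d i a) = f i a := by
  simp only [lift, gen]
  erw [RingQuot.liftAlgHom_mkAlgHom_apply]
  simp only [TensorAlgebra.lift_ι_apply, LinearMap.sum_apply, LinearMap.comp_apply,
    LinearMap.proj_apply, LinearMap.single_apply]
  rw [Finset.sum_eq_single i]
  · simp
  · intro j _ hj
    simp [Pi.single_eq_of_ne hj]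
  · simp

theorem gen_mul_gen (i j : ι) (a : N i) (b : N j) :
    gen R d i a * gen R d j b = (-1 : R) ^ (d i * d j) • (gen R d j b * gen R d i a) := by
  have h := RingQuot.mkAlgHom_rel R (Rel.swap (R := R) (N := N) (d := d) i j a b)
  rw [map_mul, map_smul, map_mul] at h
  exact h

variable (N)

/-- The elements of degree `k`: `R`-linear combinations of products of generators of total
degree `k`. -/
def grade (k : ℕ) : Submodule R (GSym R N d) :=
  Submodule.span R {x | ∃ l : List (Σ i, N i), (l.map fun s => d s.1).sum = k ∧
    x = (l.map fun s => gen R d s.1 s.2).prod}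

variable {N}

section maps

variable [Fintype ι]

/-- The projection of the graded symmetric algebra onto its polynomial degree zero part `R`. -/
def body : GSym R N d →ₐ[R] R :=
  lift d (fun _ => 0) (by intros; simp)

/-- The algebra automorphism multiplying elements of degree `k` by `(-1)^(p k)`. -/
def twist (p : ℕ) : GSym R N d →ₐ[R] GSym R N d :=
  lift d (fun i => (-1 : R) ^ (p * d i) • gen R d i) (by
    intro i j a b
    simp only [LinearMap.smul_apply, smul_mul_smul_comm, gen_mul_gen R d i j a b, smul_smul]
    congr 1
    ring)

/-- The linear form on `N j` which is `φ` for `j = i` and zero otherwise. -/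
def extend (i : ι) (φ : N i →ₗ[R] R) (j : ι) : N j →ₗ[R] R :=
  φ ∘ₗ LinearMap.proj i ∘ₗ LinearMap.single R N j

/-- The algebra homomorphism `x ↦ !![(-1)^(|φ||x|) x, ι_φ x; 0, x]` which encodes the contraction
`ι_φ`. -/
def contractAux (i : ι) (φ : N i →ₗ[R] R) :
    GSym R N d →ₐ[R] Matrix (Fin 2) (Fin 2) (GSym R N d) :=
  lift d (fun j =>
    { toFun := fun a => !![(-1 : R) ^ (d i * d j) • gen R d j a,
          algebraMap R _ (extend R i φ j a); 0, gen R d j a]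
      map_add' := by
        intro a b
        ext x y; fin_cases x <;> fin_cases y <;> simp
      map_smul' := by
        intro r a
        ext x y; fin_cases x <;> fin_cases y <;> simp [smul_comm r, Algebra.smul_def r] }) (by
    intro j k a b
    have hjk := gen_mul_gen R d j k a b
    have e : ∀ m : ℕ, (-1 : R) ^ m * (-1) ^ m = 1 := by
      intro m
      rw [← mul_pow]; simp
    have h0 : ∀ (l : ι) (c : N l), l ≠ i → extend R i φ l c = 0 := by
      intro l c hl
      simp [extend, Pi.single_eq_of_ne hl.symm]
    ext x y
    fin_cases x <;> fin_cases y
    · simp only [LinearMap.coe_mk, AddHom.coe_mk, Matrix.mul_apply, Fin.sum_univ_two,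
        Matrix.smul_apply]
      simp only [Fin.zero_eta, Matrix.of_apply, Matrix.cons_val_zero, Matrix.cons_val_one,
        smul_mul_smul_comm, hjk, smul_smul, mul_zero, add_zero]
      congr 1; ring
    · simp only [LinearMap.coe_mk, AddHom.coe_mk, Matrix.mul_apply, Fin.sum_univ_two,
        Matrix.smul_apply]
      simp only [Fin.zero_eta, Fin.mk_one, Matrix.of_apply, Matrix.cons_val', Matrix.cons_val_zero,
        Matrix.cons_val_one, ← Algebra.commutes, ← Algebra.smul_def, smul_add, smul_smul]
      rw [add_comm]
      congr 1
      · by_cases hj : j = i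
        · subst hj
          rw [mul_left_comm, e, mul_one]
        · simp [h0 j a hj]
      · by_cases hk : k = i
        · subst hk
          rw [mul_comm, mul_comm (d j) (d k)]
        · simp [h0 k b hk]
    · simp [Matrix.mul_apply]
    · simpa [Matrix.mul_apply] using hjk)

/-- The contraction with a linear form `φ` on `N i`: the derivation of degree `-d i` which is `φ` on
`N i`, and zero on `R` and on `N j` for `j ≠ i`. -/
def contract (i : ι) (φ : N i →ₗ[R] R) : GSym R N d →ₗ[R] GSym R N d where
  toFun x := contractAux R d i φ x 0 1
  map_add' x y := by simp
  map_smul' r x := by simp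

theorem contract_algebraMap (i : ι) (φ : N i →ₗ[R] R) (r : R) :
    contract R d i φ (algebraMap R _ r) = 0 := by
  simp [contract, Matrix.algebraMap_matrix_apply]

theorem contract_gen (i : ι) (φ : N i →ₗ[R] R) (a : N i) :
    contract R d i φ (gen R d i a) = algebraMap R _ (φ a) := by
  simp [contract, contractAux, lift_gen, extend]

theorem contract_gen_of_ne (i j : ι) (h : j ≠ i) (φ : N i →ₗ[R] R) (a : N j) :
    contract R d i φ (gen R d j a) = 0 := by
  simp [contract, contractAux, lift_gen, extend, Pi.single_eq_of_ne h.symm]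

theorem mem_of_gen_mem (s : Subalgebra R (GSym R N d)) (hs : ∀ i a, gen R d i a ∈ s)
    (x : GSym R N d) : x ∈ s := by
  obtain ⟨y, rfl⟩ : ∃ y, RingQuot.mkAlgHom R (Rel R N d) y = x :=
    RingQuot.mkAlgHom_surjective R (Rel R N d) x
  induction y using TensorAlgebra.induction with
  | algebraMap r => rw [AlgHom.commutes]; exact s.algebraMap_mem r
  | ι m =>
    have hm : m = ∑ i, Pi.single i (m i) := (Finset.univ_sum_single m).symm
    rw [hm, map_sum, map_sum]
    exact s.sum_mem fun i _ => hs i (m i)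
  | mul a b ha hb => rw [map_mul]; exact s.mul_mem ha hb
  | add a b ha hb => rw [map_add]; exact s.add_mem ha hb

theorem contractAux_apply (i : ι) (φ : N i →ₗ[R] R) (x : GSym R N d) :
    contractAux R d i φ x 1 0 = 0 ∧ contractAux R d i φ x 1 1 = x := by
  let s : Subalgebra R (GSym R N d) :=
    { carrier := {x | contractAux R d i φ x 1 0 = 0 ∧ contractAux R d i φ x 1 1 = x}
      mul_mem' := by
        rintro a b ⟨ha, ha'⟩ ⟨hb, hb'⟩
        simp [Matrix.mul_apply, Fin.sum_univ_two, ha, ha', hb, hb']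
      add_mem' := by
        rintro a b ⟨ha, ha'⟩ ⟨hb, hb'⟩
        simp [ha, ha', hb, hb']
      algebraMap_mem' := by
        intro r
        simp [Matrix.algebraMap_matrix_apply] }
  exact mem_of_gen_mem R d s (fun j a => by simp [s, contractAux, lift_gen]) x

theorem contract_gen_mul (i j : ι) (φ : N i →ₗ[R] R) (a : N j) (x : GSym R N d) :
    contract R d i φ (gen R d j a * x) = contract R d i φ (gen R d j a) * x
      + (-1 : R) ^ (d i * d j) • (gen R d j a * contract R d i φ x) := by
  have h := (contractAux_apply R d i φ x).2
  have h2 : contractAux R d i φ (gen R d j a) 0 0 = (-1 : R) ^ (d i * d j) • gen R d j a := by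
    simp [contractAux, lift_gen]
  simp only [contract, LinearMap.coe_mk, AddHom.coe_mk, map_mul, Matrix.mul_apply,
    Fin.sum_univ_two, h, h2, smul_mul_assoc]
  rw [add_comm]

end maps
end GSym

namespace GSym

/-! ## Homological vector fields and representations up to homotopy -/

section Homological

variable {ι : Type*} [DecidableEq ι] {R : Type*} [CommRing R] {N : ι → Type*}
  [∀ i, AddCommGroup (N i)] [∀ i, Module R (N i)] {d : ι → ℕ}
  [Algebra ℝ R] [∀ i, Module ℝ (N i)] [∀ i, IsScalarTower ℝ R (N i)]

/-- `Q` is a derivation of degree `1` of the graded algebra with `Q ∘ Q = 0`. -/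
structure IsHomological (Q : GSym R N d →ₗ[ℝ] GSym R N d) : Prop where
  degree : ∀ k, ∀ x ∈ grade R N d k, Q x ∈ grade R N d (k + 1)
  leibniz : ∀ k, ∀ x ∈ grade R N d k, ∀ y, Q (x * y) = Q x * y + (-1 : ℝ) ^ k • (x * Q y)
  square : ∀ x, Q (Q x) = 0

variable {κ : Type*} [DecidableEq κ] {P : κ → Type*} [∀ j, AddCommGroup (P j)]
  [∀ j, Module R (P j)]

/-- The elements of degree `p` of the module `GSym R N d ⊗ ⨁ j, P j`, where the elements of `P j`
have degree `g j`. -/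
def moduleGrade (R : Type*) [CommRing R] (N : ι → Type*)
    [∀ i, AddCommGroup (N i)] [∀ i, Module R (N i)] (d : ι → ℕ) (P : κ → Type*)
    [∀ j, AddCommGroup (P j)] [∀ j, Module R (P j)] (g : κ → ℤ) (p : ℤ) :
    Submodule R (GSym R N d ⊗[R] (Π j, P j)) :=
  Submodule.span R {x | ∃ (k : ℕ) (j : κ) (ξ : GSym R N d) (e : P j), ξ ∈ grade R N d k ∧
    (k : ℤ) + g j = p ∧ x = ξ ⊗ₜ[R] (Pi.single j e : Π j, P j)}

/-- `D` is the differential of a representation up to homotopy over `(GSym R N d, Q)` on the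
graded module `⨁ j, P j`, the elements of `P j` having degree `g j`: a differential graded module
structure on `GSym R N d ⊗ ⨁ j, P j`. -/
structure IsRUTH (Q : GSym R N d →ₗ[ℝ] GSym R N d) (g : κ → ℤ)
    (D : (GSym R N d ⊗[R] (Π j, P j)) →ₗ[ℝ] (GSym R N d ⊗[R] (Π j, P j))) : Prop where
  degree : ∀ p, ∀ x ∈ moduleGrade R N d P g p, D x ∈ moduleGrade R N d P g (p + 1)
  leibniz : ∀ k, ∀ ξ ∈ grade R N d k, ∀ x, D (ξ • x) = Q ξ • x + (-1 : ℝ) ^ k • (ξ • D x)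
  square : ∀ x, D (D x) = 0

end Homological

section Pairing

variable {ι : Type*} [DecidableEq ι] [Fintype ι] {R : Type*} [CommRing R] {N : ι → Type*}
  [∀ i, AddCommGroup (N i)] [∀ i, Module R (N i)] (d : ι → ℕ)
  {κ : Type*} [Fintype κ] {P P' : κ → Type*} [∀ j, AddCommGroup (P j)] [∀ j, Module R (P j)]
  [∀ j, AddCommGroup (P' j)] [∀ j, Module R (P' j)]

/-- The `GSym R N d`-valued pairing induced by pairings `b j` of `P' j` (in degree `h j`) with
`P j` (in degree `-h j`), with the Koszul sign
`⟨ξ ⊗ ε, ζ ⊗ e⟩ = (-1)^(|ε||ζ|) ξ ζ ⟨ε, e⟩`. -/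
def pairing (h : κ → ℕ) (b : ∀ j, P' j →ₗ[R] P j →ₗ[R] R) :
    (GSym R N d ⊗[R] (Π j, P' j)) →ₗ[R] (GSym R N d ⊗[R] (Π j, P j)) →ₗ[R] GSym R N d :=
  TensorProduct.lift <| LinearMap.mk₂ R
    (fun ξ ε => TensorProduct.lift <| LinearMap.mk₂ R
      (fun ζ e => ∑ j, b j (ε j) (e j) • (ξ * twist R d (h j) ζ))
      (by intros; simp [mul_add, Finset.sum_add_distrib])
      (by
        intro c ζ e
        rw [Finset.smul_sum]
        exact Finset.sum_congr rfl fun j _ => by rw [map_smul, mul_smul_comm, smul_comm])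
      (by intros; simp [add_smul, Finset.sum_add_distrib])
      (by intros; simp [Finset.smul_sum, smul_smul]))
    (by intros; ext; simp [add_mul, Finset.sum_add_distrib])
    (by
      intro c ξ ε
      refine TensorProduct.ext' fun ζ e => ?_
      simp only [LinearMap.smul_apply, TensorProduct.lift.tmul, LinearMap.mk₂_apply]
      rw [Finset.smul_sum]
      exact Finset.sum_congr rfl fun j _ => by rw [smul_mul_assoc, smul_comm])
    (by intros; ext; simp [add_smul, Finset.sum_add_distrib])
    (by intros; ext; simp [Finset.smul_sum, smul_smul])

variable [DecidableEq κ] {d} [Algebra ℝ R] [∀ i, Module ℝ (N i)] [∀ i, IsScalarTower ℝ R (N i)]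

/-- `D'` is the differential dual to `D`:
`Q ⟨ψ, η⟩ = ⟨D' ψ, η⟩ + (-1)^|ψ| ⟨ψ, D η⟩`. -/
def IsDual (Q : GSym R N d →ₗ[ℝ] GSym R N d) (h : κ → ℕ) (b : ∀ j, P' j →ₗ[R] P j →ₗ[R] R)
    (D' : (GSym R N d ⊗[R] (Π j, P' j)) →ₗ[ℝ] (GSym R N d ⊗[R] (Π j, P' j)))
    (D : (GSym R N d ⊗[R] (Π j, P j)) →ₗ[ℝ] (GSym R N d ⊗[R] (Π j, P j))) : Prop :=
  ∀ (p : ℤ), ∀ ψ ∈ moduleGrade R N d P' (fun j => (h j : ℤ)) p, ∀ η,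
    Q (pairing d h b ψ η) = pairing d h b (D' ψ) η + p.negOnePow • pairing d h b ψ (D η)

end Pairing
end GSym

/-! ## Smooth vector bundles -/

section PullbackDual

variable {EB HB : Type*} [NormedAddCommGroup EB] [NormedSpace ℝ EB] [TopologicalSpace HB]
  {I : ModelWithCorners ℝ EB HB} {B : Type*} [TopologicalSpace B] [ChartedSpace HB B]
  {EB' HB' : Type*} [NormedAddCommGroup EB'] [NormedSpace ℝ EB'] [TopologicalSpace HB']
  {I' : ModelWithCorners ℝ EB' HB'} {B' : Type*} [TopologicalSpace B'] [ChartedSpace HB' B']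
  {F : Type*} [NormedAddCommGroup F] [NormedSpace ℝ F] {E : B → Type*}
  [∀ x, AddCommGroup (E x)] [∀ x, Module ℝ (E x)] [∀ x, TopologicalSpace (E x)]
  [TopologicalSpace (TotalSpace F E)] [FiberBundle F E] [VectorBundle ℝ F E]

/-- The group structure on the fibres of a pullback bundle. -/
abbrev pullbackFibGroup (f : B' → B) (y : B') : AddCommGroup ((f *ᵖ E) y) :=
  inferInstanceAs (AddCommGroup (E (f y)))

attribute [local instance] pullbackFibGroup

theorem contMDiff_pullback_dual (f : C^∞⟮I', B'; I, B⟯) (s : ∀ x, E x →L[ℝ] ℝ)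
    (hs : ContMDiff I (I.prod 𝓘(ℝ, F →L[ℝ] ℝ)) ∞
      (fun x => TotalSpace.mk' (F →L[ℝ] ℝ) (E := fun x => E x →L[ℝ] Bundle.Trivial B ℝ x) x (s x))) :
    ContMDiff I' (I'.prod 𝓘(ℝ, F →L[ℝ] ℝ)) ∞
      (fun y => TotalSpace.mk' (F →L[ℝ] ℝ)
        (E := fun y => ((f : B' → B) *ᵖ E) y →L[ℝ] Bundle.Trivial B' ℝ y) y (s (f y))) := by
  intro x
  have h := (contMDiffAt_hom_bundle _).1 ((hs.comp f.contMDiff) x)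
  refine (contMDiffAt_hom_bundle _).2 ⟨contMDiffAt_id, ?_⟩
  refine h.2.congr_of_eventuallyEq ?_
  let e := trivializationAt F E (f x)
  have hU : (f ⁻¹' e.baseSet) ∈ nhds x :=
    f.contMDiff.continuous.continuousAt.preimage_mem_nhds
      (e.open_baseSet.mem_nhds (FiberBundle.mem_baseSet_trivializationAt' (f x)))
  filter_upwards [hU] with y hy
  ext v
  have hv : (e.pullback f).symmL ℝ y v = (e.symmL ℝ (f y) v : E (f y)) := by
    rw [Trivialization.symmL_apply (R := ℝ) (e := e.pullback f) (b := y) hy,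
      Trivialization.symmL_apply (R := ℝ) (e := e) hy]
    have h2 := (e.pullback f).symm_apply_apply_mk (b := y) hy (e.symm (f y) v)
    have h3 : ((e.pullback f) ⟨y, e.symm (f y) v⟩).2 = v :=
      congrArg Prod.snd (e.apply_mk_symm hy v)
    rw [h3] at h2
    exact h2
  have ht (c c' : B') (t : ℝ) :
      (trivializationAt ℝ (Bundle.Trivial B' ℝ) c).continuousLinearMapAt ℝ c' t = t := by simp
  have ht' (c c' : B) (t : ℝ) :
      (trivializationAt ℝ (Bundle.Trivial B ℝ) c).continuousLinearMapAt ℝ c' t = t := by simp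
  have hl := ht x y (s (f y) ((e.pullback f).symmL ℝ y v))
  have hr := ht' (f x) (f y) (s (f y) (e.symmL ℝ (f y) v))
  exact hl.trans ((congrArg (s (f y)) hv).trans hr.symm)

end PullbackDual

/-- A smooth real vector bundle of finite rank over the manifold `B`, bundled. -/
structure SmoothVB.{u₁, u₂, u₃, w} {EB : Type u₁} {HB : Type u₂} [NormedAddCommGroup EB]
    [NormedSpace ℝ EB] [TopologicalSpace HB]
    (I : ModelWithCorners ℝ EB HB) (B : Type u₃) [TopologicalSpace B] [ChartedSpace HB B] where
  /-- The model fibre. -/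
  Model : Type w
  [normedAddCommGroup : NormedAddCommGroup Model]
  [normedSpace : NormedSpace ℝ Model]
  [finiteDimensional : FiniteDimensional ℝ Model]
  /-- The fibres. -/
  Fib : B → Type w
  [fibAddCommGroup : ∀ x, AddCommGroup (Fib x)]
  [fibModule : ∀ x, Module ℝ (Fib x)]
  [fibTopology : ∀ x, TopologicalSpace (Fib x)]
  [fibTopologicalAddGroup : ∀ x, IsTopologicalAddGroup (Fib x)]
  [fibContinuousSMul : ∀ x, ContinuousSMul ℝ (Fib x)]
  [totTopology : TopologicalSpace (TotalSpace Model Fib)]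
  [fiberBundle : FiberBundle Model Fib]
  [vectorBundle : VectorBundle ℝ Model Fib]
  [smooth : ContMDiffVectorBundle ∞ Model Fib I]

namespace SmoothVB

attribute [instance] normedAddCommGroup normedSpace finiteDimensional fibAddCommGroup fibModule
  fibTopology fibTopologicalAddGroup fibContinuousSMul totTopology fiberBundle vectorBundle smooth

variable {EB HB : Type*} [NormedAddCommGroup EB] [NormedSpace ℝ EB] [TopologicalSpace HB]
  {I : ModelWithCorners ℝ EB HB} {B : Type*} [TopologicalSpace B] [ChartedSpace HB B]

/-- The total space. -/
abbrev Tot (X : SmoothVB I B) : Type _ := TotalSpace X.Model X.Fib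

/-- The model with corners of the total space. -/
abbrev totI (X : SmoothVB I B) : ModelWithCorners ℝ (EB × X.Model) (ModelProd HB X.Model) :=
  I.prod 𝓘(ℝ, X.Model)

/-- The smooth sections `Γ(X)`. -/
abbrev Sec (X : SmoothVB I B) : Type _ := Cₛ^∞⟮I; X.Model, X.Fib⟯

/-- Multiplication of sections by smooth functions. -/
instance (X : SmoothVB I B) : SMul C^∞⟮I, B; ℝ⟯ X.Sec :=
  ⟨fun f s => ⟨fun x => f x • s x, f.contMDiff.smul_section s.contMDiff⟩⟩

@[simp] theorem smul_apply (X : SmoothVB I B) (f : C^∞⟮I, B; ℝ⟯) (s : X.Sec) (x : B) :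
    (f • s) x = f x • s x := rfl

instance (X : SmoothVB I B) : Module C^∞⟮I, B; ℝ⟯ X.Sec where
  one_smul s := by ext x; simp
  mul_smul f g s := by ext x; simp [mul_smul]
  smul_zero f := by ext x; simp
  smul_add f s t := by ext x; simp
  add_smul f g s := by ext x; simp [add_smul]
  zero_smul s := by ext x; simp

instance (X : SmoothVB I B) : IsScalarTower ℝ C^∞⟮I, B; ℝ⟯ X.Sec :=
  ⟨fun r f s => by ext x; simp [mul_smul]⟩

/-- The dual bundle. -/
def dual (X : SmoothVB I B) : SmoothVB I B where
  Model := X.Model →L[ℝ] ℝ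
  Fib x := X.Fib x →L[ℝ] Bundle.Trivial B ℝ x

/-- An element of a fibre of the dual bundle as a linear form. -/
def dualFib (X : SmoothVB I B) {x : B} (ε : X.dual.Fib x) : X.Fib x →L[ℝ] ℝ := ε

theorem contMDiff_apply (X : SmoothVB I B) (ε : X.dual.Sec) {EB' HB' : Type*}
    [NormedAddCommGroup EB'] [NormedSpace ℝ EB'] [TopologicalSpace HB']
    {I' : ModelWithCorners ℝ EB' HB'} {B' : Type*} [TopologicalSpace B'] [ChartedSpace HB' B']
    {f : B' → X.Tot} (hf : ContMDiff I' X.totI ∞ f) :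
    ContMDiff I' 𝓘(ℝ, ℝ) ∞ fun y => X.dualFib (ε (f y).proj) (f y).2 := by
  have h1 : ContMDiff I' (I.prod 𝓘(ℝ, X.Model →L[ℝ] ℝ)) ∞
      (fun y => TotalSpace.mk' (X.Model →L[ℝ] ℝ)
        (E := fun x => X.Fib x →L[ℝ] Bundle.Trivial B ℝ x) (f y).proj (ε (f y).proj)) :=
    ε.contMDiff.comp ((contMDiff_proj X.Fib).comp hf)
  have h2 := ContMDiff.clm_bundle_apply h1 (v := fun y => (f y).2) hf
  intro y
  exact ((contMDiffAt_totalSpace).1 (h2 y)).2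

/-- The pairing `⟨ε, e⟩` of a section of the dual bundle with a section. -/
def pair (X : SmoothVB I B) :
    X.dual.Sec →ₗ[C^∞⟮I, B; ℝ⟯] X.Sec →ₗ[C^∞⟮I, B; ℝ⟯] C^∞⟮I, B; ℝ⟯ :=
  LinearMap.mk₂ _ (fun ε e => ⟨fun x => X.dualFib (ε x) (e x), contMDiff_apply X ε e.contMDiff⟩)
    (fun _ _ _ => rfl) (fun _ _ _ => rfl)
    (fun ε e e' => by ext x; exact (X.dualFib (ε x)).map_add _ _)
    (fun f ε e => by ext x; exact (X.dualFib (ε x)).map_smul _ _)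

/-- The function `ℓ_ψ` on the total space of `X`, linear on the fibres, given by a section `ψ` of
the dual bundle. -/
def ell (X : SmoothVB I B) (ψ : X.dual.Sec) : C^∞⟮X.totI, X.Tot; ℝ⟯ :=
  ⟨fun v => X.dualFib (ψ v.proj) v.2, contMDiff_apply X ψ contMDiff_id⟩

/-- The projection of the total space onto the base. -/
def proj (X : SmoothVB I B) : C^∞⟮X.totI, X.Tot; I, B⟯ :=
  ⟨TotalSpace.proj, contMDiff_proj X.Fib⟩

section Pullback

variable {EB' HB' : Type*} [NormedAddCommGroup EB'] [NormedSpace ℝ EB'] [TopologicalSpace HB']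
  {I' : ModelWithCorners ℝ EB' HB'} {B' : Type*} [TopologicalSpace B'] [ChartedSpace HB' B']

/-- The pullback `f^! X` of `X` along the smooth map `f`. -/
def pullback (X : SmoothVB I B) (f : C^∞⟮I', B'; I, B⟯) : SmoothVB I' B' where
  Model := X.Model
  Fib := (f : B' → B) *ᵖ X.Fib
  fibAddCommGroup x := X.fibAddCommGroup (f x)
  fibModule x := X.fibModule (f x)
  fibTopologicalAddGroup x := X.fibTopologicalAddGroup (f x)
  fibContinuousSMul x := X.fibContinuousSMul (f x)
  vectorBundle := VectorBundle.pullback (F := X.Model) (E := X.Fib) (f := f) ..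
  smooth := ContMDiffVectorBundle.pullback X.Model X.Fib I' f

/-- The fibres of the pullback. -/
def pullFib (X : SmoothVB I B) (f : C^∞⟮I', B'; I, B⟯) (y : B') :
    (X.pullback f).Fib y ≃ₗ[ℝ] X.Fib (f y) :=
  LinearEquiv.refl ℝ (X.Fib (f y))

/-- The pullback of a section of the dual bundle. -/
def pullDualSec (X : SmoothVB I B) (f : C^∞⟮I', B'; I, B⟯) (s : X.dual.Sec) :
    (X.pullback f).dual.Sec :=
  ⟨fun x => (X.dualFib (s (f x)) : X.Fib (f x) →L[ℝ] ℝ), by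
    exact contMDiff_pullback_dual (F := X.Model) (E := X.Fib) f (fun x => X.dualFib (s x)) s.contMDiff⟩

end Pullback

end SmoothVB

namespace GSym

/-- The ring homomorphism of graded symmetric algebras induced by a ring homomorphism `φ` and
degree preserving `φ`-semilinear maps of the generating modules. -/
def map {ι ι' R S : Type*} [DecidableEq ι] [DecidableEq ι'] [Fintype ι] [CommRing R] [CommRing S]
    {N : ι → Type*} [∀ i, AddCommGroup (N i)] [∀ i, Module R (N i)]
    {N' : ι' → Type*} [∀ i, AddCommGroup (N' i)] [∀ i, Module S (N' i)]
    (d : ι → ℕ) (d' : ι' → ℕ) (φ : R →+* S) (τ : ι → ι') (hτ : ∀ i, d' (τ i) = d i)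
    (f : ∀ i, N i →ₛₗ[φ] N' (τ i)) : GSym R N d →+* GSym S N' d' :=
  letI : Algebra R (GSym S N' d') :=
    ((algebraMap S (GSym S N' d')).comp φ).toAlgebra' fun r x => Algebra.commutes (φ r) x
  have hsmul : ∀ (r : R) (x : GSym S N' d'), r • x = φ r • x := fun r x => by
    rw [Algebra.smul_def, Algebra.smul_def]; rfl
  (lift (T := GSym S N' d') d
    (fun i =>
      { toFun := fun a => gen S d' (τ i) (f i a)
        map_add' := fun a b => by rw [map_add, map_add]
        map_smul' := fun r a => by rw [map_smulₛₗ, map_smul, RingHom.id_apply, hsmul] })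
    (fun i j a b => by
      simp only [LinearMap.coe_mk, AddHom.coe_mk]
      rw [gen_mul_gen S d' (τ i) (τ j), hτ, hτ, hsmul, map_pow, map_neg, map_one])).toRingHom

theorem map_algebraMap {ι ι' R S : Type*} [DecidableEq ι] [DecidableEq ι'] [Fintype ι]
    [CommRing R] [CommRing S]
    {N : ι → Type*} [∀ i, AddCommGroup (N i)] [∀ i, Module R (N i)]
    {N' : ι' → Type*} [∀ i, AddCommGroup (N' i)] [∀ i, Module S (N' i)]
    (d : ι → ℕ) (d' : ι' → ℕ) (φ : R →+* S) (τ : ι → ι') (hτ : ∀ i, d' (τ i) = d i)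
    (f : ∀ i, N i →ₛₗ[φ] N' (τ i)) (r : R) :
    map d d' φ τ hτ f (algebraMap R _ r) = algebraMap S _ (φ r) := by
  let : Algebra R (GSym S N' d') :=
    ((algebraMap S (GSym S N' d')).comp φ).toAlgebra' fun r x => Algebra.commutes (φ r) x
  exact AlgHom.commutes (lift (T := GSym S N' d') d _ _) r

end GSym

namespace SmoothVB

variable {EB HB : Type*} [NormedAddCommGroup EB] [NormedSpace ℝ EB] [TopologicalSpace HB]
  {I : ModelWithCorners ℝ EB HB} {B : Type*} [TopologicalSpace B] [ChartedSpace HB B]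
  {EB' HB' : Type*} [NormedAddCommGroup EB'] [NormedSpace ℝ EB'] [TopologicalSpace HB']
  {I' : ModelWithCorners ℝ EB' HB'} {B' : Type*} [TopologicalSpace B'] [ChartedSpace HB' B']

/-- The graded algebra of functions `Γ(S(E^*))` of the split graded manifold
`E = ⨁ i, X i [d i]` over `B`, realised as the graded symmetric algebra over `C^∞(B)` of the
`C^∞(B)`-module `⨁ i, Γ((X i)^*)`, with `Γ((X i)^*)` in degree `d i`. -/
abbrev Cin {ι : Type*} [DecidableEq ι] (X : ι → SmoothVB I B) (d : ι → ℕ) : Type _ :=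
  GSym C^∞⟮I, B; ℝ⟯ (fun i => (X i).dual.Sec) d

/-- The pullback of functions along a smooth map. -/
def pullFun (f : C^∞⟮I', B'; I, B⟯) : C^∞⟮I, B; ℝ⟯ →+* C^∞⟮I', B'; ℝ⟯ where
  toFun g := g.comp f
  map_one' := rfl
  map_mul' _ _ := rfl
  map_zero' := rfl
  map_add' _ _ := rfl

/-- `pullDualSec` as a semilinear map. -/
def pullDual (X : SmoothVB I B) (f : C^∞⟮I', B'; I, B⟯) :
    X.dual.Sec →ₛₗ[pullFun f] (X.pullback f).dual.Sec where
  toFun := X.pullDualSec f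
  map_add' _ _ := rfl
  map_smul' _ _ := rfl

end SmoothVB

/-! ## VB-Lie `n`-algebroid structures on decomposed graded double vector bundles -/

namespace DVB

open SmoothVB

variable {EM HM : Type*} [NormedAddCommGroup EM] [NormedSpace ℝ EM] [TopologicalSpace HM]
  {I : ModelWithCorners ℝ EM HM} {M : Type*} [TopologicalSpace M] [ChartedSpace HM M] {n : ℕ}

/-- The degrees of the graded vector bundle `A = A₁[1] ⊕ ⋯ ⊕ Aₙ[n]`; the summand `Aₖ` has the index
`k - 1 : Fin n`. -/
def degA (i : Fin n) : ℕ := i + 1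

/-- The summands, as vector bundles over the total space of `V`, of the graded vector bundle
`D = D₁[1] ⊕ ⋯ ⊕ Dₙ[n]` over `V`, where `D_i = V ×_M A_i ×_M C_i = q_V^! A_i ⊕ q_V^! C_i`. -/
def bundleD (V : SmoothVB I M) (A C : Fin n → SmoothVB I M) :
    Fin n ⊕ Fin n → SmoothVB V.totI V.Tot
  | .inl i => (A i).pullback V.proj
  | .inr i => (C i).pullback V.proj

/-- The degrees of the summands of `D`. -/
def degD : Fin n ⊕ Fin n → ℕ := Sum.elim degA degA

/-- The functions of the graded manifold `A`. -/
abbrev FunA (A : Fin n → SmoothVB I M) : Type _ := Cin A degA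

/-- The functions of the graded manifold `D` over `V`. -/
abbrev FunD (V : SmoothVB I M) (A C : Fin n → SmoothVB I M) : Type _ := Cin (bundleD V A C) degD

variable (V : SmoothVB I M) (A C : Fin n → SmoothVB I M)

/-- The sections of `D_i → V`, by components. -/
abbrev SecD (i : Fin n) : Type _ :=
  ((A i).pullback V.proj).Sec × ((C i).pullback V.proj).Sec

/-- The sections of the dual bundle `D_i^* → V`, by components. -/
abbrev DualSecD (i : Fin n) : Type _ :=
  ((A i).pullback V.proj).dual.Sec × ((C i).pullback V.proj).dual.Sec

variable {V A C}

/-- The pairing of sections of `D_i^* → V` and `D_i → V`. -/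
def pairD (i : Fin n) (α : DualSecD V A C i) (δ : SecD V A C i) : C^∞⟮V.totI, V.Tot; ℝ⟯ :=
  ((A i).pullback V.proj).pair α.1 δ.1 + ((C i).pullback V.proj).pair α.2 δ.2

/-- A section of `D_i^* → V` as a function on `D`. -/
def fnD (i : Fin n) (α : DualSecD V A C i) : FunD V A C :=
  GSym.gen _ degD (N := fun s => (bundleD V A C s).dual.Sec) (Sum.inl i) α.1 +
    GSym.gen _ degD (N := fun s => (bundleD V A C s).dual.Sec) (Sum.inr i) α.2

/-- The vector field on `D` given by the contraction with a section of `D_i → V`. -/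
def contractD (i : Fin n) (δ : SecD V A C i) : FunD V A C →ₗ[ℝ] FunD V A C :=
  (GSym.contract _ degD (N := fun s => (bundleD V A C s).dual.Sec) (Sum.inl i)
      (((A i).pullback V.proj).pair.flip δ.1)).restrictScalars ℝ +
    (GSym.contract _ degD (N := fun s => (bundleD V A C s).dual.Sec) (Sum.inr i)
      (((C i).pullback V.proj).pair.flip δ.2)).restrictScalars ℝ

/-- The value of a section of `D_i → V` at the point `x` of the fibre `V_m`, as an element of
`A_i ⊕ C_i` over `m`. -/
def valD (i : Fin n) (δ : SecD V A C i) (m : M) (x : V.Fib m) : (A i).Fib m × (C i).Fib m :=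
  ((A i).pullFib V.proj ⟨m, x⟩ (δ.1 ⟨m, x⟩), (C i).pullFib V.proj ⟨m, x⟩ (δ.2 ⟨m, x⟩))

/-- The section `δ` of `D_i → V` is linear: it is a vector bundle morphism from `V → M` to
`D_i → A_i` over a section `a` of `A_i → M`. -/
def IsLinearSec (i : Fin n) (δ : SecD V A C i) : Prop :=
  ∃ (a : (A i).Sec) (φ : ∀ m, V.Fib m →ₗ[ℝ] (C i).Fib m),
    ∀ m x, valD i δ m x = (a m, φ m x)

/-- The section `δ` of `D_i → V` is the core section defined by a section of `C_i → M`. -/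
def IsCoreSec (i : Fin n) (δ : SecD V A C i) : Prop :=
  ∃ c : (C i).Sec, ∀ m x, valD i δ m x = (0, c m)

/-- The iterated graded commutator `[…[[X, δ₁], δ₂], …, δ_j]` of a vector field `X` of degree `p`
on `D` with the contractions with `δ₁, …, δ_j` (the contraction with a section of `D_k[k]` having
degree `-k`). -/
def iterComm : (FunD V A C →ₗ[ℝ] FunD V A C) → ℤ → List (Σ i, SecD V A C i) →
    (FunD V A C →ₗ[ℝ] FunD V A C)
  | X, _, [] => X
  | X, p, δ :: l =>
    iterComm (X ∘ₗ contractD δ.1 δ.2 -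
      (p * (-(degA δ.1 : ℤ))).negOnePow • (contractD δ.1 δ.2 ∘ₗ X)) (p - degA δ.1) l

/-- `s = (s_k)_k`, with `s_k` a section of `D_k → V`, is the multibracket `⟦δ₁, …, δ_j⟧` of the
list of sections `l` determined by the homological vector field `Q` on `D`: the iterated commutator
`[…[[Q, δ₁], δ₂], …, δ_j]` sends each `α ∈ Γ_V(D_k^*)` to a function whose part of polynomial
degree zero is `⟨α, s_k⟩`. -/
def IsBracket (Q : FunD V A C →ₗ[ℝ] FunD V A C) (l : List (Σ i, SecD V A C i))
    (s : ∀ k, SecD V A C k) : Prop :=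
  ∀ (k : Fin n) (α : DualSecD V A C k),
    GSym.body _ degD (iterComm Q 1 l (fnD k α)) = pairD k α (s k)

/-- The first projection `V ⊕ V → V`, on total spaces. -/
def fstV (V : SmoothVB I M) (p : TotalSpace (V.Model × V.Model) (V.Fib ×ᵇ V.Fib)) : V.Tot :=
  ⟨p.proj, p.2.1⟩

/-- The second projection `V ⊕ V → V`, on total spaces. -/
def sndV (V : SmoothVB I M) (p : TotalSpace (V.Model × V.Model) (V.Fib ×ᵇ V.Fib)) : V.Tot :=
  ⟨p.proj, p.2.2⟩

/-- The addition `V ⊕ V → V`, on total spaces. -/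
def addV (V : SmoothVB I M) (p : TotalSpace (V.Model × V.Model) (V.Fib ×ᵇ V.Fib)) : V.Tot :=
  ⟨p.proj, p.2.1 + p.2.2⟩

/-- The scalar multiplication by `t` on the total space of `V`. -/
def smulV (V : SmoothVB I M) (t : ℝ) (v : V.Tot) : V.Tot := ⟨v.proj, t • v.2⟩

/-- The linear maps `ρ m x : A_i ⊕ C_i → T_{(m,x)} V` form a morphism of double vector bundles from
`(D_i, V, A_i, M)` to `(TV, V, TM, M)` over the identity of `V` and the bundle map
`ρA : A_i → TM`.  The vector bundle structure of `TV → TM` is the tangent prolongation of that of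
`V → M`: its projection, addition and scalar multiplication are the tangent maps of those of `V`. -/
structure IsAnchorMorphism (i : Fin n)
    (ρ : ∀ (m : M) (x : V.Fib m),
      ((A i).Fib m × (C i).Fib m) →ₗ[ℝ] TangentSpace V.totI (⟨m, x⟩ : V.Tot))
    (ρA : ∀ m : M, (A i).Fib m →ₗ[ℝ] TangentSpace I m) : Prop where
  proj : ∀ m x a c, mfderiv V.totI I V.proj (⟨m, x⟩ : V.Tot) (ρ m x (a, c)) = ρA m a
  add : ∀ (m : M) (x y : V.Fib m) (a : (A i).Fib m) (c c' : (C i).Fib m)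
    (w : TangentSpace (I.prod 𝓘(ℝ, V.Model × V.Model))
      (⟨m, (x, y)⟩ : TotalSpace (V.Model × V.Model) (V.Fib ×ᵇ V.Fib))),
    mfderiv (I.prod 𝓘(ℝ, V.Model × V.Model)) V.totI (fstV V) ⟨m, (x, y)⟩ w = ρ m x (a, c) →
    mfderiv (I.prod 𝓘(ℝ, V.Model × V.Model)) V.totI (sndV V) ⟨m, (x, y)⟩ w = ρ m y (a, c') →
    mfderiv (I.prod 𝓘(ℝ, V.Model × V.Model)) V.totI (addV V) ⟨m, (x, y)⟩ w
      = ρ m (x + y) (a, c + c')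
  smul : ∀ (t : ℝ) (m : M) (x : V.Fib m) (a : (A i).Fib m) (c : (C i).Fib m),
    mfderiv V.totI V.totI (smulV V t) (⟨m, x⟩ : V.Tot) (ρ m x (a, c)) = ρ m (t • x) (a, t • c)

/-- The linear maps `∂D m x : A_i ⊕ C_i → A_k ⊕ C_k` form a morphism of double vector bundles from
`(D_i, V, A_i, M)` to `(D_k, V, A_k, M)` over the identity of `V` and the bundle map
`∂A : A_i → A_k`. -/
structure IsDVBMorphism (i k : Fin n)
    (δD : ∀ (m : M), V.Fib m → (((A i).Fib m × (C i).Fib m) →ₗ[ℝ] ((A k).Fib m × (C k).Fib m)))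
    (δA : ∀ m : M, (A i).Fib m →ₗ[ℝ] (A k).Fib m) : Prop where
  proj : ∀ m x a c, (δD m x (a, c)).1 = δA m a
  add : ∀ m x y a c c',
    (δD m (x + y) (a, c + c')).2 = (δD m x (a, c)).2 + (δD m y (a, c')).2
  smul : ∀ (t : ℝ) m x a c, (δD m (t • x) (a, t • c)).2 = t • (δD m x (a, c)).2

/-- `Q` is a VB-Lie `n`-algebroid structure on the decomposed graded double vector bundle
`(D, V, A, M)` with core `C`: it is a homological vector field on `D` for which the anchor and the
`1`-bracket are morphisms of double vector bundles and the multibrackets of linear and core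
sections behave as prescribed.  (The bundle maps in `anchor` and `differential` are determined by
`Q`, and they are smooth since they send smooth sections to smooth sections.) -/
structure IsVBLie (Q : FunD V A C →ₗ[ℝ] FunD V A C) : Prop where
  /-- `Q` is a Lie `n`-algebroid structure on `D → V`. -/
  homological : GSym.IsHomological Q
  /-- The anchor `D₁ → TV`, given by `ρ(δ) f = ⟨Q f, δ⟩`, is a morphism of double vector bundles. -/
  anchor : ∀ i : Fin n, (i : ℕ) = 0 →
    ∃ (ρ : ∀ (m : M) (x : V.Fib m),
        ((A i).Fib m × (C i).Fib m) →ₗ[ℝ] TangentSpace V.totI (⟨m, x⟩ : V.Tot))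
      (ρA : ∀ m : M, (A i).Fib m →ₗ[ℝ] TangentSpace I m),
      IsAnchorMorphism i ρ ρA ∧
      ∀ (δ : SecD V A C i) (f : C^∞⟮V.totI, V.Tot; ℝ⟯) (m : M) (x : V.Fib m),
        GSym.body _ degD (contractD i δ (Q (algebraMap _ _ f))) (⟨m, x⟩ : V.Tot) =
          mfderiv V.totI 𝓘(ℝ, ℝ) f (⟨m, x⟩ : V.Tot) (ρ m x (valD i δ m x))
  /-- The `1`-bracket `D_i → D_{i-1}` is a morphism of double vector bundles. -/
  differential : ∀ i k : Fin n, (k : ℕ) + 1 = i →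
    ∃ (δD : ∀ (m : M), V.Fib m →
        (((A i).Fib m × (C i).Fib m) →ₗ[ℝ] ((A k).Fib m × (C k).Fib m)))
      (δA : ∀ m : M, (A i).Fib m →ₗ[ℝ] (A k).Fib m),
      IsDVBMorphism i k δD δA ∧
      ∀ δ : SecD V A C i, ∃ s : ∀ k, SecD V A C k, IsBracket Q [⟨i, δ⟩] s ∧
        ∀ m x, valD k (s k) m x = δD m x (valD i δ m x)
  /-- Brackets of linear sections are linear. -/
  linear : ∀ l : List (Σ i, SecD V A C i), l ≠ [] → (∀ δ ∈ l, IsLinearSec δ.1 δ.2) →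
    ∃ s, IsBracket Q l s ∧ ∀ k, IsLinearSec k (s k)
  /-- Brackets of linear sections with one core section are core sections. -/
  core : ∀ (l₁ l₂ : List (Σ i, SecD V A C i)) (γ : Σ i, SecD V A C i),
    (∀ δ ∈ l₁ ++ l₂, IsLinearSec δ.1 δ.2) → IsCoreSec γ.1 γ.2 →
    ∃ s, IsBracket Q (l₁ ++ γ :: l₂) s ∧ ∀ k, IsCoreSec k (s k)
  /-- Brackets of linear sections with at least two core sections vanish. -/
  core₂ : ∀ (l₁ l₂ l₃ : List (Σ i, SecD V A C i)) (γ γ' : Σ i, SecD V A C i),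
    (∀ δ ∈ l₁ ++ l₂ ++ l₃, IsLinearSec δ.1 δ.2 ∨ IsCoreSec δ.1 δ.2) →
    IsCoreSec γ.1 γ.2 → IsCoreSec γ'.1 γ'.2 →
    IsBracket Q (l₁ ++ γ :: l₂ ++ γ' :: l₃) 0

variable (V A C)

/-- The pullback `π_A^⋆` of functions on `A` to functions on `D`. -/
def pullA : FunA A →+* FunD V A C :=
  GSym.map degA degD (pullFun V.proj) Sum.inl (fun _ => rfl) (fun i => (A i).pullDual V.proj)

/-- The summands of the graded vector bundle `E = V[0] ⊕ C₁[1] ⊕ ⋯ ⊕ Cₙ[n]` over `M`; the index `j`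
is the summand `E_j[j]`. -/
def bundleE : Fin (n + 1) → SmoothVB I M := Fin.cons V C

/-- The module `C^∞(A) ⊗ Γ(E)` over the functions on `A`, for `E = V[0] ⊕ C₁[1] ⊕ ⋯ ⊕ Cₙ[n]`. -/
abbrev ModE : Type _ := FunA A ⊗[C^∞⟮I, M; ℝ⟯] (Π j, (bundleE V C j).Sec)

/-- The module `C^∞(A) ⊗ Γ(E^*)` over the functions on `A`. -/
abbrev ModDualE : Type _ := FunA A ⊗[C^∞⟮I, M; ℝ⟯] (Π j, (bundleE V C j).dual.Sec)

theorem ell_add (ψ ψ' : V.dual.Sec) : V.ell (ψ + ψ') = V.ell ψ + V.ell ψ' := rfl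

theorem ell_smul (f : C^∞⟮I, M; ℝ⟯) (ψ : V.dual.Sec) :
    V.ell (f • ψ) = pullFun V.proj f * V.ell ψ := rfl

theorem pullA_smul (r : C^∞⟮I, M; ℝ⟯) (ξ : FunA A) :
    pullA V A C (r • ξ) = pullFun V.proj r • pullA V A C ξ := by
  rw [Algebra.smul_def, map_mul, Algebra.smul_def]
  congr 1
  exact GSym.map_algebraMap ..

/-- The function `ℓ_ψ` on `D` given by `ψ ∈ Γ(V^*)`. -/
def genV : V.dual.Sec →ₛₗ[pullFun V.proj] FunD V A C where
  toFun ψ := algebraMap C^∞⟮V.totI, V.Tot; ℝ⟯ _ (V.ell ψ)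
  map_add' ψ ψ' := by rw [ell_add, map_add]
  map_smul' r ψ := by rw [ell_smul, map_mul, Algebra.smul_def]

/-- The function on `D` given by the pullback of `γ ∈ Γ(C_i^*)`, a linear section of
`D_i^* → V`. -/
def genC (i : Fin n) : (C i).dual.Sec →ₛₗ[pullFun V.proj] FunD V A C where
  toFun γ := GSym.gen _ degD (N := fun s => (bundleD V A C s).dual.Sec) (Sum.inr i)
    ((C i).pullDual V.proj γ)
  map_add' γ γ' := by rw [map_add]; exact map_add _ _ _
  map_smul' r γ := by rw [map_smulₛₗ]; exact map_smul _ _ _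

/-- The linear functions on `D` given by sections of `E^* = V^* ⊕ C₁^* ⊕ ⋯ ⊕ Cₙ^*`. -/
def genLin : (Π j, (bundleE V C j).dual.Sec) →ₛₗ[pullFun V.proj] FunD V A C where
  toFun η := genV V A C (η 0) + ∑ i : Fin n, genC V A C i (η i.succ)
  map_add' η η' := by
    rw [add_add_add_comm, ← Finset.sum_add_distrib]
    exact congrArg₂ (· + ·) ((genV V A C).map_add (η 0) (η' 0))
      (Finset.sum_congr rfl fun i _ => (genC V A C i).map_add (η i.succ) (η' i.succ))
  map_smul' r η := by
    rw [smul_add, Finset.smul_sum]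
    exact congrArg₂ (· + ·) ((genV V A C).map_smulₛₗ r (η 0))
      (Finset.sum_congr rfl fun i _ => (genC V A C i).map_smulₛₗ r (η i.succ))

/-- The inclusion of `C^∞(A) ⊗ Γ(E^*)` as the linear functions on `D` (viewed as a vector bundle
over the graded manifold `A`), `ξ ⊗ η ↦ π_A^⋆(ξ) η`. -/
def linFun : ModDualE V A C →+ FunD V A C :=
  TensorProduct.liftAddHom
    (AddMonoidHom.mk' (fun ξ => AddMonoidHom.mk' (fun η => pullA V A C ξ * genLin V A C η)
        fun η η' => by rw [map_add, mul_add])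
      fun ξ ξ' => by ext η; simp [add_mul])
    fun r ξ η => by
      simp only [AddMonoidHom.mk'_apply]
      rw [pullA_smul, map_smulₛₗ, smul_mul_assoc, mul_smul_comm]

variable {V A C}

/-- The homological vector field `QD` on `D` lies over the homological vector field `QA` on `A`. -/
def IsOver (QD : FunD V A C →ₗ[ℝ] FunD V A C) (QA : FunA A →ₗ[ℝ] FunA A) : Prop :=
  ∀ ξ : FunA A, QD (pullA V A C ξ) = pullA V A C (QA ξ)

/-- `D` is an `(n + 1)`-term representation up to homotopy of the split Lie `n`-algebroid
`(A, QA)` on `E = V[0] ⊕ C₁[1] ⊕ ⋯ ⊕ Cₙ[n]`; the sections of `E_j[j]` have degree `-j`. -/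
def IsRUTHOnE (QA : FunA A →ₗ[ℝ] FunA A) (D : ModE V A C →ₗ[ℝ] ModE V A C) : Prop :=
  GSym.IsRUTH QA (fun j : Fin (n + 1) => -((j : ℕ) : ℤ)) D

/-- `D'` is a representation up to homotopy of `(A, QA)` on the dual
`E^* = V^*[0] ⊕ C₁^*[-1] ⊕ ⋯ ⊕ Cₙ^*[-n]`; the sections of `E_j^*[-j]` have degree `j`. -/
def IsRUTHOnDualE (QA : FunA A →ₗ[ℝ] FunA A) (D' : ModDualE V A C →ₗ[ℝ] ModDualE V A C) : Prop :=
  GSym.IsRUTH QA (fun j : Fin (n + 1) => ((j : ℕ) : ℤ)) D'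

/-- `D'` is the differential on `C^∞(A) ⊗ Γ(E^*)` dual to the differential `D` on
`C^∞(A) ⊗ Γ(E)`. -/
def IsDualOnE (QA : FunA A →ₗ[ℝ] FunA A) (D' : ModDualE V A C →ₗ[ℝ] ModDualE V A C)
    (D : ModE V A C →ₗ[ℝ] ModE V A C) : Prop :=
  GSym.IsDual QA (fun j : Fin (n + 1) => (j : ℕ)) (fun j => (bundleE V C j).pair) D' D

/-- The restriction of the vector field `QD` to the linear functions on `D` is the operator `D'` on
`C^∞(A) ⊗ Γ(E^*)`; in particular `D' ψ = QD ℓ_ψ` for `ψ ∈ Γ(V^*)` and `D' γ = QD γ` for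
`γ ∈ Γ(C_i^*)`. -/
def IsRestriction (QD : FunD V A C →ₗ[ℝ] FunD V A C)
    (D' : ModDualE V A C →ₗ[ℝ] ModDualE V A C) : Prop :=
  ∀ x : ModDualE V A C, QD (linFun V A C x) = linFun V A C (D' x)

variable (V A C)

/-- The set of VB-Lie `n`-algebroid structures on `(D, V, A, M)` over the split Lie `n`-algebroid
`(A, QA)`. -/
def VBLieOver (QA : FunA A →ₗ[ℝ] FunA A) : Type _ :=
  {QD : FunD V A C →ₗ[ℝ] FunD V A C // IsVBLie QD ∧ IsOver QD QA}

/-- The set of `(n + 1)`-term representations up to homotopy of `(A, QA)` on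
`E = V[0] ⊕ C₁[1] ⊕ ⋯ ⊕ Cₙ[n]`. -/
def RUTHOnE (QA : FunA A →ₗ[ℝ] FunA A) : Type _ :=
  {D : ModE V A C →ₗ[ℝ] ModE V A C // IsRUTHOnE QA D}

end DVB

end

set_option linter.unusedSectionVars false

noncomputable section

/-! ### Graded symmetric algebras: degrees, induction principles and Koszul signs. -/

namespace GSym

section Algebra

variable {ι : Type*} [DecidableEq ι] {R : Type*} [CommRing R] {N : ι → Type*}
  [∀ i, AddCommGroup (N i)] [∀ i, Module R (N i)] {d : ι → ℕ}

/-! The proof turns the bracket axioms into one invariance property. Scaling the fibres of the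
vector bundle `D → A` by `t` multiplies the directions of `V` and of the `C_i` by `t` and fixes
those of the `A_i`; on functions this is `scaleD t`. It gives functions, sections and operators a
weight: functions pulled back from `A` have weight 0, the functions `ℓ_ψ` and `γ` have weight 1,
linear sections have weight 0 and core sections have weight -1. The central fact is that a
homological vector field `Q` on `D` is a VB-Lie structure exactly when it has weight 0, that is,
when it commutes with all scalings by `t ≠ 0`.

If `Q` has weight 0 (`isVBLie_of_hasWt`), an iterated commutator of `Q` with contractions has as
weight the sum of the weights of the sections. A smooth function on `V`, homogeneous along the
fibres, is zero, pulled back from `M` or fibrewise linear according as its degree is negative, 0 or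
1 (`IsHomog.eq_zero`, `IsHomog.eq_pullFun`, `IsHomog.eq_ell`). Applied to the components of the
brackets, of the anchor and of the 1-bracket, this gives all the axioms.

Conversely (`IsVBLie.hasWt_zero`), let `X` be the difference between `Q` and its conjugate by a
scaling. The anchor axiom makes `X` vanish on functions on `V`. On the remaining generators `X` is
then detected by the polynomial degree zero parts of iterated commutators, that is, by brackets of
frame sections, and the bracket axioms say that these scale as they do for weight 0.

The weight 0 part of the functions on `D` is the image of `pullA`, and the weight 1 part is the
image of `linFun` (`exists_pullA_eq`, `exists_linFun_eq`); both maps are injective. A weight 0 field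
therefore induces a unique `QA` on functions on `A`, and a unique `D'` on linear functions, and the
properties of `Q` pass to them. In the other direction, functions pulled back from `A` and linear
functions determine derivations (`IsDer.ext`), and any compatible pair `QA`, `D'` extends to a
homological field of weight 0 (`exists_extension`). The passage between `D'` on the dual of `E` and
`D` on `E` is algebraic duality over dual bases (`exists_dual_left`, `exists_dual_right`).

The analytic input is the existence of finite global frames: finitely many sections generate `Γ(X)`
with dual coefficients (`SmoothVB.exists_frame`), and finitely many functions have differentials
generating the cotangent bundle (`exists_tangent_frame`). By Hadamard's lemma the latter makes a
derivation of smooth functions a finite sum determined by its values on those functions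
(`derivation_eq_sum`). -/

theorem grade_mul {j k : ℕ} {x y : GSym R N d} (hx : x ∈ grade R N d j) (hy : y ∈ grade R N d k) :
    x * y ∈ grade R N d (j + k) := by
  refine Submodule.span_induction₂ (p := fun x y _ _ => x * y ∈ grade R N d (j + k))
    ?_ ?_ ?_ ?_ ?_ ?_ ?_ hx hy
  · rintro _ _ ⟨l, rfl, rfl⟩ ⟨l', rfl, rfl⟩
    exact Submodule.subset_span ⟨l ++ l', by simp, by simp⟩
  · intro y _; simp
  · intro y _; simp
  · intro x y z _ _ _ h h'; rw [add_mul]; exact add_mem h h'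
  · intro x y z _ _ _ h h'; rw [mul_add]; exact add_mem h h'
  · intro r x y _ _ h; rw [smul_mul_assoc]; exact Submodule.smul_mem _ _ h
  · intro r x y _ _ h; rw [mul_smul_comm]; exact Submodule.smul_mem _ _ h

theorem algebraMap_mem_grade (r : R) : algebraMap R (GSym R N d) r ∈ grade R N d 0 := by
  rw [Algebra.algebraMap_eq_smul_one]
  exact Submodule.smul_mem _ _ (Submodule.subset_span ⟨[], rfl, rfl⟩)

theorem gen_mem_grade (i : ι) (a : N i) : gen R d i a ∈ grade R N d (d i) :=
  Submodule.subset_span ⟨[⟨i, a⟩], by simp, by simp⟩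

/-- Induction on elements of degree `k`. -/
theorem grade_induction {p : ℕ → GSym R N d → Prop} (hzero : ∀ k, p k 0)
    (hadd : ∀ k x y, p k x → p k y → p k (x + y)) (hR : ∀ r, p 0 (algebraMap R _ r))
    (hgen : ∀ k i a x, x ∈ grade R N d k → p k x → p (d i + k) (gen R d i a * x))
    {k : ℕ} {x : GSym R N d} (hx : x ∈ grade R N d k) : p k x := by
  have key : ∀ (l : List (Σ i, N i)) (r : R), p (l.map fun s => d s.1).sum
      (r • (l.map fun s => gen R d s.1 s.2).prod) := by
    intro l
    induction l with
    | nil => intro r; simpa [Algebra.algebraMap_eq_smul_one] using hR r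
    | cons s l ih =>
      intro r
      simp only [List.map_cons, List.sum_cons, List.prod_cons]
      rw [← smul_mul_assoc, ← map_smul, ← one_smul R (List.prod _)]
      exact hgen _ _ _ _ (Submodule.smul_mem _ _ (Submodule.subset_span ⟨l, rfl, rfl⟩)) (ih 1)
  -- `p` is not assumed stable under multiplication by `R`; quantifying over all multiples makes the
  -- scalar case of the span induction immediate.
  suffices ∀ r : R, p k (r • x) by simpa using this 1
  induction hx using Submodule.span_induction with
  | mem x h => obtain ⟨l, rfl, rfl⟩ := h; exact key l
  | zero => intro r; simpa using hzero k
  | add x y _ _ hx hy => intro r; rw [smul_add]; exact hadd _ _ _ (hx r) (hy r)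
  | smul t x _ ih => intro r; rw [smul_smul]; exact ih _

end Algebra

section Fin

variable {ι : Type*} [DecidableEq ι] [Fintype ι] {R : Type*} [CommRing R] {N : ι → Type*}
  [∀ i, AddCommGroup (N i)] [∀ i, Module R (N i)] {d : ι → ℕ}

/-- The elements that multiply the sum of the graded pieces into itself form a subalgebra containing
the generators, hence everything; apply this to the element 1. -/
theorem iSup_grade : ⨆ k, grade R N d k = ⊤ := by
  rw [eq_top_iff]
  intro x _
  let W : Submodule R (GSym R N d) := ⨆ k, grade R N d k
  let s : Subalgebra R (GSym R N d) :=
    { carrier := {x | ∀ y ∈ W, x * y ∈ W}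
      mul_mem' := fun {a b} ha hb y hy => by rw [mul_assoc]; exact ha _ (hb _ hy)
      add_mem' := fun {a b} ha hb y hy => by rw [add_mul]; exact add_mem (ha _ hy) (hb _ hy)
      algebraMap_mem' := fun r y hy => by
        rw [← Algebra.smul_def]; exact Submodule.smul_mem _ _ hy }
  have h := mem_of_gen_mem R d s (fun i a y hy => by
    induction hy using Submodule.iSup_induction' with
    | mem k x hx => exact Submodule.mem_iSup_of_mem _ (grade_mul (gen_mem_grade i a) hx)
    | zero => simp
    | add x y _ _ hx hy => rw [mul_add]; exact add_mem hx hy) x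
  have h1 := h 1 (Submodule.mem_iSup_of_mem 0 (by simpa using algebraMap_mem_grade (d := d) (1 : R)))
  simpa using h1

/-- Induction by homogeneous components. -/
theorem homogeneous_induction {p : GSym R N d → Prop}
    (hadd : ∀ x y, p x → p y → p (x + y)) (hom : ∀ k, ∀ x ∈ grade R N d k, p x)
    (x : GSym R N d) : p x := by
  have hx : x ∈ ⨆ k, grade R N d k := iSup_grade (R := R) (N := N) (d := d) ▸ Submodule.mem_top
  induction hx using Submodule.iSup_induction' with
  | mem k x hx => exact hom k x hx
  | zero => exact hom 0 0 (zero_mem _)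
  | add x y _ _ hx hy => exact hadd _ _ hx hy

theorem gen_induction {p : GSym R N d → Prop}
    (hadd : ∀ x y, p x → p y → p (x + y)) (hR : ∀ r, p (algebraMap R _ r))
    (hgen : ∀ i a x, p x → p (gen R d i a * x)) (x : GSym R N d) : p x :=
  homogeneous_induction hadd (fun _ _ hx =>
    grade_induction (p := fun _ x => p x) (fun _ => by simpa using hR 0) (fun _ => hadd) hR
      (fun _ i a x _ => hgen i a x) hx) x

theorem algHom_ext {T : Type*} [Semiring T] [Algebra R T] {f g : GSym R N d →ₐ[R] T}
    (h : ∀ i a, f (gen R d i a) = g (gen R d i a)) : f = g :=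
  AlgHom.ext fun x => mem_of_gen_mem R d (AlgHom.equalizer f g) h x

theorem twist_gen (p : ℕ) (i : ι) (a : N i) :
    twist R d p (gen R d i a) = (-1) ^ (p * d i) * gen R d i a := by
  rw [twist, lift_gen, LinearMap.smul_apply, Algebra.smul_def, map_pow, map_neg, map_one]

theorem twist_algebraMap (p : ℕ) (r : R) :
    twist R d p (algebraMap R (GSym R N d) r) = algebraMap R _ r :=
  AlgHom.commutes _ r

/-- Koszul signs are carried throughout by the automorphism `twist`, which makes sense on
inhomogeneous elements. This is its link with the usual sign. -/
theorem twist_of_mem_grade (p : ℕ) {k : ℕ} {x : GSym R N d} (hx : x ∈ grade R N d k) :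
    twist R d p x = (-1) ^ (p * k) * x := by
  refine grade_induction (p := fun k x => twist R d p x = (-1) ^ (p * k) * x) (by simp) ?_ ?_ ?_ hx
  · intro k x y hx hy; rw [map_add, hx, hy, mul_add]
  · intro r; simp
  · intro k i a x _ hx
    rw [map_mul, hx, twist_gen, mul_add, pow_add, mul_assoc, mul_assoc, ← mul_assoc (gen R d i a),
      ← mul_assoc (_ ^ (p * k)), ((Commute.neg_one_left (gen R d i a)).pow_left _).eq]

theorem twist_twist (p q : ℕ) (x : GSym R N d) :
    twist R d p (twist R d q x) = twist R d (p + q) x := by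
  have : (twist R d p).comp (twist R d q) = twist (N := N) R d (p + q) := algHom_ext fun i a => by
    rw [AlgHom.comp_apply, twist_gen, map_mul, twist_gen, twist_gen, ← mul_assoc, map_pow, map_neg,
      map_one, ← pow_add]
    ring_nf
  exact DFunLike.congr_fun this x

theorem twist_two_mul (p : ℕ) (x : GSym R N d) : twist R d (2 * p) x = x := by
  have : twist R d (2 * p) = AlgHom.id R (GSym R N d) := algHom_ext fun i a => by
    rw [twist_gen, mul_assoc, pow_mul]; simp
  rw [this]; rfl

theorem twist_twist_self (p : ℕ) (x : GSym R N d) : twist R d p (twist R d p x) = x := by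
  rw [twist_twist, ← two_mul, twist_two_mul]

theorem twist_mem_grade (p : ℕ) {k : ℕ} {x : GSym R N d} (hx : x ∈ grade R N d k) :
    twist R d p x ∈ grade R N d k := by
  rw [twist_of_mem_grade p hx]
  rcases neg_one_pow_eq_or (GSym R N d) (p * k) with h | h <;> rw [h]
  · simpa using hx
  · simpa using hx

theorem gen_mul_comm (i : ι) (a : N i) (y : GSym R N d) :
    gen R d i a * y = twist R d (d i) y * gen R d i a := by
  induction y using gen_induction with
  | hadd x y hx hy => rw [mul_add, hx, hy, map_add, add_mul]
  | hR r => rw [twist_algebraMap, Algebra.commutes]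
  | hgen j b y hy =>
    rw [← mul_assoc, gen_mul_gen, map_mul, twist_gen, Algebra.smul_def, map_pow, map_neg, map_one]
    simp only [mul_assoc, hy]

/-- Graded commutativity. -/
theorem mul_comm_of_mem_grade {k : ℕ} {x : GSym R N d} (hx : x ∈ grade R N d k)
    (y : GSym R N d) : x * y = twist R d k y * x := by
  refine grade_induction (p := fun k x => ∀ y, x * y = twist R d k y * x) (by simp) ?_ ?_ ?_ hx y
  · intro k x y hx hy z; rw [add_mul, hx, hy, mul_add]
  · intro r y
    rw [Algebra.commutes]
    congr 1
    exact (twist_two_mul 0 y).symm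
  · intro k i a x _ hx y
    rw [mul_assoc, hx, ← mul_assoc, gen_mul_comm, twist_twist, mul_assoc]

/-! ### Contractions -/

theorem contractAux_zero_zero (i : ι) (φ : N i →ₗ[R] R) (x : GSym R N d) :
    contractAux R d i φ x 0 0 = twist R d (d i) x := by
  induction x using gen_induction with
  | hadd x y hx hy => rw [map_add, map_add, Matrix.add_apply, hx, hy]
  | hR r => rw [AlgHom.commutes, AlgHom.commutes]; simp [Matrix.algebraMap_matrix_apply]
  | hgen j a y hy =>
    rw [map_mul, map_mul, Matrix.mul_apply, Fin.sum_univ_two, hy, (contractAux_apply R d i φ y).1,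
      mul_zero, add_zero]
    congr 1
    rw [twist_gen]
    simp [contractAux, lift_gen, Algebra.smul_def]

/-- The upper right entry of the product of the two matrices that encode the contraction; their
upper left entries are twists. -/
theorem contract_mul (i : ι) (φ : N i →ₗ[R] R) (x y : GSym R N d) :
    contract R d i φ (x * y) = contract R d i φ x * y + twist R d (d i) x * contract R d i φ y := by
  have h := (contractAux_apply R d i φ y).2
  have h2 := contractAux_zero_zero i φ x
  simp only [contract, LinearMap.coe_mk, AddHom.coe_mk, map_mul, Matrix.mul_apply,
    Fin.sum_univ_two, h, h2]
  rw [add_comm]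

/-- The elements of degree `p`, for an integer `p`. -/
def gradeZ (R : Type*) [CommRing R] (N : ι → Type*) [∀ i, AddCommGroup (N i)]
    [∀ i, Module R (N i)] (d : ι → ℕ) : ℤ → Submodule R (GSym R N d)
  | .ofNat k => grade R N d k
  | .negSucc _ => ⊥

theorem gradeZ_natCast (k : ℕ) : gradeZ R N d (k : ℤ) = grade R N d k := rfl

theorem gradeZ_of_neg {p : ℤ} (hp : p < 0) : gradeZ R N d p = ⊥ := by
  obtain ⟨k, rfl⟩ := Int.eq_negSucc_of_lt_zero hp
  rfl

theorem mem_gradeZ_of_mem {k : ℕ} {p : ℤ} (h : (k : ℤ) = p) {x : GSym R N d}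
    (hx : x ∈ grade R N d k) : x ∈ gradeZ R N d p := by
  subst h; exact hx

theorem gradeZ_mul {p q : ℤ} {x y : GSym R N d} (hx : x ∈ gradeZ R N d p)
    (hy : y ∈ gradeZ R N d q) : x * y ∈ gradeZ R N d (p + q) := by
  rcases lt_or_ge p 0 with hp | hp
  · rw [gradeZ_of_neg hp, Submodule.mem_bot] at hx; simp [hx]
  rcases lt_or_ge q 0 with hq | hq
  · rw [gradeZ_of_neg hq, Submodule.mem_bot] at hy; simp [hy]
  lift p to ℕ using hp
  lift q to ℕ using hq
  exact mem_gradeZ_of_mem (by push_cast; rfl) (grade_mul hx hy)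

/-- Integer degrees are used so that a contraction that would lead below degree 0 is zero without a
case distinction in the statement. -/
theorem contract_mem_gradeZ (i : ι) (φ : N i →ₗ[R] R) {p : ℤ} {x : GSym R N d}
    (hx : x ∈ gradeZ R N d p) : contract R d i φ x ∈ gradeZ R N d (p - d i) := by
  rcases lt_or_ge p 0 with hp | hp
  · rw [gradeZ_of_neg hp, Submodule.mem_bot] at hx; simp [hx]
  lift p to ℕ using hp
  refine grade_induction (p := fun k x => contract R d i φ x ∈ gradeZ R N d (k - d i))
    (by simp) ?_ ?_ ?_ hx
  · intro k x y hx hy; rw [map_add]; exact add_mem hx hy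
  · intro r; rw [contract_algebraMap]; exact zero_mem _
  · intro k j a x hx ih
    rw [contract_mul]
    refine add_mem ?_ ?_
    · by_cases hj : j = i
      · subst hj
        rw [contract_gen]
        refine mem_gradeZ_of_mem (k := 0 + k) (by push_cast; ring)
          (grade_mul (algebraMap_mem_grade _) hx)
      · rw [contract_gen_of_ne R d i j hj, zero_mul]; exact zero_mem _
    · have := gradeZ_mul (mem_gradeZ_of_mem rfl (twist_mem_grade (d i) (gen_mem_grade (d := d) j a))) ih
      rwa [show (d j : ℤ) + (k - d i) = ((d j + k : ℕ) : ℤ) - d i by push_cast; ring] at this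

/-! ### The body -/

theorem body_algebraMap (r : R) : body R d (algebraMap R (GSym R N d) r) = r :=
  AlgHom.commutes _ r

theorem body_gen (i : ι) (a : N i) : body R d (gen R d i a) = 0 := by
  rw [body, lift_gen]; rfl

theorem body_of_mem_grade {k : ℕ} (hk : 0 < k) {x : GSym R N d}
    (hx : x ∈ grade R N d k) : body R d x = 0 := by
  refine grade_induction (p := fun k x => 0 < k → body R d x = 0) (by simp) ?_ (by simp) ?_ hx hk
  · intro k x y hx hy hk; rw [map_add, hx hk, hy hk, add_zero]
  · intro k i a x _ _ _; rw [map_mul, body_gen, zero_mul]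

/-- All generators have positive degree, so only the empty product has degree 0. -/
theorem eq_algebraMap_of_mem_grade_zero (hd : ∀ i, 0 < d i) {x : GSym R N d}
    (hx : x ∈ grade R N d 0) : x = algebraMap R _ (body R d x) := by
  refine grade_induction (p := fun k x => k = 0 → x = algebraMap R _ (body R d x)) (by simp) ?_
    (by simp) ?_ hx rfl
  · intro k x y hx hy hk; rw [map_add, map_add, ← hx hk, ← hy hk]
  · intro k i a x _ _ h; have := hd i; omega

end Fin
end GSym

/-- A finite generating family of a module together with linear forms giving coordinates. -/
structure FiniteFrame (R P J : Type*) [CommRing R] [AddCommGroup P] [Module R P] [Fintype J] where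
  /-- The generators. -/
  vec : J → P
  /-- The coordinates. -/
  co : J → P →ₗ[R] R
  sum_smul : ∀ x, ∑ j, co j x • vec j = x

/-! ### Recovering an element from its iterated contractions with a frame. -/

namespace GSym

section Reconstruction

variable {ι : Type*} [DecidableEq ι] [Fintype ι] {R : Type*} [CommRing R] {N : ι → Type*}
  [∀ i, AddCommGroup (N i)] [∀ i, Module R (N i)] {d : ι → ℕ}
  {J : ι → Type*} [∀ i, Fintype (J i)] (F : ∀ i, FiniteFrame R (N i) (J i))

/-- The Euler vector field. The operator on the left satisfies the ungraded Leibniz rule, kills `R`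
and multiplies a generator by its degree, so it multiplies degree `k` by `k`. -/
theorem euler {k : ℕ} {x : GSym R N d} (hx : x ∈ grade R N d k) :
    ∑ i, ∑ j, (d i : GSym R N d) * (gen R d i ((F i).vec j) * contract R d i ((F i).co j) x)
      = k * x := by
  refine grade_induction (p := fun k x => ∑ i, ∑ j, (d i : GSym R N d) *
    (gen R d i ((F i).vec j) * contract R d i ((F i).co j) x) = k * x) (by simp) ?_ ?_ ?_ hx
  · intro k x y hx hy
    simp only [map_add, mul_add, Finset.sum_add_distrib, hx, hy]
  · intro r; simp [contract_algebraMap]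
  · intro k m a x _ ih
    have h1 : ∀ i, ∀ j : J i, (d i : GSym R N d) * (gen R d i ((F i).vec j) *
        contract R d i ((F i).co j) (gen R d m a * x)) =
        (d i : GSym R N d) * (gen R d i ((F i).vec j) *
          contract R d i ((F i).co j) (gen R d m a)) * x
        + gen R d m a * ((d i : GSym R N d) * (gen R d i ((F i).vec j) *
          contract R d i ((F i).co j) x)) := by
      intro i j
      rw [contract_mul, mul_add, mul_add, ← mul_assoc (gen R d i _) (twist _ _ _ _),
        gen_mul_comm i _ (twist R d (d i) (gen R d m a)), twist_twist_self, ← mul_assoc (gen R d m a), ← Nat.cast_comm]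
      simp only [mul_assoc]
    simp only [← Finset.mul_sum] at ih
    simp only [h1, Finset.sum_add_distrib, ← Finset.mul_sum, ← Finset.sum_mul, ih]
    have h2 : ∑ i, (d i : GSym R N d) * ∑ j, (gen R d i ((F i).vec j) *
          contract R d i ((F i).co j) (gen R d m a)) = d m * gen R d m a := by
      rw [Finset.sum_eq_single m]
      · congr 1
        simp only [contract_gen, ← Algebra.commutes, ← Algebra.smul_def, ← map_smul, ← map_sum]
        rw [(F m).sum_smul]
      · intro i _ hi
        simp [contract_gen_of_ne R d i m hi.symm]
      · simp
    rw [h2, ← mul_assoc (gen R d m a), ← (Nat.cast_commute k (gen R d m a)).eq, Nat.cast_add,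
      add_mul, mul_assoc, mul_assoc]

/-- The iterated contraction of `x` with frame elements. -/
def contractList : List (Σ i, J i) → GSym R N d → GSym R N d
  | [], x => x
  | s :: l, x => contractList l (contract R d s.1 ((F s.1).co s.2) x)

/-- An element of degree `k` belongs to a subspace containing the terms of its expansion in
products of frame elements. -/
theorem mem_of_contractList [Algebra ℝ R] [∀ i, Module ℝ (N i)] [∀ i, IsScalarTower ℝ R (N i)]
    (hd : ∀ i, 0 < d i) {k : ℕ} {x : GSym R N d} (hx : x ∈ grade R N d k)
    (U : Submodule ℝ (GSym R N d))
    (h : ∀ l : List (Σ i, J i), (l.map fun s => d s.1).sum = k →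
      (l.map fun s => gen R d s.1 ((F s.1).vec s.2)).prod *
        algebraMap R _ (body R d (contractList F l x)) ∈ U) : x ∈ U := by
  induction k using Nat.strong_induction_on generalizing x U with
  | _ k ih =>
    rcases Nat.eq_zero_or_pos k with rfl | hk
    · have := h [] rfl
      simp only [List.map_nil, List.prod_nil, contractList, one_mul] at this
      rwa [← eq_algebraMap_of_mem_grade_zero hd hx] at this
    -- Dividing Euler's identity by `k > 0` writes `x` as a combination of frame elements times
    -- contractions of `x`, whose degrees are strictly smaller.
    have hE := euler F hx
    have hk' : (k : ℝ) ≠ 0 := by positivity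
    have hcast : ∀ m : ℕ, ∀ y : GSym R N d, (m : GSym R N d) * y = (m : ℝ) • y := fun m y => by
      rw [Algebra.smul_def, map_natCast]
    rw [hcast, ← inv_smul_eq_iff₀ hk'] at hE
    rw [← hE]
    refine U.smul_mem _ (U.sum_mem fun i _ => U.sum_mem fun j _ => ?_)
    rw [hcast]
    refine U.smul_mem _ ?_
    have hc := contract_mem_gradeZ i ((F i).co j) (mem_gradeZ_of_mem rfl hx)
    by_cases hik : d i ≤ k
    · rw [← Nat.cast_sub hik, gradeZ_natCast] at hc
      -- The subspace is replaced by the set of `y` whose product with the chosen frame element lies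
      -- in `U`; this is why `U` is generalised in the induction.
      refine ih (k - d i) (by have := hd i; omega) hc (U.comap (LinearMap.mulLeft ℝ _)) fun l hl => ?_
      rw [Submodule.mem_comap, LinearMap.mulLeft_apply, ← mul_assoc]
      exact h (⟨i, j⟩ :: l) (by simp [hl, hik])
    · rw [gradeZ_of_neg (by omega), Submodule.mem_bot] at hc
      rw [hc, mul_zero]; exact zero_mem _

end Reconstruction

/-! ### Derivations -/

section Derivation

variable {ι : Type*} [DecidableEq ι] [Fintype ι] {R : Type*} [CommRing R] {N : ι → Type*}
  [∀ i, AddCommGroup (N i)] [∀ i, Module R (N i)] {d : ι → ℕ}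
  [Algebra ℝ R] [∀ i, Module ℝ (N i)] [∀ i, IsScalarTower ℝ R (N i)]

theorem neg_one_pow_smul_real (k : ℕ) (x : GSym R N d) : (-1 : ℝ) ^ k • x = (-1) ^ k * x := by
  rw [Algebra.smul_def, map_pow, map_neg, map_one]

/-- The sign in the Leibniz rule becomes a twist, so no homogeneity assumption is needed; nearly all
later computations use this form. -/
theorem IsHomological.map_mul {Q : GSym R N d →ₗ[ℝ] GSym R N d} (hQ : IsHomological Q)
    (x y : GSym R N d) : Q (x * y) = Q x * y + twist R d 1 x * Q y := by
  induction x using homogeneous_induction with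
  | hadd x y hx hy => simp only [add_mul, map_add, hx, hy]; abel
  | hom k x hx =>
    rw [hQ.leibniz k x hx, twist_of_mem_grade 1 hx, one_mul, neg_one_pow_smul_real, mul_assoc]

theorem isHomological_of_map_mul {Q : GSym R N d →ₗ[ℝ] GSym R N d}
    (hdeg : ∀ k, ∀ x ∈ grade R N d k, Q x ∈ grade R N d (k + 1))
    (hmul : ∀ x y, Q (x * y) = Q x * y + twist R d 1 x * Q y) (hsq : ∀ x, Q (Q x) = 0) :
    IsHomological Q :=
  ⟨hdeg, fun k x hx y => by
    rw [hmul, twist_of_mem_grade 1 hx, one_mul, neg_one_pow_smul_real, mul_assoc], hsq⟩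

theorem IsHomological.mem_gradeZ {Q : GSym R N d →ₗ[ℝ] GSym R N d} (hQ : IsHomological Q) {p : ℤ}
    {x : GSym R N d} (hx : x ∈ gradeZ R N d p) : Q x ∈ gradeZ R N d (p + 1) := by
  rcases lt_or_ge p 0 with hp | hp
  · rw [gradeZ_of_neg hp, Submodule.mem_bot] at hx; simp [hx]
  lift p to ℕ using hp
  exact hQ.degree p x hx

theorem IsHomological.twist_one {Q : GSym R N d →ₗ[ℝ] GSym R N d} (hQ : IsHomological Q) (p : ℕ)
    (x : GSym R N d) : Q (twist R d p x) = (-1) ^ p * twist R d p (Q x) := by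
  induction x using homogeneous_induction with
  | hadd x y hx hy => simp only [map_add, hx, hy, mul_add]
  | hom k x hx =>
    rw [twist_of_mem_grade p hx, twist_of_mem_grade p (hQ.degree k x hx), ← mul_assoc, ← pow_add,
      ← neg_one_pow_smul_real, ← neg_one_pow_smul_real, map_smul]
    congr 1
    rw [show p + p * (k + 1) = p * k + 2 * p by ring, pow_add, pow_mul _ 2]
    simp

theorem derivation_mem_grade {Q : GSym R N d →ₗ[ℝ] GSym R N d}
    (hQ : ∀ x y, Q (x * y) = Q x * y + twist R d 1 x * Q y)
    (hR : ∀ r, Q (algebraMap R _ r) ∈ grade R N d 1)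
    (hgen : ∀ i a, Q (gen R d i a) ∈ grade R N d (d i + 1)) {k : ℕ} {x : GSym R N d}
    (hx : x ∈ grade R N d k) : Q x ∈ grade R N d (k + 1) := by
  refine grade_induction (p := fun k x => Q x ∈ grade R N d (k + 1)) (by simp) ?_ hR ?_ hx
  · intro k x y hx hy; rw [map_add]; exact add_mem hx hy
  · intro k i a x hx h
    rw [hQ]
    refine add_mem ?_ ?_
    · have := grade_mul (hgen i a) hx
      rwa [add_right_comm] at this
    · have := grade_mul (twist_mem_grade 1 (gen_mem_grade (d := d) i a)) h
      rwa [← add_assoc] at this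

variable (R N d) in
/-- The matrices `!![(-1)^|x| x, y; 0, x]`. -/
def dualSubring : Subring (Matrix (Fin 2) (Fin 2) (GSym R N d)) where
  carrier := {A | A 1 0 = 0 ∧ A 0 0 = twist R d 1 (A 1 1)}
  mul_mem' := by
    rintro A B ⟨hA, hA'⟩ ⟨hB, hB'⟩
    simp [Matrix.mul_apply, Fin.sum_univ_two, hA, hA', hB, hB']
  one_mem' := by simp
  add_mem' := by
    rintro A B ⟨hA, hA'⟩ ⟨hB, hB'⟩
    simp [hA, hA', hB, hB']
  zero_mem' := by simp
  neg_mem' := by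
    rintro A ⟨hA, hA'⟩
    simp [hA, hA']

/-- The element `!![(-1)^|x| x, y; 0, x]`. -/
def dualMk (x y : GSym R N d) : dualSubring R N d :=
  ⟨!![twist R d 1 x, y; 0, x], by simp [dualSubring]⟩

theorem dualMk_mul (x y x' y' : GSym R N d) :
    dualMk x y * dualMk x' y' = dualMk (x * x') (twist R d 1 x * y' + y * x') := by
  apply Subtype.ext
  ext a b
  fin_cases a <;> fin_cases b <;> simp [dualMk, Matrix.mul_apply, Fin.sum_univ_two]

theorem dualMk_add (x y x' y' : GSym R N d) :
    dualMk x y + dualMk x' y' = dualMk (x + x') (y + y') := by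
  apply Subtype.ext
  ext a b
  fin_cases a <;> fin_cases b <;> simp [dualMk]

theorem dualMk_eta (A : dualSubring R N d) : A = dualMk (A.1 1 1) (A.1 0 1) := by
  obtain ⟨A, h, h'⟩ := A
  apply Subtype.ext
  ext a b
  fin_cases a <;> fin_cases b <;> simp [dualMk, h, h']

/-- Derivations of degree `1` can be prescribed on `R` and on the generators. -/
theorem exists_derivation (δ₀ : R →ₗ[ℝ] GSym R N d) (q : ∀ i, N i →ₗ[ℝ] GSym R N d)
    (hδ1 : ∀ r, δ₀ r ∈ grade R N d 1)
    (hδ : ∀ r s, δ₀ (r * s) = δ₀ r * algebraMap R _ s + algebraMap R _ r * δ₀ s)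
    (hq1 : ∀ i a, q i a ∈ grade R N d (d i + 1))
    (hq : ∀ i r a, q i (r • a) = δ₀ r * gen R d i a + algebraMap R _ r * q i a) :
    ∃ Q : GSym R N d →ₗ[ℝ] GSym R N d,
      (∀ x y, Q (x * y) = Q x * y + twist R d 1 x * Q y) ∧
      (∀ r, Q (algebraMap R _ r) = δ₀ r) ∧ ∀ i a, Q (gen R d i a) = q i a := by
  have h1 : δ₀ 1 = 0 := by simpa using hδ 1 1
  -- A derivation is the off-diagonal entry of a multiplicative map into the matrices `dualMk x y`.
  -- As it is not `R`-linear, the action of `R` on these matrices is deformed by `δ₀`.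
  let θ : R →+* dualSubring R N d :=
    { toFun := fun r => dualMk (algebraMap R _ r) (δ₀ r)
      map_one' := by
        apply Subtype.ext
        ext a b
        fin_cases a <;> fin_cases b <;> simp [dualMk, h1]
      map_mul' := fun r s => by
        rw [dualMk_mul, twist_algebraMap, hδ, map_mul, add_comm]
      map_zero' := by
        apply Subtype.ext
        ext a b
        fin_cases a <;> fin_cases b <;> simp [dualMk]
      map_add' := fun r s => by rw [dualMk_add, map_add, map_add] }
  -- The image of `θ` is central because `δ₀ r` has degree 1: moving it past `x` produces the twist
  -- in the upper left corner.
  let alg : Algebra R (dualSubring R N d) := θ.toAlgebra' fun r A => by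
    rw [dualMk_eta A]
    change dualMk _ _ * _ = _ * dualMk _ _
    rw [dualMk_mul, dualMk_mul, Algebra.commutes, mul_comm_of_mem_grade (hδ1 r), twist_algebraMap,
      Algebra.commutes, add_comm]
  have hsmul : ∀ (r : R) (A : dualSubring R N d), r • A = θ r * A := fun r A => rfl
  let G : GSym R N d →ₐ[R] dualSubring R N d := lift d (fun i =>
    { toFun := fun a => dualMk (gen R d i a) (q i a)
      map_add' := fun a b => by rw [dualMk_add, map_add, map_add]
      map_smul' := fun r a => by
        rw [RingHom.id_apply, hsmul]
        change _ = dualMk _ _ * _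
        rw [dualMk_mul, twist_algebraMap, hq, map_smul, Algebra.smul_def, add_comm] }) (by
    intro i j a b
    rw [hsmul, map_pow, map_neg, map_one]
    change dualMk _ _ * dualMk _ _ = _ * (dualMk _ _ * dualMk _ _)
    rw [dualMk_mul, dualMk_mul]
    -- The sign, as a scalar of the deformed action, has no off-diagonal part.
    have e : ((-1) ^ (d i * d j) : dualSubring R N d) = dualMk ((-1) ^ (d i * d j)) 0 := by
      rcases neg_one_pow_eq_or (dualSubring R N d) (d i * d j) with h | h <;> rw [h]
      all_goals
        have h' := congrArg (fun A : dualSubring R N d => A.1 1 1) h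
        have h'' : ((((-1) ^ (d i * d j) : dualSubring R N d)).1 1 1) = (-1) ^ (d i * d j) := by
          rcases Nat.even_or_odd (d i * d j) with hh | hh <;> simp [hh.neg_one_pow]
        simp only [h''] at h'
        rw [h']
        apply Subtype.ext
        ext a b
        fin_cases a <;> fin_cases b <;> simp [dualMk]
    rw [e, dualMk_mul, zero_mul, add_zero]
    have e2 : twist (N := N) R d 1 ((-1) ^ (d i * d j)) = (-1) ^ (d i * d j) := by simp
    rw [e2, gen_mul_gen, Algebra.smul_def, map_pow, map_neg, map_one, mul_add]
    congr 1
    rw [add_comm]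
    congr 1
    · rw [mul_comm_of_mem_grade (hq1 i a), twist_gen, twist_gen, ← mul_assoc, ← mul_assoc]
      congr 2
      rw [show (d i + 1) * d j = d i * d j + 1 * d j by ring, pow_add]
    · rw [mul_comm_of_mem_grade (k := d i) (twist_mem_grade 1 (gen_mem_grade i a)),
        twist_of_mem_grade _ (hq1 j b), twist_gen, mul_assoc, mul_add, pow_add, mul_assoc]
      congr 1
      rw [← mul_assoc (q j b), ((Commute.neg_one_left (q j b)).pow_left (1 * d i)).eq.symm,
        mul_assoc, ← mul_assoc _ _ (q j b * _), ← pow_add]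
      rw [mul_one, one_mul, ← two_mul, pow_mul]
      simp)
  have hG : ∀ i a, G (gen R d i a) = dualMk (gen R d i a) (q i a) := fun i a => by
    simp only [G, lift_gen]; rfl
  -- The diagonal part of `G` is the identity, so multiplicativity of `G` becomes the twisted
  -- Leibniz rule for its off-diagonal part.
  have hG1 : ∀ x, (G x).1 1 1 = x := by
    intro x
    induction x using gen_induction with
    | hadd x y hx hy =>
      rw [map_add]
      exact congrArg₂ (· + ·) hx hy
    | hR r => rw [AlgHom.commutes]; rfl
    | hgen i a x hx =>
      rw [map_mul, hG, dualMk_eta (G x), dualMk_mul, hx]; rfl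
  have hmul : ∀ x y, (G (x * y)).1 0 1 = (G x).1 0 1 * y + twist R d 1 x * (G y).1 0 1 := by
    intro x y
    rw [map_mul, dualMk_eta (G x), dualMk_eta (G y), dualMk_mul, hG1, hG1, add_comm]; rfl
  have hR : ∀ r, (G (algebraMap R _ r)).1 0 1 = δ₀ r := fun r => by rw [AlgHom.commutes]; rfl
  refine ⟨{ toFun := fun x => (G x).1 0 1, map_add' := fun x y => by rw [map_add]; rfl
            map_smul' := fun c x => ?_ }, hmul, hR, fun i a => by
              change (G (gen R d i a)).1 0 1 = _
              rw [hG]; rfl⟩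
  -- Real constants pass through because `δ₀` is real linear and `δ₀ 1 = 0`.
  rw [← algebraMap_smul R c x, Algebra.smul_def, hmul, hR, Algebra.algebraMap_eq_smul_one c,
    map_smul, h1, smul_zero, zero_mul, zero_add, twist_algebraMap, RingHom.id_apply,
    ← Algebra.smul_def, ← Algebra.algebraMap_eq_smul_one, algebraMap_smul]

end Derivation

/-! ### Functoriality -/

section Map

variable {ι ι' R S : Type*} [DecidableEq ι] [DecidableEq ι'] [Fintype ι] [Fintype ι']
    [CommRing R] [CommRing S]
    {N : ι → Type*} [∀ i, AddCommGroup (N i)] [∀ i, Module R (N i)]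
    {N' : ι' → Type*} [∀ i, AddCommGroup (N' i)] [∀ i, Module S (N' i)]
    {d : ι → ℕ} {d' : ι' → ℕ} {φ : R →+* S} {τ : ι → ι'} {hτ : ∀ i, d' (τ i) = d i}
    {f : ∀ i, N i →ₛₗ[φ] N' (τ i)}

theorem map_gen (i : ι) (a : N i) :
    map d d' φ τ hτ f (gen R d i a) = gen S d' (τ i) (f i a) := by
  let : Algebra R (GSym S N' d') :=
    ((algebraMap S (GSym S N' d')).comp φ).toAlgebra' fun r x => Algebra.commutes (φ r) x
  exact lift_gen (T := GSym S N' d') (R := R) d _ _ i a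

theorem map_mem_grade {k : ℕ} {x : GSym R N d} (hx : x ∈ grade R N d k) :
    map d d' φ τ hτ f x ∈ grade S N' d' k := by
  refine grade_induction (p := fun k x => map d d' φ τ hτ f x ∈ grade S N' d' k)
    (by simp) ?_ ?_ ?_ hx
  · intro k x y hx hy; rw [map_add]; exact add_mem hx hy
  · intro r; rw [map_algebraMap]; exact algebraMap_mem_grade _
  · intro k i a x _ h
    rw [map_mul, map_gen, ← hτ i]
    exact grade_mul (gen_mem_grade _ _) h

theorem map_twist (p : ℕ) (x : GSym R N d) :
    map d d' φ τ hτ f (twist R d p x) = twist S d' p (map d d' φ τ hτ f x) := by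
  induction x using homogeneous_induction with
  | hadd x y hx hy => simp only [map_add, hx, hy]
  | hom k x hx =>
    rw [twist_of_mem_grade p hx, twist_of_mem_grade p (map_mem_grade hx), map_mul, map_pow, map_neg,
      map_one]

theorem body_map (x : GSym R N d) :
    body S d' (map d d' φ τ hτ f x) = φ (body R d x) := by
  induction x using gen_induction with
  | hadd x y hx hy => simp only [map_add, hx, hy]
  | hR r => rw [map_algebraMap, body_algebraMap, body_algebraMap]
  | hgen i a x hx => rw [map_mul, map_mul, map_mul, map_gen, body_gen, body_gen]; simp

end Map

end GSym

/-! ### Jointly injective fibrewise linear functions over compact sets. -/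

namespace Bundle

open Set Filter Topology

variable {E H : Type*} [NormedAddCommGroup E] [NormedSpace ℝ E] [FiniteDimensional ℝ E]
  [TopologicalSpace H] {I : ModelWithCorners ℝ E H} [I.Boundaryless]
  {M : Type*} [TopologicalSpace M] [ChartedSpace H M] [IsManifold I ∞ M]
  {F : Type*} [NormedAddCommGroup F] [NormedSpace ℝ F] [FiniteDimensional ℝ F] {W : M → Type*}
  [∀ x, AddCommGroup (W x)] [∀ x, Module ℝ (W x)] [∀ x, TopologicalSpace (W x)]
  [TopologicalSpace (TotalSpace F W)] [FiberBundle F W] [VectorBundle ℝ F W]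
  [ContMDiffVectorBundle ∞ F W I]

/-- A smooth function on the total space of a vector bundle which is linear on the fibres. -/
structure IsFibLinear (I : ModelWithCorners ℝ E H) (s : TotalSpace F W → ℝ) : Prop where
  smooth : ContMDiff (I.prod 𝓘(ℝ, F)) 𝓘(ℝ, ℝ) ∞ s
  map_add : ∀ x (w w' : W x), s ⟨x, w + w'⟩ = s ⟨x, w⟩ + s ⟨x, w'⟩
  map_smul : ∀ x (c : ℝ) (w : W x), s ⟨x, c • w⟩ = c * s ⟨x, w⟩

theorem IsFibLinear.map_zero {s : TotalSpace F W → ℝ} (h : IsFibLinear I s) (x : M) :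
    s ⟨x, (0 : W x)⟩ = 0 := by
  simpa using h.map_smul x 0 0

/-- The functions in `T` have no common zero, except zero, in the fibres over `K`. -/
def JointlyInjectiveOn (K : Set M) (T : Set (TotalSpace F W → ℝ)) : Prop :=
  ∀ x ∈ K, ∀ w : W x, (∀ s ∈ T, s ⟨x, w⟩ = 0) → w = 0

variable {𝒮 : Submodule ℝ (TotalSpace F W → ℝ)} (hlin : ∀ s ∈ 𝒮, IsFibLinear I s)
  (hsep : ∀ x (w : W x), w ≠ 0 → ∃ s ∈ 𝒮, s ⟨x, w⟩ ≠ 0)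

-- Compactness is used twice: over a compact neighbourhood in a trivialisation the unit sphere
-- bundle is compact and non-vanishing is an open condition, so finitely many functions suffice;
-- then finitely many such neighbourhoods cover `K`.
include hlin hsep in
theorem exists_finset_jointlyInjectiveOn {K : Set M} (hK : IsCompact K) :
    ∃ t : Finset (TotalSpace F W → ℝ), (t : Set (TotalSpace F W → ℝ)) ⊆ 𝒮 ∧
      JointlyInjectiveOn K (t : Set (TotalSpace F W → ℝ)) := by
  classical
  have : LocallyCompactSpace M := Manifold.locallyCompact_of_finiteDimensional I
  have : ProperSpace F := FiniteDimensional.proper ℝ F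
  refine hK.induction_on (p := fun K => ∃ t : Finset (TotalSpace F W → ℝ),
    (t : Set (TotalSpace F W → ℝ)) ⊆ 𝒮 ∧ JointlyInjectiveOn K (t : Set (TotalSpace F W → ℝ)))
    ⟨∅, by simp, fun x hx => hx.elim⟩ ?_ ?_ ?_
  · rintro s t hst ⟨T, hT, h⟩
    exact ⟨T, hT, fun x hx => h x (hst hx)⟩
  · rintro s t ⟨T, hT, h⟩ ⟨T', hT', h'⟩
    refine ⟨T ∪ T', by simp [hT, hT'], ?_⟩
    rintro x (hx | hx) w hw
    · exact h x hx w fun s hs => hw s (by simp [Finset.mem_coe.1 hs])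
    · exact h' x hx w fun s hs => hw s (by simp [Finset.mem_coe.1 hs])
  intro x₀ _
  let e := trivializationAt F W x₀
  obtain ⟨C, hC, hCe, hCc⟩ := local_compact_nhds (e.open_baseSet.mem_nhds
    (FiberBundle.mem_baseSet_trivializationAt' x₀))
  refine ⟨C, mem_nhdsWithin_of_mem_nhds hC, ?_⟩
  have hcomp : IsCompact (C ×ˢ Metric.sphere (0 : F) 1) := hCc.prod (isCompact_sphere 0 1)
  have key : ∃ t : Finset (TotalSpace F W → ℝ), (t : Set (TotalSpace F W → ℝ)) ⊆ 𝒮 ∧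
      ∀ z ∈ C ×ˢ Metric.sphere (0 : F) 1, ∃ s ∈ t,
        s (e.toOpenPartialHomeomorph.symm z) ≠ 0 := by
    refine hcomp.induction_on (p := fun Z => ∃ t : Finset (TotalSpace F W → ℝ),
      (t : Set (TotalSpace F W → ℝ)) ⊆ 𝒮 ∧
      ∀ z ∈ Z, ∃ s ∈ t, s (e.toOpenPartialHomeomorph.symm z) ≠ 0) ⟨∅, by simp, by simp⟩ ?_ ?_ ?_
    · rintro s t hst ⟨T, hT, h⟩
      exact ⟨T, hT, fun x hx => h x (hst hx)⟩
    · rintro s t ⟨T, hT, h⟩ ⟨T', hT', h'⟩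
      refine ⟨T ∪ T', by simp [hT, hT'], ?_⟩
      rintro x (hx | hx)
      · obtain ⟨s, hs, hs'⟩ := h x hx
        exact ⟨s, Finset.mem_union_left _ hs, hs'⟩
      · obtain ⟨s, hs, hs'⟩ := h' x hx
        exact ⟨s, Finset.mem_union_right _ hs, hs'⟩
    · rintro ⟨x, u⟩ ⟨hx, hu⟩
      have hxe : x ∈ e.baseSet := hCe hx
      have hw : e.symm x u ≠ 0 := by
        intro h0
        have h1 := congrArg Prod.snd (e.apply_mk_symm hxe u)
        rw [h0] at h1
        have h2 : (e ⟨x, (0 : W x)⟩).2 = 0 := by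
          have := (e.continuousLinearMapAt ℝ x).map_zero
          rwa [Trivialization.continuousLinearMapAt_apply, e.linearMapAt_apply, if_pos hxe] at this
        have h3 : u = 0 := h1.symm.trans h2
        simp [h3] at hu
      obtain ⟨s, hs, hsw⟩ := hsep x _ hw
      rw [e.mk_symm hxe] at hsw
      refine ⟨_, mem_nhdsWithin_of_mem_nhds (?_ : {z | s (e.toOpenPartialHomeomorph.symm z) ≠ 0} ∈ _),
        {s}, by simpa using hs, fun z hz => ⟨s, by simp, hz⟩⟩
      have hcont : ContinuousAt (fun z => s (e.toOpenPartialHomeomorph.symm z)) (x, u) :=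
        (hlin s hs).smooth.continuous.continuousAt.comp
          (e.toOpenPartialHomeomorph.continuousAt_symm (e.mem_target.2 hxe))
      exact hcont.preimage_mem_nhds (isOpen_ne.mem_nhds hsw)
  obtain ⟨t, ht, h⟩ := key
  refine ⟨t, ht, fun x hx w hw => ?_⟩
  by_contra hw0
  have hxe : x ∈ e.baseSet := hCe hx
  set u : F := (e ⟨x, w⟩).2 with hu
  have hsymm : ∀ c : ℝ, e.symm x (c • u) = c • w := by
    intro c
    have h1 : e.symmL ℝ x (c • u) = c • e.symmL ℝ x u := map_smul _ _ _
    rw [e.symmL_apply hxe, e.symmL_apply hxe] at h1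
    rw [h1, hu, e.symm_apply_apply_mk hxe]
  have hu0 : u ≠ 0 := by
    intro h0
    have := hsymm 1
    rw [h0, smul_zero, one_smul] at this
    have h2 := (e.symmL ℝ x).map_zero
    rw [e.symmL_apply hxe] at h2
    exact hw0 (this.symm.trans h2)
  -- Homogeneity reduces a nonzero vector to the unit sphere.
  obtain ⟨s, hs, hs'⟩ := h (x, ‖u‖⁻¹ • u) ⟨hx, by simp [norm_smul, hu0]⟩
  rw [← e.mk_symm hxe, hsymm, (hlin s (ht hs)).map_smul, hw s hs, mul_zero] at hs'
  exact hs' rfl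

/-- The image of the part of the total space over a compact set has Hausdorff dimension at most
the dimension of the total space. -/
theorem dimH_image_proj_preimage_le {N : ℕ} {s : Fin N → TotalSpace F W → ℝ}
    (hs : ∀ i, ContMDiff (I.prod 𝓘(ℝ, F)) 𝓘(ℝ, ℝ) ∞ (s i)) {K : Set M} (hK : IsCompact K) :
    dimH ((fun w i => s i w) '' {w : TotalSpace F W | w.proj ∈ K}) ≤
      (Module.finrank ℝ (E × F) : ℕ) := by
  refine hK.induction_on (p := fun K => dimH ((fun w i => s i w) ''
    {w : TotalSpace F W | w.proj ∈ K}) ≤ (Module.finrank ℝ (E × F) : ℕ)) (by simp) ?_ ?_ ?_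
  · intro K' K hKK h
    refine le_trans (dimH_mono ?_) h
    rintro _ ⟨w, hw, rfl⟩
    exact ⟨w, hKK hw, rfl⟩
  · intro K K' h h'
    have : {w : TotalSpace F W | w.proj ∈ K ∪ K'} = {w | w.proj ∈ K} ∪ {w | w.proj ∈ K'} := rfl
    rw [this, image_union, dimH_union]
    exact max_le h h'
  intro x₀ _
  let e := trivializationAt F W x₀
  have h1 : e.baseSet ∩ (extChartAt I x₀).source ∈ 𝓝 x₀ := inter_mem
    (e.open_baseSet.mem_nhds (FiberBundle.mem_baseSet_trivializationAt' x₀))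
    (extChartAt_source_mem_nhds x₀)
  have h2 : (extChartAt I x₀).symm ⁻¹' (e.baseSet ∩ (extChartAt I x₀).source) ∩
      (extChartAt I x₀).target ∈ 𝓝 (extChartAt I x₀ x₀) := by
    refine inter_mem ?_ (extChartAt_target_mem_nhds x₀)
    refine (continuousAt_extChartAt_symm x₀).preimage_mem_nhds ?_
    rwa [extChartAt_to_inv]
  obtain ⟨r, hr, hball⟩ := Metric.mem_nhds_iff.1 h2
  refine ⟨(extChartAt I x₀).source ∩ extChartAt I x₀ ⁻¹' Metric.ball (extChartAt I x₀ x₀) r,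
    mem_nhdsWithin_of_mem_nhds (inter_mem (extChartAt_source_mem_nhds x₀)
      ((continuousAt_extChartAt x₀).preimage_mem_nhds (Metric.ball_mem_nhds _ hr))), ?_⟩
  let Ψ : E × F → TotalSpace F W := fun z =>
    e.toOpenPartialHomeomorph.symm ((extChartAt I x₀).symm z.1, z.2)
  have hΨ : ContMDiffOn 𝓘(ℝ, E × F) (I.prod 𝓘(ℝ, F)) ∞ Ψ
      (Metric.ball (extChartAt I x₀ x₀) r ×ˢ univ) := by
    refine (e.contMDiffOn_symm (IB := I) (n := ∞)).comp (t := e.target)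
      (f := fun z : E × F => ((extChartAt I x₀).symm z.1, z.2)) ?_ ?_
    · refine ContMDiffOn.prodMk ?_ contDiff_snd.contMDiff.contMDiffOn
      exact (contMDiffOn_extChartAt_symm x₀).comp contDiff_fst.contMDiff.contMDiffOn
        fun z hz => (hball hz.1).2
    · intro z hz
      exact e.mem_target.2 (hball hz.1).1.1
  -- A `C¹` map on a convex set does not raise the Hausdorff dimension; hence the choice of a ball
  -- in the chart, times the whole model fibre.
  have hcd : ContDiffOn ℝ 1 (fun z i => s i (Ψ z))
      (Metric.ball (extChartAt I x₀ x₀) r ×ˢ (univ : Set F)) := by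
    rw [contDiffOn_pi]
    intro i
    have := (hs i).comp_contMDiffOn hΨ
    exact this.contDiffOn.of_le (by exact_mod_cast le_top)
  refine (dimH_mono ?_).trans ((hcd.dimH_image_le ((convex_ball _ _).prod convex_univ)
    Subset.rfl).trans ((dimH_mono (subset_univ _)).trans_eq (Real.dimH_univ_eq_finrank _)))
  rintro _ ⟨w, ⟨hw1, hw2⟩, rfl⟩
  refine ⟨(extChartAt I x₀ w.proj, (e w).2), ⟨hw2, mem_univ _⟩, ?_⟩
  have hwe : w.proj ∈ e.baseSet := by
    have := (hball hw2).1.1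
    rwa [(extChartAt I x₀).left_inv hw1] at this
  have : Ψ (extChartAt I x₀ w.proj, (e w).2) = w := by
    simp only [Ψ, (extChartAt I x₀).left_inv hw1]
    rw [← e.coe_fst' hwe]
    exact e.left_inv (e.mem_source.2 hwe)
  simp only [this]

-- A linear form of Whitney's projection argument. The values of the functions sweep out a set of
-- Hausdorff dimension at most `N` in a space of dimension `N + 1`, so some vector `l` is missed.
-- Since the fibre part is stable under scaling, no nonzero multiple of `l` is hit either, and
-- projecting along `l` preserves injectivity.
include hlin in
theorem jointlyInjectiveOn_reduce {N : ℕ} (hN : Module.finrank ℝ (E × F) ≤ N)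
    {K : Set M} (hK : IsCompact K) {s : Fin (N + 1) → TotalSpace F W → ℝ} (hs : ∀ i, s i ∈ 𝒮)
    (hinj : JointlyInjectiveOn K (range s)) :
    ∃ s' : Fin N → TotalSpace F W → ℝ, (∀ i, s' i ∈ 𝒮) ∧ JointlyInjectiveOn K (range s') := by
  have hdim := dimH_image_proj_preimage_le (I := I) (fun i => (hlin _ (hs i)).smooth) hK
  have hdense := dense_compl_of_dimH_lt_finrank (lt_of_le_of_lt hdim (by
    rw [Module.finrank_fin_fun]; exact_mod_cast Nat.lt_succ_of_le hN))
  obtain ⟨l, hl⟩ := hdense.nonempty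
  -- The zero section takes the value 0, so 0 can be missed only if `K` is empty.
  by_cases hl0 : l = 0
  · have hKe : K = ∅ := by
      by_contra hne
      obtain ⟨x, hx⟩ := nonempty_iff_ne_empty.2 hne
      refine hl ⟨⟨x, 0⟩, hx, ?_⟩
      rw [hl0]
      funext i
      exact (hlin _ (hs i)).map_zero x
    exact ⟨fun _ => 0, fun _ => zero_mem _, fun x hx => by rw [hKe] at hx; exact hx.elim⟩
  obtain ⟨i, hi⟩ := Function.ne_iff.1 hl0
  -- The coordinates of the projection along `l` onto the hyperplane where the `i`-th coordinate
  -- vanishes.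
  refine ⟨fun j => s (i.succAbove j) - (l (i.succAbove j) / l i) • s i,
    fun j => sub_mem (hs _) (𝒮.smul_mem _ (hs i)), fun x hx w hw => ?_⟩
  have hw' : ∀ j, s (i.succAbove j) ⟨x, w⟩ = (l (i.succAbove j) / l i) * s i ⟨x, w⟩ := fun j => by
    have := hw _ ⟨j, rfl⟩
    simpa [sub_eq_zero] using this
  by_cases h0 : s i ⟨x, w⟩ = 0
  · refine hinj x hx w ?_
    rintro _ ⟨j, rfl⟩
    rcases Fin.eq_self_or_eq_succAbove i j with rfl | ⟨k, rfl⟩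
    · exact h0
    · rw [hw', h0, mul_zero]
  -- The values at `w` are proportional to `l`, so a suitable rescaling of `w` would attain `l`
  -- itself.
  · refine (hl ⟨⟨x, (l i / s i ⟨x, w⟩) • w⟩, hx, ?_⟩).elim
    funext j
    simp only [(hlin _ (hs j)).map_smul]
    have hli : l i ≠ 0 := hi
    rcases Fin.eq_self_or_eq_succAbove i j with rfl | ⟨k, rfl⟩
    · field_simp
    · rw [hw']; field_simp

-- The point is that the number of functions depends only on the dimension of the total space and
-- not on `K`; this uniformity makes glueing over an exhaustion possible.
include hlin hsep in
theorem exists_jointlyInjectiveOn_of_isCompact {K : Set M} (hK : IsCompact K) :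
    ∃ s : Fin (Module.finrank ℝ (E × F)) → TotalSpace F W → ℝ,
      (∀ i, s i ∈ 𝒮) ∧ JointlyInjectiveOn K (range s) := by
  obtain ⟨t, ht, hinj⟩ := exists_finset_jointlyInjectiveOn hlin hsep hK
  have key : ∀ N, Module.finrank ℝ (E × F) ≤ N →
      (∃ s : Fin N → TotalSpace F W → ℝ, (∀ i, s i ∈ 𝒮) ∧ JointlyInjectiveOn K (range s)) →
      ∃ s : Fin (Module.finrank ℝ (E × F)) → TotalSpace F W → ℝ,
        (∀ i, s i ∈ 𝒮) ∧ JointlyInjectiveOn K (range s) := by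
    intro N hN
    induction N, hN using Nat.le_induction with
    | base => exact id
    | succ N hN ih =>
      rintro ⟨s, hs, h⟩
      exact ih (jointlyInjectiveOn_reduce hlin hN hK hs h)
  -- The family is padded with zero functions so that its size is in the range where the reduction
  -- applies.
  refine key (t.card + Module.finrank ℝ (E × F)) (by omega)
    ⟨Fin.append (fun i => (t.equivFin.symm i).1) (fun _ => 0), fun i => ?_, fun x hx w hw => ?_⟩
  · induction i using Fin.addCases with
    | left i => simpa using ht (t.equivFin.symm i).2
    | right i => simp
  · refine hinj x hx w fun s hs => hw s ⟨Fin.castAdd _ (t.equivFin ⟨s, hs⟩), ?_⟩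
    simp

end Bundle

/-! ### Globalisation over the whole base by glueing along shells. -/

namespace Bundle

open Set Filter Topology

variable {E H : Type*} [NormedAddCommGroup E] [NormedSpace ℝ E] [FiniteDimensional ℝ E]
  [TopologicalSpace H] {I : ModelWithCorners ℝ E H} [I.Boundaryless]
  {M : Type*} [TopologicalSpace M] [ChartedSpace H M] [IsManifold I ∞ M]
  [T2Space M] [SigmaCompactSpace M]
  {F : Type*} [NormedAddCommGroup F] [NormedSpace ℝ F] [FiniteDimensional ℝ F] {W : M → Type*}
  [∀ x, AddCommGroup (W x)] [∀ x, Module ℝ (W x)] [∀ x, TopologicalSpace (W x)]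
  [TopologicalSpace (TotalSpace F W)] [FiberBundle F W] [VectorBundle ℝ F W]
  [ContMDiffVectorBundle ∞ F W I]

/-- A space of fibrewise linear functions which separates the points of the fibres and admits
glueing over locally finite disjoint families contains a finite jointly injective family. -/
theorem exists_finite_jointlyInjective {𝒮 : Submodule ℝ (TotalSpace F W → ℝ)}
    (hlin : ∀ s ∈ 𝒮, IsFibLinear I s)
    (hsep : ∀ x (w : W x), w ≠ 0 → ∃ s ∈ 𝒮, s ⟨x, w⟩ ≠ 0)
    (hglue : ∀ (L : ℕ → Set M) (s : ℕ → TotalSpace F W → ℝ), (∀ j, IsClosed (L j)) →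
      LocallyFinite L → Pairwise (fun i j => Disjoint (L i) (L j)) → (∀ j, s j ∈ 𝒮) →
      ∃ t ∈ 𝒮, ∀ j, ∀ x ∈ interior (L j), ∀ w : W x, t ⟨x, w⟩ = s j ⟨x, w⟩) :
    ∃ (N : ℕ) (s : Fin N → TotalSpace F W → ℝ), (∀ i, s i ∈ 𝒮) ∧
      ∀ x (w : W x), (∀ i, s i ⟨x, w⟩ = 0) → w = 0 := by
  have : LocallyCompactSpace M := Manifold.locallyCompact_of_finiteDimensional I
  -- The exhaustion is shifted twice so that its first two members are empty; the compact shells `A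
  -- n` then cover `M`. The larger shells `L n` contain the `A n` in their interiors.
  let K₀ := (CompactExhaustion.choice M).shiftr
  let K := K₀.shiftr
  let A : ℕ → Set M := fun n => K (n + 2) \ interior (K (n + 1))
  let L : ℕ → Set M := fun n => K (n + 3) \ interior (K n)
  have hA : ∀ n, IsCompact (A n) := fun n => (K.isCompact _).diff isOpen_interior
  have hL : ∀ n, IsClosed (L n) := fun n => ((K.isCompact _).diff isOpen_interior).isClosed
  have hAL : ∀ n, A n ⊆ interior (L n) := by
    intro n
    have h1 : A n ⊆ interior (K (n + 3)) ∩ (K n)ᶜ := fun x hx =>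
      ⟨K.subset_interior_succ _ hx.1, fun h => hx.2 (K.subset_interior_succ _ h)⟩
    refine h1.trans (interior_maximal ?_ (isOpen_interior.inter (K.isCompact n).isClosed.isOpen_compl))
    exact fun x hx => ⟨interior_subset hx.1, fun h => hx.2 (interior_subset h)⟩
  have hdisj : ∀ m n, m + 4 ≤ n → Disjoint (L m) (L n) := by
    intro m n hmn
    rw [Set.disjoint_left]
    intro x hx hx'
    exact hx'.2 (K.subset_interior (by omega : m + 3 < n) hx.1)
  have hcov : ∀ x, ∃ n, x ∈ A n := by
    intro x
    have h := K₀.mem_sdiff_shiftr_find x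
    have h0 : K₀.find x = (CompactExhaustion.choice M).find x + 1 := CompactExhaustion.find_shiftr _ x
    rw [h0] at h
    exact ⟨_, h.1, fun h' => h.2 (interior_subset h')⟩
  have hlf : LocallyFinite L := by
    intro x
    obtain ⟨n, hn⟩ := K.exists_mem x
    refine ⟨interior (K (n + 1)), isOpen_interior.mem_nhds (K.subset_interior_succ n hn),
      (Set.finite_lt_nat (n + 1)).subset fun m hm => ?_⟩
    obtain ⟨y, hy, hy'⟩ := hm
    by_contra hmn
    simp only [mem_ofPred_eq, not_lt] at hmn
    exact hy.2 (interior_mono (K.subset hmn) hy')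
  choose s hs hinj using fun n => exists_jointlyInjectiveOn_of_isCompact hlin hsep (hA n)
  -- Shells `L m` and `L n` are disjoint once their indices differ by at least 4, so each residue
  -- class modulo 4 is a disjoint family; four glued families replace infinitely many.
  have key : ∀ (c : Fin 4) (i : Fin (Module.finrank ℝ (E × F))), ∃ t ∈ 𝒮, ∀ j,
      ∀ x ∈ interior (L (4 * j + c)), ∀ w : W x, t ⟨x, w⟩ = s (4 * j + c) i ⟨x, w⟩ := by
    intro c i
    refine hglue (fun j => L (4 * j + c)) (fun j => s (4 * j + c) i) (fun j => hL _)
      (hlf.comp_injective fun a b h => by simpa using h) (fun a b hab => ?_) (fun j => hs _ _)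
    rcases lt_or_gt_of_ne hab with h | h
    · exact hdisj _ _ (by omega)
    · exact (hdisj _ _ (by omega)).symm
  choose t ht htL using key
  refine ⟨4 * Module.finrank ℝ (E × F), fun i => t (finProdFinEquiv.symm i).1
    (finProdFinEquiv.symm i).2, fun i => ht _ _, fun x w hw => ?_⟩
  obtain ⟨n, hn⟩ := hcov x
  refine hinj n x hn w ?_
  rintro _ ⟨i, rfl⟩
  have h1 := htL ⟨n % 4, Nat.mod_lt _ (by norm_num)⟩ i (n / 4) x
    (by simpa [Nat.div_add_mod] using hAL n hn) w
  simp only [Nat.div_add_mod] at h1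
  rw [← h1]
  simpa using hw (finProdFinEquiv (⟨n % 4, Nat.mod_lt _ (by norm_num)⟩, i))

/-- Prescribing a value at a point is an affine condition, so a partition of unity reduces the
problem to local solutions, and near a given point at most one of the sections is prescribed. -/
theorem exists_section_glue {L : ℕ → Set M} (hL : ∀ j, IsClosed (L j)) (hlf : LocallyFinite L)
    (hd : Pairwise fun i j => Disjoint (L i) (L j)) (s : ℕ → Cₛ^∞⟮I; F, W⟯) :
    ∃ t : Cₛ^∞⟮I; F, W⟯, ∀ j, ∀ x ∈ L j, t x = s j x := by
  classical
  suffices ∃ t : Cₛ^∞⟮I; F, W⟯, ∀ x, t x ∈ {v | ∀ j, x ∈ L j → v = s j x} from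
    this.imp fun t ht j x hx => ht x j hx
  refine exists_contMDiffSection_forall_mem_convex_of_local I (n := ⊤) (F_fiber := F) W
    (fun x => {v | ∀ j, x ∈ L j → v = s j x}) (fun x => ?_) (fun x₀ => ?_)
  · intro u hu v hv a b _ _ hab j hj
    rw [hu j hj, hv j hj, ← add_smul, hab, one_smul]
  -- By local finiteness the union of the closed sets missing `x₀` is closed; off it, only a member
  -- containing `x₀` matters, and disjointness leaves at most one.
  have hU : (⋃ i : {i // x₀ ∉ L i}, L i)ᶜ ∈ 𝓝 x₀ := by
    refine IsOpen.mem_nhds ?_ (by simp)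
    exact ((hlf.comp_injective Subtype.val_injective).isClosed_iUnion fun i => hL _).isOpen_compl
  have hmem : ∀ y ∈ (⋃ i : {i // x₀ ∉ L i}, L i)ᶜ, ∀ j, y ∈ L j → x₀ ∈ L j := by
    intro y hy j hj
    by_contra h
    exact hy (mem_iUnion.2 ⟨⟨j, h⟩, hj⟩)
  by_cases h : ∃ j, x₀ ∈ L j
  · obtain ⟨j, hj⟩ := h
    refine ⟨_, hU, s j, (s j).contMDiff.contMDiffOn, fun y hy i hi => ?_⟩
    have : i = j := by
      by_contra hij
      exact Set.disjoint_left.1 (hd hij) (hmem y hy i hi) hj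
    rw [this]
  · refine ⟨_, hU, (0 : Cₛ^∞⟮I; F, W⟯), (0 : Cₛ^∞⟮I; F, W⟯).contMDiff.contMDiffOn,
      fun y hy i hi => (h ⟨i, hmem y hy i hi⟩).elim⟩

theorem exists_function_glue {L : ℕ → Set M} (hL : ∀ j, IsClosed (L j)) (hlf : LocallyFinite L)
    (hd : Pairwise fun i j => Disjoint (L i) (L j)) (s : ℕ → C^∞⟮I, M; ℝ⟯) :
    ∃ t : C^∞⟮I, M; ℝ⟯, ∀ j, ∀ x ∈ L j, t x = s j x := by
  obtain ⟨t, ht⟩ := exists_section_glue (I := I) (F := ℝ) (W := Bundle.Trivial M ℝ) hL hlf hd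
    (fun j => ⟨fun x => s j x, fun x => (Bundle.contMDiffAt_section _).2 (s j).contMDiff.contMDiffAt⟩)
  exact ⟨⟨t, fun x => (Bundle.contMDiffAt_section _).1 t.contMDiff.contMDiffAt⟩, ht⟩

/-- There is a smooth section through every point of the total space. -/
theorem exists_section_eq (x₀ : M) (v : W x₀) : ∃ s : Cₛ^∞⟮I; F, W⟯, s x₀ = v := by
  classical
  suffices ∃ t : Cₛ^∞⟮I; F, W⟯, ∀ x, t x ∈ {u | ∀ h : x = x₀, u = h ▸ v} from
    this.imp fun t ht => ht x₀ rfl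
  refine exists_contMDiffSection_forall_mem_convex_of_local I (n := ⊤) (F_fiber := F) W
    (fun x => {u | ∀ h : x = x₀, u = h ▸ v}) (fun x => ?_) (fun x₁ => ?_)
  · intro u hu w hw a b _ _ hab h
    rw [hu h, hw h, ← add_smul, hab, one_smul]
  by_cases hx : x₁ = x₀
  · subst hx
    let e := trivializationAt F W x₁
    let b := Module.finBasis ℝ F
    have hx : x₁ ∈ e.baseSet := FiberBundle.mem_baseSet_trivializationAt' x₁
    -- Near the point, take the combination of the local frame with constant coefficients, namely
    -- those of `v`; elsewhere nothing is prescribed.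
    refine ⟨e.baseSet, e.open_baseSet.mem_nhds hx,
      fun y => ∑ i, (e.basisAt b hx).repr v i • e.localFrame b i y, ?_, ?_⟩
    · refine (contMDiffOn_baseSet_iff_localFrameCoeff (I := I) (e := e) b).2 fun i => ?_
      refine contMDiffOn_const (c := (e.basisAt b hx).repr v i) |>.congr fun y hy => ?_
      refine (e.localFrameCoeff_apply_of_mem_baseSet (I := I) b hy
        (fun y => ∑ i, (e.basisAt b hx).repr v i • e.localFrame b i y) i).trans ?_
      simp [e.localFrame_apply_of_mem_baseSet b hy]
    · intro y hy h
      subst h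
      simp [e.localFrame_apply_of_mem_baseSet b hx, (e.basisAt b hx).sum_repr]
  · exact ⟨{x₀}ᶜ, isOpen_compl_singleton.mem_nhds hx, (0 : Cₛ^∞⟮I; F, W⟯),
      (0 : Cₛ^∞⟮I; F, W⟯).contMDiff.contMDiffOn, fun y hy h => (hy h).elim⟩

end Bundle

/-! ### Sections dual to a jointly injective family. -/

namespace Bundle

open Set Filter Topology

variable {E H : Type*} [NormedAddCommGroup E] [NormedSpace ℝ E] [FiniteDimensional ℝ E]
  [TopologicalSpace H] {I : ModelWithCorners ℝ E H} [I.Boundaryless]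
  {M : Type*} [TopologicalSpace M] [ChartedSpace H M] [IsManifold I ∞ M]
  [T2Space M] [SigmaCompactSpace M]
  {F : Type*} [NormedAddCommGroup F] [NormedSpace ℝ F] [FiniteDimensional ℝ F] {W : M → Type*}
  [∀ x, AddCommGroup (W x)] [∀ x, Module ℝ (W x)] [∀ x, TopologicalSpace (W x)]
  [TopologicalSpace (TotalSpace F W)] [FiberBundle F W] [VectorBundle ℝ F W]
  [ContMDiffVectorBundle ∞ F W I]

theorem contMDiffOn_det {U : Set M} {n : Type*} [Fintype n] [DecidableEq n]
    {G : M → Matrix n n ℝ} (hG : ∀ i j, ContMDiffOn I 𝓘(ℝ, ℝ) ∞ (fun x => G x i j) U) :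
    ContMDiffOn I 𝓘(ℝ, ℝ) ∞ (fun x => (G x).det) U := by
  simp only [Matrix.det_apply, Units.smul_def, zsmul_eq_mul]
  refine contMDiffOn_finsetSum fun σ _ => ContMDiffOn.mul contMDiffOn_const ?_
  exact contMDiffOn_finsetProd fun i _ => hG _ _

/-- Cramer's rule: the entries are quotients of determinants. -/
theorem contMDiffOn_inv_entry {U : Set M} {n : Type*} [Fintype n] [DecidableEq n]
    {G : M → Matrix n n ℝ} (hG : ∀ i j, ContMDiffOn I 𝓘(ℝ, ℝ) ∞ (fun x => G x i j) U)
    (hdet : ∀ x ∈ U, (G x).det ≠ 0) (i j : n) :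
    ContMDiffOn I 𝓘(ℝ, ℝ) ∞ (fun x => (G x)⁻¹ i j) U := by
  simp only [Matrix.inv_def, Matrix.smul_apply, Ring.inverse_eq_inv', smul_eq_mul,
    Matrix.adjugate_apply]
  refine ContMDiffOn.mul ((contMDiffOn_det hG).inv₀ hdet) (contMDiffOn_det fun k l => ?_)
  by_cases hk : k = j
  · subst hk; simpa using contMDiffOn_const
  · simpa [Matrix.updateRow_ne hk] using hG k l

/-- The sections dual to a finite jointly injective family of fibrewise linear functions. -/
theorem exists_dual_sections {N : ℕ} {s : Fin N → TotalSpace F W → ℝ}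
    (hs : ∀ a, IsFibLinear I (s a)) (hinj : ∀ x (w : W x), (∀ a, s a ⟨x, w⟩ = 0) → w = 0) :
    ∃ e : Fin N → Cₛ^∞⟮I; F, W⟯, ∀ x (w : W x), ∑ a, s a ⟨x, w⟩ • e a x = w := by
  classical
  have hsum : ∀ (a : Fin N) {κ : Type} (t : Finset κ) (x : M) (u : κ → W x),
      s a ⟨x, ∑ k ∈ t, u k⟩ = ∑ k ∈ t, s a ⟨x, u k⟩ := by
    intro a κ t x u
    induction t using Finset.induction_on with
    | empty => simpa using (hs a).map_zero x
    | insert k t hk ih => rw [Finset.sum_insert hk, Finset.sum_insert hk, (hs a).map_add, ih]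
  -- Joint injectivity makes the sum of the squares of the `s c` a fibre metric, and `e a` is the
  -- Riesz representative of `s a`. The defining equation is affine in the section, so local
  -- solutions can be patched.
  have key : ∀ a, ∃ e : Cₛ^∞⟮I; F, W⟯, ∀ x (u : W x),
      ∑ c, s c ⟨x, e x⟩ * s c ⟨x, u⟩ = s a ⟨x, u⟩ := by
    intro a
    suffices ∃ t : Cₛ^∞⟮I; F, W⟯, ∀ x, t x ∈
      {v | ∀ u : W x, ∑ c, s c ⟨x, v⟩ * s c ⟨x, u⟩ = s a ⟨x, u⟩} from this
    refine exists_contMDiffSection_forall_mem_convex_of_local I (n := ⊤) (F_fiber := F) W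
      (fun x => {v | ∀ u : W x, ∑ c, s c ⟨x, v⟩ * s c ⟨x, u⟩ = s a ⟨x, u⟩})
      (fun x => ?_) (fun x₀ => ?_)
    · intro v hv w hw p q _ _ hpq u
      simp only [(hs _).map_add, (hs _).map_smul, add_mul, Finset.sum_add_distrib, mul_assoc,
        ← Finset.mul_sum]
      rw [hv u, hw u, ← add_mul, hpq, one_mul]
    let e := trivializationAt F W x₀
    let b := Module.finBasis ℝ F
    let f := fun i y => e.localFrame b i y
    let G : M → Matrix (Fin (Module.finrank ℝ F)) (Fin (Module.finrank ℝ F)) ℝ := fun x =>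
      Matrix.of fun i j => ∑ c, s c ⟨x, f i x⟩ * s c ⟨x, f j x⟩
    have hf : ∀ c i, ContMDiffOn I 𝓘(ℝ, ℝ) ∞ (fun x => s c ⟨x, f i x⟩) e.baseSet := fun c i =>
      (hs c).smooth.comp_contMDiffOn (e.contMDiffOn_localFrame_baseSet (I := I) ∞ b i)
    have hG : ∀ i j, ContMDiffOn I 𝓘(ℝ, ℝ) ∞ (fun x => G x i j) e.baseSet := fun i j => by
      simp only [G, Matrix.of_apply]
      exact contMDiffOn_finsetSum fun c _ => (hf c i).mul (hf c j)
    -- `G` is the Gram matrix of a local frame for that metric; a null vector of it would be a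
    -- vector of length 0.
    have hdet : ∀ x ∈ e.baseSet, (G x).det ≠ 0 := by
      intro x hx h0
      obtain ⟨v, hv, hv0⟩ := Matrix.exists_mulVec_eq_zero_iff.2 h0
      have h1 : ∑ c, s c ⟨x, ∑ i, v i • f i x⟩ * s c ⟨x, ∑ i, v i • f i x⟩ = 0 := by
        have h2 : v ⬝ᵥ (G x).mulVec v = 0 := by rw [hv0]; simp
        rw [← h2]
        simp only [hsum, (hs _).map_smul, dotProduct, Matrix.mulVec, G, Matrix.of_apply,
          Finset.sum_mul, Finset.mul_sum]
        rw [Finset.sum_comm]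
        refine Finset.sum_congr rfl fun i _ => ?_
        rw [Finset.sum_comm]
        refine Finset.sum_congr rfl fun j _ => Finset.sum_congr rfl fun c _ => by ring
      have h2 : ∑ i, v i • f i x = 0 := hinj x _ fun c => by
        have := (Finset.sum_eq_zero_iff_of_nonneg fun c _ => mul_self_nonneg _).1 h1 c
          (Finset.mem_univ c)
        exact mul_self_eq_zero.1 this
      apply hv
      funext i
      have hfb : ∀ i, f i x = e.basisAt b hx i := fun i => e.localFrame_apply_of_mem_baseSet b hx
      simp only [hfb] at h2
      exact Fintype.linearIndependent_iff.1 (e.basisAt b hx).linearIndependent v h2 i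
    refine ⟨e.baseSet, e.open_baseSet.mem_nhds (FiberBundle.mem_baseSet_trivializationAt' x₀),
      fun x => ∑ i, (∑ j, (G x)⁻¹ i j * s a ⟨x, f j x⟩) • f i x, ?_, ?_⟩
    · refine (contMDiffOn_baseSet_iff_localFrameCoeff (I := I) (e := e) b).2 fun i => ?_
      have : ContMDiffOn I 𝓘(ℝ, ℝ) ∞ (fun x => ∑ j, (G x)⁻¹ i j * s a ⟨x, f j x⟩) e.baseSet :=
        contMDiffOn_finsetSum fun j _ => (contMDiffOn_inv_entry hG hdet i j).mul (hf a j)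
      refine this.congr fun y hy => ?_
      refine (e.localFrameCoeff_apply_of_mem_baseSet (I := I) b hy
        (fun x => ∑ i, (∑ j, (G x)⁻¹ i j * s a ⟨x, f j x⟩) • f i x) i).trans ?_
      simp only [f, e.localFrame_apply_of_mem_baseSet b hy, map_sum, map_smul,
        Module.Basis.repr_self, Finsupp.smul_single, Finsupp.finsetSum_apply]
      simp [Finsupp.single_apply]
    · intro x hx u
      have hu : u = ∑ k, (e.basisAt b hx).repr u k • f k x := by
        simp only [f, e.localFrame_apply_of_mem_baseSet b hx]
        exact ((e.basisAt b hx).sum_repr u).symm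
      have hmain : ∀ k, ∑ c, s c ⟨x, ∑ i, (∑ j, (G x)⁻¹ i j * s a ⟨x, f j x⟩) • f i x⟩ *
          s c ⟨x, f k x⟩ = s a ⟨x, f k x⟩ := by
        intro k
        have hGs : ∀ i j, G x i j = G x j i := fun i j => by
          simp only [G, Matrix.of_apply]
          exact Finset.sum_congr rfl fun c _ => mul_comm _ _
        have h3 : (G x).mulVec ((G x)⁻¹.mulVec fun j => s a ⟨x, f j x⟩) k = s a ⟨x, f k x⟩ := by
          rw [Matrix.mulVec_mulVec, Matrix.mul_nonsing_inv _ (isUnit_iff_ne_zero.2 (hdet x hx)),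
            Matrix.one_mulVec]
        rw [← h3]
        simp only [hsum, (hs _).map_smul, Matrix.mulVec, dotProduct, Finset.sum_mul]
        rw [Finset.sum_comm]
        refine Finset.sum_congr rfl fun i _ => ?_
        rw [hGs k i]
        simp only [G, Matrix.of_apply, Finset.sum_mul]
        refine Finset.sum_congr rfl fun c _ => ?_
        rw [Finset.mul_sum]
        refine Finset.sum_congr rfl fun j _ => ?_
        ring
      beta_reduce
      rw [hu]
      generalize hw : (∑ i, (∑ j, (G x)⁻¹ i j * s a ⟨x, f j x⟩) • f i x) = w at hmain ⊢
      simp only [hsum, (hs _).map_smul, Finset.mul_sum]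
      rw [Finset.sum_comm]
      refine Finset.sum_congr rfl fun k _ => ?_
      rw [← hmain k, Finset.mul_sum]
      exact Finset.sum_congr rfl fun c _ => by ring
  choose e he using key
  refine ⟨e, fun x w => ?_⟩
  rw [← sub_eq_zero]
  have hsub : ∀ c (u v : W x), s c ⟨x, u - v⟩ = s c ⟨x, u⟩ - s c ⟨x, v⟩ := fun c u v => by
    rw [sub_eq_add_neg, ← neg_one_smul ℝ v, (hs c).map_add, (hs c).map_smul]; ring
  have h1 : ∀ u : W x, ∑ c, s c ⟨x, ∑ a, s a ⟨x, w⟩ • e a x⟩ * s c ⟨x, u⟩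
      = ∑ c, s c ⟨x, w⟩ * s c ⟨x, u⟩ := by
    intro u
    simp only [hsum, (hs _).map_smul, Finset.sum_mul]
    rw [Finset.sum_comm]
    refine Finset.sum_congr rfl fun a _ => ?_
    rw [← he a x u, Finset.mul_sum]
    exact Finset.sum_congr rfl fun c _ => by ring
  refine hinj x _ fun c => ?_
  -- The difference of the two sides is orthogonal to every vector, in particular to itself.
  have h2 : ∑ c, s c ⟨x, ∑ a, s a ⟨x, w⟩ • e a x - w⟩ * s c ⟨x, ∑ a, s a ⟨x, w⟩ • e a x - w⟩
      = 0 := by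
    have := h1 (∑ a, s a ⟨x, w⟩ • e a x - w)
    rw [← sub_eq_zero, ← Finset.sum_sub_distrib] at this
    rw [← this]
    exact Finset.sum_congr rfl fun c _ => by rw [hsub c _ w, sub_mul]
  exact mul_self_eq_zero.1 ((Finset.sum_eq_zero_iff_of_nonneg fun c _ => mul_self_nonneg _).1 h2 c
    (Finset.mem_univ c))

end Bundle

/-! ### Finite global frames of vector bundles. -/

namespace SmoothVB

variable {E H : Type*} [NormedAddCommGroup E] [NormedSpace ℝ E] [FiniteDimensional ℝ E]
  [TopologicalSpace H] {I : ModelWithCorners ℝ E H} [I.Boundaryless]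
  {M : Type*} [TopologicalSpace M] [ChartedSpace H M] [IsManifold I ∞ M]
  [T2Space M] [SigmaCompactSpace M] (X : SmoothVB I M)

theorem isFibLinear_ell (ε : X.dual.Sec) : Bundle.IsFibLinear (F := X.Model) I (X.ell ε) where
  smooth := (X.ell ε).contMDiff
  map_add x w w' := (X.dualFib (ε x)).map_add w w'
  map_smul x c w := (X.dualFib (ε x)).map_smul c w

theorem exists_dualSec_eq (x : M) (l : X.Fib x →ₗ[ℝ] ℝ) :
    ∃ ε : X.dual.Sec, ∀ w, X.dualFib (ε x) w = l w := by
  have : FiniteDimensional ℝ (X.Fib x) := VectorBundle.finiteDimensional ℝ X.Model X.Fib x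
  have : T2Space (X.Fib x) := FiberBundle.t2Space X.Model X.Fib x
  let l' : X.dual.Fib x := LinearMap.toContinuousLinearMap l
  obtain ⟨ε, hε⟩ := Bundle.exists_section_eq (I := I) (F := X.dual.Model) (W := X.dual.Fib) x l'
  exact ⟨ε, fun w => by rw [hε]; rfl⟩

theorem exists_sec_eq (x : M) (v : X.Fib x) : ∃ e : X.Sec, e x = v :=
  Bundle.exists_section_eq (I := I) (F := X.Model) (W := X.Fib) x v

/-- The sections of a vector bundle have a finite global frame. -/
theorem exists_frame : ∃ (N : ℕ) (e : Fin N → X.Sec) (ε : Fin N → X.dual.Sec),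
    ∀ x (w : X.Fib x), ∑ a, X.dualFib (ε a x) w • e a x = w := by
  let 𝒮 : Submodule ℝ (X.Tot → ℝ) :=
    { carrier := {s | ∃ ε : X.dual.Sec, s = X.ell ε}
      add_mem' := by rintro _ _ ⟨a, rfl⟩ ⟨b, rfl⟩; exact ⟨a + b, rfl⟩
      zero_mem' := ⟨0, rfl⟩
      smul_mem' := by rintro c _ ⟨a, rfl⟩; exact ⟨c • a, rfl⟩ }
  obtain ⟨N, s, hs, hinj⟩ := Bundle.exists_finite_jointlyInjective (I := I) (F := X.Model)
    (W := X.Fib) (𝒮 := 𝒮) (by rintro _ ⟨ε, rfl⟩; exact X.isFibLinear_ell ε)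
    (fun x w hw => by
      have : FiniteDimensional ℝ (X.Fib x) := VectorBundle.finiteDimensional ℝ X.Model X.Fib x
      obtain ⟨l, hl⟩ := not_forall.1 (mt (Module.forall_dual_apply_eq_zero_iff ℝ w).1 hw)
      obtain ⟨ε, hε⟩ := X.exists_dualSec_eq x l
      exact ⟨_, ⟨ε, rfl⟩, by simpa [ell, hε] using hl⟩)
    (fun L s hL hlf hd hs => by
      choose ε hε using hs
      obtain ⟨t, ht⟩ := Bundle.exists_section_glue (I := I) (F := X.dual.Model) (W := X.dual.Fib)
        hL hlf hd ε
      refine ⟨_, ⟨t, rfl⟩, fun j x hx w => ?_⟩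
      rw [hε]
      change X.dualFib (t x) w = X.dualFib (ε j x) w
      rw [ht j x (interior_subset hx)])
  choose ε hε using hs
  obtain ⟨e, he⟩ := Bundle.exists_dual_sections (fun a => by rw [hε a]; exact X.isFibLinear_ell (ε a)) hinj
  refine ⟨N, e, ε, fun x w => ?_⟩
  have := he x w
  simp only [hε] at this
  exact this

end SmoothVB

/-! ### Parameter integrals and Hadamard's lemma. -/

section Hadamard

open MeasureTheory Set Filter Topology

/-- The integral is the value at 0 of a convolution, in the last variable, of the indicator of `(0,
1]` with a compactly supported cut-off of `t ↦ G (p, -t)`; convolutions depend smoothly on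
parameters. -/
theorem contDiff_intervalIntegral_param {P : Type*} [NormedAddCommGroup P] [NormedSpace ℝ P]
    {G : P × ℝ → ℝ} (hG : ContDiff ℝ ∞ G) :
    ContDiff ℝ ∞ (fun p => ∫ t in (0 : ℝ)..1, G (p, t)) := by
  let χ : ContDiffBump (0 : ℝ) := ⟨1, 2, by norm_num, by norm_num⟩
  let g : P → ℝ → ℝ := fun p s => χ s * G (p, -s)
  have hg : ContDiff ℝ ∞ (Function.uncurry g) := by
    have h1 : ContDiff ℝ ∞ (χ : ℝ → ℝ) := χ.contDiff
    exact (h1.comp contDiff_snd).mul (hG.comp (contDiff_fst.prodMk contDiff_snd.neg))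
  have h := contDiffOn_convolution_right_with_param_comp (n := ⊤) (μ := volume)
    (ContinuousLinearMap.mul ℝ ℝ) (s := (univ : Set P)) (v := fun _ => (0 : ℝ)) contDiffOn_const
    (f := indicator (Ioc 0 1) (fun _ => (1 : ℝ))) (g := g) (k := tsupport χ) isOpen_univ
    χ.hasCompactSupport
    (fun p x _ hx => by simp [g, image_eq_zero_of_notMem_tsupport hx])
    ((locallyIntegrable_const 1).indicator measurableSet_Ioc) hg.contDiffOn
  rw [contDiffOn_univ] at h
  convert h using 1
  funext p
  rw [convolution_def, intervalIntegral.integral_of_le zero_le_one, ← integral_indicator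
    measurableSet_Ioc]
  congr 1
  funext t
  by_cases ht : t ∈ Ioc (0 : ℝ) 1
  · have h1 : χ (-t) = 1 := χ.one_of_mem_closedBall (by
      simp only [mem_closedBall_zero_iff, norm_neg, Real.norm_eq_abs, abs_le]
      change -1 ≤ t ∧ t ≤ 1
      exact ⟨by linarith [ht.1], ht.2⟩)
    simp [ht, g, h1]
  · simp [ht]

/-- Hadamard's lemma. -/
theorem exists_hadamard {E : Type*} [NormedAddCommGroup E] [NormedSpace ℝ E] {u : E → ℝ}
    (hu : ContDiff ℝ ∞ u) (y₀ : E) : ∃ a : E → E → ℝ, (∀ v, ContDiff ℝ ∞ (fun y => a y v)) ∧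
      (∀ v, a y₀ v = fderiv ℝ u y₀ v) ∧
      ∀ {κ : Type} (t : Finset κ) (b : κ → E) (c : κ → ℝ) (y : E), y - y₀ = ∑ i ∈ t, c i • b i →
        u y - u y₀ = ∑ i ∈ t, c i * a y (b i) := by
  have hd : ContDiff ℝ ∞ (fderiv ℝ u) := hu.fderiv_right (by simp)
  have hG : ∀ v, ContDiff ℝ ∞ (fun z : E × ℝ => fderiv ℝ u (y₀ + z.2 • (z.1 - y₀)) v) := fun v =>
    (hd.comp (contDiff_const.add (contDiff_snd.smul (contDiff_fst.sub contDiff_const)))).clm_apply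
      contDiff_const
  refine ⟨fun y v => ∫ t in (0 : ℝ)..1, fderiv ℝ u (y₀ + t • (y - y₀)) v,
    fun v => contDiff_intervalIntegral_param (hG v), fun v => by simp, ?_⟩
  intro κ s b c y hy
  -- The fundamental theorem of calculus along the segment from `y₀` to `y`; expanding `y - y₀`
  -- under the integral gives the formula.
  have h1 : ∫ t in (0 : ℝ)..1, fderiv ℝ u (y₀ + t • (y - y₀)) (y - y₀) = u y - u y₀ := by
    have := intervalIntegral.integral_eq_sub_of_hasDerivAt (a := 0) (b := 1)
      (f := fun t : ℝ => u (y₀ + t • (y - y₀)))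
      (f' := fun t => fderiv ℝ u (y₀ + t • (y - y₀)) (y - y₀)) (fun t _ => by
        have hd1 : HasDerivAt (fun t : ℝ => y₀ + t • (y - y₀)) (y - y₀) t := by
          simpa using ((hasDerivAt_id t).smul_const (y - y₀)).const_add y₀
        exact ((hu.differentiable (by simp)).differentiableAt.hasFDerivAt).comp_hasDerivAt t hd1)
      (((hG (y - y₀)).continuous.comp (Continuous.prodMk continuous_const continuous_id)).intervalIntegrable 0 1)
    rw [this]; simp
  rw [← h1]
  simp only [hy, map_sum, map_smul]
  rw [← hy, intervalIntegral.integral_finsetSum (fun i _ => ?_)]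
  · refine Finset.sum_congr rfl fun i _ => ?_
    simp only [smul_eq_mul]
    rw [intervalIntegral.integral_const_mul]
  · exact (((hG (b i)).continuous.comp
      (Continuous.prodMk continuous_const continuous_id)).const_smul (c i)).intervalIntegrable 0 1

end Hadamard

/-! ### Point derivations depend only on the differential. -/

section PointDerivation

open Set Filter Topology

variable {E H : Type*} [NormedAddCommGroup E] [NormedSpace ℝ E] [FiniteDimensional ℝ E]
  [TopologicalSpace H] {I : ModelWithCorners ℝ E H} [I.Boundaryless]
  {M : Type*} [TopologicalSpace M] [ChartedSpace H M] [IsManifold I ∞ M] [T2Space M]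

theorem exists_eventuallyEq_of_contMDiffOn_chart {p : M} {f : M → ℝ}
    (hf : ContMDiffOn I 𝓘(ℝ, ℝ) ∞ f (chartAt H p).source) :
    ∃ g : C^∞⟮I, M; ℝ⟯, (g : M → ℝ) =ᶠ[𝓝 p] f := by
  obtain ⟨φ⟩ : Nonempty (SmoothBumpFunction I p) := inferInstance
  refine ⟨⟨fun x => φ x • f x, φ.contMDiff_smul hf⟩, ?_⟩
  filter_upwards [φ.eventuallyEq_one] with x hx
  simp [hx]

theorem exists_bump_of_mem_nhds {p : M} {U : Set M} (hU : U ∈ 𝓝 p) :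
    ∃ χ : C^∞⟮I, M; ℝ⟯, (χ : M → ℝ) =ᶠ[𝓝 p] 1 ∧ ∀ x, x ∉ U → χ x = 0 := by
  obtain ⟨φ, _, hφ⟩ := (SmoothBumpFunction.nhds_basis_tsupport (I := I) p).mem_iff.1 hU
  exact ⟨⟨φ, φ.contMDiff⟩, φ.eventuallyEq_one,
    fun x hx => image_eq_zero_of_notMem_tsupport fun h => hx (hφ h)⟩

variable {p : M} {D : C^∞⟮I, M; ℝ⟯ →ₗ[ℝ] ℝ} (hD : ∀ f g, D (f * g) = D f * g p + f p * D g)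

include hD

/-- With a bump `χ` equal to 1 near `p` one has `h = (1 - χ) * h`, a product of two functions
vanishing at `p`, which the Leibniz rule kills. -/
theorem pointDerivation_eq_zero_of_eventuallyEq {h : C^∞⟮I, M; ℝ⟯} (hh : (h : M → ℝ) =ᶠ[𝓝 p] 0) :
    D h = 0 := by
  obtain ⟨χ, hχ, hχ'⟩ := exists_bump_of_mem_nhds (I := I) hh
  have h1 : h = (1 - χ) * h := by
    ext x
    by_cases hx : h x = 0
    · simp [hx]
    · simp [hχ' x hx]
  have h2 : h p = 0 := hh.eq_of_nhds
  have h3 : χ p = 1 := hχ.eq_of_nhds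
  rw [h1, hD, h2]
  simp [h3]

/-- A point derivation vanishes on functions vanishing to second order. -/
theorem pointDerivation_eq_zero {h : C^∞⟮I, M; ℝ⟯} (h0 : h p = 0)
    (h1 : mfderiv I 𝓘(ℝ, ℝ) h p = 0) : D h = 0 := by
  let φ := extChartAt I p
  have htgt : φ.target ∈ 𝓝 (φ p) := extChartAt_target_mem_nhds p
  obtain ⟨r, hr, hball⟩ := Metric.mem_nhds_iff.1 htgt
  let ψ : ContDiffBump (φ p) := ⟨r / 4, r / 2, by positivity, by linarith⟩
  -- The coordinate expression of `h` is cut off to be smooth on the whole vector space, where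
  -- Hadamard's lemma applies.
  let u : E → ℝ := fun y => ψ y * h (φ.symm y)
  have hsymm : ContMDiffOn 𝓘(ℝ, E) 𝓘(ℝ, ℝ) ∞ (fun y => h (φ.symm y)) φ.target :=
    h.contMDiff.comp_contMDiffOn (contMDiffOn_extChartAt_symm p)
  have hu : ContDiff ℝ ∞ u := by
    rw [contDiff_iff_contDiffAt]
    intro y
    by_cases hy : y ∈ Metric.ball (φ p) r
    · refine ψ.contDiff.contDiffAt.mul ?_
      exact (hsymm.contDiffOn.contDiffAt (mem_of_superset (Metric.isOpen_ball.mem_nhds hy) hball))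
    · have : u =ᶠ[𝓝 y] fun _ => 0 := by
        have hyc : y ∈ (tsupport ψ)ᶜ := by
          rw [ψ.tsupport_eq]
          intro hyc
          refine hy (Metric.closedBall_subset_ball ?_ hyc)
          change r / 2 < r
          linarith
        filter_upwards [(isClosed_tsupport ψ).isOpen_compl.mem_nhds hyc] with z hz
        simp [u, image_eq_zero_of_notMem_tsupport hz]
      exact contDiffAt_const.congr_of_eventuallyEq this
  have huh : u =ᶠ[𝓝 (φ p)] fun y => h (φ.symm y) := by
    filter_upwards [ψ.eventuallyEq_one] with y hy
    simp [u, hy]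
  have hu0 : u (φ p) = 0 := by
    rw [huh.eq_of_nhds]
    simp only [φ, extChartAt_to_inv, h0]
  have hdu : fderiv ℝ u (φ p) = 0 := by
    rw [huh.fderiv_eq, ← mfderiv_eq_fderiv]
    have hφ : MDifferentiableAt 𝓘(ℝ, E) I φ.symm (φ p) :=
      ((contMDiffOn_extChartAt_symm (n := ∞) p).contMDiffAt htgt).mdifferentiableAt (by simp)
    have hc := mfderiv_comp (I := 𝓘(ℝ, E)) (I' := I) (I'' := 𝓘(ℝ, ℝ)) (f := φ.symm) (g := h) (φ p)
      (h.contMDiff.mdifferentiable (by simp) _) hφ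
    have hp : φ.symm (φ p) = p := extChartAt_to_inv p
    refine hc.trans ?_
    rw [hp, h1]
    exact ContinuousLinearMap.zero_comp _
  obtain ⟨a, ha, ha0, hexp⟩ := exists_hadamard hu (φ p)
  let b := Module.finBasis ℝ E
  have hφs : ContMDiffOn I 𝓘(ℝ, E) ∞ φ (chartAt H p).source := contMDiffOn_extChartAt
  have hc : ∀ i, ∃ g : C^∞⟮I, M; ℝ⟯, (g : M → ℝ) =ᶠ[𝓝 p] fun x => b.repr (φ x - φ p) i := by
    intro i
    refine exists_eventuallyEq_of_contMDiffOn_chart ?_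
    have : ContDiff ℝ ∞ (fun y : E => b.repr (y - φ p) i) :=
      (LinearMap.toContinuousLinearMap (b.coord i)).contDiff.comp (contDiff_id.sub contDiff_const)
    exact this.contMDiff.comp_contMDiffOn hφs
  have hA : ∀ i, ∃ g : C^∞⟮I, M; ℝ⟯, (g : M → ℝ) =ᶠ[𝓝 p] fun x => a (φ x) (b i) := fun i =>
    exists_eventuallyEq_of_contMDiffOn_chart ((ha (b i)).contMDiff.comp_contMDiffOn hφs)
  choose c hc using hc
  choose A hA using hA
  -- Near `p`, `h` is the sum of the products of the coordinates with the Hadamard coefficients.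
  -- Both factors vanish at `p`, the second because `du = 0` there, so `D` kills every product.
  have hsum : D (h - ∑ i, c i * A i) = 0 := by
    refine pointDerivation_eq_zero_of_eventuallyEq hD ?_
    have e1 : ∀ᶠ x in 𝓝 p, u (φ x) = h (φ.symm (φ x)) :=
      (continuousAt_extChartAt p).eventually huh
    have e2 : ∀ᶠ x in 𝓝 p, x ∈ φ.source := extChartAt_source_mem_nhds p
    filter_upwards [e1, e2, eventually_all.2 hc, eventually_all.2 hA] with x h1 h2 h3 h4
    have h5 := hexp Finset.univ b (fun i => b.repr (φ x - φ p) i) (φ x) (b.sum_repr _).symm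
    rw [hu0, sub_zero, h1, φ.left_inv h2] at h5
    have h6 : (∑ i, c i * A i : C^∞⟮I, M; ℝ⟯) x = ∑ i, c i x * A i x := by
      rw [← ContMDiffMap.coeFnAddMonoidHom_apply, map_sum, Finset.sum_apply]; rfl
    simp only [ContMDiffMap.coe_sub, Pi.sub_apply, h6, h5, h3, h4, sub_self, Pi.zero_apply]
  rw [map_sub, sub_eq_zero] at hsum
  rw [hsum, map_sum]
  refine Finset.sum_eq_zero fun i _ => ?_
  rw [hD, (hc i).eq_of_nhds, (hA i).eq_of_nhds, ha0, hdu]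
  simp

end PointDerivation

/-! ### Differentials of functions and derivations of smooth functions. -/

section Coordinates

open Set Filter Topology

variable {E H : Type*} [NormedAddCommGroup E] [NormedSpace ℝ E] [FiniteDimensional ℝ E]
  [TopologicalSpace H] {I : ModelWithCorners ℝ E H} [I.Boundaryless]
  {M : Type*} [TopologicalSpace M] [ChartedSpace H M] [IsManifold I ∞ M]

/-- The differential of a smooth function, as a linear form. -/
def dAt (g : C^∞⟮I, M; ℝ⟯) (x : M) : TangentSpace I x →ₗ[ℝ] ℝ :=
  (mfderiv I 𝓘(ℝ, ℝ) g x).toLinearMap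

theorem dAt_apply (g : C^∞⟮I, M; ℝ⟯) (x : M) (w : TangentSpace I x) :
    dAt g x w = mfderiv I 𝓘(ℝ, ℝ) g x w := rfl

theorem ContMDiffMap.mdiffAt (g : C^∞⟮I, M; ℝ⟯) (x : M) : MDifferentiableAt I 𝓘(ℝ, ℝ) g x :=
  g.contMDiff.mdifferentiable (by simp) x

theorem dAt_add (f g : C^∞⟮I, M; ℝ⟯) (x : M) (w : TangentSpace I x) :
    dAt (f + g) x w = dAt f x w + dAt g x w :=
  DFunLike.congr_fun (mfderiv_add (f.mdiffAt x) (g.mdiffAt x)) w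

theorem dAt_smul (c : ℝ) (f : C^∞⟮I, M; ℝ⟯) (x : M) (w : TangentSpace I x) :
    dAt (c • f) x w = c * dAt f x w :=
  DFunLike.congr_fun (const_smul_mfderiv (f.mdiffAt x) c) w

theorem dAt_mul (f g : C^∞⟮I, M; ℝ⟯) (x : M) (w : TangentSpace I x) :
    dAt (f * g) x w = dAt f x w * g x + f x * dAt g x w := by
  have h := DFunLike.congr_fun ((f.mdiffAt x).hasMFDerivAt.mul (g.mdiffAt x).hasMFDerivAt).mfderiv w
  refine h.trans ?_
  change f x * dAt g x w + g x * dAt f x w = _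
  ring

theorem dAt_congr {f g : C^∞⟮I, M; ℝ⟯} {x : M} (h : (f : M → ℝ) =ᶠ[𝓝 x] g) : dAt f x = dAt g x := by
  ext w
  exact DFunLike.congr_fun h.mfderiv_eq w

theorem contMDiff_dAt_comp (g : C^∞⟮I, M; ℝ⟯) {E' H' : Type*} [NormedAddCommGroup E']
    [NormedSpace ℝ E'] [TopologicalSpace H'] {I' : ModelWithCorners ℝ E' H'} {M' : Type*}
    [TopologicalSpace M'] [ChartedSpace H' M'] {f : M' → TangentBundle I M}
    (hf : ContMDiff I' I.tangent ∞ f) :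
    ContMDiff I' 𝓘(ℝ, ℝ) ∞ fun y => dAt g (f y).proj (f y).2 := by
  have h1 : ContMDiff I.tangent 𝓘(ℝ, ℝ).tangent ∞ (tangentMap I 𝓘(ℝ, ℝ) g) :=
    g.contMDiff.contMDiff_tangentMap (by simp)
  exact ((contMDiff_snd_tangentBundle_modelSpace ℝ 𝓘(ℝ, ℝ)).comp h1).comp hf

/-- The differential of a chart is injective; a linear form of the chart that does not vanish on the
image vector is extended by a bump function. -/
theorem exists_dAt_ne_zero [T2Space M] {x : M} {w : TangentSpace I x} (hw : w ≠ 0) :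
    ∃ g : C^∞⟮I, M; ℝ⟯, dAt g x w ≠ 0 := by
  let φ := extChartAt I x
  have hinj := (isInvertible_mfderiv_extChartAt (I := I) (mem_extChartAt_source (I := I) x)).injective
  have hw' : mfderiv I 𝓘(ℝ, E) φ x w ≠ 0 := fun h => hw (hinj (by rw [map_zero]; exact h))
  obtain ⟨l, hl⟩ := not_forall.1 (mt (Module.forall_dual_apply_eq_zero_iff ℝ _).1 hw')
  let l' : E →L[ℝ] ℝ := LinearMap.toContinuousLinearMap (show E →ₗ[ℝ] ℝ from l)
  obtain ⟨g, hg⟩ := exists_eventuallyEq_of_contMDiffOn_chart (I := I) (p := x) (f := fun y => l' (φ y))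
    (l'.contDiff.contMDiff.comp_contMDiffOn contMDiffOn_extChartAt)
  refine ⟨g, fun h0 => hl ?_⟩
  rw [dAt_apply, hg.mfderiv_eq] at h0
  have hc := mfderiv_comp (I := I) (I' := 𝓘(ℝ, E)) (I'' := 𝓘(ℝ, ℝ)) (f := φ) (g := l') x
    (l'.contDiff.contMDiff.mdifferentiable (n := ∞) (by simp) _)
    (mdifferentiableAt_extChartAt (mem_chart_source H x))
  have h2 := (DFunLike.congr_fun hc w).symm.trans h0
  have h3 : mfderiv 𝓘(ℝ, E) 𝓘(ℝ, ℝ) l' (φ x) = l' := by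
    rw [mfderiv_eq_fderiv]; exact l'.fderiv
  have h4 : (mfderiv 𝓘(ℝ, E) 𝓘(ℝ, ℝ) l' (φ x)) (mfderiv I 𝓘(ℝ, E) φ x w) = 0 := h2
  rw [h3] at h4
  exact h4

theorem isFibLinear_dAt (g : C^∞⟮I, M; ℝ⟯) :
    Bundle.IsFibLinear (F := E) (W := fun x : M => TangentSpace I x) I
      (fun w => dAt g w.proj w.2) where
  smooth := contMDiff_dAt_comp g contMDiff_id
  map_add x w w' := (dAt g x).map_add w w'
  map_smul x c w := (dAt g x).map_smul c w

/-- Finitely many functions whose differentials generate the cotangent bundle, with dual vector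
fields. -/
theorem exists_tangent_frame [T2Space M] [SigmaCompactSpace M] :
    ∃ (N : ℕ) (g : Fin N → C^∞⟮I, M; ℝ⟯)
      (Y : Fin N → Cₛ^∞⟮I; E, fun x : M => TangentSpace I x⟯),
      ∀ x (w : TangentSpace I x), ∑ k, dAt (g k) x w • Y k x = w := by
  let 𝒮 : Submodule ℝ (TotalSpace E (fun x : M => TangentSpace I x) → ℝ) :=
    { carrier := {s | ∃ g : C^∞⟮I, M; ℝ⟯, s = fun w => dAt g w.proj w.2}
      add_mem' := by
        rintro _ _ ⟨a, rfl⟩ ⟨b, rfl⟩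
        exact ⟨a + b, by funext w; exact (dAt_add a b _ _).symm⟩
      zero_mem' := ⟨0, by
        funext w
        have := dAt_smul 0 (0 : C^∞⟮I, M; ℝ⟯) w.proj w.2
        rw [zero_smul, zero_mul] at this
        exact this.symm⟩
      smul_mem' := by
        rintro c _ ⟨a, rfl⟩
        exact ⟨c • a, by funext w; exact (dAt_smul c a _ _).symm⟩ }
  obtain ⟨N, s, hs, hinj⟩ := Bundle.exists_finite_jointlyInjective (I := I) (F := E)
    (W := fun x : M => TangentSpace I x) (𝒮 := 𝒮) (by rintro _ ⟨g, rfl⟩; exact isFibLinear_dAt g)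
    (fun x w hw => by
      obtain ⟨g, hg⟩ := exists_dAt_ne_zero hw
      exact ⟨_, ⟨g, rfl⟩, hg⟩)
    (fun L s hL hlf hd hs => by
      choose g hg using hs
      obtain ⟨t, ht⟩ := Bundle.exists_function_glue hL hlf hd g
      refine ⟨_, ⟨t, rfl⟩, fun j x hx w => ?_⟩
      rw [hg]
      change dAt t x w = dAt (g j) x w
      rw [dAt_congr]
      filter_upwards [mem_interior_iff_mem_nhds.1 hx] with y hy using ht j y hy)
  choose g hg using hs
  obtain ⟨e, he⟩ := Bundle.exists_dual_sections (I := I) (F := E)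
    (W := fun x : M => TangentSpace I x) (fun a => by rw [hg a]; exact isFibLinear_dAt (g a)) hinj
  refine ⟨N, g, e, fun x w => ?_⟩
  have := he x w
  simp only [hg] at this
  exact this

/-- The derivation of the algebra of smooth functions given by a vector field. -/
def lieD (Y : Cₛ^∞⟮I; E, fun x : M => TangentSpace I x⟯) : C^∞⟮I, M; ℝ⟯ →ₗ[ℝ] C^∞⟮I, M; ℝ⟯ where
  toFun f := ⟨fun x => dAt f x (Y x), contMDiff_dAt_comp f Y.contMDiff⟩
  map_add' f g := by ext x; exact dAt_add f g x _
  map_smul' c f := by ext x; exact dAt_smul c f x _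

theorem lieD_apply (Y : Cₛ^∞⟮I; E, fun x : M => TangentSpace I x⟯) (f : C^∞⟮I, M; ℝ⟯) (x : M) :
    lieD Y f x = dAt f x (Y x) := rfl

theorem lieD_mul (Y : Cₛ^∞⟮I; E, fun x : M => TangentSpace I x⟯) (f g : C^∞⟮I, M; ℝ⟯) :
    lieD Y (f * g) = lieD Y f * g + f * lieD Y g := by
  ext x; exact dAt_mul f g x _

theorem sum_apply_contMDiffMap {κ : Type*} (s : Finset κ) (f : κ → C^∞⟮I, M; ℝ⟯) (x : M) :
    (∑ k ∈ s, f k) x = ∑ k ∈ s, f k x := by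
  rw [← ContMDiffMap.coeFnAddMonoidHom_apply, map_sum, Finset.sum_apply]; rfl

/-- A derivation is determined by its values on functions `g k` whose differentials, paired with
vector fields `Y k`, give a frame. -/
theorem derivation_eq_sum [T2Space M] {κ : Type*} [Fintype κ] {g : κ → C^∞⟮I, M; ℝ⟯}
    {Y : κ → Cₛ^∞⟮I; E, fun x : M => TangentSpace I x⟯}
    (hY : ∀ x (w : TangentSpace I x), ∑ k, dAt (g k) x w • Y k x = w)
    {D : C^∞⟮I, M; ℝ⟯ →ₗ[ℝ] C^∞⟮I, M; ℝ⟯} (hD : ∀ f g, D (f * g) = D f * g + f * D g)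
    (f : C^∞⟮I, M; ℝ⟯) : D f = ∑ k, lieD (Y k) f * D (g k) := by
  ext p
  let Dp : C^∞⟮I, M; ℝ⟯ →ₗ[ℝ] ℝ :=
    { toFun := fun f => D f p
      map_add' := fun f g => by rw [map_add]; rfl
      map_smul' := fun c f => by rw [map_smul]; rfl }
  have hDp : ∀ f g, Dp (f * g) = Dp f * g p + f p * Dp g := fun f g => by
    change (D (f * g)) p = _
    rw [hD]; rfl
  have hone : Dp 1 = 0 := by
    have := hDp 1 1
    simp at this
    exact this
  -- `f` minus its first order expansion at `p` in the functions `g k`. By the frame identity it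
  -- vanishes to second order at `p`, so the point derivation `Dp` kills it.
  let h : C^∞⟮I, M; ℝ⟯ := (f - f p • 1) - ∑ k, lieD (Y k) f p • (g k - g k p • 1)
  have hdone : ∀ w, dAt (1 : C^∞⟮I, M; ℝ⟯) p w = 0 := fun w => by
    have := dAt_mul (1 : C^∞⟮I, M; ℝ⟯) 1 p w
    simp at this
    exact this
  have hdsub : ∀ (f g : C^∞⟮I, M; ℝ⟯) w, dAt (f - g) p w = dAt f p w - dAt g p w := fun f g w => by
    rw [sub_eq_add_neg, ← neg_one_smul ℝ g, dAt_add, dAt_smul]; ring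
  have hdsum : ∀ (u : κ → C^∞⟮I, M; ℝ⟯) w, dAt (∑ k, u k) p w = ∑ k, dAt (u k) p w := fun u w => by
    classical
    induction (Finset.univ : Finset κ) using Finset.induction_on with
    | empty =>
      have := dAt_smul 0 (0 : C^∞⟮I, M; ℝ⟯) p w
      simpa using this
    | insert k t hk ih => rw [Finset.sum_insert hk, Finset.sum_insert hk, dAt_add, ih]
  have h0 : h p = 0 := by
    simp [h, sum_apply_contMDiffMap]
  have h1 : mfderiv I 𝓘(ℝ, ℝ) h p = 0 := by
    ext w
    change dAt h p w = 0
    simp only [h, hdsub, hdsum, dAt_smul, hdone, lieD_apply]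
    have h2 : dAt f p w = ∑ k, dAt f p (Y k p) * dAt (g k) p w := by
      conv_lhs => rw [← hY p w, map_sum]
      exact Finset.sum_congr rfl fun k _ => by rw [map_smul, smul_eq_mul, mul_comm]
    rw [h2]
    simp
  have h2 := pointDerivation_eq_zero hDp h0 h1
  simp only [h, map_sub, map_sum, map_smul, hone, smul_zero, sub_zero, sub_eq_zero] at h2
  rw [sum_apply_contMDiffMap]
  exact h2

end Coordinates

/-! ### Chosen frames of a bundle, of its dual and of its pullbacks. -/

namespace SmoothVB

section Ext

variable {E H : Type*} [NormedAddCommGroup E] [NormedSpace ℝ E]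
  [TopologicalSpace H] {I : ModelWithCorners ℝ E H}
  {M : Type*} [TopologicalSpace M] [ChartedSpace H M] (X : SmoothVB I M)

theorem sec_sum_apply {κ : Type*} (s : Finset κ) (e : κ → X.Sec) (x : M) :
    (∑ k ∈ s, e k) x = ∑ k ∈ s, e k x := by
  classical
  induction s using Finset.induction_on with
  | empty => simp
  | insert k s hk ih => rw [Finset.sum_insert hk, Finset.sum_insert hk, ← ih]; rfl

theorem dual_ext {ε ε' : X.dual.Sec} (h : ∀ x w, X.dualFib (ε x) w = X.dualFib (ε' x) w) :
    ε = ε' := by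
  ext x
  exact ContinuousLinearMap.ext (h x)

end Ext

section Frames

variable {E H : Type*} [NormedAddCommGroup E] [NormedSpace ℝ E] [FiniteDimensional ℝ E]
  [TopologicalSpace H] {I : ModelWithCorners ℝ E H} [I.Boundaryless]
  {M : Type*} [TopologicalSpace M] [ChartedSpace H M] [IsManifold I ∞ M]
  [T2Space M] [SigmaCompactSpace M] (X : SmoothVB I M)

/-- The number of elements of a chosen finite global frame of `X`. -/
def frameCard : ℕ := X.exists_frame.choose

/-- A chosen finite global frame of `X`. -/
def frame : Fin X.frameCard → X.Sec := X.exists_frame.choose_spec.choose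

/-- The dual of the chosen finite global frame of `X`. -/
def coframe : Fin X.frameCard → X.dual.Sec := X.exists_frame.choose_spec.choose_spec.choose

theorem sum_coframe_smul_frame_apply (x : M) (w : X.Fib x) :
    ∑ a, X.dualFib (X.coframe a x) w • X.frame a x = w :=
  X.exists_frame.choose_spec.choose_spec.choose_spec x w

theorem sum_coframe_smul_frame (e : X.Sec) : ∑ a, X.pair (X.coframe a) e • X.frame a = e := by
  ext x
  rw [sec_sum_apply]
  exact X.sum_coframe_smul_frame_apply x (e x)

theorem sum_frame_smul_coframe (ε : X.dual.Sec) :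
    ∑ a, X.pair ε (X.frame a) • X.coframe a = ε := by
  have key : ∀ (x : M) (w : X.Fib x) (s : Finset (Fin X.frameCard)),
      X.dualFib ((∑ a ∈ s, X.pair ε (X.frame a) • X.coframe a) x) w
        = ∑ a ∈ s, X.dualFib (ε x) (X.frame a x) * X.dualFib (X.coframe a x) w := by
    classical
    intro x w s
    induction s using Finset.induction_on with
    | empty => rfl
    | insert k s hk ih => rw [Finset.sum_insert hk, Finset.sum_insert hk, ← ih]; rfl
  refine X.dual_ext fun x w => ?_
  rw [key]
  conv_rhs => rw [← X.sum_coframe_smul_frame_apply x w, map_sum]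
  exact Finset.sum_congr rfl fun a _ => by rw [map_smul, smul_eq_mul, mul_comm]

/-- The chosen frame of the dual bundle, as a frame of the module of sections. -/
def dualSecFrame : FiniteFrame C^∞⟮I, M; ℝ⟯ X.dual.Sec (Fin X.frameCard) where
  vec := X.coframe
  co a := X.pair.flip (X.frame a)
  sum_smul := X.sum_frame_smul_coframe

end Frames

section Pullback

variable {E H : Type*} [NormedAddCommGroup E] [NormedSpace ℝ E]
  [TopologicalSpace H] {I : ModelWithCorners ℝ E H}
  {M : Type*} [TopologicalSpace M] [ChartedSpace H M] (X : SmoothVB I M)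
  {E' H' : Type*} [NormedAddCommGroup E'] [NormedSpace ℝ E'] [TopologicalSpace H']
  {I' : ModelWithCorners ℝ E' H'} {M' : Type*} [TopologicalSpace M'] [ChartedSpace H' M']

theorem contMDiff_pullback_section (f : C^∞⟮I', M'; I, M⟯) (e : X.Sec) :
    ContMDiff I' (I'.prod 𝓘(ℝ, X.Model)) ∞ (fun y => TotalSpace.mk' X.Model
      (E := ((f : M' → M) *ᵖ X.Fib)) y (e (f y))) := by
  intro y
  have h := ((contMDiffAt_totalSpace).1 ((e.contMDiff.comp f.contMDiff) y)).2
  exact (contMDiffAt_totalSpace).2 ⟨contMDiffAt_id, h⟩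

/-- The pullback of sections. -/
def pullSec (f : C^∞⟮I', M'; I, M⟯) : X.Sec →ₛₗ[pullFun f] (X.pullback f).Sec where
  toFun e := ⟨fun y => (e (f y) : X.Fib (f y)), X.contMDiff_pullback_section f e⟩
  map_add' _ _ := rfl
  map_smul' _ _ := rfl

end Pullback

section PullbackFrame

variable {E H : Type*} [NormedAddCommGroup E] [NormedSpace ℝ E] [FiniteDimensional ℝ E]
  [TopologicalSpace H] {I : ModelWithCorners ℝ E H} [I.Boundaryless]
  {M : Type*} [TopologicalSpace M] [ChartedSpace H M] [IsManifold I ∞ M]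
  [T2Space M] [SigmaCompactSpace M] (X : SmoothVB I M)
  {E' H' : Type*} [NormedAddCommGroup E'] [NormedSpace ℝ E'] [TopologicalSpace H']
  {I' : ModelWithCorners ℝ E' H'} {M' : Type*} [TopologicalSpace M'] [ChartedSpace H' M']
  (f : C^∞⟮I', M'; I, M⟯)

/-- The pulled back frames still generate over the larger ring, since the frame identity is a
pointwise statement about the fibre over `f y`. -/
theorem sum_pullDual_coframe (σ : (X.pullback f).dual.Sec) :
    ∑ a, (X.pullback f).pair σ (X.pullSec f (X.frame a)) • X.pullDual f (X.coframe a) = σ := by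
  refine dual_ext _ fun y w => ?_
  have hw := X.sum_coframe_smul_frame_apply (f y) w
  have key : ∀ (s : Finset (Fin X.frameCard)), (X.pullback f).dualFib ((∑ a ∈ s,
      (X.pullback f).pair σ (X.pullSec f (X.frame a)) • X.pullDual f (X.coframe a)) y) w
        = ∑ a ∈ s, (X.pullback f).pair σ (X.pullSec f (X.frame a)) y *
          X.dualFib (X.coframe a (f y)) w := by
    classical
    intro s
    induction s using Finset.induction_on with
    | empty => rfl
    | insert k s hk ih => rw [Finset.sum_insert hk, Finset.sum_insert hk, ← ih]; rfl
  rw [key]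
  have := congrArg ((X.pullback f).dualFib (σ y)) hw.symm
  refine Eq.symm (this.trans ((map_sum ((X.pullback f).dualFib (σ y)) _ _).trans ?_))
  refine Finset.sum_congr rfl fun a _ => ?_
  exact (((X.pullback f).dualFib (σ y)).map_smul _ _).trans (mul_comm _ _)

/-- The frame of the dual of a pullback bundle given by the chosen frame of `X`. -/
def pullDualFrame : FiniteFrame C^∞⟮I', M'; ℝ⟯ (X.pullback f).dual.Sec (Fin X.frameCard) where
  vec a := X.pullDual f (X.coframe a)
  co a := (X.pullback f).pair.flip (X.pullSec f (X.frame a))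
  sum_smul := X.sum_pullDual_coframe f

end PullbackFrame

/-! ### Smoothness of maps into the total space of a vector bundle. -/

section TotalSpace

variable {E H : Type*} [NormedAddCommGroup E] [NormedSpace ℝ E]
  [TopologicalSpace H] {I : ModelWithCorners ℝ E H}
  {M : Type*} [TopologicalSpace M] [ChartedSpace H M] (V : SmoothVB I M)

instance t2Space_tot [T2Space M] : T2Space V.Tot := by
  refine ⟨fun v w hvw => ?_⟩
  by_cases h : v.proj = w.proj
  · let e := trivializationAt V.Model V.Fib v.proj
    have hv : v ∈ e.source := by rw [e.mem_source]; exact mem_baseSet_trivializationAt _ _ _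
    have hw : w ∈ e.source := by rw [e.mem_source, ← h]; exact mem_baseSet_trivializationAt _ _ _
    have hne : e v ≠ e w := fun h' => hvw (e.toOpenPartialHomeomorph.injOn hv hw h')
    obtain ⟨U, U', hU, hU', hvU, hwU, hd⟩ := t2_separation hne
    refine ⟨e.source ∩ e ⁻¹' U, e.source ∩ e ⁻¹' U',
      e.toOpenPartialHomeomorph.isOpen_inter_preimage hU,
      e.toOpenPartialHomeomorph.isOpen_inter_preimage hU', ⟨hv, hvU⟩, ⟨hw, hwU⟩, ?_⟩
    rw [Set.disjoint_left]
    rintro u ⟨_, hu⟩ ⟨_, hu'⟩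
    exact Set.disjoint_left.1 hd hu hu'
  · exact separated_by_continuous (f := TotalSpace.proj) V.proj.contMDiff.continuous h

/-- The trivialisation is replaced by `linearMapAt`, linear on every fibre, so that sums and
multiples of maps into the total space can be treated termwise. -/
theorem contMDiff_tot_iff {E' H' : Type*} [NormedAddCommGroup E'] [NormedSpace ℝ E']
    [TopologicalSpace H'] {I' : ModelWithCorners ℝ E' H'} {M' : Type*} [TopologicalSpace M']
    [ChartedSpace H' M'] {f : M' → V.Tot} (hf : ContMDiff I' I ∞ fun y => (f y).proj) :
    ContMDiff I' V.totI ∞ f ↔ ∀ y₀, ContMDiffAt I' 𝓘(ℝ, V.Model) ∞ (fun y =>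
      (trivializationAt V.Model V.Fib (f y₀).proj).linearMapAt ℝ (f y).proj (f y).2) y₀ := by
  refine forall_congr' fun y₀ => ?_
  rw [contMDiffAt_totalSpace]
  refine (and_iff_right (hf y₀)).trans ?_
  refine Filter.EventuallyEq.contMDiffAt_iff ?_
  have : ∀ᶠ y in nhds y₀, (f y).proj ∈ (trivializationAt V.Model V.Fib (f y₀).proj).baseSet :=
    (hf y₀).continuousAt.eventually ((trivializationAt V.Model V.Fib (f y₀).proj).open_baseSet.mem_nhds
      (mem_baseSet_trivializationAt _ _ _))
  filter_upwards [this] with y hy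
  rw [Trivialization.coe_linearMapAt_of_mem _ hy]

theorem contMDiff_add_tot {E' H' : Type*} [NormedAddCommGroup E'] [NormedSpace ℝ E']
    [TopologicalSpace H'] {I' : ModelWithCorners ℝ E' H'} {M' : Type*} [TopologicalSpace M']
    [ChartedSpace H' M'] {b : M' → M} {u v : ∀ y, V.Fib (b y)}
    (hu : ContMDiff I' V.totI ∞ fun y => (⟨b y, u y⟩ : V.Tot))
    (hv : ContMDiff I' V.totI ∞ fun y => (⟨b y, v y⟩ : V.Tot)) :
    ContMDiff I' V.totI ∞ fun y => (⟨b y, u y + v y⟩ : V.Tot) := by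
  have hb : ContMDiff I' I ∞ b := V.proj.contMDiff.comp hu
  refine (V.contMDiff_tot_iff hb).2 fun y₀ => ?_
  simp only [map_add]
  exact ((V.contMDiff_tot_iff hb).1 hu y₀).add ((V.contMDiff_tot_iff hb).1 hv y₀)

theorem contMDiff_smul_tot {E' H' : Type*} [NormedAddCommGroup E'] [NormedSpace ℝ E']
    [TopologicalSpace H'] {I' : ModelWithCorners ℝ E' H'} {M' : Type*} [TopologicalSpace M']
    [ChartedSpace H' M'] {b : M' → M} {c : M' → ℝ} {u : ∀ y, V.Fib (b y)}
    (hc : ContMDiff I' 𝓘(ℝ, ℝ) ∞ c)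
    (hu : ContMDiff I' V.totI ∞ fun y => (⟨b y, u y⟩ : V.Tot)) :
    ContMDiff I' V.totI ∞ fun y => (⟨b y, c y • u y⟩ : V.Tot) := by
  have hb : ContMDiff I' I ∞ b := V.proj.contMDiff.comp hu
  refine (V.contMDiff_tot_iff hb).2 fun y₀ => ?_
  simp only [map_smul]
  exact (hc y₀).smul ((V.contMDiff_tot_iff hb).1 hu y₀)

theorem contMDiff_sum_tot {E' H' : Type*} [NormedAddCommGroup E'] [NormedSpace ℝ E']
    [TopologicalSpace H'] {I' : ModelWithCorners ℝ E' H'} {M' : Type*} [TopologicalSpace M']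
    [ChartedSpace H' M'] {b : M' → M} {κ : Type*} (s : Finset κ) {u : κ → ∀ y, V.Fib (b y)}
    (hb : ContMDiff I' I ∞ b)
    (hu : ∀ k, ContMDiff I' V.totI ∞ fun y => (⟨b y, u k y⟩ : V.Tot)) :
    ContMDiff I' V.totI ∞ fun y => (⟨b y, ∑ k ∈ s, u k y⟩ : V.Tot) := by
  refine (V.contMDiff_tot_iff hb).2 fun y₀ => ?_
  simp only [map_sum]
  exact contMDiffAt_finsetSum fun k _ => (V.contMDiff_tot_iff hb).1 (hu k) y₀

end TotalSpace

end SmoothVB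

/-! ### The structure maps of `V` as smooth maps. -/

namespace DVB

open SmoothVB

variable {E H : Type*} [NormedAddCommGroup E] [NormedSpace ℝ E]
  [TopologicalSpace H] {I : ModelWithCorners ℝ E H}
  {M : Type*} [TopologicalSpace M] [ChartedSpace H M] (V : SmoothVB I M)

theorem contMDiff_smulV (t : ℝ) : ContMDiff V.totI V.totI ∞ (smulV V t) :=
  V.contMDiff_smul_tot contMDiff_const contMDiff_id

theorem contMDiff_fstV : ContMDiff (I.prod 𝓘(ℝ, V.Model × V.Model)) V.totI ∞ (fstV V) := by
  refine (V.contMDiff_tot_iff (contMDiff_proj (V.Fib ×ᵇ V.Fib))).2 fun y₀ => ?_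
  have h := ((contMDiffAt_totalSpace).1 (contMDiff_id (I := I.prod 𝓘(ℝ, V.Model × V.Model))
    (n := ∞) y₀)).2
  refine (contDiff_fst.contMDiff.contMDiffAt.comp y₀ h).congr_of_eventuallyEq ?_
  have hp := (contMDiff_proj (IB := I) (n := ∞) (F := V.Model × V.Model) (V.Fib ×ᵇ V.Fib)).continuous
  have : ∀ᶠ y in nhds y₀, y.proj ∈ (trivializationAt V.Model V.Fib y₀.proj).baseSet :=
    hp.continuousAt.eventually ((trivializationAt V.Model V.Fib y₀.proj).open_baseSet.mem_nhds
      (mem_baseSet_trivializationAt _ _ _))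
  filter_upwards [this] with y hy
  exact congrFun (Trivialization.coe_linearMapAt_of_mem _ hy) y.2.1

theorem contMDiff_sndV : ContMDiff (I.prod 𝓘(ℝ, V.Model × V.Model)) V.totI ∞ (sndV V) := by
  refine (V.contMDiff_tot_iff (contMDiff_proj (V.Fib ×ᵇ V.Fib))).2 fun y₀ => ?_
  have h := ((contMDiffAt_totalSpace).1 (contMDiff_id (I := I.prod 𝓘(ℝ, V.Model × V.Model))
    (n := ∞) y₀)).2
  refine (contDiff_snd.contMDiff.contMDiffAt.comp y₀ h).congr_of_eventuallyEq ?_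
  have hp := (contMDiff_proj (IB := I) (n := ∞) (F := V.Model × V.Model) (V.Fib ×ᵇ V.Fib)).continuous
  have : ∀ᶠ y in nhds y₀, y.proj ∈ (trivializationAt V.Model V.Fib y₀.proj).baseSet :=
    hp.continuousAt.eventually ((trivializationAt V.Model V.Fib y₀.proj).open_baseSet.mem_nhds
      (mem_baseSet_trivializationAt _ _ _))
  filter_upwards [this] with y hy
  exact congrFun (Trivialization.coe_linearMapAt_of_mem _ hy) y.2.2

theorem contMDiff_addV : ContMDiff (I.prod 𝓘(ℝ, V.Model × V.Model)) V.totI ∞ (addV V) :=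
  V.contMDiff_add_tot (contMDiff_fstV V) (contMDiff_sndV V)

/-- The scalar multiplication on the total space, as a smooth map. -/
def smulMap (t : ℝ) : C^∞⟮V.totI, V.Tot; V.totI, V.Tot⟯ := ⟨smulV V t, contMDiff_smulV V t⟩

end DVB

theorem dAt_comp {E H : Type*} [NormedAddCommGroup E] [NormedSpace ℝ E]
    [TopologicalSpace H] {I : ModelWithCorners ℝ E H} {M : Type*} [TopologicalSpace M]
    [ChartedSpace H M] [FiniteDimensional ℝ E] [I.Boundaryless] [IsManifold I ∞ M]
    {E' H' : Type*} [NormedAddCommGroup E'] [NormedSpace ℝ E'] [TopologicalSpace H']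
    {I' : ModelWithCorners ℝ E' H'} {M' : Type*} [TopologicalSpace M'] [ChartedSpace H' M']
    [FiniteDimensional ℝ E'] [I'.Boundaryless] [IsManifold I' ∞ M']
    (f : C^∞⟮I, M; ℝ⟯) (φ : C^∞⟮I', M'; I, M⟯) (y : M')
    (w : TangentSpace I' y) : dAt (f.comp φ) y w = dAt f (φ y) (mfderiv I' I φ y w) :=
  DFunLike.congr_fun (mfderiv_comp (I' := I) (I'' := 𝓘(ℝ, ℝ)) y (f.mdiffAt (φ y))
    (φ.contMDiff.mdifferentiable (by simp) y)) w

/-! ### Vector fields on `V` obtained from its frame. -/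

namespace DVB

open SmoothVB

variable {E H : Type*} [NormedAddCommGroup E] [NormedSpace ℝ E] [FiniteDimensional ℝ E]
  [TopologicalSpace H] {I : ModelWithCorners ℝ E H} [I.Boundaryless]
  {M : Type*} [TopologicalSpace M] [ChartedSpace H M] [IsManifold I ∞ M]
  [T2Space M] [SigmaCompactSpace M] (V : SmoothVB I M)

/-- The linear combinations of the frame of `V`, as a smooth map. -/
def fibComb : C^∞⟮I.prod 𝓘(ℝ, Fin V.frameCard → ℝ), M × (Fin V.frameCard → ℝ); V.totI, V.Tot⟯ :=
  ⟨fun p => ⟨p.1, ∑ c, p.2 c • V.frame c p.1⟩, by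
    refine V.contMDiff_sum_tot Finset.univ contMDiff_fst fun c => ?_
    refine V.contMDiff_smul_tot ?_ ((V.frame c).contMDiff.comp contMDiff_fst)
    exact ((ContinuousLinearMap.proj (R := ℝ) (φ := fun _ : Fin V.frameCard => ℝ)
      c).contMDiff).comp contMDiff_snd⟩

/-- The components with respect to the frame of `V`, as a smooth map. -/
def fibCoord : C^∞⟮V.totI, V.Tot; I.prod 𝓘(ℝ, Fin V.frameCard → ℝ), M × (Fin V.frameCard → ℝ)⟯ :=
  ⟨fun v => (v.proj, fun c => V.ell (V.coframe c) v),
    V.proj.contMDiff.prodMk (contMDiff_pi_space.2 fun c => (V.ell (V.coframe c)).contMDiff)⟩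

/-- A global frame exhibits the total space of `V` as a smooth retract of `M × ℝ^N`. Vector fields
and differentials on `V` are computed on this product without local coordinates. -/
theorem fibComb_fibCoord (v : V.Tot) : fibComb V (fibCoord V v) = v :=
  congrArg (TotalSpace.mk v.proj) (V.sum_coframe_smul_frame_apply v.proj v.2)

theorem tangent_mk_congr {M' : Type*} [TopologicalSpace M'] [ChartedSpace H M'] {a b : M'}
    (h : a = b) (X : E) : (⟨a, X⟩ : TangentBundle I M') = ⟨b, X⟩ := by rw [h]

/-- The tangent vector of a product with given components. -/
def prodVec {M' G : Type*} [TopologicalSpace M'] [ChartedSpace H M'] [NormedAddCommGroup G]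
    [NormedSpace ℝ G] (p : M' × G) (a : TangentSpace I p.1) (y : G) :
    TangentSpace (I.prod 𝓘(ℝ, G)) p :=
  ((a, y) : E × G)

/-- The vector field on the total space of `V` given by a vector field on the base and a linear
combination of the frame. -/
def liftField (Y : Cₛ^∞⟮I; E, fun x : M => TangentSpace I x⟯) (y : Fin V.frameCard → ℝ) :
    Cₛ^∞⟮V.totI; E × V.Model, fun v : V.Tot => TangentSpace V.totI v⟯ where
  toFun v := (mfderiv (I.prod 𝓘(ℝ, Fin V.frameCard → ℝ)) V.totI (fibComb V) (fibCoord V v)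
    (prodVec (fibCoord V v) (Y v.proj) y) : E × V.Model)
  contMDiff_toFun := by
    have h1 : ContMDiff (I.prod 𝓘(ℝ, Fin V.frameCard → ℝ)).tangent V.totI.tangent ∞
        (tangentMap (I.prod 𝓘(ℝ, Fin V.frameCard → ℝ)) V.totI (fibComb V)) :=
      (fibComb V).contMDiff.contMDiff_tangentMap (by simp)
    have h2 : ContMDiff V.totI I.tangent ∞ (fun v : V.Tot => (⟨v.proj, Y v.proj⟩ : TangentBundle I M)) :=
      Y.contMDiff.comp V.proj.contMDiff
    have h3 : ContMDiff V.totI 𝓘(ℝ, Fin V.frameCard → ℝ).tangent ∞ (fun v : V.Tot =>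
        (⟨(fibCoord V v).2, y⟩ : TangentBundle 𝓘(ℝ, Fin V.frameCard → ℝ) (Fin V.frameCard → ℝ))) := by
      refine fun v₀ => contMDiffAt_totalSpace.2
        ⟨(contMDiff_snd.comp (fibCoord V).contMDiff) v₀, ?_⟩
      simp only [TangentBundle.trivializationAt_apply]
      simp
      refine (contMDiffAt_const (I := V.totI) (M := V.Tot) (I' := 𝓘(ℝ, Fin V.frameCard → ℝ))
        (c := y)).congr_of_eventuallyEq (Filter.Eventually.of_forall fun v => ?_)
      change fderiv ℝ id _ y = y
      simp
    have h4 := (contMDiff_equivTangentBundleProd_symm (I := I) (M := M) (n := ∞)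
      (I' := 𝓘(ℝ, Fin V.frameCard → ℝ)) (M' := Fin V.frameCard → ℝ)).comp (h2.prodMk h3)
    -- The tangent map of `fibComb` applied to a smooth vector on the product lands over `fibComb
    -- (fibCoord v)`, which is `v`.
    refine (h1.comp h4).congr fun v => ?_
    exact (tangent_mk_congr (I := V.totI) (fibComb_fibCoord V v) _).symm

theorem lieD_liftField (Y : Cₛ^∞⟮I; E, fun x : M => TangentSpace I x⟯) (y : Fin V.frameCard → ℝ)
    (f : C^∞⟮V.totI, V.Tot; ℝ⟯) (v : V.Tot) :
    lieD (liftField V Y y) f v =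
      dAt (f.comp (fibComb V)) (fibCoord V v) (prodVec (fibCoord V v) (Y v.proj) y) := by
  refine Eq.trans ?_ (dAt_comp f (fibComb V) (fibCoord V v) _).symm
  have : ∀ u : V.Tot, u = v → ∀ X : E × V.Model, dAt f v X = dAt f u X := by rintro _ rfl X; rfl
  exact this _ (fibComb_fibCoord V v) _

theorem dAt_fst_prodVec {G : Type*} [NormedAddCommGroup G] [NormedSpace ℝ G]
    [FiniteDimensional ℝ G] (g : C^∞⟮I, M; ℝ⟯) (p : M × G) (a : TangentSpace I p.1) (y : G) :
    dAt (I := I.prod 𝓘(ℝ, G)) (g.comp ContMDiffMap.fst) p (prodVec p a y)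
      = dAt g p.1 a := by
  refine (dAt_comp g ContMDiffMap.fst p _).trans ?_
  have : mfderiv (I.prod 𝓘(ℝ, G)) I (Prod.fst : M × G → M) p (prodVec p a y) = a := by
    rw [mfderiv_fst]; rfl
  exact congrArg (dAt g p.1) this

/-- The function on a product with a vector space given by a linear form. -/
def linSnd {G : Type*} [NormedAddCommGroup G] [NormedSpace ℝ G] (l : G →L[ℝ] ℝ) :
    C^∞⟮I.prod 𝓘(ℝ, G), M × G; ℝ⟯ :=
  ⟨fun q => l q.2, l.contMDiff.comp contMDiff_snd⟩

theorem dAt_linSnd_prodVec {G : Type*} [NormedAddCommGroup G] [NormedSpace ℝ G]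
    [FiniteDimensional ℝ G] (l : G →L[ℝ] ℝ) (p : M × G) (a : TangentSpace I p.1) (y : G) :
    dAt (I := I.prod 𝓘(ℝ, G)) (linSnd l) p (prodVec p a y) = l y := by
  have h := dAt_comp (I := 𝓘(ℝ, G)) (⟨l, l.contMDiff⟩ : C^∞⟮𝓘(ℝ, G), G; ℝ⟯)
    (ContMDiffMap.snd : C^∞⟮I.prod 𝓘(ℝ, G), M × G; 𝓘(ℝ, G), G⟯) p (prodVec p a y)
  refine h.trans ?_
  have h2 : mfderiv (I.prod 𝓘(ℝ, G)) 𝓘(ℝ, G) (Prod.snd : M × G → G) p (prodVec p a y) = y := by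
    rw [mfderiv_snd]; rfl
  refine (congrArg (dAt _ p.2) h2).trans ?_
  change mfderiv 𝓘(ℝ, G) 𝓘(ℝ, ℝ) l p.2 y = _
  rw [mfderiv_eq_fderiv]
  exact DFunLike.congr_fun l.fderiv y

theorem dAt_sum {κ : Type*} (s : Finset κ) (f : κ → C^∞⟮I, M; ℝ⟯) (x : M) (w : TangentSpace I x) :
    dAt (∑ k ∈ s, f k) x w = ∑ k ∈ s, dAt (f k) x w := by
  classical
  induction s using Finset.induction_on with
  | empty => simpa using dAt_smul 0 (0 : C^∞⟮I, M; ℝ⟯) x w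
  | insert k t hk ih => rw [Finset.sum_insert hk, Finset.sum_insert hk, dAt_add, ih]

theorem lieD_liftField_pullFun (Y : Cₛ^∞⟮I; E, fun x : M => TangentSpace I x⟯)
    (y : Fin V.frameCard → ℝ) (g : C^∞⟮I, M; ℝ⟯) :
    lieD (liftField V Y y) (pullFun V.proj g) = pullFun V.proj (lieD Y g) := by
  ext v
  rw [lieD_liftField]
  exact dAt_fst_prodVec g (fibCoord V v) (Y v.proj) y

/-- On the product, a fibrewise linear function becomes a sum of functions on `M` times coordinates
of `ℝ^N`, so its derivatives follow from the product rule. -/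
theorem ell_comp_fibComb (ψ : V.dual.Sec) : (V.ell ψ).comp (fibComb V) =
    ∑ c, (V.pair ψ (V.frame c)).comp ContMDiffMap.fst *
      linSnd (ContinuousLinearMap.proj (R := ℝ) (φ := fun _ : Fin V.frameCard => ℝ) c) := by
  ext p
  rw [sum_apply_contMDiffMap]
  change V.dualFib (ψ p.1) (∑ c, p.2 c • V.frame c p.1) = _
  rw [map_sum]
  exact Finset.sum_congr rfl fun c _ => by rw [map_smul, smul_eq_mul, mul_comm]; rfl

theorem lieD_liftField_ell (Y : Cₛ^∞⟮I; E, fun x : M => TangentSpace I x⟯)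
    (y : Fin V.frameCard → ℝ) (ψ : V.dual.Sec) :
    lieD (liftField V Y y) (V.ell ψ) =
      ∑ c, (pullFun V.proj (lieD Y (V.pair ψ (V.frame c))) * V.ell (V.coframe c) +
        y c • pullFun V.proj (V.pair ψ (V.frame c))) := by
  ext v
  rw [lieD_liftField, ell_comp_fibComb, dAt_sum, sum_apply_contMDiffMap]
  refine Finset.sum_congr rfl fun c _ => ?_
  refine (dAt_mul _ _ _ _).trans (congrArg₂ (· + ·) (congrArg (· * _)
    (dAt_fst_prodVec _ (fibCoord V v) _ _)) ?_)
  exact (congrArg _ (dAt_linSnd_prodVec _ (fibCoord V v) _ _)).trans (mul_comm _ _)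

theorem mfderiv_fibCoord (v : V.Tot) (w : TangentSpace V.totI v) :
    mfderiv V.totI (I.prod 𝓘(ℝ, Fin V.frameCard → ℝ)) (fibCoord V) v w =
      prodVec (fibCoord V v) (mfderiv V.totI I V.proj v w)
        (fun c => dAt (V.ell (V.coframe c)) v w) := by
  let φ : C^∞⟮V.totI, V.Tot; 𝓘(ℝ, Fin V.frameCard → ℝ), Fin V.frameCard → ℝ⟯ :=
    ContMDiffMap.snd.comp (fibCoord V)
  have h2 : mfderiv V.totI 𝓘(ℝ, Fin V.frameCard → ℝ) φ v w =
      fun c => dAt (V.ell (V.coframe c)) v w := by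
    funext c
    let l := ContinuousLinearMap.proj (R := ℝ) (φ := fun _ : Fin V.frameCard => ℝ) c
    have h := dAt_comp (I := 𝓘(ℝ, Fin V.frameCard → ℝ))
      (⟨l, l.contMDiff⟩ : C^∞⟮𝓘(ℝ, Fin V.frameCard → ℝ), Fin V.frameCard → ℝ; ℝ⟯) φ v w
    refine Eq.symm (h.trans ?_)
    change mfderiv 𝓘(ℝ, Fin V.frameCard → ℝ) 𝓘(ℝ, ℝ) l _ _ = _
    rw [mfderiv_eq_fderiv]
    exact DFunLike.congr_fun l.fderiv _
  have h1 := (V.proj.contMDiff.mdifferentiable (by simp) v).hasMFDerivAt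
  have h3 := (φ.contMDiff.mdifferentiable (by simp) v).hasMFDerivAt
  refine (DFunLike.congr_fun (h1.prodMk h3).mfderiv w).trans ?_
  exact congrArg (prodVec (fibCoord V v) (mfderiv V.totI I V.proj v w)) h2

/-- The derivative of the retraction identity. -/
theorem mfderiv_fibComb_fibCoord (v : V.Tot) (w : TangentSpace V.totI v) :
    (mfderiv (I.prod 𝓘(ℝ, Fin V.frameCard → ℝ)) V.totI (fibComb V) (fibCoord V v)
      (mfderiv V.totI (I.prod 𝓘(ℝ, Fin V.frameCard → ℝ)) (fibCoord V) v w) : E × V.Model) = w := by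
  have h := mfderiv_comp (I := V.totI) (I' := I.prod 𝓘(ℝ, Fin V.frameCard → ℝ)) (I'' := V.totI) v
    ((fibComb V).contMDiff.mdifferentiable (by simp) (fibCoord V v))
    ((fibCoord V).contMDiff.mdifferentiable (by simp) v)
  have h2 : (fibComb V ∘ fibCoord V : V.Tot → V.Tot) = id := funext (fibComb_fibCoord V)
  rw [h2, mfderiv_id] at h
  exact (DFunLike.congr_fun h w).symm

end DVB

/-! ### A tangent frame of the total space of `V`, and homogeneous functions on `V`. -/

namespace DVB

open SmoothVB

variable {E H : Type*} [NormedAddCommGroup E] [NormedSpace ℝ E] [FiniteDimensional ℝ E]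
  [TopologicalSpace H] {I : ModelWithCorners ℝ E H} [I.Boundaryless]
  {M : Type*} [TopologicalSpace M] [ChartedSpace H M] [IsManifold I ∞ M]
  [T2Space M] [SigmaCompactSpace M] (V : SmoothVB I M)

variable (I M) in
/-- The number of elements of a chosen family of functions on `M` with generating differentials. -/
def tanCard : ℕ := (exists_tangent_frame (I := I) (M := M)).choose

variable (I M) in
/-- A chosen finite family of functions on `M` with generating differentials. -/
def tanFun : Fin (tanCard I M) → C^∞⟮I, M; ℝ⟯ :=
  (exists_tangent_frame (I := I) (M := M)).choose_spec.choose

variable (I M) in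
/-- The vector fields dual to the chosen functions. -/
def tanField : Fin (tanCard I M) → Cₛ^∞⟮I; E, fun x : M => TangentSpace I x⟯ :=
  (exists_tangent_frame (I := I) (M := M)).choose_spec.choose_spec.choose

theorem sum_dAt_tanFun (x : M) (w : TangentSpace I x) :
    ∑ k, dAt (tanFun I M k) x w • tanField I M k x = w :=
  (exists_tangent_frame (I := I) (M := M)).choose_spec.choose_spec.choose_spec x w

/-- Functions on the total space of `V` with generating differentials. -/
def baseFun : Fin (tanCard I M) ⊕ Fin V.frameCard → C^∞⟮V.totI, V.Tot; ℝ⟯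
  | .inl k => pullFun V.proj (tanFun I M k)
  | .inr c => V.ell (V.coframe c)

/-- The vector fields on the total space of `V` dual to `baseFun`. -/
def baseField : Fin (tanCard I M) ⊕ Fin V.frameCard →
    Cₛ^∞⟮V.totI; E × V.Model, fun v : V.Tot => TangentSpace V.totI v⟯
  | .inl k => liftField V (tanField I M k) 0
  | .inr c => liftField V 0 (Pi.single c 1)

theorem sum_smul_prodVec {G κ : Type*} [NormedAddCommGroup G] [NormedSpace ℝ G] (s : Finset κ)
    (p : M × G) (r : κ → ℝ) (a : κ → TangentSpace I p.1) (y : κ → G) :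
    ∑ k ∈ s, r k • prodVec p (a k) (y k) =
      prodVec p (∑ k ∈ s, r k • a k) (∑ k ∈ s, r k • y k) := by
  classical
  induction s using Finset.induction_on with
  | empty => rfl
  | insert k s hk ih =>
    rw [Finset.sum_insert hk, Finset.sum_insert hk, Finset.sum_insert hk, ih]; rfl

/-- The image of `w` in the tangent space of `M × ℝ^N` splits into a part along `M`, expanded in the
tangent frame of `M`, and a part along `ℝ^N`; pushing forward again returns `w`. So functions pulled
back from `M` and fibrewise linear functions determine derivations on `V`. -/
theorem sum_dAt_baseFun (v : V.Tot) (w : TangentSpace V.totI v) :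
    ∑ j, dAt (baseFun V j) v w • baseField V j v = w := by
  refine Eq.trans ?_ (mfderiv_fibComb_fibCoord V v w)
  rw [mfderiv_fibCoord]
  have h : prodVec (fibCoord V v) (mfderiv V.totI I V.proj v w)
        (fun c => dAt (V.ell (V.coframe c)) v w) =
      ∑ k, dAt (baseFun V (.inl k)) v w • prodVec (fibCoord V v) (tanField I M k v.proj) 0 +
      ∑ c, dAt (baseFun V (.inr c)) v w • prodVec (fibCoord V v) (0 : TangentSpace I v.proj)
        (Pi.single c 1) := by
    refine Eq.trans ?_ (congrArg₂ (· + ·) (sum_smul_prodVec _ (fibCoord V v) _ _ _).symm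
      (sum_smul_prodVec _ (fibCoord V v) _ _ _).symm)
    have h1 : ∑ k, dAt (baseFun V (.inl k)) v w • tanField I M k v.proj =
        mfderiv V.totI I V.proj v w := by
      conv_rhs => rw [← sum_dAt_tanFun (I := I) _ (mfderiv V.totI I V.proj v w)]
      refine Finset.sum_congr rfl fun k _ => ?_
      exact congrArg (· • tanField I M k v.proj) (dAt_comp (tanFun I M k) V.proj v w)
    have h2 : ∑ c, dAt (baseFun V (.inr c)) v w • (Pi.single c 1 : Fin V.frameCard → ℝ) =
        fun c => dAt (V.ell (V.coframe c)) v w := by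
      funext c
      rw [Finset.sum_apply]
      simp [Pi.single_apply]
      rfl
    have h3 : ∀ (a : TangentSpace I v.proj) (y : Fin V.frameCard → ℝ), prodVec (fibCoord V v) a y =
        prodVec (fibCoord V v) a 0 + prodVec (fibCoord V v) (0 : TangentSpace I v.proj) y :=
      fun a y => congrArg₂ (fun a b => ((a, b) : E × (Fin V.frameCard → ℝ))) (add_zero _).symm
        (zero_add _).symm
    refine (h3 _ _).trans (congrArg₂ (· + ·) ?_ ?_)
    · refine congrArg₂ (prodVec (fibCoord V v)) h1.symm ?_
      exact (Finset.sum_eq_zero fun k _ => smul_zero _).symm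
    · refine congrArg₂ (prodVec (fibCoord V v)) ?_ h2.symm
      exact (Finset.sum_eq_zero fun k _ => smul_zero _).symm
  rw [h, map_add, map_sum, map_sum, Fintype.sum_sum_type]
  refine congrArg₂ (· + ·) (Finset.sum_congr rfl fun k _ => ?_) (Finset.sum_congr rfl fun c _ => ?_)
  · exact (map_smul (mfderiv (I.prod 𝓘(ℝ, Fin V.frameCard → ℝ)) V.totI (fibComb V) (fibCoord V v))
      _ _).symm
  · exact (map_smul (mfderiv (I.prod 𝓘(ℝ, Fin V.frameCard → ℝ)) V.totI (fibComb V) (fibCoord V v))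
      _ _).symm

theorem lieD_zero (f : C^∞⟮I, M; ℝ⟯) :
    lieD (0 : Cₛ^∞⟮I; E, fun x : M => TangentSpace I x⟯) f = 0 := by
  ext x; exact (dAt f x).map_zero

theorem lieD_baseField_inl_pullFun (k : Fin (tanCard I M)) (g : C^∞⟮I, M; ℝ⟯) :
    lieD (baseField V (.inl k)) (pullFun V.proj g) = pullFun V.proj (lieD (tanField I M k) g) :=
  lieD_liftField_pullFun V _ _ g

theorem lieD_baseField_inr_pullFun (c : Fin V.frameCard) (g : C^∞⟮I, M; ℝ⟯) :
    lieD (baseField V (.inr c)) (pullFun V.proj g) = 0 := by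
  rw [baseField, lieD_liftField_pullFun, lieD_zero, map_zero]

theorem lieD_baseField_inl_ell (k : Fin (tanCard I M)) (ψ : V.dual.Sec) :
    lieD (baseField V (.inl k)) (V.ell ψ) =
      ∑ c, pullFun V.proj (lieD (tanField I M k) (V.pair ψ (V.frame c))) * V.ell (V.coframe c) := by
  rw [baseField, lieD_liftField_ell]
  simp

theorem lieD_baseField_inr_ell (c : Fin V.frameCard) (ψ : V.dual.Sec) :
    lieD (baseField V (.inr c)) (V.ell ψ) = pullFun V.proj (V.pair ψ (V.frame c)) := by
  rw [baseField, lieD_liftField_ell]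
  simp [lieD_zero, Pi.single_apply]

/-- A section of `V`, as a smooth map into the total space. -/
def secMap (e : V.Sec) : C^∞⟮I, M; V.totI, V.Tot⟯ := ⟨fun x => ⟨x, e x⟩, e.contMDiff⟩

theorem pullFun_secMap_pullFun (e : V.Sec) (g : C^∞⟮I, M; ℝ⟯) :
    pullFun (secMap V e) (pullFun V.proj g) = g := rfl

theorem pullFun_secMap_ell (e : V.Sec) (ψ : V.dual.Sec) :
    pullFun (secMap V e) (V.ell ψ) = V.pair ψ e := rfl

/-- The function `F` on the total space of `V` is homogeneous of degree `w` along the fibres. -/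
def IsHomog (w : ℤ) (F : C^∞⟮V.totI, V.Tot; ℝ⟯) : Prop :=
  ∀ t : ℝ, t ≠ 0 → pullFun (smulMap V t) F = t ^ w • F

theorem isHomog_iff {V : SmoothVB I M} {w : ℤ} {F : C^∞⟮V.totI, V.Tot; ℝ⟯} : IsHomog V w F ↔
    ∀ t : ℝ, t ≠ 0 → ∀ m (x : V.Fib m), F ⟨m, t • x⟩ = t ^ w * F ⟨m, x⟩ := by
  refine forall₂_congr fun t _ => ?_
  rw [ContMDiffMap.ext_iff]
  exact ⟨fun h m x => h ⟨m, x⟩, fun h v => h v.proj v.2⟩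

theorem pullFun_smulMap_pullFun (t : ℝ) (g : C^∞⟮I, M; ℝ⟯) :
    pullFun (smulMap V t) (pullFun V.proj g) = pullFun V.proj g := rfl

theorem pullFun_smulMap_ell (t : ℝ) (ψ : V.dual.Sec) :
    pullFun (smulMap V t) (V.ell ψ) = t • V.ell ψ := by
  ext v
  exact (V.dualFib (ψ v.proj)).map_smul t v.2

variable {V}

theorem continuous_smul_line (F : C^∞⟮V.totI, V.Tot; ℝ⟯) (m : M) (x : V.Fib m) :
    Continuous fun t : ℝ => F ⟨m, t • x⟩ :=
  F.contMDiff.continuous.comp (V.contMDiff_smul_tot (I' := 𝓘(ℝ, ℝ)) contMDiff_id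
    (contMDiff_const (c := (⟨m, x⟩ : V.Tot)))).continuous

theorem apply_zero_of_forall_ne {g : ℝ → ℝ} (hg : Continuous g) {c : ℝ} (h : ∀ t, t ≠ 0 → g t = c) :
    g 0 = c :=
  congrFun (hg.ext_on (dense_compl_singleton 0) continuous_const fun t ht => h t ht) 0

/-- For `t ≠ 0` the function `t^(-w) F(t x)` has the constant value `F(x)`; by continuity so does
its value at `t = 0`, which is 0. -/
theorem IsHomog.eq_zero {w : ℤ} (hw : w < 0) {F : C^∞⟮V.totI, V.Tot; ℝ⟯} (hF : IsHomog V w F) :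
    F = 0 := by
  ext ⟨m, x⟩
  obtain ⟨k, rfl⟩ : ∃ k : ℕ, w = -(k + 1 : ℤ) := ⟨(-w - 1).toNat, by omega⟩
  have h := apply_zero_of_forall_ne (g := fun t => t ^ (k + 1) * F ⟨m, t • x⟩) (c := F ⟨m, x⟩)
    ((continuous_pow _).mul (continuous_smul_line F m x)) (fun t ht => by
      rw [isHomog_iff.1 hF t ht, zpow_neg]
      have : (t : ℝ) ^ ((k : ℤ) + 1) = t ^ (k + 1) := by exact_mod_cast zpow_natCast t (k + 1)
      rw [this, mul_inv_cancel_left₀ (pow_ne_zero _ ht)])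
  simp at h
  exact h.symm

/-- `F(t x)` is constant for `t ≠ 0` and continuous in `t`. -/
theorem IsHomog.apply_eq_zero_sec {F : C^∞⟮V.totI, V.Tot; ℝ⟯} (hF : IsHomog V 0 F) (m : M)
    (x : V.Fib m) : F ⟨m, x⟩ = F ⟨m, 0⟩ := by
  have h := apply_zero_of_forall_ne (c := F ⟨m, x⟩) (continuous_smul_line F m x)
    (fun t ht => by rw [isHomog_iff.1 hF t ht, zpow_zero, one_mul])
  rw [← h, zero_smul]

theorem IsHomog.eq_pullFun {F : C^∞⟮V.totI, V.Tot; ℝ⟯} (hF : IsHomog V 0 F) :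
    F = pullFun V.proj (pullFun (secMap V 0) F) := by
  ext ⟨m, x⟩
  exact hF.apply_eq_zero_sec m x

/-- A differentiable function that is homogeneous of degree 1 equals its derivative at 0, hence is
linear. This is applied on `ℝ^N` after composing with the frame; the values of `F` on the frame then
give the section. -/
theorem IsHomog.eq_ell {F : C^∞⟮V.totI, V.Tot; ℝ⟯} (hF : IsHomog V 1 F) :
    F = V.ell (∑ c, pullFun (secMap V (V.frame c)) F • V.coframe c) := by
  have key : ∀ (m : M) (y : Fin V.frameCard → ℝ), F (fibComb V (m, y)) =
      ∑ c, y c * F ⟨m, V.frame c m⟩ := by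
    intro m y
    let G : (Fin V.frameCard → ℝ) → ℝ := fun y => F (fibComb V (m, y))
    have hG : ContDiff ℝ ∞ G := ContMDiff.contDiff
      ((F.contMDiff.comp (fibComb V).contMDiff).comp (contMDiff_const.prodMk contMDiff_id))
    have hh : ∀ t : ℝ, t ≠ 0 → ∀ y, G (t • y) = t * G y := by
      intro t ht y
      have h1 := isHomog_iff.1 hF t ht m (∑ c, y c • V.frame c m)
      rw [zpow_one] at h1
      refine Eq.trans (congrArg (fun u : V.Fib m => F ⟨m, u⟩) ?_) h1
      rw [Finset.smul_sum]
      exact Finset.sum_congr rfl fun c _ => by rw [smul_smul]; rfl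
    have h0 : G 0 = 0 := by
      have := hh 2 two_ne_zero 0
      rw [smul_zero] at this
      linarith
    -- The derivative of `G (t • y) = t * G y` at `t = 0`, computed in two ways.
    have hlin : ∀ y, fderiv ℝ G 0 y = G y := by
      intro y
      have hd : HasFDerivAt G (fderiv ℝ G 0) ((0 : ℝ) • y) := by
        rw [zero_smul]
        exact (hG.differentiable (by simp) 0).hasFDerivAt
      have hl : HasDerivAt (fun t : ℝ => t • y) y 0 := by
        simpa using (hasDerivAt_id (0 : ℝ)).smul_const y
      have h1 : HasDerivAt (fun t : ℝ => G (t • y)) (fderiv ℝ G 0 y) 0 := by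
        exact HasFDerivAt.comp_hasDerivAt (f := fun t : ℝ => t • y) (l := G) (0 : ℝ) hd hl
      have h2 : HasDerivAt (fun t : ℝ => G (t • y)) (G y) 0 := by
        have : (fun t : ℝ => G (t • y)) = fun t => t * G y := by
          funext t
          by_cases ht : t = 0
          · rw [ht, zero_smul, h0, zero_mul]
          · exact hh t ht y
        rw [this]
        simpa using (hasDerivAt_id (0 : ℝ)).mul_const (G y)
      exact h1.unique h2
    change G y = _
    rw [← hlin]
    conv_lhs => rw [← Finset.univ_sum_single y, map_sum]
    refine Finset.sum_congr rfl fun c _ => ?_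
    have : (Pi.single c (y c) : Fin V.frameCard → ℝ) = y c • Pi.single c 1 := by
      rw [← Pi.single_smul', smul_eq_mul, mul_one]
    rw [this, map_smul, hlin, smul_eq_mul]
    refine congrArg (fun u : V.Fib m => y c * F ⟨m, u⟩) ?_
    rw [Finset.sum_eq_single c]
    · simp
    · intro b _ hb; simp [Pi.single_eq_of_ne hb]
    · simp
  ext ⟨m, x⟩
  have h1 := key m (fibCoord V ⟨m, x⟩).2
  have h2 : fibComb V (m, (fibCoord V ⟨m, x⟩).2) = ⟨m, x⟩ := fibComb_fibCoord V ⟨m, x⟩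
  rw [h2] at h1
  refine h1.trans ?_
  have h3 : ∀ s : Finset (Fin V.frameCard), V.dualFib ((∑ c ∈ s,
      pullFun (secMap V (V.frame c)) F • V.coframe c) m) x =
      ∑ c ∈ s, F ⟨m, V.frame c m⟩ * V.dualFib (V.coframe c m) x := by
    classical
    intro s
    induction s using Finset.induction_on with
    | empty => rfl
    | insert k s hk ih => rw [Finset.sum_insert hk, Finset.sum_insert hk, ← ih]; rfl
  refine Eq.symm ((h3 Finset.univ).trans (Finset.sum_congr rfl fun c _ => mul_comm _ _))

end DVB

/-! ### Free graded modules and their pairing. -/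

namespace GSym

section Module

variable {ι : Type*} [DecidableEq ι] [Fintype ι] {R : Type*} [CommRing R] {N : ι → Type*}
  [∀ i, AddCommGroup (N i)] [∀ i, Module R (N i)] {d : ι → ℕ}
  {κ : Type*} [DecidableEq κ] [Fintype κ] {P P' : κ → Type*} [∀ j, AddCommGroup (P j)]
  [∀ j, Module R (P j)] [∀ j, AddCommGroup (P' j)] [∀ j, Module R (P' j)]

variable (R N d P) in
/-- The element `1 ⊗ e` of the module `GSym R N d ⊗ ⨁ j, P j` given by `e : P j`. -/
def pureT (j : κ) : P j →ₗ[R] GSym R N d ⊗[R] (Π j, P j) :=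
  TensorProduct.mk R (GSym R N d) (Π j, P j) 1 ∘ₗ LinearMap.single R P j

theorem smul_pureT (ξ : GSym R N d) (j : κ) (e : P j) :
    ξ • pureT R N d P j e = ξ ⊗ₜ[R] (Pi.single j e : Π j, P j) := by
  simp [pureT, TensorProduct.smul_tmul']

theorem pureT_mem_moduleGrade (g : κ → ℤ) (j : κ) (e : P j) :
    pureT R N d P j e ∈ moduleGrade R N d P g (g j) := by
  refine Submodule.subset_span ⟨0, j, 1, e, ?_, by simp, rfl⟩
  simpa using algebraMap_mem_grade (N := N) (d := d) (1 : R)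

theorem smul_mem_moduleGrade (g : κ → ℤ) {k p : ℤ} {x : GSym R N d} (hx : x ∈ gradeZ R N d k)
    {η : GSym R N d ⊗[R] (Π j, P j)} (hη : η ∈ moduleGrade R N d P g p) :
    x • η ∈ moduleGrade R N d P g (k + p) := by
  rcases lt_or_ge k 0 with hk | hk
  · rw [gradeZ_of_neg hk, Submodule.mem_bot] at hx; simp [hx]
  lift k to ℕ using hk
  induction hη using Submodule.span_induction with
  | mem y hy =>
    obtain ⟨l, j, ξ, e, hξ, rfl, rfl⟩ := hy
    rw [TensorProduct.smul_tmul']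
    exact Submodule.subset_span ⟨k + l, j, x * ξ, e, grade_mul hx hξ, by push_cast; ring, rfl⟩
  | zero => simp
  | add y z _ _ hy hz => rw [smul_add]; exact add_mem hy hz
  | smul r y _ hy => rw [smul_comm]; exact Submodule.smul_mem _ _ hy

theorem neg_tensor_smul (ξ : GSym R N d) (x : GSym R N d ⊗[R] (Π j, P j)) :
    (-ξ) • x = -(ξ • x) :=
  eq_neg_of_add_eq_zero_left (by rw [← add_smul, neg_add_cancel, zero_smul])

theorem neg_one_smul_tensor (x : GSym R N d ⊗[R] (Π j, P j)) : (-1 : R) • x = -x :=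
  eq_neg_of_add_eq_zero_left (by
    conv_lhs => enter [2]; rw [← one_smul R x]
    rw [← add_smul, neg_add_cancel, zero_smul])

theorem module_induction {p : GSym R N d ⊗[R] (Π j, P j) → Prop} (h0 : p 0)
    (hadd : ∀ x y, p x → p y → p (x + y))
    (hs : ∀ k (ξ : GSym R N d) j (e : P j), ξ ∈ grade R N d k → p (ξ • pureT R N d P j e))
    (x : GSym R N d ⊗[R] (Π j, P j)) : p x := by
  induction x using TensorProduct.induction_on with
  | zero => exact h0
  | add x y hx hy => exact hadd x y hx hy
  | tmul ξ e =>
    rw [← Finset.univ_sum_single e, TensorProduct.tmul_sum]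
    refine Finset.sum_induction _ p hadd h0 fun j _ => ?_
    induction ξ using homogeneous_induction with
    | hadd x y hx hy => rw [TensorProduct.add_tmul]; exact hadd _ _ hx hy
    | hom k ξ hξ => rw [← smul_pureT]; exact hs k ξ j _ hξ

@[elab_as_elim]
theorem moduleGrade_induction {g : κ → ℤ} {p : ℤ}
    {q : ∀ x, x ∈ moduleGrade R N d P g p → Prop}
    (h0 : q 0 (zero_mem _)) (hadd : ∀ x y hx hy, q x hx → q y hy → q (x + y) (add_mem hx hy))
    (hs : ∀ (k : ℕ) (ξ : GSym R N d) j (e : P j), ξ ∈ grade R N d k → (k : ℤ) + g j = p →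
      ∀ hx, q (ξ • pureT R N d P j e) hx)
    {x : GSym R N d ⊗[R] (Π j, P j)} (hx : x ∈ moduleGrade R N d P g p) : q x hx := by
  suffices ∃ hx, q x hx from this.choose_spec
  induction hx using Submodule.closure_induction with
  | zero => exact ⟨_, h0⟩
  | add x y _ _ hx hy => exact ⟨_, hadd x y _ _ hx.choose_spec hy.choose_spec⟩
  | smul_mem r x hx =>
    obtain ⟨k, j, ξ, e, hξ, hk, rfl⟩ := hx
    rw [TensorProduct.smul_tmul', ← smul_pureT]
    have hrξ : r • ξ ∈ grade R N d k := Submodule.smul_mem _ _ hξ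
    refine ⟨?_, hs k _ j e hrξ hk _⟩
    rw [← hk]
    exact smul_mem_moduleGrade g (k := (k : ℤ)) hrξ (pureT_mem_moduleGrade g j e)

/-- The operator multiplying the elements of degree `p` by `(-1)^p`. -/
def signT (h : κ → ℕ) : (GSym R N d ⊗[R] (Π j, P' j)) →ₗ[R] (GSym R N d ⊗[R] (Π j, P' j)) :=
  TensorProduct.map (twist R d 1).toLinearMap
    (LinearMap.pi fun j => ((-1 : R) ^ h j) • LinearMap.proj j)

theorem signT_smul (h : κ → ℕ) (x : GSym R N d) (ψ : GSym R N d ⊗[R] (Π j, P' j)) :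
    signT h (x • ψ) = twist R d 1 x • signT h ψ := by
  induction ψ using TensorProduct.induction_on with
  | zero => simp
  | add ψ ψ' hψ hψ' => rw [smul_add, map_add, hψ, hψ', map_add, smul_add]
  | tmul ξ ε =>
    simp [signT, TensorProduct.smul_tmul']

theorem signT_pureT (h : κ → ℕ) (j : κ) (ε : P' j) :
    signT h (pureT R N d P' j ε) = (-1 : R) ^ h j • pureT R N d P' j ε := by
  simp only [signT, pureT, LinearMap.comp_apply, TensorProduct.mk_apply, TensorProduct.map_tmul,
    AlgHom.toLinearMap_apply, map_one, ← TensorProduct.tmul_smul]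
  congr 1
  ext i
  by_cases hi : i = j
  · subst hi; simp
  · simp [Pi.single_eq_of_ne hi]

theorem signT_signT (h : κ → ℕ) (ψ : GSym R N d ⊗[R] (Π j, P' j)) :
    signT h (signT h ψ) = ψ := by
  induction ψ using module_induction with
  | h0 => simp
  | hadd x y hx hy => rw [map_add, map_add, hx, hy]
  | hs k ξ j e _ =>
    rw [signT_smul, signT_pureT, signT_smul, twist_twist_self, map_smul, signT_pureT, smul_smul,
      ← mul_pow]
    simp

/-- `signT` plays for the module the role that `twist` plays for the algebra: it makes sign rules
available on inhomogeneous elements. -/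
theorem signT_of_mem {h : κ → ℕ} {p : ℤ} {ψ : GSym R N d ⊗[R] (Π j, P' j)}
    (hψ : ψ ∈ moduleGrade R N d P' (fun j => (h j : ℤ)) p) : signT h ψ = p.negOnePow • ψ := by
  induction hψ using moduleGrade_induction with
  | h0 => simp
  | hadd x y _ _ hx hy => rw [map_add, hx, hy, smul_add]
  | hs k ξ j e hξ hk =>
    have he : ∀ m : ℕ, Even m → (m : ℤ).negOnePow = 1 := fun m hm =>
      Int.negOnePow_even _ (by exact_mod_cast hm)
    have ho : ∀ m : ℕ, Odd m → (m : ℤ).negOnePow = -1 := fun m hm =>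
      Int.negOnePow_odd _ (by exact_mod_cast hm)
    rw [signT_smul, signT_pureT, twist_of_mem_grade 1 hξ, ← hk, Int.negOnePow_add]
    rcases Nat.even_or_odd k with h1 | h1 <;> rcases Nat.even_or_odd (h j) with h2 | h2 <;>
      simp [h1.neg_one_pow, h2.neg_one_pow, he, ho, h1, h2, neg_tensor_smul,
        neg_one_smul_tensor]

section Pairing

variable (h : κ → ℕ) (b : ∀ j, P' j →ₗ[R] P j →ₗ[R] R)

theorem pairing_tmul (ξ : GSym R N d) (ε : Π j, P' j) (ζ : GSym R N d) (e : Π j, P j) :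
    pairing d h b (ξ ⊗ₜ ε) (ζ ⊗ₜ e) = ∑ j, b j (ε j) (e j) • (ξ * twist R d (h j) ζ) := rfl

theorem pairing_smul_left (x : GSym R N d) (ψ : GSym R N d ⊗[R] (Π j, P' j))
    (η : GSym R N d ⊗[R] (Π j, P j)) :
    pairing d h b (x • ψ) η = x * pairing d h b ψ η := by
  induction ψ using TensorProduct.induction_on with
  | zero => simp
  | add ψ ψ' hψ hψ' =>
    rw [smul_add, map_add, LinearMap.add_apply, hψ, hψ', map_add, LinearMap.add_apply, mul_add]
  | tmul ξ ε =>
    induction η using TensorProduct.induction_on with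
    | zero => simp
    | add η η' hη hη' => rw [map_add, hη, hη', map_add, mul_add]
    | tmul ζ e =>
      rw [TensorProduct.smul_tmul', smul_eq_mul, pairing_tmul, pairing_tmul, Finset.mul_sum]
      exact Finset.sum_congr rfl fun j _ => by rw [mul_smul_comm, mul_assoc]

theorem pairing_pureT_left (j : κ) (ε : P' j) (ζ : GSym R N d) (e : Π j, P j) :
    pairing d h b (pureT R N d P' j ε) (ζ ⊗ₜ e) = b j ε (e j) • twist R d (h j) ζ := by
  rw [pureT, LinearMap.comp_apply, TensorProduct.mk_apply, pairing_tmul, Finset.sum_eq_single j]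
  · simp
  · intro i _ hi; simp [Pi.single_eq_of_ne hi]
  · simp

theorem pairing_pureT_smul_right (j : κ) (ε : P' j) (x : GSym R N d)
    (η : GSym R N d ⊗[R] (Π j, P j)) :
    pairing d h b (pureT R N d P' j ε) (x • η) =
      twist R d (h j) x * pairing d h b (pureT R N d P' j ε) η := by
  induction η using TensorProduct.induction_on with
  | zero => simp
  | add η η' hη hη' => rw [smul_add, map_add, hη, hη', map_add, mul_add]
  | tmul ζ e =>
    rw [TensorProduct.smul_tmul', smul_eq_mul, pairing_pureT_left, pairing_pureT_left, map_mul,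
      mul_smul_comm]

theorem pairing_pureT_pureT (j : κ) (ε : P' j) (i : κ) (e : P i) :
    pairing d h b (pureT R N d P' j ε) (pureT R N d P i e) =
      algebraMap R _ (b j ε ((Pi.single i e : Π i, P i) j)) := by
  rw [pureT, LinearMap.comp_apply, TensorProduct.mk_apply]
  exact (pairing_pureT_left h b j ε 1 _).trans (by rw [map_one, Algebra.algebraMap_eq_smul_one]; rfl)

/-- Scalars on the right must pass the coefficient and the dual vector of `ψ`, which together have
degree `p`. -/
theorem pairing_smul_right {p : ℕ} {ψ : GSym R N d ⊗[R] (Π j, P' j)}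
    (hψ : ψ ∈ moduleGrade R N d P' (fun j => (h j : ℤ)) p) (x : GSym R N d)
    (η : GSym R N d ⊗[R] (Π j, P j)) :
    pairing d h b ψ (x • η) = twist R d p x * pairing d h b ψ η := by
  induction hψ using moduleGrade_induction with
  | h0 => simp
  | hadd y z _ _ hy hz => rw [map_add, LinearMap.add_apply, hy, hz, LinearMap.add_apply, mul_add]
  | hs k ξ j e hξ hk =>
    have hk' : p = k + h j := by exact_mod_cast hk.symm
    rw [pairing_smul_left, pairing_pureT_smul_right, ← mul_assoc, mul_comm_of_mem_grade hξ,
      twist_twist, pairing_smul_left, mul_assoc, hk']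

theorem pairing_mem_gradeZ {p q : ℤ} {ψ : GSym R N d ⊗[R] (Π j, P' j)}
    (hψ : ψ ∈ moduleGrade R N d P' (fun j => (h j : ℤ)) p) {η : GSym R N d ⊗[R] (Π j, P j)}
    (hη : η ∈ moduleGrade R N d P (fun j => -(h j : ℤ)) q) :
    pairing d h b ψ η ∈ gradeZ R N d (p + q) := by
  induction hψ using moduleGrade_induction with
  | h0 => simp
  | hadd y z _ _ hy hz => rw [map_add, LinearMap.add_apply]; exact add_mem hy hz
  | hs k ξ j e hξ hk =>
    induction hη using moduleGrade_induction with
    | h0 => simp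
    | hadd y z _ _ hy hz => rw [map_add]; exact add_mem hy hz
    | hs l ζ i e' hζ hl =>
      rw [pairing_smul_left, pairing_pureT_smul_right, pairing_pureT_pureT]
      by_cases hij : j = i
      · subst hij
        refine mem_gradeZ_of_mem (k := k + (l + 0)) (by push_cast; linarith) ?_
        exact grade_mul hξ (grade_mul (twist_mem_grade _ hζ) (algebraMap_mem_grade _))
      · rw [Pi.single_eq_of_ne hij]; simp

end Pairing

/-- Finite frames of the modules `P j` and `P' j` dual to each other under the pairings `b j`. -/
structure DualFrames (b : ∀ j, P' j →ₗ[R] P j →ₗ[R] R) (J : κ → Type*) [∀ j, Fintype (J j)] where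
  /-- The frames of the modules `P j`. -/
  vec : ∀ j, J j → P j
  /-- The dual frames of the modules `P' j`. -/
  covec : ∀ j, J j → P' j
  sum_vec : ∀ j x, ∑ a, b j (covec j a) x • vec j a = x
  sum_covec : ∀ j y, ∑ a, b j y (vec j a) • covec j a = y

namespace DualFrames

variable {b : ∀ j, P' j →ₗ[R] P j →ₗ[R] R} {J : κ → Type*} [∀ j, Fintype (J j)]
  (F : DualFrames b J) (h : κ → ℕ)

/-- The twist undoes the Koszul sign that arises when the dual vector passes the coefficient. -/
theorem sum_pairing_smul_vec (η : GSym R N d ⊗[R] (Π j, P j)) :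
    ∑ c : Σ j, J j, twist R d (h c.1)
      (pairing d h b (pureT R N d P' c.1 (F.covec c.1 c.2)) η) • pureT R N d P c.1 (F.vec c.1 c.2)
      = η := by
  induction η using TensorProduct.induction_on with
  | zero => simp
  | add η η' hη hη' =>
    simp only [map_add, add_smul, Finset.sum_add_distrib]
    rw [hη, hη']
  | tmul ζ e =>
    simp only [pairing_pureT_left, map_smul, twist_twist_self]
    rw [Fintype.sum_sigma]
    conv_rhs => rw [← Finset.univ_sum_single e, TensorProduct.tmul_sum]
    refine Finset.sum_congr rfl fun j _ => ?_
    rw [← smul_pureT]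
    conv_rhs => rw [← F.sum_vec j (e j), map_sum, Finset.smul_sum]
    exact Finset.sum_congr rfl fun a _ => by rw [map_smul, smul_assoc, smul_comm]

theorem sum_pairing_smul_covec (ψ : GSym R N d ⊗[R] (Π j, P' j)) :
    ∑ c : Σ j, J j, (pairing d h b ψ (pureT R N d P c.1 (F.vec c.1 c.2))) •
      pureT R N d P' c.1 (F.covec c.1 c.2) = ψ := by
  induction ψ using module_induction with
  | h0 => simp
  | hadd η η' hη hη' =>
    simp only [map_add, LinearMap.add_apply, add_smul, Finset.sum_add_distrib]
    rw [hη, hη']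
  | hs k ξ j ε _ =>
    simp only [pairing_smul_left, pairing_pureT_pureT, ← Algebra.commutes, ← Algebra.smul_def]
    rw [Fintype.sum_sigma, Finset.sum_eq_single j]
    · conv_rhs => rw [← F.sum_covec j ε, map_sum, Finset.smul_sum]
      exact Finset.sum_congr rfl fun a _ => by
        rw [Pi.single_eq_same, smul_assoc, map_smul, smul_comm]
    · intro i _ hi
      exact Finset.sum_eq_zero fun a _ => by rw [Pi.single_eq_of_ne hi.symm]; simp
    · simp

include F in
theorem ext_right {ψ ψ' : GSym R N d ⊗[R] (Π j, P' j)}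
    (H : ∀ η, pairing d h b ψ η = pairing d h b ψ' η) : ψ = ψ' := by
  rw [← F.sum_pairing_smul_covec h ψ, ← F.sum_pairing_smul_covec h ψ']
  exact Finset.sum_congr rfl fun c _ => by rw [H]

include F in
theorem ext_left {η η' : GSym R N d ⊗[R] (Π j, P j)}
    (H : ∀ j ε, pairing d h b (pureT R N d P' j ε) η = pairing d h b (pureT R N d P' j ε) η') :
    η = η' := by
  rw [← F.sum_pairing_smul_vec h η, ← F.sum_pairing_smul_vec h η']
  exact Finset.sum_congr rfl fun c _ => by rw [H]

end DualFrames

end Module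
end GSym

/-! ### Duality of representations up to homotopy. -/

namespace GSym

section Duality

variable {ι : Type*} [DecidableEq ι] [Fintype ι] {R : Type*} [CommRing R] {N : ι → Type*}
  [∀ i, AddCommGroup (N i)] [∀ i, Module R (N i)] {d : ι → ℕ}
  [Algebra ℝ R] [∀ i, Module ℝ (N i)] [∀ i, IsScalarTower ℝ R (N i)]
  {κ : Type*} [DecidableEq κ] [Fintype κ] {P P' : κ → Type*} [∀ j, AddCommGroup (P j)]
  [∀ j, Module R (P j)] [∀ j, AddCommGroup (P' j)] [∀ j, Module R (P' j)]
  {b : ∀ j, P' j →ₗ[R] P j →ₗ[R] R} {J : κ → Type*} [∀ j, Fintype (J j)]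
  (F : DualFrames b J) (h : κ → ℕ) {Q : GSym R N d →ₗ[ℝ] GSym R N d}
  {D' : (GSym R N d ⊗[R] (Π j, P' j)) →ₗ[ℝ] (GSym R N d ⊗[R] (Π j, P' j))}
  {D : (GSym R N d ⊗[R] (Π j, P j)) →ₗ[ℝ] (GSym R N d ⊗[R] (Π j, P j))}

theorem real_smul_eq (c : ℝ) (x : GSym R N d ⊗[R] (Π j, P j)) : c • x = algebraMap ℝ R c • x := by
  induction x using TensorProduct.induction_on with
  | zero => simp
  | add x y hx hy => rw [smul_add, hx, hy, smul_add]
  | tmul ξ e => rw [TensorProduct.smul_tmul', TensorProduct.smul_tmul', algebraMap_smul]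

theorem neg_one_smul_real_tensor (x : GSym R N d ⊗[R] (Π j, P j)) : (-1 : ℝ) • x = -x := by
  rw [real_smul_eq, map_neg, map_one, neg_one_smul_tensor]

theorem IsRUTH.map_smul {g : κ → ℤ} (hD : IsRUTH Q g D) (ξ : GSym R N d)
    (x : GSym R N d ⊗[R] (Π j, P j)) : D (ξ • x) = Q ξ • x + twist R d 1 ξ • D x := by
  induction ξ using homogeneous_induction with
  | hadd ξ ζ hξ hζ => simp only [add_smul, map_add, hξ, hζ]; abel
  | hom k ξ hξ =>
    rw [hD.leibniz k ξ hξ, twist_of_mem_grade 1 hξ, one_mul]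
    congr 1
    rcases neg_one_pow_eq_or ℝ k with hk | hk
    · have hk' : (-1 : GSym R N d) ^ k = 1 := by
        rcases Nat.even_or_odd k with he | ho
        · exact he.neg_one_pow
        · rw [ho.neg_one_pow] at hk; norm_num at hk
      rw [hk, hk', one_smul, one_mul]
    · have hk' : (-1 : GSym R N d) ^ k = -1 := by
        rcases Nat.even_or_odd k with he | ho
        · rw [he.neg_one_pow] at hk; norm_num at hk
        · exact ho.neg_one_pow
      rw [hk, hk', neg_one_mul, neg_tensor_smul, neg_one_smul_real_tensor]

theorem isRUTH_of_map_smul {g : κ → ℤ}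
    (hdeg : ∀ p, ∀ x ∈ moduleGrade R N d P g p, D x ∈ moduleGrade R N d P g (p + 1))
    (hmul : ∀ (ξ : GSym R N d) x, D (ξ • x) = Q ξ • x + twist R d 1 ξ • D x)
    (hsq : ∀ x, D (D x) = 0) : IsRUTH Q g D := by
  refine ⟨hdeg, fun k ξ hξ x => ?_, hsq⟩
  rw [hmul, twist_of_mem_grade 1 hξ, one_mul]
  congr 1
  rcases Nat.even_or_odd k with he | ho
  · rw [he.neg_one_pow, he.neg_one_pow, one_smul, one_mul]
  · rw [ho.neg_one_pow, ho.neg_one_pow, neg_one_mul, neg_tensor_smul,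
      neg_one_smul_real_tensor]

theorem pairing_negOnePow_smul (p : ℤ) (ψ : GSym R N d ⊗[R] (Π j, P' j))
    (η : GSym R N d ⊗[R] (Π j, P j)) :
    pairing d h b (p.negOnePow • ψ) η = p.negOnePow • pairing d h b ψ η := by
  rw [Units.smul_def, Units.smul_def, map_zsmul, LinearMap.smul_apply]

/-- With `signT` the duality relation becomes additive in `ψ` and can be used without splitting into
degrees. -/
theorem isDual_iff : IsDual Q h b D' D ↔ ∀ ψ η, Q (pairing d h b ψ η) =
    pairing d h b (D' ψ) η + pairing d h b (signT h ψ) (D η) := by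
  refine ⟨fun H ψ η => ?_, fun H p ψ hψ η => ?_⟩
  · induction ψ using module_induction with
    | h0 => simp
    | hadd x y hx hy => simp only [map_add, LinearMap.add_apply, hx, hy]; abel
    | hs k ξ j e hξ =>
      have hm := smul_mem_moduleGrade (fun j => (h j : ℤ)) (k := (k : ℤ)) hξ
        (pureT_mem_moduleGrade _ j e)
      rw [H _ _ hm, signT_of_mem hm, pairing_negOnePow_smul]
  · rw [H, signT_of_mem hψ, pairing_negOnePow_smul]

theorem signT_mem_moduleGrade {p : ℤ} {ψ : GSym R N d ⊗[R] (Π j, P' j)}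
    (hψ : ψ ∈ moduleGrade R N d P' (fun j => (h j : ℤ)) p) :
    signT h ψ ∈ moduleGrade R N d P' (fun j => (h j : ℤ)) p := by
  rw [signT_of_mem hψ, Units.smul_def]
  exact zsmul_mem hψ _

theorem IsRUTH.signT_comm (hD' : IsRUTH Q (fun j => (h j : ℤ)) D')
    (ψ : GSym R N d ⊗[R] (Π j, P' j)) : signT h (D' ψ) = -D' (signT h ψ) := by
  induction ψ using module_induction with
  | h0 => simp
  | hadd x y hx hy => simp only [map_add, hx, hy, neg_add]
  | hs k ξ j e hξ =>
    have hm := smul_mem_moduleGrade (fun j => (h j : ℤ)) (k := (k : ℤ)) hξ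
      (pureT_mem_moduleGrade _ j e)
    rw [signT_of_mem hm, signT_of_mem (hD'.degree _ _ hm), Int.negOnePow_succ, Units.smul_def,
      Units.smul_def, map_zsmul]
    simp

theorem mul_twist_comm {k : ℤ} {p q : ℕ} (hk : k + q = p) {x : GSym R N d}
    (hx : x ∈ gradeZ R N d k) (y : GSym R N d) : x * twist R d q y = twist R d p y * x := by
  rcases lt_or_ge k 0 with h0 | h0
  · rw [gradeZ_of_neg h0, Submodule.mem_bot] at hx; simp [hx]
  lift k to ℕ using h0
  have : p = k + q := by exact_mod_cast hk.symm
  rw [mul_comm_of_mem_grade hx, twist_twist, this]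

include F

theorem isDual_left_unique {D₁ D₂ : (GSym R N d ⊗[R] (Π j, P' j)) →ₗ[ℝ]
    (GSym R N d ⊗[R] (Π j, P' j))} (h₁ : IsDual Q h b D₁ D) (h₂ : IsDual Q h b D₂ D) :
    D₁ = D₂ := by
  rw [isDual_iff] at h₁ h₂
  refine LinearMap.ext fun ψ => F.ext_right h fun η => ?_
  exact add_right_cancel ((h₁ ψ η).symm.trans (h₂ ψ η))

theorem isDual_right_unique {D₁ D₂ : (GSym R N d ⊗[R] (Π j, P j)) →ₗ[ℝ]
    (GSym R N d ⊗[R] (Π j, P j))} (h₁ : IsDual Q h b D' D₁) (h₂ : IsDual Q h b D' D₂) :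
    D₁ = D₂ := by
  rw [isDual_iff] at h₁ h₂
  refine LinearMap.ext fun η => F.ext_left h fun j ε => ?_
  have := add_left_cancel ((h₁ (signT h (pureT R N d P' j ε)) η).symm.trans
    (h₂ (signT h (pureT R N d P' j ε)) η))
  rwa [signT_signT] at this

/-- The duality relation dictates `⟨D' ψ, η⟩ = L ψ η`. The derivative terms of `Q` and `D` cancel in
`L`, which is therefore linear in `η` over the graded algebra up to sign, so its values on the frame
define `D' ψ`. Degree, Leibniz rule and square zero then follow by nondegeneracy of the pairing. -/
theorem exists_dual_left (hQ : IsHomological Q) (hD : IsRUTH Q (fun j => -(h j : ℤ)) D) :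
    ∃ D', IsRUTH Q (fun j => (h j : ℤ)) D' ∧ IsDual Q h b D' D := by
  let L : (GSym R N d ⊗[R] (Π j, P' j)) → (GSym R N d ⊗[R] (Π j, P j)) → GSym R N d :=
    fun ψ η => Q (pairing d h b ψ η) - pairing d h b (signT h ψ) (D η)
  have hLr : ∀ (c : ℝ) ψ η, L (c • ψ) η = c • L ψ η := by
    intro c ψ η
    have h3 : ∀ ψ η, pairing d h b (c • ψ) η = c • pairing d h b ψ η := fun ψ η => by
      rw [real_smul_eq (N := N) (d := d) c ψ, LinearMap.map_smul, LinearMap.smul_apply, algebraMap_smul]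
    have h2 : signT h (c • ψ) = c • signT h ψ := by
      rw [real_smul_eq (N := N) (d := d) c ψ, LinearMap.map_smul, ← real_smul_eq (N := N) (d := d) c]
    simp only [L, h2, h3, map_smul, smul_sub]
  let D' : (GSym R N d ⊗[R] (Π j, P' j)) →ₗ[ℝ] (GSym R N d ⊗[R] (Π j, P' j)) :=
    { toFun := fun ψ => ∑ c : Σ j, J j, L ψ (pureT R N d P c.1 (F.vec c.1 c.2)) •
        pureT R N d P' c.1 (F.covec c.1 c.2)
      map_add' := fun ψ ψ' => by
        rw [← Finset.sum_add_distrib]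
        refine Finset.sum_congr rfl fun c _ => ?_
        rw [← add_smul]
        congr 1
        simp only [L, map_add, LinearMap.add_apply]
        abel
      map_smul' := fun r ψ => by
        rw [Finset.smul_sum]
        refine Finset.sum_congr rfl fun c _ => ?_
        rw [hLr, real_smul_eq, ← algebraMap_smul R r (L _ _), smul_assoc]; rfl }
  have hdual : IsDual Q h b D' D := by
    refine fun p ψ hψ η => ?_
    -- All degrees occurring in the dual module are nonnegative, so its part of negative degree is
    -- zero.
    rcases lt_or_ge p 0 with hp | hp
    · have : ψ = 0 := by
        induction hψ using moduleGrade_induction with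
        | h0 => rfl
        | hadd x y _ _ hx hy => rw [hx, hy, add_zero]
        | hs k ξ j e _ hk => omega
      rw [this]; simp
    lift p to ℕ using hp
    -- Both `Q` and `D` contribute a term with `Q ζ`, and these two terms cancel by the sign in the
    -- duality relation.
    have hLmul : ∀ ζ η, L ψ (ζ • η) = twist R d (p + 1) ζ * L ψ η := by
      intro ζ η
      simp only [L]
      rw [pairing_smul_right h b hψ, hQ.map_mul, hQ.twist_one, hD.map_smul, map_add,
        pairing_smul_right h b (signT_mem_moduleGrade h hψ),
        pairing_smul_right h b (signT_mem_moduleGrade h hψ), twist_twist, twist_twist,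
        signT_of_mem hψ, pairing_negOnePow_smul, pairing_negOnePow_smul, mul_sub, add_comm 1 p]
      have : (p : ℤ).negOnePow • pairing d h b ψ η = (-1) ^ p * pairing d h b ψ η := by
        rcases Nat.even_or_odd p with hp | hp
        · rw [Int.negOnePow_even _ (by exact_mod_cast hp), hp.neg_one_pow, one_smul, one_mul]
        · rw [Int.negOnePow_odd _ (by exact_mod_cast hp), hp.neg_one_pow]; simp
      rw [this, ← mul_assoc (twist R d p (Q ζ))]
      have hc : twist R d p (Q ζ) * (-1) ^ p = (-1) ^ p * twist R d p (Q ζ) :=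
        ((Commute.neg_one_left (twist R d p (Q ζ))).pow_left p).eq.symm
      rw [hc]
      abel
    have hLdeg : ∀ j (e : P j), L ψ (pureT R N d P j e) ∈ gradeZ R N d (p + 1 - h j) := by
      intro j e
      have he := pureT_mem_moduleGrade (R := R) (N := N) (d := d) (fun j => -(h j : ℤ)) j e
      refine sub_mem ?_ ?_
      · have := hQ.mem_gradeZ (pairing_mem_gradeZ h b hψ he)
        rwa [show (p : ℤ) + -(h j : ℤ) + 1 = p + 1 - h j by ring] at this
      · have := pairing_mem_gradeZ h b (signT_mem_moduleGrade h hψ) (hD.degree _ _ he)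
        rwa [show (p : ℤ) + (-(h j : ℤ) + 1) = p + 1 - h j by ring] at this
    have hmain : pairing d h b (D' ψ) η = L ψ η := by
      conv_rhs => rw [← F.sum_pairing_smul_vec h η]
      have hsum : ∀ (s : Finset (Σ j, J j)) (f : (Σ j, J j) → GSym R N d ⊗[R] (Π j, P j)),
          L ψ (∑ c ∈ s, f c) = ∑ c ∈ s, L ψ (f c) := by
        intro s f
        simp only [L, map_sum, Finset.sum_sub_distrib]
      rw [hsum]
      simp only [D', LinearMap.coe_mk, AddHom.coe_mk, map_sum, LinearMap.sum_apply]
      refine Finset.sum_congr rfl fun c _ => ?_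
      rw [hLmul, pairing_smul_left]
      rw [← mul_twist_comm (k := p + 1 - h c.1) (q := h c.1) (by push_cast; ring) (hLdeg _ _),
        twist_twist_self]
    rw [hmain]
    simp only [L, signT_of_mem hψ, pairing_negOnePow_smul]
    abel
  have hdual' := (isDual_iff h).1 hdual
  have hdual2 : ∀ ψ η, pairing d h b (D' ψ) η = Q (pairing d h b ψ η) -
      pairing d h b (signT h ψ) (D η) := fun ψ η => by rw [hdual', add_sub_cancel_right]
  have hdeg : ∀ p, ∀ x ∈ moduleGrade R N d P' (fun j => (h j : ℤ)) p,
      D' x ∈ moduleGrade R N d P' (fun j => (h j : ℤ)) (p + 1) := by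
    intro p ψ hψ
    refine sum_mem fun c _ => ?_
    have he := pureT_mem_moduleGrade (R := R) (N := N) (d := d) (fun j => -(h j : ℤ)) c.1
      (F.vec c.1 c.2)
    have := smul_mem_moduleGrade (fun j => (h j : ℤ)) (sub_mem
      (hQ.mem_gradeZ (pairing_mem_gradeZ h b hψ he))
      (show _ ∈ gradeZ R N d (p + -(h c.1 : ℤ) + 1) by
        have := pairing_mem_gradeZ h b (signT_mem_moduleGrade h hψ) (hD.degree _ _ he)
        rwa [← add_assoc] at this)) (pureT_mem_moduleGrade (R := R) (N := N) (d := d)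
          (fun j => (h j : ℤ)) c.1 (F.covec c.1 c.2))
    rwa [show p + -(h c.1 : ℤ) + 1 + h c.1 = p + 1 by ring] at this
  have hmul : ∀ (ξ : GSym R N d) ψ, D' (ξ • ψ) = Q ξ • ψ + twist R d 1 ξ • D' ψ := by
    intro ξ ψ
    refine F.ext_right h fun η => ?_
    rw [hdual2, map_add, LinearMap.add_apply, pairing_smul_left, pairing_smul_left,
      pairing_smul_left, hdual2, signT_smul, pairing_smul_left, hQ.map_mul]
    noncomm_ring
  have hR := fun hsq => isRUTH_of_map_smul hdeg hmul hsq
  -- Expanding the pairing with `D' (D' ψ)` twice leaves the terms with `Q ∘ Q` and `D ∘ D`, which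
  -- vanish; the mixed terms cancel since `D'` anticommutes with `signT`.
  refine ⟨D', hR fun ψ => F.ext_right h fun η => ?_, hdual⟩
  have hcomm : signT h (D' ψ) = -D' (signT h ψ) := by
    induction ψ using module_induction with
    | h0 => simp
    | hadd x y hx hy => simp only [map_add, hx, hy, neg_add]
    | hs k ξ j e hξ =>
      have hm := smul_mem_moduleGrade (fun j => (h j : ℤ)) (k := (k : ℤ)) hξ
        (pureT_mem_moduleGrade _ j e)
      rw [signT_of_mem hm, signT_of_mem (hdeg _ _ hm), Int.negOnePow_succ, Units.smul_def,
        Units.smul_def, map_zsmul]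
      simp
  rw [hdual2, hdual2, hcomm, map_neg, LinearMap.neg_apply, hdual2, signT_signT, hD.square, map_sub,
    hQ.square]
  simp

/-- The same construction with the roles exchanged. Solving the duality relation for the pairing
with `D η` puts `signT` in front of `ψ`, and this `L` is exactly linear in `ψ` over the graded
algebra. -/
theorem exists_dual_right (hQ : IsHomological Q) (hD' : IsRUTH Q (fun j => (h j : ℤ)) D') :
    ∃ D, IsRUTH Q (fun j => -(h j : ℤ)) D ∧ IsDual Q h b D' D := by
  let L : (GSym R N d ⊗[R] (Π j, P' j)) → (GSym R N d ⊗[R] (Π j, P j)) → GSym R N d :=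
    fun ψ η => Q (pairing d h b (signT h ψ) η) - pairing d h b (D' (signT h ψ)) η
  have hLadd : ∀ ψ ψ' η, L (ψ + ψ') η = L ψ η + L ψ' η := by
    intro ψ ψ' η
    simp only [L, map_add, LinearMap.add_apply]
    abel
  have hLmul : ∀ ξ ψ η, L (ξ • ψ) η = ξ * L ψ η := by
    intro ξ ψ η
    simp only [L]
    rw [signT_smul, pairing_smul_left, hQ.map_mul, hD'.map_smul, map_add, LinearMap.add_apply,
      pairing_smul_left, pairing_smul_left, twist_twist_self]
    noncomm_ring
  have hLr : ∀ ψ (c : ℝ) η, L ψ (c • η) = c • L ψ η := by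
    intro ψ c η
    have h3 : ∀ ψ, pairing d h b ψ (c • η) = c • pairing d h b ψ η := fun ψ => by
      rw [real_smul_eq, LinearMap.map_smul, algebraMap_smul]
    simp only [L, h3, map_smul, smul_sub]
  have hLadd' : ∀ ψ η η', L ψ (η + η') = L ψ η + L ψ η' := by
    intro ψ η η'
    simp only [L, map_add]
    abel
  let D : (GSym R N d ⊗[R] (Π j, P j)) →ₗ[ℝ] (GSym R N d ⊗[R] (Π j, P j)) :=
    { toFun := fun η => ∑ c : Σ j, J j,
        twist R d (h c.1) (L (pureT R N d P' c.1 (F.covec c.1 c.2)) η) •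
          pureT R N d P c.1 (F.vec c.1 c.2)
      map_add' := fun η η' => by
        rw [← Finset.sum_add_distrib]
        exact Finset.sum_congr rfl fun c _ => by rw [hLadd', map_add, add_smul]
      map_smul' := fun r η => by
        rw [Finset.smul_sum]
        refine Finset.sum_congr rfl fun c _ => ?_
        rw [hLr, real_smul_eq, ← algebraMap_smul R r (L _ _), map_smul, smul_assoc]; rfl }
  have hmain : ∀ ψ η, pairing d h b ψ (D η) = L ψ η := by
    intro ψ η
    conv_rhs => rw [← F.sum_pairing_smul_covec h ψ]
    have hsum : ∀ (s : Finset (Σ j, J j)) (f : (Σ j, J j) → GSym R N d ⊗[R] (Π j, P' j)),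
        L (∑ c ∈ s, f c) η = ∑ c ∈ s, L (f c) η := by
      intro s f
      simp only [L, map_sum, LinearMap.sum_apply, Finset.sum_sub_distrib]
    have key : ∀ j (ε : P' j), pairing d h b (pureT R N d P' j ε) (D η) =
        L (pureT R N d P' j ε) η := by
      intro j ε
      simp only [D, LinearMap.coe_mk, AddHom.coe_mk, map_sum, pairing_pureT_smul_right,
        pairing_pureT_pureT]
      rw [Fintype.sum_sigma, Finset.sum_eq_single j]
      · have hsum' : ∀ (s : Finset (J j)) (f : J j → GSym R N d ⊗[R] (Π j, P' j)),
            L (∑ c ∈ s, f c) η = ∑ c ∈ s, L (f c) η := by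
          intro s f
          simp only [L, map_sum, LinearMap.sum_apply, Finset.sum_sub_distrib]
        conv_rhs => rw [← F.sum_covec j ε, map_sum, hsum']
        refine Finset.sum_congr rfl fun a _ => ?_
        rw [Pi.single_eq_same, twist_twist_self, LinearMap.map_smul, ← algebraMap_smul (GSym R N d),
          hLmul, Algebra.commutes]
      · intro i _ hi
        exact Finset.sum_eq_zero fun a _ => by rw [Pi.single_eq_of_ne hi.symm]; simp
      · simp
    rw [hsum]
    conv_lhs => rw [← F.sum_pairing_smul_covec h ψ, map_sum, LinearMap.sum_apply]
    refine Finset.sum_congr rfl fun c _ => ?_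
    rw [pairing_smul_left, hLmul, key]
  have hdual : ∀ ψ η, Q (pairing d h b ψ η) =
    pairing d h b (D' ψ) η + pairing d h b (signT h ψ) (D η) := by
    intro ψ η
    rw [hmain]
    simp only [L, signT_signT]
    abel
  have hdeg : ∀ p, ∀ x ∈ moduleGrade R N d P (fun j => -(h j : ℤ)) p,
      D x ∈ moduleGrade R N d P (fun j => -(h j : ℤ)) (p + 1) := by
    intro p η hη
    refine sum_mem fun c _ => ?_
    have he := pureT_mem_moduleGrade (R := R) (N := N) (d := d) (fun j => (h j : ℤ)) c.1
      (F.covec c.1 c.2)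
    have he' := signT_mem_moduleGrade h he
    have hm : L (pureT R N d P' c.1 (F.covec c.1 c.2)) η ∈ gradeZ R N d (h c.1 + p + 1) := by
      refine sub_mem (hQ.mem_gradeZ (pairing_mem_gradeZ h b he' hη)) ?_
      have := pairing_mem_gradeZ h b (hD'.degree _ _ he') hη
      rwa [add_right_comm] at this
    have hm' : twist R d (h c.1) (L (pureT R N d P' c.1 (F.covec c.1 c.2)) η) ∈
        gradeZ R N d (h c.1 + p + 1) := by
      rcases lt_or_ge (h c.1 + p + 1 : ℤ) 0 with h0 | h0
      · rw [gradeZ_of_neg h0, Submodule.mem_bot] at hm ⊢; rw [hm, map_zero]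
      · lift (h c.1 + p + 1 : ℤ) to ℕ using h0 with k
        exact twist_mem_grade _ hm
    have := smul_mem_moduleGrade (fun j => -(h j : ℤ)) hm' (pureT_mem_moduleGrade
      (fun j => -(h j : ℤ)) c.1 (F.vec c.1 c.2))
    rwa [show (h c.1 : ℤ) + p + 1 + -(h c.1 : ℤ) = p + 1 by ring] at this
  have hmul : ∀ (ξ : GSym R N d) η, D (ξ • η) = Q ξ • η + twist R d 1 ξ • D η := by
    intro ξ η
    refine F.ext_left h fun j ε => ?_
    have he := pureT_mem_moduleGrade (R := R) (N := N) (d := d) (fun j => (h j : ℤ)) j ε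
    have he' := signT_mem_moduleGrade h he
    have he'' := hD'.degree _ _ he'
    have he3 : D' (signT h (pureT R N d P' j ε)) ∈
      moduleGrade R N d P' (fun j => (h j : ℤ)) ((h j + 1 : ℕ) : ℤ) := by exact_mod_cast he''
    rw [map_add, pairing_pureT_smul_right, pairing_pureT_smul_right, hmain, hmain]
    simp only [L]
    rw [pairing_smul_right h b he', pairing_smul_right h b he3, hQ.map_mul, hQ.twist_one,
      twist_twist, twist_twist, add_comm 1 (h j), mul_sub]
    have hs : (-1) ^ h j * pairing d h b (signT h (pureT R N d P' j ε)) η =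
        pairing d h b (pureT R N d P' j ε) η := by
      rw [signT_pureT, LinearMap.map_smul, LinearMap.smul_apply, Algebra.smul_def, map_pow, map_neg,
        map_one, ← mul_assoc, ← pow_add, ← two_mul, pow_mul]
      simp
    have hc : (-1) ^ h j * twist R d (h j) (Q ξ) = twist R d (h j) (Q ξ) * (-1) ^ h j :=
      ((Commute.neg_one_left (twist R d (h j) (Q ξ))).pow_left (h j)).eq
    rw [hc, mul_assoc, hs]
    abel
  refine ⟨D, isRUTH_of_map_smul hdeg hmul fun η => F.ext_left h fun j ε => ?_, (isDual_iff h).2 hdual⟩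
  rw [hmain]
  simp only [L]
  have hcomm := hD'.signT_comm h (signT h (pureT R N d P' j ε))
  rw [signT_signT] at hcomm
  have h1 := hdual (signT h (D' (signT h (pureT R N d P' j ε)))) η
  have h2 : pairing d h b (D' (signT h (pureT R N d P' j ε))) (D η) =
      L (D' (signT h (pureT R N d P' j ε))) η := hmain _ _
  rw [h2, hmain]
  simp only [L]
  rw [signT_signT, hcomm, map_neg, map_neg, hD'.square, map_sub, hQ.square]
  simp

end Duality
end GSym

/-- The semilinear map with prescribed values on a frame (up to the relations of the frame). -/
def FiniteFrame.mapSL {R S P P' J : Type*} [CommRing R] [CommRing S] [AddCommGroup P] [Module R P]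
    [AddCommGroup P'] [Module S P'] [Fintype J] (F : FiniteFrame R P J) (φ : R →+* S)
    (vec' : J → P') : P →ₛₗ[φ] P' where
  toFun x := ∑ j, φ (F.co j x) • vec' j
  map_add' x y := by simp only [map_add, add_smul, Finset.sum_add_distrib]
  map_smul' r x := by simp only [map_smul, smul_eq_mul, map_mul, mul_smul, Finset.smul_sum]

theorem FiniteFrame.mapSL_apply {R S P P' J : Type*} [CommRing R] [CommRing S] [AddCommGroup P]
    [Module R P] [AddCommGroup P'] [Module S P'] [Fintype J] (F : FiniteFrame R P J) (φ : R →+* S)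
    (vec' : J → P') (x : P) : F.mapSL φ vec' x = ∑ j, φ (F.co j x) • vec' j := rfl

/-! ### Derivations from frames, and contractions under induced maps. -/

namespace GSym

section Tools

variable {ι : Type*} [DecidableEq ι] [Fintype ι] {R : Type*} [CommRing R] {N : ι → Type*}
  [∀ i, AddCommGroup (N i)] [∀ i, Module R (N i)] {d : ι → ℕ}
  {J : ι → Type*} [∀ i, Fintype (J i)] (F : ∀ i, FiniteFrame R (N i) (J i))

theorem contractList_add (l : List (Σ i, J i)) (x y : GSym R N d) :
    contractList F l (x + y) = contractList F l x + contractList F l y := by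
  induction l generalizing x y with
  | nil => rfl
  | cons s l ih => simp only [contractList, map_add, ih]

theorem contractList_smul (l : List (Σ i, J i)) (r : R) (x : GSym R N d) :
    contractList F l (r • x) = r • contractList F l x := by
  induction l generalizing x with
  | nil => rfl
  | cons s l ih => simp only [contractList, map_smul, ih]

variable [Algebra ℝ R] [∀ i, Module ℝ (N i)] [∀ i, IsScalarTower ℝ R (N i)]

/-- The expansion in products of frame elements, applied to the zero subspace: an element is
detected by the function parts of its iterated contractions. -/
theorem eq_zero_of_contractList (hd : ∀ i, 0 < d i) {k : ℕ} {x : GSym R N d}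
    (hx : x ∈ grade R N d k)
    (h : ∀ l : List (Σ i, J i), (l.map fun s => d s.1).sum = k →
      body R d (contractList F l x) = 0) : x = 0 := by
  have := mem_of_contractList F hd hx (⊥ : Submodule ℝ (GSym R N d)) fun l hl => by
    rw [h l hl, map_zero, mul_zero]; exact zero_mem _
  simpa using this

include F in
/-- If the derivations of the base ring are determined by their values on elements `β j`, then so
are those with values in the graded symmetric algebra. -/
theorem baseDerivation_eq_sum (hd : ∀ i, 0 < d i) {τ : Type*} [Fintype τ] {β : τ → R}
    {L : τ → R → R} (hβ : ∀ D : R →ₗ[ℝ] R, (∀ r s, D (r * s) = D r * s + r * D s) →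
      ∀ r, D r = ∑ j, L j r * D (β j))
    {δ : R →ₗ[ℝ] GSym R N d} {k : ℕ} (hdeg : ∀ r, δ r ∈ grade R N d k)
    (hmul : ∀ r s, δ (r * s) = s • δ r + r • δ s) (r : R) : δ r = ∑ j, L j r • δ (β j) := by
  rw [← sub_eq_zero]
  refine eq_zero_of_contractList F hd (sub_mem (hdeg r) (sum_mem fun j _ =>
    Submodule.smul_mem _ _ (hdeg _))) fun l _ => ?_
  -- Iterated contraction followed by `body` is `R`-linear, so it turns the derivation into one with
  -- values in `R`, where the hypothesis applies; these functionals separate elements.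
  let c : GSym R N d →ₗ[R] R :=
    { toFun := fun x => body R d (contractList F l x)
      map_add' := fun x y => by rw [contractList_add, map_add]
      map_smul' := fun r x => by rw [contractList_smul, map_smul, RingHom.id_apply] }
  have h := hβ (c.restrictScalars ℝ ∘ₗ δ) (fun r s => by
    simp only [LinearMap.comp_apply, LinearMap.restrictScalars_apply, hmul, map_add, map_smul,
      smul_eq_mul]
    ring) r
  change c (δ r - ∑ j, L j r • δ (β j)) = 0
  rw [map_sub, map_sum, sub_eq_zero]
  simp only [map_smul, smul_eq_mul]
  exact h

/-- A graded derivation vanishes if it vanishes on the generators in a frame and on functions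
which determine the derivations of the base ring. -/
theorem derivation_eq_zero (hd : ∀ i, 0 < d i) {X : GSym R N d →ₗ[ℝ] GSym R N d} (p : ℕ)
    {k : ℕ} (hdeg : ∀ r, X (algebraMap R _ r) ∈ grade R N d k)
    (hmul : ∀ x y, X (x * y) = X x * y + twist R d p x * X y)
    {τ : Type*} [Fintype τ] {β : τ → R} {L : τ → R → R}
    (hβ : ∀ D : R →ₗ[ℝ] R, (∀ r s, D (r * s) = D r * s + r * D s) →
      ∀ r, D r = ∑ j, L j r * D (β j))
    (hXβ : ∀ j, X (algebraMap R _ (β j)) = 0)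
    (hgen : ∀ i j, X (gen R d i ((F i).vec j)) = 0) (x : GSym R N d) : X x = 0 := by
  have hR : ∀ r, X (algebraMap R _ r) = 0 := by
    intro r
    have h := baseDerivation_eq_sum F hd hβ
      (δ := X ∘ₗ (Algebra.linearMap R (GSym R N d)).restrictScalars ℝ) hdeg (fun r s => by
        simp only [LinearMap.comp_apply, LinearMap.restrictScalars_apply, Algebra.linearMap_apply,
          map_mul, hmul, twist_algebraMap]
        rw [← Algebra.commutes, ← Algebra.smul_def, ← Algebra.smul_def]) r
    refine h.trans (Finset.sum_eq_zero fun j _ => ?_)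
    exact (congrArg (L j r • ·) (hXβ j)).trans (smul_zero _)
  have hlin : ∀ (r : R) y, X (r • y) = r • X y := fun r y => by
    rw [Algebra.smul_def, hmul, hR, zero_mul, zero_add, twist_algebraMap, ← Algebra.smul_def]
  induction x using gen_induction with
  | hadd x y hx hy => rw [map_add, hx, hy, add_zero]
  | hR r => exact hR r
  | hgen i a x hx =>
    rw [hmul, hx, mul_zero, add_zero]
    have : X (gen R d i a) = 0 := by
      rw [← (F i).sum_smul a, map_sum, map_sum]
      exact Finset.sum_eq_zero fun j _ => by rw [map_smul, hlin, hgen, smul_zero]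
    rw [this, zero_mul]

/-- Derivations of degree `1` with prescribed values on functions and on a frame. -/
theorem exists_derivation_of_frame (δ₀ : R →ₗ[ℝ] GSym R N d) (hδ1 : ∀ r, δ₀ r ∈ grade R N d 1)
    (hδ : ∀ r s, δ₀ (r * s) = δ₀ r * algebraMap R _ s + algebraMap R _ r * δ₀ s)
    (Y : ∀ i, J i → GSym R N d) (hY : ∀ i j, Y i j ∈ grade R N d (d i + 1)) :
    ∃ Q : GSym R N d →ₗ[ℝ] GSym R N d,
      (∀ x y, Q (x * y) = Q x * y + twist R d 1 x * Q y) ∧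
      (∀ r, Q (algebraMap R _ r) = δ₀ r) ∧ ∀ i a, Q (gen R d i a) =
        ∑ j, (δ₀ ((F i).co j a) * gen R d i ((F i).vec j) + algebraMap R _ ((F i).co j a) * Y i j) := by
  -- The Leibniz rule applied to the frame expansion of `a`. The formula is consistent for any `Y`,
  -- because the coordinates are linear forms; frame elements may be dependent, so it need not
  -- return `Y i j` on them.
  let q : ∀ i, N i →ₗ[ℝ] GSym R N d := fun i => ∑ j,
    (LinearMap.mulRight ℝ (gen R d i ((F i).vec j)) ∘ₗ δ₀ ∘ₗ ((F i).co j).restrictScalars ℝ +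
      LinearMap.mulRight ℝ (Y i j) ∘ₗ (Algebra.linearMap R (GSym R N d)).restrictScalars ℝ ∘ₗ
        ((F i).co j).restrictScalars ℝ)
  have hq : ∀ i a, q i a = ∑ j, (δ₀ ((F i).co j a) * gen R d i ((F i).vec j) +
      algebraMap R _ ((F i).co j a) * Y i j) := fun i a => by
    rw [LinearMap.sum_apply]; rfl
  obtain ⟨Q, h1, h2, h3⟩ := exists_derivation δ₀ q hδ1 hδ (fun i a => by
    rw [hq, add_comm (d i)]
    refine sum_mem fun j _ => add_mem (grade_mul (hδ1 _) (gen_mem_grade _ _)) ?_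
    rw [← Algebra.smul_def, add_comm]
    exact Submodule.smul_mem _ _ (hY i j)) (fun i r a => by
    have hs : gen R d i a = ∑ j, algebraMap R _ ((F i).co j a) * gen R d i ((F i).vec j) := by
      conv_lhs => rw [← (F i).sum_smul a, map_sum]
      exact Finset.sum_congr rfl fun j _ => by rw [map_smul, Algebra.smul_def]
    rw [hq, hq, hs, Finset.mul_sum, Finset.mul_sum, ← Finset.sum_add_distrib]
    refine Finset.sum_congr rfl fun j _ => ?_
    rw [map_smul, smul_eq_mul, hδ, map_mul, add_mul, mul_add, mul_assoc, mul_assoc, mul_assoc]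
    abel)
  exact ⟨Q, h1, h2, fun i a => (h3 i a).trans (hq i a)⟩

end Tools

section Maps

variable {ι : Type*} [DecidableEq ι] [Fintype ι] {R : Type*} [CommRing R] {N : ι → Type*}
  [∀ i, AddCommGroup (N i)] [∀ i, Module R (N i)] {d : ι → ℕ}

theorem ringHom_ext {T : Type*} [Ring T] {f g : GSym R N d →+* T}
    (hR : ∀ r, f (algebraMap R _ r) = g (algebraMap R _ r))
    (hgen : ∀ i a, f (gen R d i a) = g (gen R d i a)) : f = g := by
  ext x
  induction x using gen_induction with
  | hadd x y hx hy => rw [map_add, map_add, hx, hy]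
  | hR r => exact hR r
  | hgen i a x hx => rw [map_mul, map_mul, hgen, hx]

variable {S : Type*} [CommRing S] {N' : ι → Type*}
  [∀ i, AddCommGroup (N' i)] [∀ i, Module S (N' i)] {φ : R →+* S}
  {f : ∀ i, N i →ₛₗ[φ] N' i}

/-- For induced maps it suffices to compare the contractions on generators; the factor `c` records
the weight when the map is a scaling. -/
theorem contract_map (i : ι) (ψ : N i →ₗ[R] R) (ψ' : N' i →ₗ[S] S) (c : S)
    (h : ∀ a, ψ' (f i a) = c * φ (ψ a)) (x : GSym R N d) :
    contract S d i ψ' (map d d φ id (fun _ => rfl) f x) =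
      c • map d d φ id (fun _ => rfl) f (contract R d i ψ x) := by
  induction x using gen_induction with
  | hadd x y hx hy => simp only [map_add, hx, hy, smul_add]
  | hR r => rw [map_algebraMap, contract_algebraMap, contract_algebraMap, map_zero, smul_zero]
  | hgen j a x hx =>
    rw [map_mul, map_gen]
    change contract S d i ψ' (gen S d j (f j a) * _) = _
    rw [contract_gen_mul, contract_gen_mul, hx, map_add, map_mul, smul_add]
    congr 1
    · by_cases hij : j = i
      · subst hij
        rw [contract_gen, contract_gen, h, map_algebraMap, map_mul, mul_assoc, ← Algebra.smul_def]
      · rw [contract_gen_of_ne _ _ _ _ hij, contract_gen_of_ne _ _ _ _ hij]; simp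
    · rw [Algebra.smul_def ((-1 : R) ^ _), map_mul, map_mul, map_algebraMap, map_gen, map_pow,
        map_neg, map_one, mul_smul_comm, smul_comm, Algebra.smul_def ((-1 : S) ^ _)]
      rfl

end Maps

end GSym

namespace DVB

open SmoothVB

/-! Shortcuts for instance search. -/

section Instances

variable {E H : Type*} [NormedAddCommGroup E] [NormedSpace ℝ E]
  [TopologicalSpace H] {I : ModelWithCorners ℝ E H}
  {M : Type*} [TopologicalSpace M] [ChartedSpace H M] {n : ℕ}
  (V : SmoothVB I M) (A C : Fin n → SmoothVB I M)

abbrev addCommGroupDualSec (s : Fin n ⊕ Fin n) : AddCommGroup (bundleD V A C s).dual.Sec :=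
  inferInstance

abbrev moduleDualSec (s : Fin n ⊕ Fin n) :
    Module C^∞⟮V.totI, V.Tot; ℝ⟯ (bundleD V A C s).dual.Sec :=
  inferInstance

abbrev ringD : Ring (FunD V A C) := inferInstance

abbrev semiringD : Semiring (FunD V A C) := Ring.toSemiring

abbrev addCommGroupD : AddCommGroup (FunD V A C) := Ring.toAddCommGroup

abbrev addCommMonoidD : AddCommMonoid (FunD V A C) :=
  NonUnitalNonAssocSemiring.toAddCommMonoid

abbrev algebraD : Algebra C^∞⟮V.totI, V.Tot; ℝ⟯ (FunD V A C) := GSym.instAlg ..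

abbrev algebraRealD : Algebra ℝ (FunD V A C) := GSym.instAlgReal ..

abbrev moduleD : Module C^∞⟮V.totI, V.Tot; ℝ⟯ (FunD V A C) := Algebra.toModule

abbrev moduleRealD : Module ℝ (FunD V A C) := Algebra.toModule

abbrev actionRealD : MulAction ℝ (FunD V A C) := Module.toDistribMulAction.toMulAction

abbrev ringA : Ring (FunA A) := inferInstance

abbrev semiringA : Semiring (FunA A) := Ring.toSemiring

abbrev addCommGroupA : AddCommGroup (FunA A) := Ring.toAddCommGroup

abbrev addCommMonoidA : AddCommMonoid (FunA A) := NonUnitalNonAssocSemiring.toAddCommMonoid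

abbrev algebraA : Algebra C^∞⟮I, M; ℝ⟯ (FunA A) := GSym.instAlg ..

abbrev moduleA : Module C^∞⟮I, M; ℝ⟯ (FunA A) := Algebra.toModule

abbrev moduleRealA : Module ℝ (FunA A) := Algebra.toModule

abbrev addCommGroupDualE : AddCommGroup (ModDualE V A C) := inferInstance

abbrev addCommMonoidDualE : AddCommMonoid (ModDualE V A C) := inferInstance

abbrev moduleDualE : Module (FunA A) (ModDualE V A C) := inferInstance

abbrev moduleRealDualE : Module ℝ (ModDualE V A C) := inferInstance

end Instances
end DVB

attribute [local instance] DVB.addCommGroupDualSec DVB.moduleDualSec DVB.ringD DVB.semiringD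
  DVB.addCommGroupD DVB.addCommMonoidD DVB.algebraD DVB.algebraRealD DVB.moduleD
  DVB.moduleRealD DVB.actionRealD DVB.ringA DVB.semiringA DVB.addCommGroupA DVB.addCommMonoidA
  DVB.algebraA DVB.moduleA DVB.moduleRealA DVB.addCommGroupDualE DVB.addCommMonoidDualE
  DVB.moduleDualE DVB.moduleRealDualE


/-! ### The scaling of `D → A`. -/

namespace DVB

open SmoothVB

section Scaling

variable {E H : Type*} [NormedAddCommGroup E] [NormedSpace ℝ E] [FiniteDimensional ℝ E]
  [TopologicalSpace H] {I : ModelWithCorners ℝ E H} [I.Boundaryless]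
  {M : Type*} [TopologicalSpace M] [ChartedSpace H M] [IsManifold I ∞ M]
  [T2Space M] [SigmaCompactSpace M]

theorem _root_.GSym.map_real_smul {ι ι' R S : Type*} [DecidableEq ι] [DecidableEq ι'] [Fintype ι]
    [CommRing R] [CommRing S] [Algebra ℝ R] [Algebra ℝ S]
    {N : ι → Type*} [∀ i, AddCommGroup (N i)] [∀ i, Module R (N i)]
    {N' : ι' → Type*} [∀ i, AddCommGroup (N' i)] [∀ i, Module S (N' i)]
    [∀ i, Module ℝ (N i)] [∀ i, IsScalarTower ℝ R (N i)]
    [∀ i, Module ℝ (N' i)] [∀ i, IsScalarTower ℝ S (N' i)]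
    {d : ι → ℕ} {d' : ι' → ℕ} {φ : R →+* S} {τ : ι → ι'} {hτ : ∀ i, d' (τ i) = d i}
    {f : ∀ i, N i →ₛₗ[φ] N' (τ i)}
    (hφ : ∀ c : ℝ, φ (algebraMap ℝ R c) = algebraMap ℝ S c) (c : ℝ) (x : GSym R N d) :
    GSym.map d d' φ τ hτ f (c • x) = c • GSym.map d d' φ τ hτ f x := by
  rw [← algebraMap_smul R c x, Algebra.smul_def, map_mul, GSym.map_algebraMap,
    ← Algebra.smul_def, hφ, algebraMap_smul]

variable (V : SmoothVB I M)

/-- The pairing of a section of the dual of the pullback of `X` with an element of a fibre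
of `X`. -/
def evalAt (X : SmoothVB I M) (σ : (X.pullback V.proj).dual.Sec) (m : M) (x : V.Fib m) :
    X.Fib m →ₗ[ℝ] ℝ :=
  ((X.pullback V.proj).dualFib (σ ⟨m, x⟩)).toLinearMap ∘ₗ (X.pullFib V.proj ⟨m, x⟩).symm.toLinearMap

theorem evalAt_smul (X : SmoothVB I M) (f : C^∞⟮V.totI, V.Tot; ℝ⟯)
    (σ : (X.pullback V.proj).dual.Sec) (m : M) (x : V.Fib m) (u : X.Fib m) :
    evalAt V X (f • σ) m x u = f ⟨m, x⟩ * evalAt V X σ m x u := rfl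

theorem evalAt_sum (X : SmoothVB I M) {κ : Type*} (s : Finset κ)
    (σ : κ → (X.pullback V.proj).dual.Sec) (m : M) (x : V.Fib m) (u : X.Fib m) :
    evalAt V X (∑ k ∈ s, σ k) m x u = ∑ k ∈ s, evalAt V X (σ k) m x u := by
  classical
  induction s using Finset.induction_on with
  | empty => rfl
  | insert k s hk ih => rw [Finset.sum_insert hk, Finset.sum_insert hk, ← ih]; rfl

/-- The pullback along the multiplication by `t` of sections of the dual of the pullback of `X`,
multiplied by `c`. -/
def scaleDual (X : SmoothVB I M) (t c : ℝ) :
    (X.pullback V.proj).dual.Sec →ₛₗ[pullFun (smulMap V t)] (X.pullback V.proj).dual.Sec :=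
  (X.pullDualFrame V.proj).mapSL _ fun a => c • X.pullDual V.proj (X.coframe a)

/-- The definition by a frame gives the intended pointwise pullback, so it does not depend on the
frame. Later statements use only this description. -/
theorem evalAt_scaleDual (X : SmoothVB I M) (t c : ℝ) (σ : (X.pullback V.proj).dual.Sec) (m : M)
    (x : V.Fib m) (u : X.Fib m) :
    evalAt V X (scaleDual V X t c σ) m x u = c * evalAt V X σ m (t • x) u := by
  rw [scaleDual, FiniteFrame.mapSL_apply, evalAt_sum]
  conv_rhs => rw [← X.sum_coframe_smul_frame_apply m u, map_sum, Finset.mul_sum]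
  refine Finset.sum_congr rfl fun a _ => ?_
  rw [evalAt_smul, map_smul, smul_eq_mul]
  change evalAt V X σ m (t • x) (X.frame a m) * (c * X.dualFib (X.coframe a m) u) = _
  ring

theorem pullback_dual_ext_evalAt (X : SmoothVB I M) {σ σ' : (X.pullback V.proj).dual.Sec}
    (h : ∀ m x u, evalAt V X σ m x u = evalAt V X σ' m x u) : σ = σ' :=
  dual_ext _ fun y w => h y.proj y.2 w

theorem scaleDual_pullDual (X : SmoothVB I M) (t c : ℝ) (α : X.dual.Sec) :
    scaleDual V X t c (X.pullDual V.proj α) = c • X.pullDual V.proj α := by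
  refine pullback_dual_ext_evalAt V X fun m x u => ?_
  rw [evalAt_scaleDual]; rfl

variable {n : ℕ} (A C : Fin n → SmoothVB I M)

theorem degA_pos (i : Fin n) : 0 < degA i := Nat.succ_pos _

theorem degD_pos (s : Fin n ⊕ Fin n) : 0 < degD s := by
  rcases s with i | i <;> exact degA_pos i

/-- The numbers of elements of the frames `frameD`. -/
def cardD : Fin n ⊕ Fin n → ℕ
  | .inl i => (A i).frameCard
  | .inr i => (C i).frameCard

/-- Frames for the generators of the functions on `D`. -/
def frameD : ∀ s, FiniteFrame C^∞⟮V.totI, V.Tot; ℝ⟯ (bundleD V A C s).dual.Sec (Fin (cardD A C s))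
  | .inl i => (A i).pullDualFrame V.proj
  | .inr i => (C i).pullDualFrame V.proj

/-- The sections of `D` dual to `frameD`. -/
def secD : (Σ s : Fin n ⊕ Fin n, Fin (cardD A C s)) → Σ i, SecD V A C i
  | ⟨.inl i, a⟩ => ⟨i, ((A i).pullSec V.proj ((A i).frame a), 0)⟩
  | ⟨.inr i, a⟩ => ⟨i, (0, (C i).pullSec V.proj ((C i).frame a))⟩

/-- The functions on `D` given by the sections of the dual of the pullback of `A_i`. -/
def genDA (i : Fin n) : ((A i).pullback V.proj).dual.Sec →ₗ[C^∞⟮V.totI, V.Tot; ℝ⟯] FunD V A C :=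
  GSym.gen _ degD (N := fun s => (bundleD V A C s).dual.Sec) (Sum.inl i)

/-- The functions on `D` given by the sections of the dual of the pullback of `C_i`. -/
def genDC (i : Fin n) : ((C i).pullback V.proj).dual.Sec →ₗ[C^∞⟮V.totI, V.Tot; ℝ⟯] FunD V A C :=
  GSym.gen _ degD (N := fun s => (bundleD V A C s).dual.Sec) (Sum.inr i)

/-- The action of the scaling on the generators. -/
def scaleGen (t : ℝ) : ∀ s, (bundleD V A C s).dual.Sec →ₛₗ[pullFun (smulMap V t)]
    (bundleD V A C s).dual.Sec
  | .inl i => scaleDual V (A i) t 1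
  | .inr i => scaleDual V (C i) t t

/-- The pullback of functions on `D` under the scalar multiplication by `t` of the vector bundle
`D → A`. -/
def scaleD (t : ℝ) : FunD V A C →+* FunD V A C :=
  GSym.map degD degD (pullFun (smulMap V t)) id (fun _ => rfl) (scaleGen V A C t)

variable {V A C}

theorem scaleD_algebraMap (t : ℝ) (f : C^∞⟮V.totI, V.Tot; ℝ⟯) :
    scaleD V A C t (algebraMap _ _ f) = algebraMap _ _ (pullFun (smulMap V t) f) :=
  GSym.map_algebraMap ..

theorem scaleD_gen (t : ℝ) (s : Fin n ⊕ Fin n) (σ : (bundleD V A C s).dual.Sec) :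
    scaleD V A C t (GSym.gen _ degD s σ) = GSym.gen _ degD s (scaleGen V A C t s σ) :=
  GSym.map_gen ..

theorem scaleD_genDA (t : ℝ) (i : Fin n) (σ : ((A i).pullback V.proj).dual.Sec) :
    scaleD V A C t (genDA V A C i σ) = genDA V A C i (scaleDual V (A i) t 1 σ) :=
  scaleD_gen t (Sum.inl i) σ

theorem scaleD_genDC (t : ℝ) (i : Fin n) (σ : ((C i).pullback V.proj).dual.Sec) :
    scaleD V A C t (genDC V A C i σ) = genDC V A C i (scaleDual V (C i) t t σ) :=
  scaleD_gen t (Sum.inr i) σ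

theorem genC_apply (i : Fin n) (γ : (C i).dual.Sec) :
    genC V A C i γ = genDC V A C i ((C i).pullDual V.proj γ) := rfl

theorem genV_apply (ψ : V.dual.Sec) : genV V A C ψ = algebraMap _ _ (V.ell ψ) := rfl

theorem body_real_smul (c : ℝ) (x : FunD V A C) :
    GSym.body C^∞⟮V.totI, V.Tot; ℝ⟯ degD (c • x) = c • GSym.body C^∞⟮V.totI, V.Tot; ℝ⟯ degD x :=
  ((GSym.body C^∞⟮V.totI, V.Tot; ℝ⟯ (N := fun s => (bundleD V A C s).dual.Sec)
    degD).toLinearMap.restrictScalars ℝ).map_smul c x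

theorem scaleD_smul (t c : ℝ) (x : FunD V A C) : scaleD V A C t (c • x) = c • scaleD V A C t x :=
  GSym.map_real_smul (R := C^∞⟮V.totI, V.Tot; ℝ⟯) (S := C^∞⟮V.totI, V.Tot; ℝ⟯)
    (N := fun s => (bundleD V A C s).dual.Sec) (N' := fun s => (bundleD V A C s).dual.Sec)
    (fun _ => rfl) c x

theorem body_scaleD (t : ℝ) (x : FunD V A C) :
    GSym.body _ degD (scaleD V A C t x) = pullFun (smulMap V t) (GSym.body _ degD x) :=
  GSym.body_map x

theorem scaleD_mem_grade (t : ℝ) {k : ℕ} {x : FunD V A C}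
    (hx : x ∈ GSym.grade _ (fun s => (bundleD V A C s).dual.Sec) degD k) :
    scaleD V A C t x ∈ GSym.grade _ (fun s => (bundleD V A C s).dual.Sec) degD k :=
  GSym.map_mem_grade hx

theorem scaleD_scaleD_inv {t : ℝ} (ht : t ≠ 0) (x : FunD V A C) :
    scaleD V A C t (scaleD V A C t⁻¹ x) = x := by
  have : (scaleD V A C t).comp (scaleD V A C t⁻¹) = RingHom.id _ := by
    refine GSym.ringHom_ext (fun f => ?_) fun s σ => ?_
    · rw [RingHom.comp_apply, scaleD_algebraMap, scaleD_algebraMap, RingHom.id_apply]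
      congr 1
      ext ⟨m, x⟩
      change f ⟨m, t⁻¹ • t • x⟩ = f ⟨m, x⟩
      rw [inv_smul_smul₀ ht]
    · rw [RingHom.comp_apply, scaleD_gen, scaleD_gen, RingHom.id_apply]
      congr 1
      rcases s with i | i
      · refine pullback_dual_ext_evalAt V (A i) fun m x u => ?_
        refine (evalAt_scaleDual ..).trans ((congrArg _ (evalAt_scaleDual ..)).trans ?_)
        rw [inv_smul_smul₀ ht, one_mul, one_mul]
      · refine pullback_dual_ext_evalAt V (C i) fun m x u => ?_
        refine (evalAt_scaleDual ..).trans ((congrArg _ (evalAt_scaleDual ..)).trans ?_)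
        rw [inv_smul_smul₀ ht, mul_inv_cancel_left₀ ht]
  exact DFunLike.congr_fun this x

theorem pullA_algebraMap (f : C^∞⟮I, M; ℝ⟯) :
    pullA V A C (algebraMap _ _ f) = algebraMap _ _ (pullFun V.proj f) :=
  GSym.map_algebraMap ..

theorem pullA_gen (i : Fin n) (α : (A i).dual.Sec) :
    pullA V A C (GSym.gen _ degA (N := fun i => (A i).dual.Sec) i α) =
      genDA V A C i ((A i).pullDual V.proj α) :=
  GSym.map_gen ..

theorem scaleD_pullA (t : ℝ) (ξ : FunA A) : scaleD V A C t (pullA V A C ξ) = pullA V A C ξ := by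
  have : (scaleD V A C t).comp (pullA V A C) = pullA V A C := by
    refine GSym.ringHom_ext (fun f => ?_) fun i α => ?_
    · rw [RingHom.comp_apply, pullA_algebraMap, scaleD_algebraMap, pullFun_smulMap_pullFun]
    · rw [RingHom.comp_apply, pullA_gen, scaleD_genDA, scaleDual_pullDual, one_smul]
  exact DFunLike.congr_fun this ξ

theorem algebraMap_real_smul (t : ℝ) (f : C^∞⟮V.totI, V.Tot; ℝ⟯) :
    algebraMap _ (FunD V A C) (t • f) = t • algebraMap _ (FunD V A C) f := by
  rw [Algebra.algebraMap_eq_smul_one, smul_assoc, ← Algebra.algebraMap_eq_smul_one]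

theorem scaleD_genV (t : ℝ) (ψ : V.dual.Sec) :
    scaleD V A C t (genV V A C ψ) = t • genV V A C ψ := by
  rw [genV_apply, scaleD_algebraMap, pullFun_smulMap_ell, algebraMap_real_smul]

theorem scaleD_genC (t : ℝ) (i : Fin n) (γ : (C i).dual.Sec) :
    scaleD V A C t (genC V A C i γ) = t • genC V A C i γ := by
  rw [genC_apply, scaleD_genDC, scaleDual_pullDual]
  exact ((genDC V A C i).restrictScalars ℝ).map_smul t _

theorem genLin_apply (η : Π j, (bundleE V C j).dual.Sec) :
    genLin V A C η = genV V A C (η 0) + ∑ i : Fin n, genC V A C i (η i.succ) := rfl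

theorem scaleD_smul_add_sum (t : ℝ) {x : FunD V A C} {f : Fin n → FunD V A C}
    (hx : scaleD V A C t x = t • x) (hf : ∀ i, scaleD V A C t (f i) = t • f i) :
    scaleD V A C t (x + ∑ i, f i) = t • (x + ∑ i, f i) := by
  rw [map_add, map_sum, smul_add, Finset.smul_sum, hx]
  simp only [hf]

theorem scaleD_genLin (t : ℝ) (η : Π j, (bundleE V C j).dual.Sec) :
    scaleD V A C t (genLin V A C η) = t • genLin V A C η := by
  rw [genLin_apply]
  apply scaleD_smul_add_sum
  · have h := scaleD_genV (A := A) (C := C) t (show V.dual.Sec from η 0)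
    exact h
  · intro i
    have h := scaleD_genC (V := V) (A := A) t i (show (C i).dual.Sec from η i.succ)
    exact h

theorem linFun_tmul (ξ : FunA A) (η : Π j, (bundleE V C j).dual.Sec) :
    linFun V A C (ξ ⊗ₜ η) = pullA V A C ξ * genLin V A C η := rfl

theorem scaleD_linFun (t : ℝ) (y : ModDualE V A C) :
    scaleD V A C t (linFun V A C y) = t • linFun V A C y := by
  induction y using TensorProduct.induction_on with
  | zero => simp
  | add x y hx hy => rw [map_add, map_add, hx, hy, smul_add]
  | tmul ξ η => rw [linFun_tmul, map_mul, scaleD_pullA, scaleD_genLin, mul_smul_comm]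

/-! ### Weights -/

/-- The section `δ` of `D_i → V` is homogeneous of weight `w` under the scaling. -/
def HasWtSec (i : Fin n) (δ : SecD V A C i) (w : ℤ) : Prop :=
  ∀ t : ℝ, t ≠ 0 → ∀ m x, valD i δ m (t • x) =
    (t ^ w • (valD i δ m x).1, t ^ (w + 1) • (valD i δ m x).2)

theorem IsLinearSec.hasWtSec {i : Fin n} {δ : SecD V A C i} (h : IsLinearSec i δ) :
    HasWtSec i δ 0 := by
  obtain ⟨a, φ, h⟩ := h
  intro t _ m x
  rw [h, h]
  simp

theorem IsCoreSec.hasWtSec {i : Fin n} {δ : SecD V A C i} (h : IsCoreSec i δ) :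
    HasWtSec i δ (-1) := by
  obtain ⟨c, h⟩ := h
  intro t _ m x
  rw [h, h]
  simp

/-- The operator `X` on the functions on `D` is homogeneous of weight `w` under the scaling. -/
def HasWt (w : ℤ) (X : FunD V A C →ₗ[ℝ] FunD V A C) : Prop :=
  ∀ t : ℝ, t ≠ 0 → ∀ x, scaleD V A C t (X x) = t ^ w • X (scaleD V A C t x)

theorem HasWtSec.pair_fst {i : Fin n} {δ : SecD V A C i} {w : ℤ} (h : HasWtSec i δ w) {t : ℝ}
    (ht : t ≠ 0) (σ : ((A i).pullback V.proj).dual.Sec) (m : M) (x : V.Fib m) :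
    evalAt V (A i) (scaleDual V (A i) t 1 σ) m x (valD i δ m x).1 =
      (t ^ w)⁻¹ * evalAt V (A i) σ m (t • x) (valD i δ m (t • x)).1 := by
  rw [evalAt_scaleDual, h t ht, map_smul, smul_eq_mul,
    inv_mul_cancel_left₀ (zpow_ne_zero _ ht), one_mul]

theorem HasWtSec.pair_snd {i : Fin n} {δ : SecD V A C i} {w : ℤ} (h : HasWtSec i δ w) {t : ℝ}
    (ht : t ≠ 0) (σ : ((C i).pullback V.proj).dual.Sec) (m : M) (x : V.Fib m) :
    evalAt V (C i) (scaleDual V (C i) t t σ) m x (valD i δ m x).2 =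
      (t ^ w)⁻¹ * evalAt V (C i) σ m (t • x) (valD i δ m (t • x)).2 := by
  rw [evalAt_scaleDual, h t ht, map_smul, smul_eq_mul, zpow_add_one₀ ht, mul_assoc,
    inv_mul_cancel_left₀ (zpow_ne_zero _ ht)]

/-- The homogeneity of the section cancels, in its pairings with scaled generators, the factor
introduced by the scaling. The shift by one in the `C` component in `HasWtSec` matches the extra
factor `t` on the generators dual to `C`. -/
theorem HasWtSec.hasWt_contractD {i : Fin n} {δ : SecD V A C i} {w : ℤ} (h : HasWtSec i δ w) :
    HasWt w (contractD i δ) := by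
  intro t ht x
  let c : C^∞⟮V.totI, V.Tot; ℝ⟯ := algebraMap ℝ _ ((t ^ w)⁻¹)
  have h1 := GSym.contract_map (d := degD) (f := scaleGen V A C t) (Sum.inl i)
    (((A i).pullback V.proj).pair.flip δ.1) (((A i).pullback V.proj).pair.flip δ.1) c
    (fun σ => by ext ⟨m, x⟩; exact h.pair_fst ht σ m x) x
  have h2 := GSym.contract_map (d := degD) (f := scaleGen V A C t) (Sum.inr i)
    (((C i).pullback V.proj).pair.flip δ.2) (((C i).pullback V.proj).pair.flip δ.2) c
    (fun σ => by ext ⟨m, x⟩; exact h.pair_snd ht σ m x) x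
  have h3 : contractD i δ (scaleD V A C t x) = (t ^ w)⁻¹ • scaleD V A C t (contractD i δ x) := by
    refine (congrArg₂ (· + ·) h1 h2).trans ?_
    rw [← smul_add, ← map_add, algebraMap_smul]; rfl
  rw [h3, smul_inv_smul₀ (zpow_ne_zero _ ht)]

theorem HasWt.comp {w w' : ℤ} {X Y : FunD V A C →ₗ[ℝ] FunD V A C} (hX : HasWt w X)
    (hY : HasWt w' Y) : HasWt (w + w') (X ∘ₗ Y) := by
  intro t ht x
  rw [LinearMap.comp_apply, LinearMap.comp_apply, hX t ht, hY t ht, map_smul, smul_smul,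
    zpow_add₀ ht]

theorem negOnePow_smul_eq_real {P : Type*} [AddCommGroup P] [Module ℝ P] (p : ℤ) (x : P) :
    p.negOnePow • x = ((p.negOnePow : ℤ) : ℝ) • x := by
  rw [Units.smul_def, Int.cast_smul_eq_zsmul]

/-- Weights add under composition and the two terms of a commutator have equal weight. -/
theorem HasWt.iterComm {w : ℤ} {X : FunD V A C →ₗ[ℝ] FunD V A C} (hX : HasWt w X) (p : ℤ)
    (l : List ((Σ i, SecD V A C i) × ℤ)) (hl : ∀ s ∈ l, HasWtSec s.1.1 s.1.2 s.2) :
    HasWt (w + (l.map Prod.snd).sum) (DVB.iterComm X p (l.map Prod.fst)) := by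
  induction l generalizing X p w with
  | nil => simpa [DVB.iterComm] using hX
  | cons s l ih =>
    have hs := (hl s (by simp)).hasWt_contractD
    simp only [List.map_cons, List.sum_cons, DVB.iterComm, ← add_assoc]
    refine ih ?_ _ fun s hs => hl s (by simp [hs])
    intro t ht x
    have h1 := hX.comp hs t ht x
    have h2 := hs.comp hX t ht x
    rw [LinearMap.sub_apply, LinearMap.sub_apply, map_sub, h1, LinearMap.smul_apply,
      LinearMap.smul_apply, negOnePow_smul_eq_real, negOnePow_smul_eq_real, scaleD_smul, h2,
      smul_sub, add_comm s.2 w, smul_comm]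

end Scaling

end DVB

theorem GSym.contract_zero {ι : Type*} [DecidableEq ι] [Fintype ι] {R : Type*} [CommRing R]
    {N : ι → Type*} [∀ i, AddCommGroup (N i)] [∀ i, Module R (N i)] {d : ι → ℕ} (i : ι)
    (x : GSym R N d) : GSym.contract R d i 0 x = 0 := by
  induction x using GSym.gen_induction with
  | hadd x y hx hy => rw [map_add, hx, hy, add_zero]
  | hR r => exact GSym.contract_algebraMap ..
  | hgen j a x hx =>
    rw [GSym.contract_gen_mul, hx, mul_zero, smul_zero, add_zero]
    by_cases h : j = i
    · subst h; rw [GSym.contract_gen]; simp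
    · rw [GSym.contract_gen_of_ne _ _ _ _ h, zero_mul]

/-! ### Linear functions on `D` as a module over the functions on `A`. -/

namespace DVB

open SmoothVB

section Weights

variable {E H : Type*} [NormedAddCommGroup E] [NormedSpace ℝ E] [FiniteDimensional ℝ E]
  [TopologicalSpace H] {I : ModelWithCorners ℝ E H} [I.Boundaryless]
  {M : Type*} [TopologicalSpace M] [ChartedSpace H M] [IsManifold I ∞ M]
  [T2Space M] [SigmaCompactSpace M] {n : ℕ}
  (V : SmoothVB I M) (A C : Fin n → SmoothVB I M)

/-- The linear function `ψ ∈ Γ(V^*)`, as an element of the module of linear functions. -/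
def linV : V.dual.Sec →ₗ[C^∞⟮I, M; ℝ⟯] ModDualE V A C :=
  GSym.pureT _ _ degA (fun j => (bundleE V C j).dual.Sec) 0

/-- The linear function `γ ∈ Γ(C_i^*)`, as an element of the module of linear functions. -/
def linC (i : Fin n) : (C i).dual.Sec →ₗ[C^∞⟮I, M; ℝ⟯] ModDualE V A C :=
  GSym.pureT _ _ degA (fun j => (bundleE V C j).dual.Sec) i.succ

/-- The section `v` of `V`, as an element of the module `C^∞(A) ⊗ Γ(E)`. -/
def vecV : V.Sec →ₗ[C^∞⟮I, M; ℝ⟯] ModE V A C :=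
  GSym.pureT _ _ degA (fun j => (bundleE V C j).Sec) 0

/-- The section `c` of `C_i`, as an element of the module `C^∞(A) ⊗ Γ(E)`. -/
def vecC (i : Fin n) : (C i).Sec →ₗ[C^∞⟮I, M; ℝ⟯] ModE V A C :=
  GSym.pureT _ _ degA (fun j => (bundleE V C j).Sec) i.succ

variable {V A C}

theorem pullA_real_smul (c : ℝ) (ξ : FunA A) : pullA V A C (c • ξ) = c • pullA V A C ξ :=
  GSym.map_real_smul (R := C^∞⟮I, M; ℝ⟯) (S := C^∞⟮V.totI, V.Tot; ℝ⟯)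
    (N := fun i => (A i).dual.Sec) (N' := fun s => (bundleD V A C s).dual.Sec)
    (fun _ => rfl) c ξ

theorem pullA_twist (p : ℕ) (ξ : FunA A) : pullA V A C (GSym.twist _ degA p ξ) =
    GSym.twist _ degD p (pullA V A C ξ) := GSym.map_twist ..

theorem pullA_mem_grade {k : ℕ} {ξ : FunA A}
    (hξ : ξ ∈ GSym.grade _ (fun i => (A i).dual.Sec) degA k) :
    pullA V A C ξ ∈ GSym.grade _ (fun s => (bundleD V A C s).dual.Sec) degD k :=
  GSym.map_mem_grade hξ

theorem linV_mem_moduleGrade (ψ : V.dual.Sec) : linV V A C ψ ∈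
    GSym.moduleGrade _ _ degA (fun j => (bundleE V C j).dual.Sec) (fun j => ((j : ℕ) : ℤ)) 0 :=
  GSym.pureT_mem_moduleGrade (P := fun j => (bundleE V C j).dual.Sec)
    (fun j => ((j : ℕ) : ℤ)) 0 _

theorem linC_mem_moduleGrade (i : Fin n) (γ : (C i).dual.Sec) : linC V A C i γ ∈
    GSym.moduleGrade _ _ degA (fun j => (bundleE V C j).dual.Sec) (fun j => ((j : ℕ) : ℤ))
      ((i : ℕ) + 1 : ℕ) :=
  GSym.pureT_mem_moduleGrade (P := fun j => (bundleE V C j).dual.Sec)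
    (fun j => ((j : ℕ) : ℤ)) i.succ _

theorem linFun_smul (ξ : FunA A) (y : ModDualE V A C) :
    linFun V A C (ξ • y) = pullA V A C ξ * linFun V A C y := by
  induction y using TensorProduct.induction_on with
  | zero => simp
  | add x y hx hy => rw [smul_add, map_add, map_add, hx, hy, mul_add]
  | tmul ζ η => rw [TensorProduct.smul_tmul', linFun_tmul, linFun_tmul, smul_eq_mul, map_mul,
      mul_assoc]

theorem linFun_real_smul (c : ℝ) (y : ModDualE V A C) :
    linFun V A C (c • y) = c • linFun V A C y := by
  induction y using TensorProduct.induction_on with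
  | zero => simp
  | add x y hx hy => rw [smul_add, map_add, map_add, hx, hy, smul_add]
  | tmul ζ η => rw [TensorProduct.smul_tmul', linFun_tmul, linFun_tmul, pullA_real_smul,
      smul_mul_assoc]

theorem genLin_single_zero (ψ : V.dual.Sec) :
    genLin V A C (Pi.single (M := fun j => (bundleE V C j).dual.Sec) 0 ψ) = genV V A C ψ := by
  rw [genLin_apply]
  have h1 : ∀ i : Fin n, genC V A C i
      (Pi.single (M := fun j => (bundleE V C j).dual.Sec) 0 ψ i.succ) = 0 := fun i =>
    (congrArg (genC V A C i) (Pi.single_eq_of_ne (Fin.succ_ne_zero i) _)).trans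
      (map_zero (genC V A C i))
  rw [Finset.sum_eq_zero fun i _ => h1 i, add_zero]
  exact congrArg (genV V A C) (Pi.single_eq_same _ _)

theorem genLin_single_succ (i : Fin n) (γ : (C i).dual.Sec) :
    genLin V A C (Pi.single (M := fun j => (bundleE V C j).dual.Sec) i.succ γ) =
      genC V A C i γ := by
  rw [genLin_apply]
  have h1 : ∀ k : Fin n, k ≠ i → genC V A C k
      (Pi.single (M := fun j => (bundleE V C j).dual.Sec) i.succ γ k.succ) = 0 := fun k hk =>
    (congrArg (genC V A C k) (Pi.single_eq_of_ne (fun h => hk (Fin.succ_injective _ h)) _)).trans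
      (map_zero (genC V A C k))
  have h2 : genV V A C
      (Pi.single (M := fun j => (bundleE V C j).dual.Sec) i.succ γ 0) = 0 :=
    (congrArg (genV V A C) (Pi.single_eq_of_ne (Fin.succ_ne_zero i).symm _)).trans
      (map_zero (genV V A C))
  rw [h2, zero_add, Finset.sum_eq_single i (fun k _ hk => h1 k hk) (by simp)]
  exact congrArg (genC V A C i) (Pi.single_eq_same _ _)

theorem linFun_linV (ψ : V.dual.Sec) : linFun V A C (linV V A C ψ) = genV V A C ψ := by
  refine Eq.trans (b := pullA V A C 1 * genLin V A C _) rfl ?_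
  rw [map_one, one_mul]
  exact genLin_single_zero ψ

theorem linFun_linC (i : Fin n) (γ : (C i).dual.Sec) :
    linFun V A C (linC V A C i γ) = genC V A C i γ := by
  refine Eq.trans (b := pullA V A C 1 * genLin V A C _) rfl ?_
  rw [map_one, one_mul]
  exact genLin_single_succ i γ

theorem genV_mem_grade (ψ : V.dual.Sec) :
    genV V A C ψ ∈ GSym.grade _ (fun s => (bundleD V A C s).dual.Sec) degD 0 :=
  GSym.algebraMap_mem_grade _

theorem genC_mem_grade (i : Fin n) (γ : (C i).dual.Sec) :
    genC V A C i γ ∈ GSym.grade _ (fun s => (bundleD V A C s).dual.Sec) degD (i + 1) :=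
  GSym.gen_mem_grade (d := degD) (Sum.inr i) _

theorem linFun_pureT_mem_grade (j : Fin (n + 1)) (η : (bundleE V C j).dual.Sec) :
    linFun V A C (GSym.pureT _ _ degA (fun j => (bundleE V C j).dual.Sec) j η) ∈
      GSym.grade _ (fun s => (bundleD V A C s).dual.Sec) degD (j : ℕ) := by
  cases j using Fin.cases with
  | zero =>
    have h := genV_mem_grade (A := A) (C := C) (show V.dual.Sec from η)
    rw [← linFun_linV] at h
    exact h
  | succ i =>
    have h := genC_mem_grade (V := V) (A := A) i (show (C i).dual.Sec from η)
    rw [← linFun_linC] at h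
    exact h

theorem linFun_mem_gradeZ {p : ℤ} {y : ModDualE V A C}
    (hy : y ∈ GSym.moduleGrade _ _ degA (fun j => (bundleE V C j).dual.Sec)
      (fun j => ((j : ℕ) : ℤ)) p) :
    linFun V A C y ∈ GSym.gradeZ _ (fun s => (bundleD V A C s).dual.Sec) degD p := by
  induction hy using GSym.moduleGrade_induction with
  | h0 => rw [map_zero]; exact zero_mem _
  | hadd x y _ _ hx hy => rw [map_add]; exact add_mem hx hy
  | hs k ξ j e hξ hk _ =>
    rw [linFun_smul]
    exact GSym.mem_gradeZ_of_mem (by push_cast; exact hk)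
      (GSym.grade_mul (pullA_mem_grade hξ) (linFun_pureT_mem_grade j e))

/-- The expansions used below carry their coefficients on the right, while linear functions form a
left module; graded commutativity moves the factor across at the cost of a twist. -/
theorem exists_linFun_mul_pullA {p : ℤ} {y : ModDualE V A C}
    (hy : y ∈ GSym.moduleGrade _ _ degA (fun j => (bundleE V C j).dual.Sec)
      (fun j => ((j : ℕ) : ℤ)) p) {k : ℕ} {ζ : FunA A}
    (hζ : ζ ∈ GSym.grade _ (fun i => (A i).dual.Sec) degA k) :
    ∃ z ∈ GSym.moduleGrade _ _ degA (fun j => (bundleE V C j).dual.Sec)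
      (fun j => ((j : ℕ) : ℤ)) (p + k), linFun V A C z = linFun V A C y * pullA V A C ζ := by
  induction hy using GSym.moduleGrade_induction with
  | h0 => exact ⟨0, zero_mem _, by simp⟩
  | hadd x y _ _ hx hy =>
    obtain ⟨z, hz, hz'⟩ := hx
    obtain ⟨w, hw, hw'⟩ := hy
    exact ⟨z + w, add_mem hz hw, by rw [map_add, map_add, hz', hw', add_mul]⟩
  | hs l ξ j e hξ hl _ =>
    refine ⟨(ξ * GSym.twist _ degA j ζ) • GSym.pureT _ _ degA
      (fun j => (bundleE V C j).dual.Sec) j e, ?_, ?_⟩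
    · have := GSym.smul_mem_moduleGrade (R := C^∞⟮I, M; ℝ⟯) (fun j : Fin (n + 1) => ((j : ℕ) : ℤ))
        (k := ((l + k : ℕ) : ℤ))
        (GSym.grade_mul hξ (GSym.twist_mem_grade j hζ)) (GSym.pureT_mem_moduleGrade
          (P := fun j => (bundleE V C j).dual.Sec) _ j e)
      convert this using 2
      push_cast; omega
    · rw [linFun_smul, linFun_smul, map_mul, pullA_twist, mul_assoc, mul_assoc,
        GSym.mul_comm_of_mem_grade (linFun_pureT_mem_grade j e)]

end Weights
end DVB

/-! ### Functions of weight 0 and 1. -/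

namespace DVB

open SmoothVB

section Expansion

variable {E H : Type*} [NormedAddCommGroup E] [NormedSpace ℝ E] [FiniteDimensional ℝ E]
  [TopologicalSpace H] {I : ModelWithCorners ℝ E H} [I.Boundaryless]
  {M : Type*} [TopologicalSpace M] [ChartedSpace H M] [IsManifold I ∞ M]
  [T2Space M] [SigmaCompactSpace M] {n : ℕ}
  {V : SmoothVB I M} {A C : Fin n → SmoothVB I M}

/-- The function `x` on `D` is homogeneous of weight `w` under the scaling. -/
def IsWt (w : ℤ) (x : FunD V A C) : Prop := ∀ t : ℝ, t ≠ 0 → scaleD V A C t x = t ^ w • x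

theorem isWt_pullA (ξ : FunA A) : IsWt 0 (pullA V A C ξ) := fun t _ => by
  rw [scaleD_pullA, zpow_zero, one_smul]

theorem isWt_linFun (y : ModDualE V A C) : IsWt 1 (linFun V A C y) := fun t _ => by
  rw [scaleD_linFun, zpow_one]

theorem HasWt.isWt {w w' : ℤ} {X : FunD V A C →ₗ[ℝ] FunD V A C} (hX : HasWt w X)
    {x : FunD V A C} (hx : IsWt w' x) : IsWt (w + w') (X x) := fun t ht => by
  rw [hX t ht, hx t ht, X.map_smul, smul_smul, zpow_add₀ ht]

theorem IsWt.isHomog_body {w : ℤ} {x : FunD V A C} (hx : IsWt w x) :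
    IsHomog V w (GSym.body _ degD x) := fun t ht => by
  rw [← body_scaleD, hx t ht, body_real_smul]

theorem contractD_secD (s : Σ s : Fin n ⊕ Fin n, Fin (cardD A C s)) (x : FunD V A C) :
    contractD (secD V A C s).1 (secD V A C s).2 x =
      GSym.contract _ degD s.1 ((frameD V A C s.1).co s.2) x := by
  obtain ⟨i | i, a⟩ := s
  · refine (congrArg _ ((congrArg (fun φ => GSym.contract _ degD (Sum.inr i) φ x) ?_).trans
      (GSym.contract_zero (Sum.inr i) x))).trans (add_zero _)
    exact map_zero ((C i).pullback V.proj).pair.flip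
  · refine (congrArg (· + _) ((congrArg (fun φ => GSym.contract _ degD (Sum.inl i) φ x) ?_).trans
      (GSym.contract_zero (Sum.inl i) x))).trans (zero_add _)
    exact map_zero ((A i).pullback V.proj).pair.flip

/-- The weights of the sections `secD`. -/
def wtD : Fin n ⊕ Fin n → ℤ := Sum.elim 0 (-1)

theorem isLinearSec_secD_inl (i : Fin n) (a : Fin (cardD A C (.inl i))) :
    IsLinearSec i (secD V A C ⟨.inl i, a⟩).2 :=
  ⟨(A i).frame a, fun _ => 0, fun _ _ => rfl⟩

theorem isCoreSec_secD_inr (i : Fin n) (a : Fin (cardD A C (.inr i))) :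
    IsCoreSec i (secD V A C ⟨.inr i, a⟩).2 :=
  ⟨(C i).frame a, fun _ _ => rfl⟩

theorem hasWtSec_secD (s : Σ s : Fin n ⊕ Fin n, Fin (cardD A C s)) :
    HasWtSec (secD V A C s).1 (secD V A C s).2 (wtD s.1) := by
  obtain ⟨i | i, a⟩ := s
  · exact (isLinearSec_secD_inl i a).hasWtSec
  · exact (isCoreSec_secD_inr i a).hasWtSec

/-- The total weight of a list of frame sections. -/
def listWt (l : List (Σ s : Fin n ⊕ Fin n, Fin (cardD A C s))) : ℤ := (l.map fun s => wtD s.1).sum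

theorem listWt_nonpos (l : List (Σ s : Fin n ⊕ Fin n, Fin (cardD A C s))) : listWt l ≤ 0 := by
  induction l with
  | nil => exact le_rfl
  | cons s l ih =>
    have : wtD s.1 ≤ 0 := by rcases s with ⟨i | i, a⟩ <;> simp [wtD]
    simp only [listWt, List.map_cons, List.sum_cons] at ih ⊢
    omega

/-- A contraction with a frame section keeps the weight for `A` and lowers it by one for `C`; so
`listWt` is minus the number of entries from `C`. -/
theorem IsWt.contractList {w : ℤ} {x : FunD V A C} (hx : IsWt w x)
    (l : List (Σ s : Fin n ⊕ Fin n, Fin (cardD A C s))) :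
    IsWt (listWt l + w) (GSym.contractList (frameD V A C) l x) := by
  induction l generalizing x w with
  | nil =>
    rw [show listWt ([] : List (Σ s : Fin n ⊕ Fin n, Fin (cardD A C s))) = 0 from rfl, zero_add]
    exact hx
  | cons s l ih =>
    have h := ih ((hasWtSec_secD s).hasWt_contractD.isWt hx)
    rw [contractD_secD] at h
    have e : listWt (s :: l) + w = listWt l + (wtD s.1 + w) := by
      simp only [listWt, List.map_cons, List.sum_cons]; ring
    rw [e]
    exact h

/-- The product of the frame generators indexed by a list. -/
def prodD (V : SmoothVB I M) (A C : Fin n → SmoothVB I M)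
    (l : List (Σ s : Fin n ⊕ Fin n, Fin (cardD A C s))) : FunD V A C :=
  (l.map fun s => GSym.gen _ degD s.1 ((frameD V A C s.1).vec s.2)).prod

theorem prodD_inl (i : Fin n) (a : Fin (cardD A C (.inl i)))
    (l : List (Σ s : Fin n ⊕ Fin n, Fin (cardD A C s))) :
    prodD V A C (⟨.inl i, a⟩ :: l) =
      pullA V A C (GSym.gen _ degA (N := fun i => (A i).dual.Sec) i ((A i).coframe a)) *
        prodD V A C l :=
  (List.prod_cons ..).trans (congrArg (· * prodD V A C l) (pullA_gen i _).symm)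

theorem prodD_inr (i : Fin n) (a : Fin (cardD A C (.inr i)))
    (l : List (Σ s : Fin n ⊕ Fin n, Fin (cardD A C s))) :
    prodD V A C (⟨.inr i, a⟩ :: l) = genC V A C i ((C i).coframe a) * prodD V A C l :=
  List.prod_cons ..

theorem listWt_inl (i : Fin n) (a : Fin (cardD A C (.inl i)))
    (l : List (Σ s : Fin n ⊕ Fin n, Fin (cardD A C s))) : listWt (⟨.inl i, a⟩ :: l) = listWt l := by
  simp [listWt, wtD]

theorem listWt_inr (i : Fin n) (a : Fin (cardD A C (.inr i)))
    (l : List (Σ s : Fin n ⊕ Fin n, Fin (cardD A C s))) :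
    listWt (⟨.inr i, a⟩ :: l) = listWt l - 1 := by
  simp [listWt, wtD]; ring

theorem prodD_eq_pullA (l : List (Σ s : Fin n ⊕ Fin n, Fin (cardD A C s))) (hl : listWt l = 0) :
    ∃ ξ ∈ GSym.grade _ (fun i => (A i).dual.Sec) degA (l.map fun s => degD s.1).sum,
      pullA V A C ξ = prodD V A C l := by
  induction l with
  | nil =>
    have h := GSym.algebraMap_mem_grade (d := degA) (N := fun i => (A i).dual.Sec)
      (1 : C^∞⟮I, M; ℝ⟯)
    rw [map_one] at h
    exact ⟨1, h, map_one _⟩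
  | cons s l ih =>
    obtain ⟨i | i, a⟩ := s
    · rw [listWt_inl] at hl
      obtain ⟨ξ, hξ, hξ'⟩ := ih hl
      have hg := GSym.gen_mem_grade (d := degA) (N := fun i => (A i).dual.Sec)
        (R := C^∞⟮I, M; ℝ⟯) i ((A i).coframe a)
      refine ⟨_, GSym.grade_mul hg hξ, ?_⟩
      rw [map_mul, hξ', prodD_inl]
    · rw [listWt_inr] at hl
      have := listWt_nonpos l
      omega

/-- Exactly one factor comes from `C`; the factors before it act on the left and those after it are
moved across. -/
theorem prodD_eq_linFun (l : List (Σ s : Fin n ⊕ Fin n, Fin (cardD A C s)))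
    (hl : listWt l = -1) :
    ∃ y ∈ GSym.moduleGrade _ _ degA (fun j => (bundleE V C j).dual.Sec)
      (fun j => ((j : ℕ) : ℤ)) (l.map fun s => degD s.1).sum,
      linFun V A C y = prodD V A C l := by
  induction l with
  | nil => simp [listWt] at hl
  | cons s l ih =>
    obtain ⟨i | i, a⟩ := s
    · rw [listWt_inl] at hl
      obtain ⟨y, hy, hy'⟩ := ih hl
      refine ⟨GSym.gen C^∞⟮I, M; ℝ⟯ degA (N := fun i => (A i).dual.Sec) i ((A i).coframe a) • y, ?_, ?_⟩
      · have hg := GSym.gen_mem_grade (d := degA) (N := fun i => (A i).dual.Sec)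
          (R := C^∞⟮I, M; ℝ⟯) i ((A i).coframe a)
        have := GSym.smul_mem_moduleGrade (fun j : Fin (n + 1) => ((j : ℕ) : ℤ))
          (k := ((degA i : ℕ) : ℤ)) hg hy
        convert this using 2
        simp [degD]
      · rw [linFun_smul, hy', prodD_inl]
    · rw [listWt_inr] at hl
      obtain ⟨ξ, hξ, hξ'⟩ := prodD_eq_pullA (V := V) l (by omega)
      have h := linC_mem_moduleGrade (V := V) (A := A) i ((C i).coframe a)
      obtain ⟨z, hz, hz'⟩ := exists_linFun_mul_pullA h hξ
      refine ⟨z, ?_, ?_⟩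
      · convert hz using 2
        simp [degD, degA]
      · rw [hz', linFun_linC, hξ', prodD_inr]

/-- In the expansion of `x` in products of frame generators, the coefficient of a product with `r`
factors from `C` is a function on `V` of degree `-r`. It vanishes for `r > 0`, and for `r = 0` it is
pulled back from `M`. -/
theorem exists_pullA_eq {k : ℕ} {x : FunD V A C}
    (hx : x ∈ GSym.grade _ (fun s => (bundleD V A C s).dual.Sec) degD k) (hw : IsWt 0 x) :
    ∃ ξ ∈ GSym.grade _ (fun i => (A i).dual.Sec) degA k, pullA V A C ξ = x := by
  let P : FunA A →ₗ[ℝ] FunD V A C :=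
    { toFun := pullA V A C, map_add' := map_add _, map_smul' := pullA_real_smul }
  refine GSym.mem_of_contractList (frameD V A C) degD_pos hx
    (((GSym.grade _ (fun i => (A i).dual.Sec) degA k).restrictScalars ℝ).map P) fun l hl => ?_
  have hb := (hw.contractList l).isHomog_body
  rw [add_zero] at hb
  rcases (listWt_nonpos l).lt_or_eq with h | h
  · rw [hb.eq_zero h, map_zero, mul_zero]; exact zero_mem _
  · rw [h] at hb
    obtain ⟨ξ, hξ, hξ'⟩ := prodD_eq_pullA (V := V) l h
    rw [hl] at hξ
    rw [hb.eq_pullFun, ← pullA_algebraMap]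
    refine ⟨ξ * algebraMap _ (FunA A) (pullFun (secMap V 0)
      (GSym.body _ degD (GSym.contractList (frameD V A C) l x))),
      GSym.grade_mul (k := 0) hξ (GSym.algebraMap_mem_grade _), ?_⟩
    exact (map_mul (pullA V A C) _ _).trans (congrArg (· * _) hξ')

/-- Here the coefficient of a product with `r` factors from `C` has degree `1 - r`: for `r = 0` it
is fibrewise linear, for `r = 1` it comes from `M`, and otherwise it is zero. The first two kinds of
term are linear functions. -/
theorem exists_linFun_eq {k : ℕ} {x : FunD V A C}
    (hx : x ∈ GSym.grade _ (fun s => (bundleD V A C s).dual.Sec) degD k) (hw : IsWt 1 x) :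
    ∃ y ∈ GSym.moduleGrade _ _ degA (fun j => (bundleE V C j).dual.Sec)
      (fun j => ((j : ℕ) : ℤ)) k, linFun V A C y = x := by
  let P : ModDualE V A C →ₗ[ℝ] FunD V A C :=
    { toFun := linFun V A C, map_add' := map_add _, map_smul' := linFun_real_smul }
  refine GSym.mem_of_contractList (frameD V A C) degD_pos hx
    (((GSym.moduleGrade _ _ degA (fun j => (bundleE V C j).dual.Sec)
      (fun j => ((j : ℕ) : ℤ)) k).restrictScalars ℝ).map P) fun l hl => ?_
  have hb := (hw.contractList l).isHomog_body
  rcases lt_trichotomy (listWt l + 1) 0 with h | h | h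
  · rw [hb.eq_zero h, map_zero, mul_zero]; exact zero_mem _
  · rw [h] at hb
    obtain ⟨y, hy, hy'⟩ := prodD_eq_linFun (V := V) l (by omega)
    rw [hl] at hy
    rw [hb.eq_pullFun, ← pullA_algebraMap]
    obtain ⟨z, hz, hz'⟩ := exists_linFun_mul_pullA hy
      (GSym.algebraMap_mem_grade (d := degA) (N := fun i => (A i).dual.Sec) (pullFun (secMap V 0)
        (GSym.body _ degD (GSym.contractList (frameD V A C) l x))))
    rw [Nat.cast_zero, add_zero] at hz
    refine ⟨z, hz, hz'.trans (congrArg (· * _) hy')⟩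
  · have h0 : listWt l = 0 := by have := listWt_nonpos l; omega
    rw [h0, zero_add] at hb
    obtain ⟨ξ, hξ, hξ'⟩ := prodD_eq_pullA (V := V) l h0
    rw [hl] at hξ
    rw [hb.eq_ell, ← genV_apply, ← linFun_linV]
    set y := linV V A C (∑ c, pullFun (secMap V (V.frame c))
      (GSym.body _ degD (GSym.contractList (frameD V A C) l x)) • V.coframe c) with hy
    refine ⟨ξ • y, ?_, (linFun_smul ξ y).trans (congrArg (· * linFun V A C y) hξ')⟩
    have := GSym.smul_mem_moduleGrade (fun j : Fin (n + 1) => ((j : ℕ) : ℤ)) (k := (k : ℤ)) hξ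
      (linV_mem_moduleGrade (A := A) (C := C) (∑ c, pullFun (secMap V (V.frame c))
        (GSym.body _ degD (GSym.contractList (frameD V A C) l x)) • V.coframe c))
    rw [add_zero] at this
    exact this

end Expansion
end DVB

/-! ### Injectivity of the inclusions of weight 0 and weight 1 functions. -/

namespace DVB

open SmoothVB

section Restriction

variable {E H : Type*} [NormedAddCommGroup E] [NormedSpace ℝ E] [FiniteDimensional ℝ E]
  [TopologicalSpace H] {I : ModelWithCorners ℝ E H} [I.Boundaryless]
  {M : Type*} [TopologicalSpace M] [ChartedSpace H M] [IsManifold I ∞ M]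
  [T2Space M] [SigmaCompactSpace M] {n : ℕ}
  (V : SmoothVB I M) (A C : Fin n → SmoothVB I M)

/-- The action on generators of the pullback along a section of `V`. -/
def restrGen (e : V.Sec) : ∀ s : Fin n ⊕ Fin n, (bundleD V A C s).dual.Sec
    →ₛₗ[pullFun (secMap V e)] (A (Sum.elim id id s)).dual.Sec
  | .inl i => ((A i).pullDualFrame V.proj).mapSL _ (A i).coframe
  | .inr _ => 0

/-- The pullback of functions on `D` to functions on `A` along the section `e` of `V` and the zero
sections of the core bundles. -/
def restrA (e : V.Sec) : FunD V A C →+* FunA A :=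
  GSym.map degD degA (pullFun (secMap V e)) (Sum.elim id id) (by rintro (i | i) <;> rfl)
    (restrGen V A C e)

/-- The dual frames of the summands of `E`. -/
def frameE : GSym.DualFrames (fun j => (bundleE V C j).pair)
    (fun j => Fin (bundleE V C j).frameCard) where
  vec j := (bundleE V C j).frame
  covec j := (bundleE V C j).coframe
  sum_vec j x := (bundleE V C j).sum_coframe_smul_frame x
  sum_covec j y := (bundleE V C j).sum_frame_smul_coframe y

variable {V A C}

theorem restrA_algebraMap (e : V.Sec) (f : C^∞⟮V.totI, V.Tot; ℝ⟯) :
    restrA V A C e (algebraMap _ _ f) = algebraMap _ _ (pullFun (secMap V e) f) :=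
  GSym.map_algebraMap ..

theorem restrA_genDA (e : V.Sec) (i : Fin n) (σ : ((A i).pullback V.proj).dual.Sec) :
    restrA V A C e (genDA V A C i σ) = GSym.gen _ degA (N := fun i => (A i).dual.Sec) i
      (((A i).pullDualFrame V.proj).mapSL (pullFun (secMap V e)) (A i).coframe σ) :=
  GSym.map_gen ..

theorem restrA_gen (e : V.Sec) (s : Fin n ⊕ Fin n) (σ : (bundleD V A C s).dual.Sec) :
    restrA V A C e (GSym.gen _ degD (N := fun s => (bundleD V A C s).dual.Sec) s σ) =
      GSym.gen _ degA (N := fun i => (A i).dual.Sec) (Sum.elim id id s) (restrGen V A C e s σ) :=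
  GSym.map_gen ..

theorem restrA_gen_eq_zero (e : V.Sec) {s : Fin n ⊕ Fin n} {σ : (bundleD V A C s).dual.Sec}
    (h : restrGen V A C e s σ = 0) :
    restrA V A C e (GSym.gen _ degD (N := fun s => (bundleD V A C s).dual.Sec) s σ) = 0 := by
  rw [restrA_gen, h, map_zero]

theorem restrA_genDC (e : V.Sec) (i : Fin n) (σ : ((C i).pullback V.proj).dual.Sec) :
    restrA V A C e (genDC V A C i σ) = 0 :=
  restrA_gen_eq_zero e (s := Sum.inr i) rfl

theorem restrA_pullA (e : V.Sec) (ξ : FunA A) : restrA V A C e (pullA V A C ξ) = ξ := by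
  have : (restrA V A C e).comp (pullA V A C) = RingHom.id _ := by
    refine GSym.ringHom_ext (fun f => ?_) fun i α => ?_
    · rw [RingHom.comp_apply, pullA_algebraMap, restrA_algebraMap, pullFun_secMap_pullFun,
        RingHom.id_apply]
    · rw [RingHom.comp_apply, pullA_gen, restrA_genDA, RingHom.id_apply]
      congr 1
      exact (A i).sum_frame_smul_coframe α
  exact DFunLike.congr_fun this ξ

/-- Restriction along a section of `V`, with zero core components, is a left inverse. -/
theorem pullA_injective : Function.Injective (pullA V A C) := fun ξ ζ h => by
  rw [← restrA_pullA (C := C) (0 : V.Sec) ξ, h, restrA_pullA]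

theorem contract_inr_pullA (i : Fin n) (φ : (bundleD V A C (.inr i)).dual.Sec →ₗ[
    C^∞⟮V.totI, V.Tot; ℝ⟯] C^∞⟮V.totI, V.Tot; ℝ⟯) (ξ : FunA A) :
    GSym.contract _ degD (Sum.inr i) φ (pullA V A C ξ) = 0 := by
  induction ξ using GSym.gen_induction with
  | hadd x y hx hy => rw [map_add, map_add, hx, hy, add_zero]
  | hR r => rw [pullA_algebraMap]; exact GSym.contract_algebraMap ..
  | hgen j a x hx =>
    rw [map_mul, GSym.contract_mul, hx, mul_zero, add_zero, pullA_gen]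
    have h := GSym.contract_gen_of_ne (N := fun s => (bundleD V A C s).dual.Sec) _ degD (Sum.inr i)
      (Sum.inl j) (by simp) φ
      ((A j).pullDual V.proj a)
    exact (congrArg (· * pullA V A C x) h).trans (zero_mul _)

/-- The contraction with the core section of `D_i` given by a section of `C_i`. -/
def contractC (i : Fin n) (c : (C i).Sec) : FunD V A C →ₗ[C^∞⟮V.totI, V.Tot; ℝ⟯] FunD V A C :=
  GSym.contract _ degD (N := fun s => (bundleD V A C s).dual.Sec) (Sum.inr i)
    (((C i).pullback V.proj).pair.flip ((C i).pullSec V.proj c))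

theorem contractC_pullA_mul (i : Fin n) (c : (C i).Sec) (ξ : FunA A) (z : FunD V A C) :
    contractC i c (pullA V A C ξ * z) = pullA V A C (GSym.twist _ degA (degA i) ξ) *
      contractC i c z := by
  refine (GSym.contract_mul ..).trans ?_
  refine (congrArg₂ (· + ·) (congrArg (· * z) (contract_inr_pullA i _ ξ))
    (congrArg (· * contractC i c z) (pullA_twist (degA i) ξ).symm)).trans ?_
  exact (congrArg (· + _) (zero_mul z)).trans (zero_add _)

theorem contractC_genV (i : Fin n) (c : (C i).Sec) (ψ : V.dual.Sec) :
    contractC (A := A) i c (genV V A C ψ) = 0 := GSym.contract_algebraMap ..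

theorem contractC_genC (i : Fin n) (c : (C i).Sec) (γ : (C i).dual.Sec) :
    contractC (A := A) i c (genC V A C i γ) =
      algebraMap _ _ (pullFun V.proj ((C i).pair γ c)) := GSym.contract_gen ..

theorem contractC_genC_of_ne {i k : Fin n} (h : k ≠ i) (c : (C i).Sec) (γ : (C k).dual.Sec) :
    contractC (A := A) i c (genC V A C k γ) = 0 :=
  GSym.contract_gen_of_ne _ degD (Sum.inr i) (Sum.inr k) (by simpa using h) _ _

theorem pureT_induction {p : ∀ j, (bundleE V C j).dual.Sec → Prop}
    (hV : ∀ ψ : V.dual.Sec, p 0 ψ) (hC : ∀ i (γ : (C i).dual.Sec), p i.succ γ) (j) (η) : p j η := by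
  cases j using Fin.cases with
  | zero => exact hV η
  | succ i => exact hC i η

/-- The pairing of `C^∞(A) ⊗ Γ(E^*)` with `C^∞(A) ⊗ Γ(E)`. -/
def pairE : ModDualE V A C →ₗ[C^∞⟮I, M; ℝ⟯] ModE V A C →ₗ[C^∞⟮I, M; ℝ⟯] FunA A :=
  GSym.pairing degA (fun j : Fin (n + 1) => (j : ℕ)) (fun j => (bundleE V C j).pair)

theorem pairE_smul (ξ : FunA A) (y : ModDualE V A C) (z : ModE V A C) :
    pairE (ξ • y) z = ξ * pairE y z := GSym.pairing_smul_left ..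

theorem pairE_linV_vecV (ψ : V.dual.Sec) (e : V.Sec) :
    pairE (linV V A C ψ) (vecV V A C e) = algebraMap _ _ (V.pair ψ e) := by
  refine (GSym.pairing_pureT_pureT ..).trans (congrArg (algebraMap _ _) ?_)
  exact congrArg (V.pair ψ) (Pi.single_eq_same (M := fun j => (bundleE V C j).Sec) 0 e)

theorem pairE_linC_vecV (i : Fin n) (γ : (C i).dual.Sec) (e : V.Sec) :
    pairE (linC V A C i γ) (vecV V A C e) = 0 := by
  refine (GSym.pairing_pureT_pureT ..).trans ?_
  refine (congrArg (algebraMap C^∞⟮I, M; ℝ⟯ (FunA A)) ?_).trans (map_zero _)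
  exact (congrArg ((C i).pair γ) (Pi.single_eq_of_ne (M := fun j => (bundleE V C j).Sec)
    (Fin.succ_ne_zero i) e)).trans (map_zero _)

theorem pairE_linV_vecC (ψ : V.dual.Sec) (i : Fin n) (c : (C i).Sec) :
    pairE (linV V A C ψ) (vecC V A C i c) = 0 := by
  refine (GSym.pairing_pureT_pureT ..).trans ?_
  refine (congrArg (algebraMap C^∞⟮I, M; ℝ⟯ (FunA A)) ?_).trans (map_zero _)
  exact (congrArg (V.pair ψ) (Pi.single_eq_of_ne (M := fun j => (bundleE V C j).Sec)
    (Fin.succ_ne_zero i).symm c)).trans (map_zero _)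

theorem pairE_linC_vecC (i : Fin n) (γ : (C i).dual.Sec) (c : (C i).Sec) :
    pairE (linC V A C i γ) (vecC V A C i c) = algebraMap _ _ ((C i).pair γ c) := by
  refine (GSym.pairing_pureT_pureT ..).trans (congrArg (algebraMap _ _) ?_)
  exact congrArg ((C i).pair γ) (Pi.single_eq_same (M := fun j => (bundleE V C j).Sec) i.succ c)

theorem pairE_linC_vecC_of_ne {i k : Fin n} (h : k ≠ i) (γ : (C k).dual.Sec) (c : (C i).Sec) :
    pairE (linC V A C k γ) (vecC V A C i c) = 0 := by
  refine (GSym.pairing_pureT_pureT ..).trans ?_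
  refine (congrArg (algebraMap C^∞⟮I, M; ℝ⟯ (FunA A)) ?_).trans (map_zero _)
  exact (congrArg ((C k).pair γ) (Pi.single_eq_of_ne (M := fun j => (bundleE V C j).Sec)
    (fun h' => h (Fin.succ_injective _ h')) c)).trans (map_zero _)

theorem modDualE_induction {p : ModDualE V A C → Prop} (h0 : p 0)
    (hadd : ∀ x y, p x → p y → p (x + y))
    (hV : ∀ k, ∀ ξ ∈ GSym.grade C^∞⟮I, M; ℝ⟯ (fun i => (A i).dual.Sec) degA k, ∀ ψ, p (ξ • linV V A C ψ))
    (hC : ∀ k, ∀ ξ ∈ GSym.grade C^∞⟮I, M; ℝ⟯ (fun i => (A i).dual.Sec) degA k, ∀ i γ,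
      p (ξ • linC V A C i γ)) (y : ModDualE V A C) : p y := by
  induction y using GSym.module_induction with
  | h0 => exact h0
  | hadd x y hx hy => exact hadd x y hx hy
  | hs k ξ j η hξ =>
    exact pureT_induction (p := fun j η => p (ξ • GSym.pureT _ _ degA
      (fun j => (bundleE V C j).dual.Sec) j η)) (hV k ξ hξ) (hC k ξ hξ) j η

/-- The components of a linear function along `V` are recovered by restricting it along sections of
`V`. -/
theorem pairE_vecV (y : ModDualE V A C) (e : V.Sec) :
    pairE y (vecV V A C e) = restrA V A C e (linFun V A C y) := by
  induction y using modDualE_induction with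
  | h0 => simp
  | hadd x y hx hy => rw [map_add, LinearMap.add_apply, hx, hy, map_add, map_add]
  | hV k ξ _ ψ =>
    rw [pairE_smul, pairE_linV_vecV, linFun_smul, map_mul, restrA_pullA, linFun_linV, genV_apply,
      restrA_algebraMap, pullFun_secMap_ell]
  | hC k ξ _ i γ =>
    rw [pairE_smul, pairE_linC_vecV, linFun_smul, map_mul, restrA_pullA, linFun_linC, genC_apply,
      restrA_genDC]

/-- The components along `C_i` are recovered by contracting with a core section and restricting to
the zero section. The twist removes the sign from moving the contraction past the coefficient. -/
theorem pairE_vecC (y : ModDualE V A C) (i : Fin n) (c : (C i).Sec) :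
    pairE y (vecC V A C i c) = GSym.twist _ degA (degA i)
      (restrA V A C 0 (contractC i c (linFun V A C y))) := by
  induction y using modDualE_induction with
  | h0 => simp
  | hadd x y hx hy => rw [map_add, LinearMap.add_apply, hx, hy, map_add, map_add, map_add, map_add]
  | hV k ξ _ ψ =>
    rw [pairE_smul, pairE_linV_vecC, linFun_smul, linFun_linV, contractC_pullA_mul,
      contractC_genV, mul_zero, mul_zero, map_zero, map_zero]
  | hC k ξ _ j γ =>
    rw [pairE_smul, linFun_smul, linFun_linC, contractC_pullA_mul, map_mul, map_mul, restrA_pullA,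
      GSym.twist_twist_self]
    by_cases h : j = i
    · subst h
      rw [pairE_linC_vecC, contractC_genC, restrA_algebraMap, pullFun_secMap_pullFun,
        GSym.twist_algebraMap]
    · rw [pairE_linC_vecC_of_ne h, contractC_genC_of_ne h, map_zero, map_zero]

/-- All pairings with the frame of `E` can be read off from the function, and they determine the
element. -/
theorem linFun_injective : Function.Injective (linFun V A C) := by
  refine (injective_iff_map_eq_zero _).2 fun y hy => ?_
  have h := (frameE V C).sum_pairing_smul_covec (d := degA) (N := fun i => (A i).dual.Sec)
    (fun j => (j : ℕ)) y
  rw [← h]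
  refine Finset.sum_eq_zero fun c _ => ?_
  have h0 : pairE y (GSym.pureT _ _ degA (fun j => (bundleE V C j).Sec) c.1
      ((frameE V C).vec c.1 c.2)) = 0 := by
    generalize (frameE V C).vec c.1 c.2 = e
    obtain ⟨j, a⟩ := c
    cases j using Fin.cases with
    | zero =>
      have h := pairE_vecV y (show V.Sec from e)
      rw [hy, map_zero] at h
      exact h
    | succ i =>
      have h := pairE_vecC y i (show (C i).Sec from e)
      rw [hy, map_zero, map_zero, map_zero] at h
      exact h
  exact (congrArg (· • _) h0).trans (zero_smul _ _)

end Restriction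
end DVB

/-! ### Restriction of weight 0 fields to `A` and to linear functions. -/

namespace DVB

open SmoothVB

section Restriction

variable {E H : Type*} [NormedAddCommGroup E] [NormedSpace ℝ E] [FiniteDimensional ℝ E]
  [TopologicalSpace H] {I : ModelWithCorners ℝ E H} [I.Boundaryless]
  {M : Type*} [TopologicalSpace M] [ChartedSpace H M] [IsManifold I ∞ M]
  [T2Space M] [SigmaCompactSpace M] {n : ℕ}
  {V : SmoothVB I M} {A C : Fin n → SmoothVB I M}

variable {Q : FunD V A C →ₗ[ℝ] FunD V A C}

theorem HasWt.exists_pullA_eq (hw : HasWt 0 Q) (hQ : GSym.IsHomological Q) {k : ℕ} {ξ : FunA A}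
    (hξ : ξ ∈ GSym.grade _ (fun i => (A i).dual.Sec) degA k) :
    ∃ ζ ∈ GSym.grade _ (fun i => (A i).dual.Sec) degA (k + 1),
      pullA V A C ζ = Q (pullA V A C ξ) :=
  DVB.exists_pullA_eq (hQ.degree k _ (pullA_mem_grade hξ)) (hw.isWt (isWt_pullA ξ))

/-- `Q` preserves the functions of weight 0, that is, those pulled back from `A`; since the pullback
is injective, degree, Leibniz rule and square zero are inherited. -/
theorem HasWt.exists_isOver (hw : HasWt 0 Q) (hQ : GSym.IsHomological Q) :
    ∃ QA : FunA A →ₗ[ℝ] FunA A, GSym.IsHomological QA ∧ IsOver Q QA := by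
  have hex : ∀ ξ, ∃ ζ, pullA V A C ζ = Q (pullA V A C ξ) := fun ξ => by
    induction ξ using GSym.homogeneous_induction with
    | hadd x y hx hy =>
      obtain ⟨z, hz⟩ := hx
      obtain ⟨w, hw⟩ := hy
      exact ⟨z + w, by rw [map_add, map_add, map_add, hz, hw]⟩
    | hom k ξ hξ =>
      obtain ⟨ζ, _, h⟩ := hw.exists_pullA_eq hQ hξ
      exact ⟨ζ, h⟩
  choose q hq using hex
  let QA : FunA A →ₗ[ℝ] FunA A :=
    { toFun := q
      map_add' := fun x y => pullA_injective (V := V) (C := C) <| by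
        rw [map_add, hq, hq, hq, map_add, map_add]
      map_smul' := fun c x => pullA_injective (V := V) (C := C) <| by
        rw [RingHom.id_apply, pullA_real_smul, hq, hq, pullA_real_smul, map_smul] }
  have hover : IsOver Q QA := fun ξ => (hq ξ).symm
  refine ⟨QA, GSym.isHomological_of_map_mul ?_ ?_ ?_, hover⟩
  · intro k ξ hξ
    obtain ⟨ζ, hζ, h⟩ := hw.exists_pullA_eq hQ hξ
    rwa [pullA_injective (h.trans (hover ξ))] at hζ
  · intro x y
    refine pullA_injective (V := V) (C := C) ?_
    rw [← hover, map_mul, hQ.map_mul, map_add, map_mul, map_mul, hover, hover, pullA_twist]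
  · intro x
    refine pullA_injective (V := V) (C := C) ?_
    rw [← hover, ← hover, hQ.square, map_zero]

theorem isOver_unique {QA QA' : FunA A →ₗ[ℝ] FunA A} (h : IsOver Q QA) (h' : IsOver Q QA') :
    QA = QA' :=
  LinearMap.ext fun ξ => pullA_injective (V := V) (C := C) ((h ξ).symm.trans (h' ξ))

theorem isRestriction_unique {D₁ D₂ : ModDualE V A C →ₗ[ℝ] ModDualE V A C}
    (h : IsRestriction Q D₁) (h' : IsRestriction Q D₂) : D₁ = D₂ :=
  LinearMap.ext fun y => linFun_injective ((h y).symm.trans (h' y))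

theorem HasWt.exists_linFun_eq (hw : HasWt 0 Q) (hQ : GSym.IsHomological Q) {p : ℤ}
    {y : ModDualE V A C} (hy : y ∈ GSym.moduleGrade _ _ degA (fun j => (bundleE V C j).dual.Sec)
      (fun j => ((j : ℕ) : ℤ)) p) :
    ∃ z ∈ GSym.moduleGrade _ _ degA (fun j => (bundleE V C j).dual.Sec)
      (fun j => ((j : ℕ) : ℤ)) (p + 1), linFun V A C z = Q (linFun V A C y) := by
  have h := hQ.mem_gradeZ (linFun_mem_gradeZ hy)
  rcases lt_or_ge (p + 1) 0 with hp | hp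
  · rw [GSym.gradeZ_of_neg hp, Submodule.mem_bot] at h
    exact ⟨0, zero_mem _, by rw [h, map_zero]⟩
  · obtain ⟨k, hk⟩ := Int.eq_ofNat_of_zero_le hp
    rw [hk] at h ⊢
    exact DVB.exists_linFun_eq h (hw.isWt (isWt_linFun y))

/-- The same for weight 1: `Q` preserves linear functions, and injectivity of `linFun` transfers all
identities to `D'`. -/
theorem HasWt.exists_isRestriction (hw : HasWt 0 Q) (hQ : GSym.IsHomological Q)
    {QA : FunA A →ₗ[ℝ] FunA A} (hover : IsOver Q QA) :
    ∃ D' : ModDualE V A C →ₗ[ℝ] ModDualE V A C, IsRUTHOnDualE QA D' ∧ IsRestriction Q D' := by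
  have hex : ∀ y, ∃ z, linFun V A C z = Q (linFun V A C y) := fun y => by
    induction y using GSym.module_induction with
    | h0 => exact ⟨0, by simp⟩
    | hadd x y hx hy =>
      obtain ⟨z, hz⟩ := hx
      obtain ⟨w, hw⟩ := hy
      exact ⟨z + w, by rw [map_add, map_add, map_add, hz, hw]⟩
    | hs k ξ j e hξ =>
      obtain ⟨z, _, h⟩ := hw.exists_linFun_eq hQ (GSym.smul_mem_moduleGrade
        (fun j : Fin (n + 1) => ((j : ℕ) : ℤ)) (k := (k : ℤ)) hξ
        (GSym.pureT_mem_moduleGrade (P := fun j => (bundleE V C j).dual.Sec) _ j e))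
      exact ⟨z, h⟩
  choose q hq using hex
  let D' : ModDualE V A C →ₗ[ℝ] ModDualE V A C :=
    { toFun := q
      map_add' := fun x y => linFun_injective <| by
        rw [map_add, hq, hq, hq, map_add, map_add]
      map_smul' := fun c x => linFun_injective <| by
        rw [RingHom.id_apply, linFun_real_smul, hq, hq, linFun_real_smul, map_smul] }
  have hres : IsRestriction Q D' := fun y => (hq y).symm
  refine ⟨D', GSym.isRUTH_of_map_smul ?_ ?_ ?_, hres⟩
  · intro p y hy
    obtain ⟨z, hz, h⟩ := hw.exists_linFun_eq hQ hy
    rwa [linFun_injective (h.trans (hres y))] at hz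
  · intro ξ y
    refine linFun_injective ?_
    rw [← hres, linFun_smul, hQ.map_mul, map_add, linFun_smul, linFun_smul, hover, hres,
      pullA_twist]
  · intro y
    refine linFun_injective ?_
    rw [← hres, ← hres, hQ.square, map_zero]

end Restriction
end DVB

/-! ### Derivations of functions on `D`: uniqueness and construction data. -/

namespace DVB

open SmoothVB

section Extension

variable {E H : Type*} [NormedAddCommGroup E] [NormedSpace ℝ E] [FiniteDimensional ℝ E]
  [TopologicalSpace H] {I : ModelWithCorners ℝ E H} [I.Boundaryless]
  {M : Type*} [TopologicalSpace M] [ChartedSpace H M] [IsManifold I ∞ M]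
  [T2Space M] [SigmaCompactSpace M] {n : ℕ}
  {V : SmoothVB I M} {A C : Fin n → SmoothVB I M}

/-- The twisted Leibniz rule for operators of degree `1` on the functions on `D`. -/
def IsDer (Q : FunD V A C →ₗ[ℝ] FunD V A C) : Prop :=
  ∀ x y, Q (x * y) = Q x * y + GSym.twist _ degD 1 x * Q y

/-- The base functions and frame generators that detect derivations can all be chosen pulled back
from `A` or linear. The sign parameter `p` covers both differences of odd fields and the square of
an odd field. -/
theorem IsDer.eq_zero {X : FunD V A C →ₗ[ℝ] FunD V A C} (p : ℕ) {k : ℕ}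
    (hdeg : ∀ f : C^∞⟮V.totI, V.Tot; ℝ⟯, X (algebraMap _ _ f) ∈ GSym.grade _ (fun s => (bundleD V A C s).dual.Sec) degD k)
    (hmul : ∀ x y, X (x * y) = X x * y + GSym.twist _ degD p x * X y)
    (hfun : ∀ g : C^∞⟮I, M; ℝ⟯, X (algebraMap _ _ (pullFun V.proj g)) = 0)
    (hV : ∀ ψ, X (genV V A C ψ) = 0)
    (hA : ∀ i α, X (genDA V A C i ((A i).pullDual V.proj α)) = 0)
    (hC : ∀ i γ, X (genC V A C i γ) = 0) (x : FunD V A C) : X x = 0 := by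
  refine GSym.derivation_eq_zero (frameD V A C) degD_pos p hdeg hmul
    (fun D hD f => derivation_eq_sum (sum_dAt_baseFun V) hD f) ?_ ?_ x
  · rintro (k | c)
    · exact hfun _
    · exact hV _
  · rintro (i | i) a
    · exact hA i _
    · exact hC i _

/-- A derivation of degree `1` is determined by its values on the functions pulled back from `A`
and the linear functions. -/
theorem IsDer.ext {Q Q' : FunD V A C →ₗ[ℝ] FunD V A C} (hQ : IsDer Q) (hQ' : IsDer Q')
    (hdeg : ∀ f : C^∞⟮V.totI, V.Tot; ℝ⟯, Q (algebraMap _ _ f) ∈ GSym.grade _ (fun s => (bundleD V A C s).dual.Sec) degD 1)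
    (hdeg' : ∀ f : C^∞⟮V.totI, V.Tot; ℝ⟯, Q' (algebraMap _ _ f) ∈
      GSym.grade _ (fun s => (bundleD V A C s).dual.Sec) degD 1)
    (hA : ∀ ξ, Q (pullA V A C ξ) = Q' (pullA V A C ξ))
    (hL : ∀ y, Q (linFun V A C y) = Q' (linFun V A C y)) : Q = Q' := by
  refine LinearMap.ext fun x => ?_
  rw [← sub_eq_zero, ← LinearMap.sub_apply]
  refine IsDer.eq_zero (X := Q - Q') 1 (k := 1) ?_ ?_ ?_ ?_ ?_ ?_ x
  · intro f; exact sub_mem (hdeg f) (hdeg' f)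
  · intro x y
    rw [LinearMap.sub_apply, LinearMap.sub_apply, LinearMap.sub_apply, hQ, hQ', sub_mul, mul_sub]
    abel
  · intro g
    rw [← pullA_algebraMap, LinearMap.sub_apply, hA, sub_self]
  · intro ψ
    rw [← linFun_linV, LinearMap.sub_apply, hL, sub_self]
  · intro i α
    rw [← pullA_gen, LinearMap.sub_apply, hA, sub_self]
  · intro i γ
    rw [← linFun_linC, LinearMap.sub_apply, hL, sub_self]

/-- The operator `Q` conjugated with the scaling by `t`. -/
def conjScale (t : ℝ) (Q : FunD V A C →ₗ[ℝ] FunD V A C) : FunD V A C →ₗ[ℝ] FunD V A C where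
  toFun x := scaleD V A C t (Q (scaleD V A C t⁻¹ x))
  map_add' x y := by rw [map_add, map_add, map_add]
  map_smul' c x := by rw [scaleD_smul, map_smul, scaleD_smul, RingHom.id_apply]

theorem conjScale_apply (t : ℝ) (Q : FunD V A C →ₗ[ℝ] FunD V A C) (x : FunD V A C) :
    conjScale t Q x = scaleD V A C t (Q (scaleD V A C t⁻¹ x)) := rfl

theorem hasWt_zero_of_conjScale {Q : FunD V A C →ₗ[ℝ] FunD V A C}
    (h : ∀ t : ℝ, t ≠ 0 → conjScale t Q = Q) : HasWt 0 Q := by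
  intro t ht x
  have h2 := scaleD_scaleD_inv (inv_ne_zero ht) x
  rw [inv_inv] at h2
  have h1 := DFunLike.congr_fun (h t ht) (scaleD V A C t x)
  rw [conjScale_apply, h2] at h1
  rw [h1, zpow_zero, one_smul]

theorem scaleD_twist (t : ℝ) (p : ℕ) (x : FunD V A C) :
    scaleD V A C t (GSym.twist _ degD p x) = GSym.twist _ degD p (scaleD V A C t x) :=
  GSym.map_twist ..

theorem IsDer.conjScale {Q : FunD V A C →ₗ[ℝ] FunD V A C} (hQ : IsDer Q) {t : ℝ} (ht : t ≠ 0) :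
    IsDer (conjScale t Q) := by
  intro x y
  rw [conjScale_apply, conjScale_apply, conjScale_apply, map_mul, hQ, map_add, map_mul, map_mul,
    scaleD_scaleD_inv ht, scaleD_twist, scaleD_scaleD_inv ht]

theorem conjScale_mem_grade {Q : FunD V A C →ₗ[ℝ] FunD V A C}
    (hdeg : ∀ f : C^∞⟮V.totI, V.Tot; ℝ⟯, Q (algebraMap _ _ f) ∈ GSym.grade _ (fun s => (bundleD V A C s).dual.Sec) degD 1)
    (t : ℝ) (f : C^∞⟮V.totI, V.Tot; ℝ⟯) : DVB.conjScale t Q (algebraMap _ _ f) ∈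
      GSym.grade _ (fun s => (bundleD V A C s).dual.Sec) degD 1 := by
  rw [conjScale_apply, scaleD_algebraMap]
  exact scaleD_mem_grade t (hdeg _)

section Construct

variable (QA : FunA A →ₗ[ℝ] FunA A) (D' : ModDualE V A C →ₗ[ℝ] ModDualE V A C)

/-- The images of the functions `baseFun` under the vector field defined by `QA` and `D'`. -/
def baseImg : Fin (tanCard I M) ⊕ Fin V.frameCard → FunD V A C
  | .inl k => pullA V A C (QA (algebraMap _ _ (tanFun I M k)))
  | .inr c => linFun V A C (D' (linV V A C (V.coframe c)))

/-- The images of the frame generators under the vector field defined by `QA` and `D'`. -/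
def genImg : ∀ s, Fin (cardD A C s) → FunD V A C
  | .inl i, a => pullA V A C (QA (GSym.gen _ degA (N := fun i => (A i).dual.Sec) i
      ((A i).coframe a)))
  | .inr i, a => linFun V A C (D' (linC V A C i ((C i).coframe a)))

/-- The action on functions on `V` of the vector field defined by `QA` and `D'`. -/
def baseDer : C^∞⟮V.totI, V.Tot; ℝ⟯ →ₗ[ℝ] FunD V A C :=
  ∑ j, (LinearMap.toSpanSingleton C^∞⟮V.totI, V.Tot; ℝ⟯ (FunD V A C)
    (baseImg QA D' j)).restrictScalars ℝ ∘ₗ lieD (baseField V j)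

theorem baseDer_apply (f : C^∞⟮V.totI, V.Tot; ℝ⟯) :
    baseDer QA D' f = ∑ j, lieD (baseField V j) f • baseImg QA D' j := by
  rw [baseDer, LinearMap.sum_apply]; rfl

theorem baseDer_mul (f g : C^∞⟮V.totI, V.Tot; ℝ⟯) : baseDer QA D' (f * g) =
    baseDer QA D' f * algebraMap _ _ g + algebraMap _ _ f * baseDer QA D' g := by
  rw [← Algebra.commutes, ← Algebra.smul_def, ← Algebra.smul_def]
  simp only [baseDer_apply, Finset.smul_sum, ← Finset.sum_add_distrib, lieD_mul, add_smul, mul_smul]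
  refine Finset.sum_congr rfl fun j _ => ?_
  rw [smul_comm]

variable {QA D'}

/-- On functions on `M`, `QA` is determined by its values on the chosen functions with generating
differentials, and the vector fields lifted to `V` act compatibly; so the choice of values on the
frame is consistent. -/
theorem pullA_eq_baseDer (hQA : GSym.IsHomological QA) (g : C^∞⟮I, M; ℝ⟯) :
    pullA V A C (QA (algebraMap _ _ g)) = baseDer QA D' (pullFun V.proj g) := by
  have h := GSym.baseDerivation_eq_sum (fun i => (A i).dualSecFrame) (d := degA) degA_pos
    (fun D hD f => derivation_eq_sum (sum_dAt_tanFun (I := I) (M := M)) hD f)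
    (δ := QA ∘ₗ (Algebra.linearMap _ (FunA A)).restrictScalars ℝ) (k := 1)
    (fun r => hQA.degree 0 _ (GSym.algebraMap_mem_grade r)) (fun r s => by
      simp only [LinearMap.comp_apply, LinearMap.restrictScalars_apply, Algebra.linearMap_apply,
        map_mul, hQA.map_mul, GSym.twist_algebraMap]
      rw [← Algebra.commutes, ← Algebra.smul_def, ← Algebra.smul_def]) g
  refine (congrArg (pullA V A C) h).trans ?_
  rw [map_sum, baseDer_apply, Fintype.sum_sum_type]
  simp only [lieD_baseField_inl_pullFun, lieD_baseField_inr_pullFun, zero_smul,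
    Finset.sum_const_zero, add_zero, pullA_smul]
  rfl

/-- Expand `ψ` in the coframe. The Leibniz rule of `D'` differentiates the coefficients, which is
what the lifted vector fields do, and the vertical fields account for the remaining terms. -/
theorem linFun_eq_baseDer (hQA : GSym.IsHomological QA) (hD : IsRUTHOnDualE QA D')
    (ψ : V.dual.Sec) : linFun V A C (D' (linV V A C ψ)) = baseDer QA D' (V.ell ψ) := by
  have h1 : linV V A C ψ = ∑ c, algebraMap _ (FunA A) (V.pair ψ (V.frame c)) •
      linV V A C (V.coframe c) := by
    conv_lhs => rw [← V.sum_frame_smul_coframe ψ, map_sum]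
    exact Finset.sum_congr rfl fun c _ => by rw [map_smul, algebraMap_smul]
  rw [h1, map_sum, map_sum, baseDer_apply, Fintype.sum_sum_type]
  have h2 : ∀ c, linFun V A C (D' (algebraMap _ (FunA A) (V.pair ψ (V.frame c)) •
      linV V A C (V.coframe c))) =
      ∑ k, (pullFun V.proj (lieD (tanField I M k) (V.pair ψ (V.frame c))) * V.ell (V.coframe c)) •
        baseImg QA D' (.inl k) +
      pullFun V.proj (V.pair ψ (V.frame c)) • baseImg QA D' (.inr c) := by
    intro c
    rw [hD.map_smul, GSym.twist_algebraMap, map_add, linFun_smul, linFun_smul, linFun_linV,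
      pullA_eq_baseDer (D' := D') hQA, pullA_algebraMap, ← Algebra.smul_def, baseDer_apply,
      Fintype.sum_sum_type]
    simp only [lieD_baseField_inl_pullFun, lieD_baseField_inr_pullFun, zero_smul,
      Finset.sum_const_zero, add_zero, genV_apply]
    rw [← Algebra.commutes, ← Algebra.smul_def, Finset.smul_sum]
    congr 1
    exact Finset.sum_congr rfl fun k _ => by rw [smul_smul, mul_comm]
  rw [Finset.sum_congr rfl fun c _ => h2 c, Finset.sum_add_distrib, Finset.sum_comm]
  congr 1
  · refine Finset.sum_congr rfl fun k _ => ?_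
    rw [lieD_baseField_inl_ell, Finset.sum_smul]
  · exact Finset.sum_congr rfl fun c _ => by rw [lieD_baseField_inr_ell]

theorem baseImg_mem_grade (hQA : GSym.IsHomological QA) (hD : IsRUTHOnDualE QA D') (j) :
    baseImg QA D' j ∈ GSym.grade _ (fun s => (bundleD V A C s).dual.Sec) degD 1 := by
  rcases j with k | c
  · exact pullA_mem_grade (hQA.degree 0 _ (GSym.algebraMap_mem_grade _))
  · exact linFun_mem_gradeZ (p := 1) (hD.degree 0 _ (linV_mem_moduleGrade _))

theorem genImg_mem_grade (hQA : GSym.IsHomological QA) (hD : IsRUTHOnDualE QA D') (s) (a) :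
    genImg QA D' s a ∈ GSym.grade _ (fun s => (bundleD V A C s).dual.Sec) degD (degD s + 1) := by
  rcases s with i | i
  · exact pullA_mem_grade (hQA.degree (degA i) _ (GSym.gen_mem_grade i _))
  · exact linFun_mem_gradeZ (p := ((i + 1 : ℕ) : ℤ) + 1) (hD.degree _ _ (linC_mem_moduleGrade i _))

end Construct

end Extension
end DVB

/-- The square of an odd derivation is an even one: the cross terms have opposite signs. -/
theorem GSym.sq_map_mul {ι : Type*} [DecidableEq ι] [Fintype ι] {R : Type*} [CommRing R]
    {N : ι → Type*} [∀ i, AddCommGroup (N i)] [∀ i, Module R (N i)] {d : ι → ℕ} [Algebra ℝ R]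
    [∀ i, Module ℝ (N i)] [∀ i, IsScalarTower ℝ R (N i)] {Q : GSym R N d →ₗ[ℝ] GSym R N d}
    (hdeg : ∀ k, ∀ x ∈ GSym.grade R N d k, Q x ∈ GSym.grade R N d (k + 1))
    (hmul : ∀ x y, Q (x * y) = Q x * y + GSym.twist R d 1 x * Q y) (x y : GSym R N d) :
    Q (Q (x * y)) = Q (Q x) * y + x * Q (Q y) := by
  induction x using GSym.homogeneous_induction with
  | hadd x z hx hz => simp only [add_mul, map_add, hx, hz]; abel
  | hom k x hx =>
    rw [hmul, map_add, hmul, hmul, GSym.twist_twist_self, GSym.twist_of_mem_grade 1 hx,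
      GSym.twist_of_mem_grade 1 (hdeg k x hx), one_mul, one_mul, pow_succ]
    rcases neg_one_pow_eq_or (GSym R N d) k with h | h <;> rw [h]
    · rw [one_mul, one_mul, neg_one_mul, neg_mul]; abel
    · rw [neg_one_mul, neg_one_mul, map_neg, neg_neg, one_mul, neg_mul]; abel

/-! ### Extension of `QA` and `D'` to a homological vector field on `D`. -/

namespace DVB

open SmoothVB

section Extension

variable {E H : Type*} [NormedAddCommGroup E] [NormedSpace ℝ E] [FiniteDimensional ℝ E]
  [TopologicalSpace H] {I : ModelWithCorners ℝ E H} [I.Boundaryless]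
  {M : Type*} [TopologicalSpace M] [ChartedSpace H M] [IsManifold I ∞ M]
  [T2Space M] [SigmaCompactSpace M] {n : ℕ}
  {V : SmoothVB I M} {A C : Fin n → SmoothVB I M}
  {QA : FunA A →ₗ[ℝ] FunA A} {D' : ModDualE V A C →ₗ[ℝ] ModDualE V A C}
  {Q : FunD V A C →ₗ[ℝ] FunD V A C}

theorem sum_gen_coframe (i : Fin n) (α : (A i).dual.Sec) :
    GSym.gen _ degA (N := fun i => (A i).dual.Sec) i α =
      ∑ a, algebraMap _ (FunA A) ((A i).pair α ((A i).frame a)) *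
        GSym.gen _ degA (N := fun i => (A i).dual.Sec) i ((A i).coframe a) := by
  conv_lhs => rw [← (A i).sum_frame_smul_coframe α, map_sum]
  exact Finset.sum_congr rfl fun a _ => by rw [map_smul, Algebra.smul_def]

theorem sum_linC_coframe (i : Fin n) (γ : (C i).dual.Sec) :
    linC V A C i γ = ∑ a, algebraMap _ (FunA A) ((C i).pair γ ((C i).frame a)) •
      linC V A C i ((C i).coframe a) := by
  conv_lhs => rw [← (C i).sum_frame_smul_coframe γ, map_sum]
  exact Finset.sum_congr rfl fun c _ => by rw [map_smul, algebraMap_smul]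

theorem IsDer.isOver (hQ : IsDer Q) (hQA : GSym.IsHomological QA)
    (h : ∀ f, Q (algebraMap _ _ (pullFun V.proj f)) = pullA V A C (QA (algebraMap _ _ f)))
    (hg : ∀ i α, Q (genDA V A C i ((A i).pullDual V.proj α)) =
      pullA V A C (QA (GSym.gen _ degA (N := fun i => (A i).dual.Sec) i α))) : IsOver Q QA := by
  intro ξ
  induction ξ using GSym.gen_induction with
  | hadd x y hx hy => simp only [map_add, hx, hy]
  | hR r => rw [pullA_algebraMap, h]
  | hgen i a x hx =>
    rw [map_mul, hQ, hx, pullA_gen, hg, ← pullA_gen, hQA.map_mul, map_add, map_mul, map_mul,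
      pullA_twist]

theorem IsDer.isRestriction (hQ : IsDer Q) (hD : IsRUTHOnDualE QA D') (hover : IsOver Q QA)
    (hV : ∀ ψ, Q (genV V A C ψ) = linFun V A C (D' (linV V A C ψ)))
    (hC : ∀ i γ, Q (genC V A C i γ) = linFun V A C (D' (linC V A C i γ))) :
    IsRestriction Q D' := by
  intro y
  induction y using modDualE_induction with
  | h0 => simp
  | hadd x y hx hy => simp only [map_add, hx, hy]
  | hV k ξ _ ψ => rw [linFun_smul, linFun_linV, hQ, hover, hV, hD.map_smul, map_add, linFun_smul,
      linFun_smul, linFun_linV, pullA_twist]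
  | hC k ξ _ i γ => rw [linFun_smul, linFun_linC, hQ, hover, hC, hD.map_smul, map_add, linFun_smul,
      linFun_smul, linFun_linC, pullA_twist]

/-- Conjugation by a scaling does not change the values of `Q` on functions pulled back from `A` or
on linear functions, which have pure weight and are preserved; those values determine `Q`. -/
theorem IsDer.hasWt_zero (hQ : IsDer Q)
    (hdeg : ∀ f : C^∞⟮V.totI, V.Tot; ℝ⟯, Q (algebraMap _ _ f) ∈
      GSym.grade _ (fun s => (bundleD V A C s).dual.Sec) degD 1)
    (hover : IsOver Q QA) (hres : IsRestriction Q D') : HasWt 0 Q := by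
  refine hasWt_zero_of_conjScale fun t ht => (hQ.conjScale ht).ext hQ (conjScale_mem_grade hdeg t)
    hdeg (fun ξ => ?_) fun y => ?_
  · rw [conjScale_apply, scaleD_pullA, hover, scaleD_pullA]
  · rw [conjScale_apply, scaleD_linFun, map_smul, scaleD_smul, hres, scaleD_linFun,
      inv_smul_smul₀ ht]

theorem extension_unique {Q' : FunD V A C →ₗ[ℝ] FunD V A C} (hQ : GSym.IsHomological Q)
    (hQ' : GSym.IsHomological Q') (hover : IsOver Q QA) (hover' : IsOver Q' QA)
    (hres : IsRestriction Q D') (hres' : IsRestriction Q' D') : Q = Q' :=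
  IsDer.ext hQ.map_mul hQ'.map_mul (fun _ => hQ.degree 0 _ (GSym.algebraMap_mem_grade _))
    (fun _ => hQ'.degree 0 _ (GSym.algebraMap_mem_grade _))
    (fun ξ => (hover ξ).trans (hover' ξ).symm) fun y => (hres y).trans (hres' y).symm

theorem IsDer.square (hQ : IsDer Q)
    (hdeg : ∀ k, ∀ x ∈ GSym.grade _ (fun s => (bundleD V A C s).dual.Sec) degD k,
      Q x ∈ GSym.grade _ (fun s => (bundleD V A C s).dual.Sec) degD (k + 1))
    (hA : ∀ ξ, Q (Q (pullA V A C ξ)) = 0) (hL : ∀ y, Q (Q (linFun V A C y)) = 0)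
    (x : FunD V A C) : Q (Q x) = 0 := by
  have hdeg0 : ∀ f : C^∞⟮V.totI, V.Tot; ℝ⟯, Q (algebraMap _ _ f) ∈
      GSym.grade _ (fun s => (bundleD V A C s).dual.Sec) degD 1 := fun f =>
    hdeg 0 _ (GSym.algebraMap_mem_grade f)
  have hg : ∀ g : C^∞⟮I, M; ℝ⟯, Q (Q (algebraMap _ _ (pullFun V.proj g))) = 0 := fun g => by
    rw [← pullA_algebraMap, hA]
  have hV : ∀ ψ, Q (Q (genV V A C ψ)) = 0 := fun ψ => by rw [← linFun_linV, hL]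
  refine IsDer.eq_zero (X := Q ∘ₗ Q) 0 (k := 2) (fun f => hdeg 1 _ (hdeg0 f)) ?_ hg hV ?_ ?_ x
  · intro x y
    refine (GSym.sq_map_mul hdeg hQ x y).trans ?_
    exact congrArg (fun z => Q (Q x) * y + z * Q (Q y)) (GSym.twist_two_mul 0 x).symm
  · intro i α
    rw [← pullA_gen]; exact hA _
  · intro i γ
    rw [← linFun_linC]; exact hL _

/-- A representation up to homotopy on the dual of `E` is the restriction to the linear functions
of a homological vector field on `D`. -/
theorem exists_extension (hQA : GSym.IsHomological QA) (hD : IsRUTHOnDualE QA D') :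
    ∃ Q : FunD V A C →ₗ[ℝ] FunD V A C, GSym.IsHomological Q ∧ HasWt 0 Q ∧ IsOver Q QA ∧
      IsRestriction Q D' := by
  have hδ1 : ∀ f, baseDer QA D' f ∈
      GSym.grade _ (fun s => (bundleD V A C s).dual.Sec) degD 1 := fun f => by
    rw [baseDer_apply]
    exact sum_mem fun j _ => Submodule.smul_mem _ _ (baseImg_mem_grade hQA hD j)
  -- Only the values on base functions and the frame formula on generators are built in. The Leibniz
  -- rules of `QA` and `D'` show next that `Q` restricts correctly to all generators, including
  -- dependent frame elements.
  obtain ⟨Q, h1, h2, h3⟩ := GSym.exists_derivation_of_frame (frameD V A C) (baseDer QA D') hδ1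
    (baseDer_mul QA D') (genImg QA D') (genImg_mem_grade hQA hD)
  have hQ : IsDer Q := h1
  have hfun : ∀ f, Q (algebraMap _ _ (pullFun V.proj f)) = pullA V A C (QA (algebraMap _ _ f)) :=
    fun f => by rw [h2, pullA_eq_baseDer hQA]
  have hA : ∀ i α, Q (genDA V A C i ((A i).pullDual V.proj α)) =
      pullA V A C (QA (GSym.gen _ degA (N := fun i => (A i).dual.Sec) i α)) := by
    intro i α
    have h : Q (genDA V A C i ((A i).pullDual V.proj α)) = ∑ a,
        (baseDer QA D' (pullFun V.proj ((A i).pair α ((A i).frame a))) *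
          genDA V A C i ((A i).pullDual V.proj ((A i).coframe a)) +
        algebraMap _ _ (pullFun V.proj ((A i).pair α ((A i).frame a))) *
          pullA V A C (QA (GSym.gen _ degA (N := fun i => (A i).dual.Sec) i ((A i).coframe a)))) :=
      h3 (Sum.inl i) _
    rw [h, sum_gen_coframe, map_sum, map_sum]
    refine Finset.sum_congr rfl fun a _ => ?_
    rw [hQA.map_mul, GSym.twist_algebraMap, map_add, map_mul, map_mul,
      pullA_eq_baseDer (D' := D') hQA, pullA_gen, pullA_algebraMap]
  have hover := hQ.isOver hQA hfun hA
  have hV : ∀ ψ, Q (genV V A C ψ) = linFun V A C (D' (linV V A C ψ)) := fun ψ => by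
    rw [genV_apply, h2, linFun_eq_baseDer hQA hD]
  have hC : ∀ i γ, Q (genC V A C i γ) = linFun V A C (D' (linC V A C i γ)) := by
    intro i γ
    have h : Q (genC V A C i γ) = ∑ a,
        (baseDer QA D' (pullFun V.proj ((C i).pair γ ((C i).frame a))) *
          genC V A C i ((C i).coframe a) +
        algebraMap _ _ (pullFun V.proj ((C i).pair γ ((C i).frame a))) *
          linFun V A C (D' (linC V A C i ((C i).coframe a)))) :=
      h3 (Sum.inr i) _
    rw [h, sum_linC_coframe, map_sum, map_sum]
    refine Finset.sum_congr rfl fun a _ => ?_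
    rw [hD.map_smul, GSym.twist_algebraMap, map_add, linFun_smul, linFun_smul, linFun_linC,
      pullA_eq_baseDer (D' := D') hQA, pullA_algebraMap]
  have hres := hQ.isRestriction hD hover hV hC
  have hdeg0 : ∀ f : C^∞⟮V.totI, V.Tot; ℝ⟯, Q (algebraMap _ _ f) ∈
      GSym.grade _ (fun s => (bundleD V A C s).dual.Sec) degD 1 := fun f => by
    rw [h2]; exact hδ1 f
  have hdegg : ∀ s σ, Q (GSym.gen _ degD (N := fun s => (bundleD V A C s).dual.Sec) s σ) ∈
      GSym.grade _ (fun s => (bundleD V A C s).dual.Sec) degD (degD s + 1) := fun s σ => by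
    rw [h3]
    refine sum_mem fun a _ => add_mem ?_ ?_
    · rw [add_comm]; exact GSym.grade_mul (hδ1 _) (GSym.gen_mem_grade _ _)
    · rw [← Algebra.smul_def]; exact Submodule.smul_mem _ _ (genImg_mem_grade hQA hD s a)
  have hsqA : ∀ ξ, Q (Q (pullA V A C ξ)) = 0 := fun ξ => by
    rw [hover, hover, hQA.square, map_zero]
  have hsqL : ∀ y, Q (Q (linFun V A C y)) = 0 := fun y => by
    rw [hres, hres, hD.square, map_zero]
  have hdeg : ∀ k, ∀ x ∈ GSym.grade _ (fun s => (bundleD V A C s).dual.Sec) degD k,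
      Q x ∈ GSym.grade _ (fun s => (bundleD V A C s).dual.Sec) degD (k + 1) :=
    fun k x hx => GSym.derivation_mem_grade h1 hdeg0 hdegg hx
  exact ⟨Q, GSym.isHomological_of_map_mul hdeg h1 (hQ.square hdeg hsqA hsqL),
    hQ.hasWt_zero hdeg0 hover hres, hover, hres⟩

end Extension
end DVB

/-! ### Iterated commutators, scaling and lists of frame sections. -/

namespace DVB

open SmoothVB

section IterComm

variable {E H : Type*} [NormedAddCommGroup E] [NormedSpace ℝ E] [FiniteDimensional ℝ E]
  [TopologicalSpace H] {I : ModelWithCorners ℝ E H} [I.Boundaryless]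
  {M : Type*} [TopologicalSpace M] [ChartedSpace H M] [IsManifold I ∞ M]
  [T2Space M] [SigmaCompactSpace M] {n : ℕ}
  {V : SmoothVB I M} {A C : Fin n → SmoothVB I M}

theorem negOnePow_smul_comm (p : ℤ) (c : ℝ) {P : Type*} [AddCommGroup P] [Module ℝ P] (x : P) :
    p.negOnePow • c • x = c • p.negOnePow • x := by
  rw [negOnePow_smul_eq_real, negOnePow_smul_eq_real, smul_comm]

theorem iterComm_sub (X Y : FunD V A C →ₗ[ℝ] FunD V A C) (p : ℤ) (l : List (Σ i, SecD V A C i)) :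
    iterComm (X - Y) p l = iterComm X p l - iterComm Y p l := by
  induction l generalizing X Y p with
  | nil => rfl
  | cons δ l ih =>
    simp only [iterComm]
    rw [← ih]
    congr 1
    rw [LinearMap.sub_comp, LinearMap.comp_sub, smul_sub]
    abel

theorem iterComm_smul (c : ℝ) (X : FunD V A C →ₗ[ℝ] FunD V A C) (p : ℤ)
    (l : List (Σ i, SecD V A C i)) : iterComm (c • X) p l = c • iterComm X p l := by
  induction l generalizing X p with
  | nil => rfl
  | cons δ l ih =>
    simp only [iterComm]
    rw [← ih]
    congr 1
    refine LinearMap.ext fun x => ?_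
    simp only [LinearMap.sub_apply, LinearMap.smul_apply, LinearMap.comp_apply, map_smul, smul_sub]
    rw [negOnePow_smul_comm]

theorem HasWtSec.contractD_scaleD {i : Fin n} {δ : SecD V A C i} {w : ℤ} (h : HasWtSec i δ w)
    {t : ℝ} (ht : t ≠ 0) (x : FunD V A C) :
    contractD i δ (scaleD V A C t x) = (t ^ w)⁻¹ • scaleD V A C t (contractD i δ x) := by
  rw [h.hasWt_contractD t ht, inv_smul_smul₀ (zpow_ne_zero _ ht)]

theorem HasWtSec.comm_conjScale {i : Fin n} {δ : SecD V A C i} {w : ℤ} (h : HasWtSec i δ w)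
    {t : ℝ} (ht : t ≠ 0) (Q : FunD V A C →ₗ[ℝ] FunD V A C) (p : ℤ) :
    conjScale t Q ∘ₗ contractD i δ - p.negOnePow • (contractD i δ ∘ₗ conjScale t Q) =
      (t ^ w)⁻¹ • conjScale t (Q ∘ₗ contractD i δ - p.negOnePow • (contractD i δ ∘ₗ Q)) := by
  refine LinearMap.ext fun x => ?_
  simp only [LinearMap.sub_apply, LinearMap.smul_apply, LinearMap.comp_apply, conjScale_apply,
    h.contractD_scaleD ht, h.contractD_scaleD (inv_ne_zero ht), map_sub, map_smul, scaleD_smul,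
    smul_sub]
  congr 1
  · rw [inv_zpow, inv_inv, inv_smul_smul₀ (zpow_ne_zero _ ht)]
  · rw [negOnePow_smul_eq_real, negOnePow_smul_eq_real, scaleD_smul, smul_comm]

/-- Conjugating a contraction by the scaling multiplies it by a power of `t`, so conjugation can be
pulled out of the iterated commutator at the cost of the total weight. -/
theorem iterComm_conjScale {t : ℝ} (ht : t ≠ 0) (Q : FunD V A C →ₗ[ℝ] FunD V A C) (p : ℤ)
    (l : List (Σ s : Fin n ⊕ Fin n, Fin (cardD A C s))) :
    iterComm (conjScale t Q) p (l.map (secD V A C)) =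
      (t ^ listWt l)⁻¹ • conjScale t (iterComm Q p (l.map (secD V A C))) := by
  induction l generalizing Q p with
  | nil => simp [listWt, iterComm]
  | cons s l ih =>
    rw [List.map_cons, iterComm, iterComm, (hasWtSec_secD s).comm_conjScale ht, iterComm_smul, ih,
      smul_smul]
    congr 1
    have e : listWt (s :: l) = wtD s.1 + listWt l := by simp [listWt]
    rw [e, zpow_add₀ ht, mul_inv]

theorem contractD_gen (i : Fin n) (δ : SecD V A C i) (s : Fin n ⊕ Fin n)
    (σ : (bundleD V A C s).dual.Sec) : ∃ f : C^∞⟮V.totI, V.Tot; ℝ⟯,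
      contractD i δ (GSym.gen _ degD (N := fun s => (bundleD V A C s).dual.Sec) s σ) =
        algebraMap _ _ f := by
  have key : ∀ (s' : Fin n ⊕ Fin n) (φ : (bundleD V A C s').dual.Sec →ₗ[C^∞⟮V.totI, V.Tot; ℝ⟯]
      C^∞⟮V.totI, V.Tot; ℝ⟯), ∃ f : C^∞⟮V.totI, V.Tot; ℝ⟯,
      GSym.contract _ degD s' φ (GSym.gen _ degD (N := fun s => (bundleD V A C s).dual.Sec) s σ) =
        algebraMap _ _ f := by
    intro s' φ
    by_cases h : s = s'
    · subst h; exact ⟨_, GSym.contract_gen ..⟩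
    · exact ⟨0, by rw [GSym.contract_gen_of_ne _ _ _ _ h, map_zero]⟩
  obtain ⟨f, hf⟩ := key (.inl i) (((A i).pullback V.proj).pair.flip δ.1)
  obtain ⟨g, hg⟩ := key (.inr i) (((C i).pullback V.proj).pair.flip δ.2)
  exact ⟨f + g, (congrArg₂ (· + ·) hf hg).trans (map_add _ _ _).symm⟩

theorem contractD_algebraMap (i : Fin n) (δ : SecD V A C i) (f : C^∞⟮V.totI, V.Tot; ℝ⟯) :
    contractD i δ (algebraMap _ _ f) = 0 := by
  refine (congrArg₂ (fun x y : FunD V A C => x + y) (GSym.contract_algebraMap ..)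
    (GSym.contract_algebraMap ..)).trans ?_
  exact add_zero _

/-- For an operator which vanishes on the functions on `V`, the iterated commutators with
contractions are, up to sign, iterated contractions. -/
theorem body_contractList_eq_zero (X : FunD V A C →ₗ[ℝ] FunD V A C)
    (hX : ∀ f : C^∞⟮V.totI, V.Tot; ℝ⟯, X (algebraMap _ _ f) = 0) (p : ℤ)
    (l : List (Σ s : Fin n ⊕ Fin n, Fin (cardD A C s))) (s : Fin n ⊕ Fin n)
    (σ : (bundleD V A C s).dual.Sec)
    (h : GSym.body C^∞⟮V.totI, V.Tot; ℝ⟯ degD (iterComm X p (l.map (secD V A C))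
      (GSym.gen _ degD (N := fun s => (bundleD V A C s).dual.Sec) s σ)) = 0) :
    GSym.body C^∞⟮V.totI, V.Tot; ℝ⟯ degD (GSym.contractList (frameD V A C) l
      (X (GSym.gen _ degD s σ))) = 0 := by
  induction l generalizing X p with
  | nil => exact h
  | cons r l ih =>
    rw [List.map_cons, iterComm] at h
    have h2 := ih _ (fun f => by
      rw [LinearMap.sub_apply, LinearMap.comp_apply, contractD_algebraMap, map_zero,
        LinearMap.smul_apply, LinearMap.comp_apply, hX, map_zero, smul_zero, sub_zero]) _ h
    -- The contraction of a generator is a function on `V`, which `X` kills; only the other term of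
    -- the commutator survives.
    obtain ⟨f, hf⟩ := contractD_gen (secD V A C r).1 (secD V A C r).2 s σ
    rw [LinearMap.sub_apply, LinearMap.comp_apply, hf, hX, LinearMap.smul_apply,
      LinearMap.comp_apply, zero_sub, contractD_secD] at h2
    rw [GSym.contractList]
    generalize GSym.contract _ degD r.1 ((frameD V A C r.1).co r.2)
      (X (GSym.gen _ degD s σ)) = z at h2
    generalize (p * -(degA (secD V A C r).1 : ℤ)) = q at h2
    rcases Int.even_or_odd q with hq | hq
    · rw [Int.negOnePow_even _ hq, one_smul, ← neg_one_smul C^∞⟮V.totI, V.Tot; ℝ⟯,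
        GSym.contractList_smul, map_smul] at h2
      simpa using h2
    · rwa [Int.negOnePow_odd _ hq, Units.neg_smul, one_smul, neg_neg] at h2

theorem isLinearSec_of_listWt {l : List (Σ s : Fin n ⊕ Fin n, Fin (cardD A C s))}
    (hl : listWt l = 0) : ∀ δ ∈ l.map (secD V A C), IsLinearSec δ.1 δ.2 := by
  induction l with
  | nil => simp
  | cons s l ih =>
    obtain ⟨i | i, a⟩ := s
    · rw [listWt_inl] at hl
      rw [List.map_cons, List.forall_mem_cons]
      exact ⟨isLinearSec_secD_inl i a, ih hl⟩
    · rw [listWt_inr] at hl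
      have := listWt_nonpos l
      omega

theorem isLinearSec_or_isCoreSec (s : Σ s : Fin n ⊕ Fin n, Fin (cardD A C s)) :
    IsLinearSec (secD V A C s).1 (secD V A C s).2 ∨ IsCoreSec (secD V A C s).1 (secD V A C s).2 := by
  obtain ⟨i | i, a⟩ := s
  · exact Or.inl (isLinearSec_secD_inl i a)
  · exact Or.inr (isCoreSec_secD_inr i a)

theorem exists_split_core {l : List (Σ s : Fin n ⊕ Fin n, Fin (cardD A C s))} (hl : listWt l < 0) :
    ∃ l₁ s l₂, l = l₁ ++ s :: l₂ ∧ IsCoreSec (secD V A C s).1 (secD V A C s).2 ∧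
      listWt l₁ = 0 ∧ listWt l₂ = listWt l + 1 := by
  induction l with
  | nil => simp [listWt] at hl
  | cons s l ih =>
    obtain ⟨i | i, a⟩ := s
    · rw [listWt_inl] at hl
      obtain ⟨l₁, s, l₂, rfl, hs, h1, h2⟩ := ih hl
      exact ⟨⟨.inl i, a⟩ :: l₁, s, l₂, rfl, hs, by rw [listWt_inl, h1], by rw [listWt_inl, h2]⟩
    · exact ⟨[], ⟨.inr i, a⟩, l, rfl, isCoreSec_secD_inr i a, rfl, by rw [listWt_inr]; ring⟩

end IterComm
end DVB

/-! ### VB-Lie structures have weight 0. -/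

namespace DVB

open SmoothVB

section WeightZero

variable {E H : Type*} [NormedAddCommGroup E] [NormedSpace ℝ E] [FiniteDimensional ℝ E]
  [TopologicalSpace H] {I : ModelWithCorners ℝ E H} [I.Boundaryless]
  {M : Type*} [TopologicalSpace M] [ChartedSpace H M] [IsManifold I ∞ M]
  [T2Space M] [SigmaCompactSpace M] {n : ℕ}
  {V : SmoothVB I M} {A C : Fin n → SmoothVB I M} {Q : FunD V A C →ₗ[ℝ] FunD V A C}

theorem fnD_left (k : Fin n) (σ : ((A k).pullback V.proj).dual.Sec) :
    fnD k (σ, (0 : ((C k).pullback V.proj).dual.Sec)) = genDA V A C k σ :=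
  (congrArg (genDA V A C k σ + ·) (map_zero (genDC V A C k))).trans (add_zero _)

theorem fnD_right (k : Fin n) (σ : ((C k).pullback V.proj).dual.Sec) :
    fnD k ((0 : ((A k).pullback V.proj).dual.Sec), σ) = genDC V A C k σ :=
  (congrArg (· + genDC V A C k σ) (map_zero (genDA V A C k))).trans (zero_add _)

theorem fnD_eq (k : Fin n) (σ : DualSecD V A C k) :
    fnD k σ = genDA V A C k σ.1 + genDC V A C k σ.2 := rfl

theorem pairD_apply (k : Fin n) (σ : DualSecD V A C k) (s : SecD V A C k) (m : M) (x : V.Fib m) :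
    pairD k σ s ⟨m, x⟩ = evalAt V (A k) σ.1 m x (valD k s m x).1 +
      evalAt V (C k) σ.2 m x (valD k s m x).2 := rfl

theorem pairD_pullDual_left (k : Fin n) (α : (A k).dual.Sec) (s : SecD V A C k) (m : M)
    (x : V.Fib m) : pairD k ((A k).pullDual V.proj α, 0) s ⟨m, x⟩ =
      (A k).dualFib (α m) (valD k s m x).1 := by
  rw [pairD_apply]
  exact add_zero _

theorem pairD_pullDual_right (k : Fin n) (γ : (C k).dual.Sec) (s : SecD V A C k) (m : M)
    (x : V.Fib m) : pairD k (0, (C k).pullDual V.proj γ) s ⟨m, x⟩ =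
      (C k).dualFib (γ m) (valD k s m x).2 := by
  rw [pairD_apply]
  exact zero_add _

theorem IsBracket.body_genDA {l : List (Σ i, SecD V A C i)} {s : ∀ k, SecD V A C k}
    (h : IsBracket Q l s) (k : Fin n) (α : (A k).dual.Sec) (m : M) (x : V.Fib m) :
    GSym.body C^∞⟮V.totI, V.Tot; ℝ⟯ degD
      (iterComm Q 1 l (genDA V A C k ((A k).pullDual V.proj α))) ⟨m, x⟩ =
      (A k).dualFib (α m) (valD k (s k) m x).1 := by
  rw [← fnD_left, h, pairD_pullDual_left]

theorem IsBracket.body_genC {l : List (Σ i, SecD V A C i)} {s : ∀ k, SecD V A C k}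
    (h : IsBracket Q l s) (k : Fin n) (γ : (C k).dual.Sec) (m : M) (x : V.Fib m) :
    GSym.body C^∞⟮V.totI, V.Tot; ℝ⟯ degD (iterComm Q 1 l (genC V A C k γ)) ⟨m, x⟩ =
      (C k).dualFib (γ m) (valD k (s k) m x).2 := by
  rw [genC_apply, ← fnD_right, h, pairD_pullDual_right]

theorem isHomog_zero (w : ℤ) : IsHomog V w 0 := fun t _ => by rw [map_zero, smul_zero]

theorem genDA_mem_grade (i : Fin n) (σ : ((A i).pullback V.proj).dual.Sec) :
    genDA V A C i σ ∈ GSym.grade _ (fun s => (bundleD V A C s).dual.Sec) degD (i + 1) :=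
  GSym.gen_mem_grade (d := degD) (Sum.inl i) _

/-- The components of a bracket of frame sections scale as for a field of weight 0. The cases are
the number of core sections in the list: none, one, or at least two, one for each bracket axiom. The
empty list is separate; there the function part vanishes for degree reasons. -/
theorem IsVBLie.isHomog_body (hQ : IsVBLie Q)
    (l : List (Σ s : Fin n ⊕ Fin n, Fin (cardD A C s))) :
    (∀ k α, IsHomog V (listWt l) (GSym.body _ degD (iterComm Q 1 (l.map (secD V A C))
      (genDA V A C k ((A k).pullDual V.proj α))))) ∧
    ∀ k γ, IsHomog V (listWt l + 1) (GSym.body _ degD (iterComm Q 1 (l.map (secD V A C))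
      (genC V A C k γ))) := by
  have hcases : l = [] ∨ (l ≠ [] ∧ listWt l = 0) ∨ listWt l = -1 ∨ listWt l < -1 := by
    have := listWt_nonpos l
    by_cases h : l = []
    · exact Or.inl h
    · have : listWt l = 0 ∨ listWt l = -1 ∨ listWt l < -1 := by omega
      tauto
  rcases hcases with rfl | ⟨hne, hl⟩ | hl | hl
  · refine ⟨fun k α => ?_, fun k γ => ?_⟩
    · have h := GSym.body_of_mem_grade (Nat.succ_pos _)
        (hQ.homological.degree _ _ (genDA_mem_grade (V := V) (C := C) k ((A k).pullDual V.proj α)))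
      rw [List.map_nil, iterComm, h]
      exact isHomog_zero _
    · have h := GSym.body_of_mem_grade (Nat.succ_pos _)
        (hQ.homological.degree _ _ (genC_mem_grade (V := V) (A := A) k γ))
      rw [List.map_nil, iterComm, h]
      exact isHomog_zero _
  · obtain ⟨s, hs, hlin⟩ := hQ.linear (l.map (secD V A C)) (by simpa using hne)
      (isLinearSec_of_listWt hl)
    refine ⟨fun k α => isHomog_iff.2 fun t ht m x => ?_,
      fun k γ => isHomog_iff.2 fun t ht m x => ?_⟩ <;> obtain ⟨a, φ, h⟩ := hlin k
    · rw [hs.body_genDA, hs.body_genDA, h, h, hl, zpow_zero, one_mul]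
    · rw [hs.body_genC, hs.body_genC, h, h, hl, zero_add, zpow_one, map_smul, map_smul, smul_eq_mul]
  · obtain ⟨l₁, r, l₂, rfl, hr, h1, h2⟩ := exists_split_core (l := l) (by omega)
    obtain ⟨s, hs, hcore⟩ := hQ.core (l₁.map (secD V A C)) (l₂.map (secD V A C)) (secD V A C r)
      (by
        rw [List.forall_mem_append]
        exact ⟨isLinearSec_of_listWt h1, isLinearSec_of_listWt (by omega)⟩) hr
    rw [← List.map_cons, ← List.map_append] at hs
    refine ⟨fun k α => isHomog_iff.2 fun t ht m x => ?_,
      fun k γ => isHomog_iff.2 fun t ht m x => ?_⟩ <;> obtain ⟨c, h⟩ := hcore k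
    · rw [hs.body_genDA, hs.body_genDA, h, h, map_zero, mul_zero]
    · rw [hs.body_genC, hs.body_genC, h, h, hl, neg_add_cancel, zpow_zero, one_mul]
  · obtain ⟨l₁, r, l₂, rfl, hr, h1, h2⟩ := exists_split_core (l := l) (by omega)
    obtain ⟨l₃, r', l₄, rfl, hr', h3, h4⟩ := exists_split_core (l := l₂) (by omega)
    have hs := hQ.core₂ (l₁.map (secD V A C)) (l₃.map (secD V A C)) (l₄.map (secD V A C))
      (secD V A C r) (secD V A C r') (by
        rw [← List.map_append, ← List.map_append]
        intro δ hδ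
        obtain ⟨r, _, rfl⟩ := List.mem_map.1 hδ
        exact isLinearSec_or_isCoreSec r) hr hr'
    have e : l₁.map (secD V A C) ++ secD V A C r :: l₃.map (secD V A C) ++
        secD V A C r' :: l₄.map (secD V A C) =
        (l₁ ++ r :: (l₃ ++ r' :: l₄)).map (secD V A C) := by simp
    rw [e] at hs
    refine ⟨fun k α => isHomog_iff.2 fun t ht m x => ?_,
      fun k γ => isHomog_iff.2 fun t ht m x => ?_⟩
    · rw [hs.body_genDA, hs.body_genDA]
      exact ((map_zero _).trans (mul_zero _).symm).trans (congrArg _ (map_zero _).symm)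
    · rw [hs.body_genC, hs.body_genC]
      exact ((map_zero _).trans (mul_zero _).symm).trans (congrArg _ (map_zero _).symm)

/-- The anchor intertwines the scaling of `D₁` with the tangent map of the scaling of `V`; the chain
rule then absorbs the scaling of `f`. -/
theorem IsVBLie.body_contractD_conjScale (hQ : IsVBLie Q) {i : Fin n} (hi : (i : ℕ) = 0)
    {δ : SecD V A C i} {w : ℤ} (hδ : HasWtSec i δ w) {t : ℝ} (ht : t ≠ 0)
    (f : C^∞⟮V.totI, V.Tot; ℝ⟯) :
    GSym.body C^∞⟮V.totI, V.Tot; ℝ⟯ degD (contractD i δ (conjScale t Q (algebraMap _ _ f))) =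
      GSym.body C^∞⟮V.totI, V.Tot; ℝ⟯ degD (contractD i δ (Q (algebraMap _ _ f))) := by
  obtain ⟨ρ, ρA, hρ, h⟩ := hQ.anchor i hi
  ext ⟨m, x⟩
  rw [conjScale_apply, scaleD_algebraMap, hδ.contractD_scaleD ht, body_real_smul, body_scaleD, h]
  have h1 := h δ (pullFun (smulMap V t⁻¹) f) m (t • x)
  have h2 : valD i δ m (t • x) =
      t ^ w • ((valD i δ m x).1, t • (valD i δ m x).2) := by
    rw [hδ t ht, zpow_add_one₀ ht, mul_smul]; rfl
  have h5 : dAt (pullFun (smulMap V t⁻¹) f) (⟨m, t • x⟩ : V.Tot)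
      (ρ m (t • x) (valD i δ m (t • x))) = t ^ w * dAt (pullFun (smulMap V t⁻¹) f)
        (⟨m, t • x⟩ : V.Tot) (ρ m (t • x) ((valD i δ m x).1, t • (valD i δ m x).2)) := by
    rw [h2, map_smul, map_smul, smul_eq_mul]
  have h6 := congrArg (dAt (pullFun (smulMap V t⁻¹) f) (⟨m, t • x⟩ : V.Tot))
    (hρ.smul t m x (valD i δ m x).1 (valD i δ m x).2)
  have h3 := dAt_comp (pullFun (smulMap V t⁻¹) f) (smulMap V t) (⟨m, x⟩ : V.Tot)
    (ρ m x ((valD i δ m x).1, (valD i δ m x).2))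
  have h4 : (pullFun (smulMap V t⁻¹) f).comp (smulMap V t) = f := by
    ext ⟨m, x⟩
    change f ⟨m, t⁻¹ • t • x⟩ = f ⟨m, x⟩
    rw [inv_smul_smul₀ ht]
  rw [h4] at h3
  refine (congrArg ((t ^ w)⁻¹ * ·) (h1.trans h5)).trans ?_
  refine (inv_mul_cancel_left₀ (zpow_ne_zero _ ht) _).trans ?_
  exact (h3.trans h6).symm

theorem IsVBLie.conjScale_algebraMap (hQ : IsVBLie Q) {t : ℝ} (ht : t ≠ 0)
    (f : C^∞⟮V.totI, V.Tot; ℝ⟯) : conjScale t Q (algebraMap _ _ f) = Q (algebraMap _ _ f) := by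
  have hdeg : ∀ f : C^∞⟮V.totI, V.Tot; ℝ⟯, Q (algebraMap _ _ f) ∈
      GSym.grade _ (fun s => (bundleD V A C s).dual.Sec) degD 1 :=
    fun _ => hQ.homological.degree 0 _ (GSym.algebraMap_mem_grade _)
  rw [← sub_eq_zero]
  refine GSym.eq_zero_of_contractList (frameD V A C) degD_pos
    (sub_mem (conjScale_mem_grade hdeg t f) (hdeg f)) fun l hl => ?_
  -- The difference has degree 1 and every generator has positive degree, so only single
  -- contractions with sections of `D₁` need to be tested.
  rcases l with _ | ⟨s, l⟩
  · simp at hl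
  rcases l with _ | ⟨s', l⟩
  · have hi : ((secD V A C s).1 : ℕ) = 0 := by
      rcases s with ⟨i | i, a⟩ <;> simpa [degD, degA, secD] using hl
    have h := hQ.body_contractD_conjScale hi (hasWtSec_secD s) ht f
    rw [GSym.contractList, GSym.contractList, ← contractD_secD, map_sub, map_sub, h, sub_self]
  · have h1 := degD_pos s.1
    have h2 := degD_pos s'.1
    simp only [List.map_cons, List.sum_cons] at hl
    omega

/-- The difference `X` between `Q` and its conjugate is a derivation that vanishes on functions on
`V` by the anchor axiom. For such an `X` iterated contractions of its values on generators are, up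
to sign, iterated commutators, and these vanish because the brackets of frame sections scale
correctly. -/
theorem IsVBLie.hasWt_zero (hQ : IsVBLie Q) : HasWt 0 Q := by
  refine hasWt_zero_of_conjScale fun t ht => LinearMap.ext fun x => ?_
  rw [← sub_eq_zero, ← LinearMap.sub_apply]
  have hder : IsDer Q := hQ.homological.map_mul
  have hX : ∀ f : C^∞⟮V.totI, V.Tot; ℝ⟯, (conjScale t Q - Q) (algebraMap _ _ f) = 0 := fun f => by
    rw [LinearMap.sub_apply, hQ.conjScale_algebraMap ht, sub_self]
  -- Three powers of `t` meet: from the contractions, from the weight of `β`, and from the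
  -- homogeneity of the bracket. Their product is 1.
  have hbody : ∀ (l : List (Σ s : Fin n ⊕ Fin n, Fin (cardD A C s))) (β : FunD V A C) (w : ℤ),
      IsWt w β → IsHomog V (listWt l + w)
        (GSym.body _ degD (iterComm Q 1 (l.map (secD V A C)) β)) →
      GSym.body C^∞⟮V.totI, V.Tot; ℝ⟯ degD
        (iterComm (conjScale t Q - Q) 1 (l.map (secD V A C)) β) = 0 := by
    intro l β w hβ h
    rw [iterComm_sub, iterComm_conjScale ht, LinearMap.sub_apply, LinearMap.smul_apply,
      conjScale_apply, hβ t⁻¹ (inv_ne_zero ht), map_smul, scaleD_smul, map_sub, body_real_smul,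
      body_real_smul, body_scaleD, h t ht, smul_smul, smul_smul, zpow_add₀ ht, inv_zpow]
    have e : (t ^ listWt l)⁻¹ * (t ^ w)⁻¹ * (t ^ listWt l * t ^ w) = 1 := by
      have h1 := zpow_ne_zero (listWt l) ht
      have h2 := zpow_ne_zero w ht
      field_simp
    rw [e, one_smul, sub_self]
  have hgrade : ∀ s σ, (conjScale t Q - Q)
      (GSym.gen _ degD (N := fun s => (bundleD V A C s).dual.Sec) s σ) ∈
      GSym.grade _ (fun s => (bundleD V A C s).dual.Sec) degD (degD s + 1) := fun s σ => by
    refine sub_mem (scaleD_mem_grade t (hQ.homological.degree _ _ (scaleD_mem_grade t⁻¹ ?_)))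
      (hQ.homological.degree _ _ ?_) <;> exact GSym.gen_mem_grade _ _
  refine IsDer.eq_zero (X := conjScale t Q - Q) 1 (k := 1) ?_ ?_ ?_ ?_ ?_ ?_ x
  · intro f; rw [hX]; exact zero_mem _
  · intro x y
    have h1 := hder.conjScale ht x y
    have h2 := hder x y
    rw [LinearMap.sub_apply, LinearMap.sub_apply, LinearMap.sub_apply, h1, h2, sub_mul, mul_sub]
    abel
  · intro g; exact hX _
  · intro ψ; exact hX _
  · intro i α
    refine GSym.eq_zero_of_contractList (frameD V A C) degD_pos (hgrade (.inl i) _) fun l _ => ?_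
    refine body_contractList_eq_zero _ hX 1 l (.inl i) _ ?_
    have hw : IsWt 0 (genDA V A C i ((A i).pullDual V.proj α)) := by
      rw [← pullA_gen]; exact isWt_pullA _
    refine hbody l _ 0 hw ?_
    rw [add_zero]
    exact (hQ.isHomog_body l).1 i α
  · intro i γ
    refine GSym.eq_zero_of_contractList (frameD V A C) degD_pos (hgrade (.inr i) _) fun l _ => ?_
    refine body_contractList_eq_zero _ hX 1 l (.inr i) _ ?_
    have hw : IsWt 1 (genC V A C i γ) := fun t _ => by rw [scaleD_genC, zpow_one]
    exact hbody l _ 1 hw ((hQ.isHomog_body l).2 i γ)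

end WeightZero
end DVB

/-! ### Pointwise evaluation of contractions. -/

namespace DVB

open SmoothVB

section Evaluation

variable {E H : Type*} [NormedAddCommGroup E] [NormedSpace ℝ E] [FiniteDimensional ℝ E]
  [TopologicalSpace H] {I : ModelWithCorners ℝ E H} [I.Boundaryless]
  {M : Type*} [TopologicalSpace M] [ChartedSpace H M] [IsManifold I ∞ M]
  [T2Space M] [SigmaCompactSpace M] {n : ℕ}
  {V : SmoothVB I M} {A C : Fin n → SmoothVB I M} {Q : FunD V A C →ₗ[ℝ] FunD V A C}

theorem contractD_mul (i : Fin n) (δ : SecD V A C i) (x y : FunD V A C) :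
    contractD i δ (x * y) = contractD i δ x * y +
      GSym.twist _ degD (degA i) x * contractD i δ y := by
  refine (congrArg₂ (· + ·) (GSym.contract_mul (Sum.inl i) _ x y)
    (GSym.contract_mul (Sum.inr i) _ x y)).trans ?_
  refine (add_add_add_comm _ _ _ _).trans ?_
  exact congrArg₂ (· + ·) (add_mul _ _ _).symm (mul_add _ _ _).symm

theorem contractD_gen_inl (i : Fin n) (δ : SecD V A C i) (σ : ((A i).pullback V.proj).dual.Sec) :
    contractD i δ (genDA V A C i σ) = algebraMap _ _ (((A i).pullback V.proj).pair σ δ.1) := by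
  refine (congrArg₂ (fun x y : FunD V A C => x + y)
    (GSym.contract_gen (N := fun s => (bundleD V A C s).dual.Sec) _ degD (Sum.inl i) _ σ) (GSym.contract_gen_of_ne (N := fun s => (bundleD V A C s).dual.Sec) _ degD
    (Sum.inr i) (Sum.inl i) (by simp) _ σ)).trans ?_
  exact add_zero _

theorem contractD_gen_inr (i : Fin n) (δ : SecD V A C i) (σ : ((C i).pullback V.proj).dual.Sec) :
    contractD i δ (genDC V A C i σ) = algebraMap _ _ (((C i).pullback V.proj).pair σ δ.2) := by
  refine (congrArg₂ (fun x y : FunD V A C => x + y)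
    (GSym.contract_gen_of_ne (N := fun s => (bundleD V A C s).dual.Sec) _ degD (Sum.inl i) (Sum.inr i) (by simp) _ σ) (GSym.contract_gen
    (N := fun s => (bundleD V A C s).dual.Sec) _ degD (Sum.inr i) _ σ)).trans ?_
  exact zero_add _

theorem contractD_genDA_of_ne {i k : Fin n} (h : k ≠ i) (δ : SecD V A C i)
    (σ : ((A k).pullback V.proj).dual.Sec) : contractD i δ (genDA V A C k σ) = 0 := by
  refine (congrArg₂ (fun x y : FunD V A C => x + y) (GSym.contract_gen_of_ne (N := fun s => (bundleD V A C s).dual.Sec) _ degD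
    (Sum.inl i) (Sum.inl k) (by simpa using h) _ σ) (GSym.contract_gen_of_ne
    (N := fun s => (bundleD V A C s).dual.Sec) _ degD (Sum.inr i) (Sum.inl k) (by simp) _ σ)).trans ?_
  exact zero_add _

theorem contractD_genDC_of_ne {i k : Fin n} (h : k ≠ i) (δ : SecD V A C i)
    (σ : ((C k).pullback V.proj).dual.Sec) : contractD i δ (genDC V A C k σ) = 0 := by
  refine (congrArg₂ (fun x y : FunD V A C => x + y) (GSym.contract_gen_of_ne (N := fun s => (bundleD V A C s).dual.Sec) _ degD
    (Sum.inl i) (Sum.inr k) (by simp) _ σ) (GSym.contract_gen_of_ne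
    (N := fun s => (bundleD V A C s).dual.Sec) _ degD (Sum.inr i) (Sum.inr k) (by simpa using h) _
    σ)).trans (zero_add _)

theorem funD_induction {p : FunD V A C → Prop} (hadd : ∀ x y, p x → p y → p (x + y))
    (hR : ∀ f : C^∞⟮V.totI, V.Tot; ℝ⟯, p (algebraMap _ _ f))
    (hA : ∀ i σ x, p x → p (genDA V A C i σ * x)) (hC : ∀ i σ x, p x → p (genDC V A C i σ * x))
    (x : FunD V A C) : p x := by
  induction x using GSym.gen_induction with
  | hadd x y hx hy => exact hadd x y hx hy
  | hR f => exact hR f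
  | hgen s σ x hx =>
    rcases s with i | i
    · exact hA i σ x hx
    · exact hC i σ x hx

theorem body_genDA (i : Fin n) (σ : ((A i).pullback V.proj).dual.Sec) :
    GSym.body C^∞⟮V.totI, V.Tot; ℝ⟯ degD (genDA V A C i σ) = 0 := GSym.body_gen (Sum.inl i) _

theorem body_genDC (i : Fin n) (σ : ((C i).pullback V.proj).dual.Sec) :
    GSym.body C^∞⟮V.totI, V.Tot; ℝ⟯ degD (genDC V A C i σ) = 0 := GSym.body_gen (Sum.inr i) _

theorem twist_genDA (p : ℕ) (i : Fin n) (σ : ((A i).pullback V.proj).dual.Sec) :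
    GSym.body C^∞⟮V.totI, V.Tot; ℝ⟯ degD (GSym.twist _ degD p (genDA V A C i σ)) = 0 :=
  GSym.body_of_mem_grade (Nat.succ_pos _)
    (GSym.twist_mem_grade p (genDA_mem_grade i σ))

theorem genDC_mem_grade (i : Fin n) (σ : ((C i).pullback V.proj).dual.Sec) :
    genDC V A C i σ ∈ GSym.grade _ (fun s => (bundleD V A C s).dual.Sec) degD (i + 1) :=
  GSym.gen_mem_grade (d := degD) (Sum.inr i) _

theorem twist_genDC (p : ℕ) (i : Fin n) (σ : ((C i).pullback V.proj).dual.Sec) :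
    GSym.body C^∞⟮V.totI, V.Tot; ℝ⟯ degD (GSym.twist _ degD p (genDC V A C i σ)) = 0 :=
  GSym.body_of_mem_grade (Nat.succ_pos _)
    (GSym.twist_mem_grade p (genDC_mem_grade i σ))

theorem mul_apply_tot (f g : C^∞⟮V.totI, V.Tot; ℝ⟯) (v : V.Tot) : (f * g) v = f v * g v := rfl

/-- The part of polynomial degree zero of a contraction depends linearly on the value of the
section at each point. -/
theorem body_contractD_linear (i : Fin n) {δ δ' δ'' : SecD V A C i} (c : ℝ) (m : M) (x : V.Fib m)
    (h : valD i δ'' m x = c • valD i δ m x + valD i δ' m x) (z : FunD V A C) :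
    GSym.body C^∞⟮V.totI, V.Tot; ℝ⟯ degD (contractD i δ'' z) (⟨m, x⟩ : V.Tot) =
      c * GSym.body C^∞⟮V.totI, V.Tot; ℝ⟯ degD (contractD i δ z) (⟨m, x⟩ : V.Tot) +
        GSym.body C^∞⟮V.totI, V.Tot; ℝ⟯ degD (contractD i δ' z) (⟨m, x⟩ : V.Tot) := by
  have h1 : (valD i δ'' m x).1 = c • (valD i δ m x).1 + (valD i δ' m x).1 := by rw [h]; rfl
  have h2 : (valD i δ'' m x).2 = c • (valD i δ m x).2 + (valD i δ' m x).2 := by rw [h]; rfl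
  induction z using funD_induction with
  | hadd y z hy hz =>
    rw [map_add, map_add, map_add, map_add, map_add, map_add]
    refine (congrArg₂ (· + ·) hy hz).trans ?_
    change _ = c * (_ + _) + (_ + _)
    ring
  | hR f =>
    rw [contractD_algebraMap, contractD_algebraMap, contractD_algebraMap, map_zero]
    change (0 : ℝ) = c * 0 + 0
    ring
  | hA k σ z hz =>
    simp only [contractD_mul, map_add, map_mul, twist_genDA, zero_mul, add_zero, mul_apply_tot]
    by_cases hk : k = i
    · subst hk
      simp only [contractD_gen_inl, GSym.body_algebraMap]
      have e : ∀ δ : SecD V A C k, ((A k).pullback V.proj).pair σ δ.1 (⟨m, x⟩ : V.Tot) =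
        evalAt V (A k) σ m x (valD k δ m x).1 := fun _ => rfl
      rw [e, e, e, h1, map_add, map_smul, smul_eq_mul]
      ring
    · simp only [contractD_genDA_of_ne hk, map_zero]
      change (0 : ℝ) * _ = c * (0 * _) + 0 * _
      ring
  | hC k σ z hz =>
    simp only [contractD_mul, map_add, map_mul, twist_genDC, zero_mul, add_zero, mul_apply_tot]
    by_cases hk : k = i
    · subst hk
      simp only [contractD_gen_inr, GSym.body_algebraMap]
      have e : ∀ δ : SecD V A C k, ((C k).pullback V.proj).pair σ δ.2 (⟨m, x⟩ : V.Tot) =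
        evalAt V (C k) σ m x (valD k δ m x).2 := fun _ => rfl
      rw [e, e, e, h2, map_add, map_smul, smul_eq_mul]
      ring
    · simp only [contractD_genDC_of_ne hk, map_zero]
      change (0 : ℝ) * _ = c * (0 * _) + 0 * _
      ring

/-- A section of `X` with a given value at a point. -/
def extSec (X : SmoothVB I M) (m : M) (v : X.Fib m) : X.Sec := (X.exists_sec_eq m v).choose

theorem extSec_apply (X : SmoothVB I M) (m : M) (v : X.Fib m) : extSec X m v m = v :=
  (X.exists_sec_eq m v).choose_spec

/-- The section of `D_i` given by sections of `A_i` and `C_i`. -/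
def pullSecD (V : SmoothVB I M) (A C : Fin n → SmoothVB I M) (i : Fin n) (a : (A i).Sec)
    (c : (C i).Sec) : SecD V A C i :=
  ((A i).pullSec V.proj a, (C i).pullSec V.proj c)

theorem valD_pullSecD (i : Fin n) (a : (A i).Sec) (c : (C i).Sec) (m : M) (x : V.Fib m) :
    valD i (pullSecD V A C i a c) m x = (a m, c m) := rfl

/-- The part of polynomial degree zero of the contraction of `z` with an element of `D_i` over the
point `x` of `V_m`. -/
def evD (i : Fin n) (z : FunD V A C) (m : M) (x : V.Fib m) :
    ((A i).Fib m × (C i).Fib m) →ₗ[ℝ] ℝ where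
  -- The vector is extended to a section through arbitrary sections of `A_i` and `C_i` over `M`; the
  -- value depends only on the vector, as the linearity in the value at a point shows.
  toFun u := GSym.body C^∞⟮V.totI, V.Tot; ℝ⟯ degD
    (contractD i (pullSecD V A C i (extSec (A i) m u.1) (extSec (C i) m u.2)) z) (⟨m, x⟩ : V.Tot)
  map_add' u v := by
    rw [body_contractD_linear i (δ := pullSecD V A C i (extSec (A i) m u.1) (extSec (C i) m u.2))
      (δ' := pullSecD V A C i (extSec (A i) m v.1) (extSec (C i) m v.2)) 1 m x, one_mul]
    simp only [valD_pullSecD, extSec_apply, one_smul]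
  map_smul' c u := by
    rw [body_contractD_linear i (δ := pullSecD V A C i (extSec (A i) m u.1) (extSec (C i) m u.2))
      (δ' := pullSecD V A C i 0 0) c m x]
    · have h := body_contractD_linear i (δ := pullSecD V A C i 0 0) (δ' := pullSecD V A C i 0 0)
        (δ'' := pullSecD V A C i 0 0) 1 m x (by
          simp only [valD_pullSecD, one_smul]
          exact (add_zero (0 : (A i).Fib m × (C i).Fib m)).symm) z
      rw [one_mul, left_eq_add] at h
      rw [h, add_zero]; rfl
    · simp only [valD_pullSecD, extSec_apply]
      exact (add_zero (c • u)).symm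

theorem evD_valD (i : Fin n) (δ : SecD V A C i) (z : FunD V A C) (m : M) (x : V.Fib m) :
    evD i z m x (valD i δ m x) =
      GSym.body C^∞⟮V.totI, V.Tot; ℝ⟯ degD (contractD i δ z) (⟨m, x⟩ : V.Tot) := by
  have h := body_contractD_linear i (δ := δ) (δ' := δ) (δ'' := pullSecD V A C i
    (extSec (A i) m (valD i δ m x).1) (extSec (C i) m (valD i δ m x).2)) 0 m x (by
      rw [valD_pullSecD, extSec_apply, extSec_apply, zero_smul, zero_add]) z
  rw [zero_mul, zero_add] at h
  exact h

theorem evD_left (i : Fin n) (a : (A i).Sec) (z : FunD V A C) (m : M) (x : V.Fib m) :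
    evD i z m x (a m, 0) =
      GSym.body C^∞⟮V.totI, V.Tot; ℝ⟯ degD (contractD i (pullSecD V A C i a 0) z) ⟨m, x⟩ := by
  rw [← evD_valD, valD_pullSecD]; rfl

theorem evD_right (i : Fin n) (c : (C i).Sec) (z : FunD V A C) (m : M) (x : V.Fib m) :
    evD i z m x (0, c m) =
      GSym.body C^∞⟮V.totI, V.Tot; ℝ⟯ degD (contractD i (pullSecD V A C i 0 c) z) ⟨m, x⟩ := by
  rw [← evD_valD, valD_pullSecD]; rfl

theorem isHomog_left {i : Fin n} (a : (A i).Sec) {w : ℤ} {z : FunD V A C} (hz : IsWt w z) :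
    IsHomog V w (GSym.body _ degD (contractD i (pullSecD V A C i a 0) z)) := by
  have h : IsLinearSec i (pullSecD V A C i a 0) := ⟨a, fun _ => 0, fun m x => rfl⟩
  have := (h.hasWtSec.hasWt_contractD.isWt hz).isHomog_body
  rwa [zero_add] at this

theorem isHomog_right {i : Fin n} (c : (C i).Sec) {w : ℤ} {z : FunD V A C} (hz : IsWt w z) :
    IsHomog V (-1 + w) (GSym.body _ degD (contractD i (pullSecD V A C i 0 c) z)) := by
  have h : IsCoreSec i (pullSecD V A C i 0 c) := ⟨c, fun m x => rfl⟩
  exact (h.hasWtSec.hasWt_contractD.isWt hz).isHomog_body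

theorem evD_mk (i : Fin n) (z : FunD V A C) (m : M) (x : V.Fib m) (a : (A i).Fib m)
    (c : (C i).Fib m) : evD i z m x (a, c) = evD i z m x (a, 0) + evD i z m x (0, c) := by
  rw [← map_add, Prod.mk_add_mk, add_zero, zero_add]

/-- Contraction with a linear section keeps weight 0, giving a function pulled back from `M`;
contraction with a core section gives weight -1, hence zero. -/
theorem IsWt.evD_zero {z : FunD V A C} (hz : IsWt 0 z) (i : Fin n) (m : M) (x : V.Fib m)
    (a : (A i).Fib m) (c : (C i).Fib m) : evD i z m x (a, c) = evD i z m 0 (a, 0) := by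
  obtain ⟨a', rfl⟩ := (A i).exists_sec_eq m a
  obtain ⟨c', rfl⟩ := (C i).exists_sec_eq m c
  rw [evD_mk, evD_left, evD_left, evD_right, (isHomog_right c' hz).eq_zero (by norm_num)]
  rw [(isHomog_left a' hz).apply_eq_zero_sec m x]
  exact add_zero _

theorem IsWt.evD_one_left {z : FunD V A C} (hz : IsWt 1 z) (i : Fin n) (m : M)
    (a : (A i).Fib m) : ∃ φ : V.Fib m →ₗ[ℝ] ℝ, ∀ x, evD i z m x (a, 0) = φ x := by
  obtain ⟨a', rfl⟩ := (A i).exists_sec_eq m a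
  have h := (isHomog_left a' hz).eq_ell
  refine ⟨(V.dualFib ((∑ c, pullFun (secMap V (V.frame c))
    (GSym.body _ degD (contractD i (pullSecD V A C i a' 0) z)) • V.coframe c) m)).toLinearMap,
    fun x => ?_⟩
  rw [evD_left]
  exact DFunLike.congr_fun h ⟨m, x⟩

theorem IsWt.evD_one_right {z : FunD V A C} (hz : IsWt 1 z) (i : Fin n) (m : M) (x : V.Fib m)
    (c : (C i).Fib m) : evD i z m x (0, c) = evD i z m 0 (0, c) := by
  obtain ⟨c', rfl⟩ := (C i).exists_sec_eq m c
  have h := isHomog_right c' hz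
  rw [neg_add_cancel] at h
  rw [evD_right, evD_right, h.apply_eq_zero_sec m x]

/-- The `A` part is linear in the point of `V_m` and the `C` part does not depend on it, by
homogeneity of degree 1 and 0. This is compatibility with the addition of `D_i → A_i`. -/
theorem IsWt.evD_one_add {z : FunD V A C} (hz : IsWt 1 z) (i : Fin n) (m : M) (x y : V.Fib m)
    (a : (A i).Fib m) (c c' : (C i).Fib m) :
    evD i z m (x + y) (a, c + c') = evD i z m x (a, c) + evD i z m y (a, c') := by
  obtain ⟨φ, h⟩ := hz.evD_one_left i m a
  rw [evD_mk, evD_mk i z m x, evD_mk i z m y, h, h, h, hz.evD_one_right, hz.evD_one_right i m x,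
    hz.evD_one_right i m y, map_add]
  have e : ((0, c + c') : (A i).Fib m × (C i).Fib m) = (0, c) + (0, c') := by
    rw [Prod.mk_add_mk, add_zero]
  rw [e, map_add]
  ring

theorem IsWt.evD_one_smul {z : FunD V A C} (hz : IsWt 1 z) (i : Fin n) (t : ℝ) (m : M)
    (x : V.Fib m) (a : (A i).Fib m) (c : (C i).Fib m) :
    evD i z m (t • x) (a, t • c) = t * evD i z m x (a, c) := by
  obtain ⟨φ, h⟩ := hz.evD_one_left i m a
  rw [evD_mk, evD_mk i z m x, h, h, hz.evD_one_right, hz.evD_one_right i m x, map_smul]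
  have e : ((0, t • c) : (A i).Fib m × (C i).Fib m) = t • (0, c) := by
    rw [Prod.smul_mk, smul_zero]
  rw [e, map_smul, smul_eq_mul, smul_eq_mul]
  ring

end Evaluation
end DVB

/-! ### Existence of the multibrackets as sections. -/

namespace DVB

open SmoothVB

section Brackets

variable {E H : Type*} [NormedAddCommGroup E] [NormedSpace ℝ E] [FiniteDimensional ℝ E]
  [TopologicalSpace H] {I : ModelWithCorners ℝ E H} [I.Boundaryless]
  {M : Type*} [TopologicalSpace M] [ChartedSpace H M] [IsManifold I ∞ M]
  [T2Space M] [SigmaCompactSpace M] {n : ℕ}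
  {V : SmoothVB I M} {A C : Fin n → SmoothVB I M} {Q : FunD V A C →ₗ[ℝ] FunD V A C}

theorem comm_leibniz_sub {S : Type*} [Ring S] (a b c d e f g : S) :
    a * c + b * d - (e * f + a * c + b * g) = -e * f + b * (d - g) := by noncomm_ring

theorem comm_leibniz_add {S : Type*} [Ring S] (a b c d e f g : S) :
    a * c + b * d + (e * f + -a * c + b * g) = e * f + b * (d + g) := by noncomm_ring

theorem twist_of_mem_gradeZ (q : ℕ) {p : ℤ} {x : FunD V A C}
    (hx : x ∈ GSym.gradeZ C^∞⟮V.totI, V.Tot; ℝ⟯ (fun s => (bundleD V A C s).dual.Sec) degD p) :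
    GSym.twist _ degD q x = (p * (-(q : ℤ))).negOnePow • x := by
  rcases lt_or_ge p 0 with hp | hp
  · rw [GSym.gradeZ_of_neg hp, Submodule.mem_bot] at hx
    rw [hx, map_zero, smul_zero]
  lift p to ℕ using hp
  rw [GSym.twist_of_mem_grade q hx, ← GSym.neg_one_pow_smul_real, negOnePow_smul_eq_real]
  congr 1
  rw [mul_neg, Int.negOnePow_neg, ← Nat.cast_mul, Int.negOnePow_def, zpow_natCast, mul_comm q p]
  push_cast
  ring

/-- `X` is a derivation of degree `p` along the functions on `V`. -/
def IsFunDer (p : ℤ) (X : FunD V A C →ₗ[ℝ] FunD V A C) : Prop :=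
  (∀ f : C^∞⟮V.totI, V.Tot; ℝ⟯, X (algebraMap _ _ f) ∈
    GSym.gradeZ C^∞⟮V.totI, V.Tot; ℝ⟯ (fun s => (bundleD V A C s).dual.Sec) degD p) ∧
  ∀ (f : C^∞⟮V.totI, V.Tot; ℝ⟯) y, X (algebraMap _ _ f * y) =
    X (algebraMap _ _ f) * y + algebraMap _ _ f * X y

theorem contractD_mem_gradeZ (i : Fin n) (δ : SecD V A C i) {p : ℤ} {x : FunD V A C}
    (hx : x ∈ GSym.gradeZ C^∞⟮V.totI, V.Tot; ℝ⟯ (fun s => (bundleD V A C s).dual.Sec) degD p) :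
    contractD i δ x ∈ GSym.gradeZ C^∞⟮V.totI, V.Tot; ℝ⟯ (fun s => (bundleD V A C s).dual.Sec) degD
      (p - degA i) :=
  add_mem (GSym.contract_mem_gradeZ (d := degD) (Sum.inl i) _ hx)
    (GSym.contract_mem_gradeZ (d := degD) (Sum.inr i) _ hx)

theorem contractD_algebraMap_mul (i : Fin n) (δ : SecD V A C i) (f : C^∞⟮V.totI, V.Tot; ℝ⟯)
    (y : FunD V A C) : contractD i δ (algebraMap _ _ f * y) = algebraMap _ _ f * contractD i δ y := by
  rw [contractD_mul, contractD_algebraMap, zero_mul, zero_add, GSym.twist_algebraMap]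

-- The terms in which the contraction passes the degree `p` element `X f` cancel against the terms
-- from `X` by the commutator sign, so the Leibniz rule along functions survives. Splitting by the
-- parity of the sign exponent reduces this to two identities in a ring.
set_option maxHeartbeats 1000000 in
theorem IsFunDer.comm {p : ℤ} {X : FunD V A C →ₗ[ℝ] FunD V A C} (hX : IsFunDer p X) (i : Fin n)
    (δ : SecD V A C i) : IsFunDer (p - degA i) (X ∘ₗ contractD i δ -
      (p * (-(degA i : ℤ))).negOnePow • (contractD i δ ∘ₗ X)) := by
  have hι : ∀ f : C^∞⟮V.totI, V.Tot; ℝ⟯, contractD i δ (X (algebraMap _ _ f)) ∈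
      GSym.gradeZ C^∞⟮V.totI, V.Tot; ℝ⟯ (fun s => (bundleD V A C s).dual.Sec) degD (p - degA i) :=
    fun f => contractD_mem_gradeZ i δ (hX.1 f)
  have htw := fun f => twist_of_mem_gradeZ (degA i) (hX.1 f)
  rcases Int.even_or_odd (p * (-(degA i : ℤ))) with hq | hq
  · rw [Int.negOnePow_even _ hq, one_smul]
    simp only [Int.negOnePow_even _ hq, one_smul] at htw
    have hT : ∀ x, (X ∘ₗ contractD i δ - contractD i δ ∘ₗ X) x =
      X (contractD i δ x) - contractD i δ (X x) := fun _ => rfl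
    have hf : ∀ f : C^∞⟮V.totI, V.Tot; ℝ⟯, (X ∘ₗ contractD i δ - contractD i δ ∘ₗ X)
        (algebraMap _ _ f) = -contractD i δ (X (algebraMap _ _ f)) := fun f => by
      rw [hT, contractD_algebraMap, map_zero, zero_sub]
    refine ⟨fun f => by rw [hf]; exact neg_mem (hι f), fun f y => ?_⟩
    rw [hf, hT, hT, contractD_algebraMap_mul, hX.2, hX.2, (contractD i δ).map_add, contractD_mul,
      contractD_algebraMap_mul, htw]
    exact comm_leibniz_sub (S := FunD V A C) _ _ _ _ _ _ _
  · rw [Int.negOnePow_odd _ hq, Units.neg_smul, one_smul, sub_neg_eq_add]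
    simp only [Int.negOnePow_odd _ hq, Units.neg_smul, one_smul] at htw
    have hT : ∀ x, (X ∘ₗ contractD i δ + contractD i δ ∘ₗ X) x =
      X (contractD i δ x) + contractD i δ (X x) := fun _ => rfl
    have hf : ∀ f : C^∞⟮V.totI, V.Tot; ℝ⟯, (X ∘ₗ contractD i δ + contractD i δ ∘ₗ X)
        (algebraMap _ _ f) = contractD i δ (X (algebraMap _ _ f)) := fun f => by
      rw [hT, contractD_algebraMap, X.map_zero]
      exact zero_add (contractD i δ (X (algebraMap _ _ f)))
    refine ⟨fun f => by rw [hf]; exact hι f, fun f y => ?_⟩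
    rw [hf, hT, hT, contractD_algebraMap_mul, hX.2, hX.2, (contractD i δ).map_add,
      contractD_mul i δ (X (algebraMap _ _ f)) y, contractD_algebraMap_mul, htw]
    exact comm_leibniz_add (S := FunD V A C) _ _ _ _ _ _ _

theorem IsFunDer.iterComm {p : ℤ} {X : FunD V A C →ₗ[ℝ] FunD V A C} (hX : IsFunDer p X)
    (l : List (Σ i, SecD V A C i)) : ∃ q, IsFunDer q (iterComm X p l) := by
  induction l generalizing X p with
  | nil => exact ⟨p, hX⟩
  | cons δ l ih => exact ih (hX.comm δ.1 δ.2)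

theorem isFunDer_of_isHomological (hQ : GSym.IsHomological Q) : IsFunDer 1 Q :=
  ⟨fun f => hQ.degree 0 _ (GSym.algebraMap_mem_grade f), fun f y => by
    rw [hQ.map_mul, GSym.twist_algebraMap]⟩

/-- On elements without function part the function part of the commutator is linear over functions
on `V`. This tensoriality is what makes the bracket a section, computable on a frame. -/
theorem body_iterComm_smul (hQ : GSym.IsHomological Q) (l : List (Σ i, SecD V A C i))
    (f : C^∞⟮V.totI, V.Tot; ℝ⟯) {z : FunD V A C}
    (hz : GSym.body C^∞⟮V.totI, V.Tot; ℝ⟯ degD z = 0) :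
    GSym.body C^∞⟮V.totI, V.Tot; ℝ⟯ degD (iterComm Q 1 l (f • z)) =
      f * GSym.body _ degD (iterComm Q 1 l z) := by
  obtain ⟨q, -, h⟩ := (isFunDer_of_isHomological hQ).iterComm l
  rw [Algebra.smul_def, h, map_add, map_mul, map_mul, hz, mul_zero, zero_add, GSym.body_algebraMap]

/-- The multibracket of sections of `D`. -/
def bracketSec (Q : FunD V A C →ₗ[ℝ] FunD V A C) (l : List (Σ i, SecD V A C i)) (k : Fin n) :
    SecD V A C k :=
  (∑ b, GSym.body C^∞⟮V.totI, V.Tot; ℝ⟯ degD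
      (iterComm Q 1 l (genDA V A C k ((A k).pullDual V.proj ((A k).coframe b)))) •
        (A k).pullSec V.proj ((A k).frame b),
    ∑ b, GSym.body C^∞⟮V.totI, V.Tot; ℝ⟯ degD
      (iterComm Q 1 l (genC V A C k ((C k).coframe b))) • (C k).pullSec V.proj ((C k).frame b))

theorem body_iterComm_genDA (hQ : GSym.IsHomological Q) (l : List (Σ i, SecD V A C i)) (k : Fin n)
    (σ : ((A k).pullback V.proj).dual.Sec) :
    GSym.body C^∞⟮V.totI, V.Tot; ℝ⟯ degD (iterComm Q 1 l (genDA V A C k σ)) =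
      ((A k).pullback V.proj).pair σ (bracketSec Q l k).1 := by
  conv_lhs => rw [← ((A k).pullDualFrame V.proj).sum_smul σ]
  rw [map_sum, map_sum, map_sum, bracketSec, map_sum]
  refine Finset.sum_congr rfl fun b _ => ?_
  rw [map_smul, body_iterComm_smul hQ l _ (body_genDA k _), map_smul, smul_eq_mul, mul_comm]
  rfl

theorem body_iterComm_genDC (hQ : GSym.IsHomological Q) (l : List (Σ i, SecD V A C i)) (k : Fin n)
    (σ : ((C k).pullback V.proj).dual.Sec) :
    GSym.body C^∞⟮V.totI, V.Tot; ℝ⟯ degD (iterComm Q 1 l (genDC V A C k σ)) =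
      ((C k).pullback V.proj).pair σ (bracketSec Q l k).2 := by
  conv_lhs => rw [← ((C k).pullDualFrame V.proj).sum_smul σ]
  rw [map_sum, map_sum, map_sum, bracketSec, map_sum]
  refine Finset.sum_congr rfl fun b _ => ?_
  rw [map_smul, body_iterComm_smul hQ l _ (body_genDC k _), map_smul, smul_eq_mul, mul_comm]
  rfl

theorem isBracket_bracketSec (hQ : GSym.IsHomological Q) (l : List (Σ i, SecD V A C i)) :
    IsBracket Q l (bracketSec Q l) := fun k α => by
  rw [fnD_eq, map_add, map_add, body_iterComm_genDA hQ, body_iterComm_genDC hQ]; rfl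

theorem valD_bracketSec_fst (l : List (Σ i, SecD V A C i)) (k : Fin n) (m : M) (x : V.Fib m) :
    (valD k (bracketSec Q l k) m x).1 = ∑ b, GSym.body C^∞⟮V.totI, V.Tot; ℝ⟯ degD
      (iterComm Q 1 l (genDA V A C k ((A k).pullDual V.proj ((A k).coframe b)))) ⟨m, x⟩ •
        (A k).frame b m := by
  change (A k).pullFib V.proj ⟨m, x⟩ ((bracketSec Q l k).1 ⟨m, x⟩) = _
  rw [bracketSec, sec_sum_apply, map_sum]
  rfl

theorem valD_bracketSec_snd (l : List (Σ i, SecD V A C i)) (k : Fin n) (m : M) (x : V.Fib m) :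
    (valD k (bracketSec Q l k) m x).2 = ∑ b, GSym.body C^∞⟮V.totI, V.Tot; ℝ⟯ degD
      (iterComm Q 1 l (genC V A C k ((C k).coframe b))) ⟨m, x⟩ • (C k).frame b m := by
  change (C k).pullFib V.proj ⟨m, x⟩ ((bracketSec Q l k).2 ⟨m, x⟩) = _
  rw [bracketSec, sec_sum_apply, map_sum]
  rfl

end Brackets
end DVB

/-! ### Weights of brackets: linear, core and vanishing cases. -/

namespace DVB

open SmoothVB

section BracketWeights

variable {E H : Type*} [NormedAddCommGroup E] [NormedSpace ℝ E] [FiniteDimensional ℝ E]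
  [TopologicalSpace H] {I : ModelWithCorners ℝ E H} [I.Boundaryless]
  {M : Type*} [TopologicalSpace M] [ChartedSpace H M] [IsManifold I ∞ M]
  [T2Space M] [SigmaCompactSpace M] {n : ℕ}
  {V : SmoothVB I M} {A C : Fin n → SmoothVB I M} {Q : FunD V A C →ₗ[ℝ] FunD V A C}

theorem isWt_genDA_pullDual (k : Fin n) (α : (A k).dual.Sec) :
    IsWt 0 (genDA V A C k ((A k).pullDual V.proj α)) := by
  rw [← pullA_gen]; exact isWt_pullA _

theorem isWt_genC (k : Fin n) (γ : (C k).dual.Sec) : IsWt 1 (genC V A C k γ) := fun t _ => by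
  rw [scaleD_genC, zpow_one]

theorem HasWt.isHomog_body_genDA {w : ℤ} {T : FunD V A C →ₗ[ℝ] FunD V A C} (hT : HasWt w T)
    (k : Fin n) (α : (A k).dual.Sec) :
    IsHomog V w (GSym.body _ degD (T (genDA V A C k ((A k).pullDual V.proj α)))) := by
  have := (hT.isWt (isWt_genDA_pullDual k α)).isHomog_body
  rwa [add_zero] at this

theorem HasWt.isHomog_body_genC {w : ℤ} {T : FunD V A C →ₗ[ℝ] FunD V A C} (hT : HasWt w T)
    (k : Fin n) (γ : (C k).dual.Sec) :
    IsHomog V (w + 1) (GSym.body _ degD (T (genC V A C k γ))) :=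
  (hT.isWt (isWt_genC k γ)).isHomog_body

/-- The components in the frame of `A_k` have degree 0, so they come from `M`; those in the frame of
`C_k` have degree 1, so they are linear on the fibres of `V`. -/
theorem isLinearSec_bracketSec {l : List (Σ i, SecD V A C i)} (h : HasWt 0 (iterComm Q 1 l))
    (k : Fin n) : IsLinearSec k (bracketSec Q l k) := by
  have h1 := fun b => (h.isHomog_body_genDA k ((A k).coframe b)).eq_pullFun
  have h2 := fun b => (h.isHomog_body_genC k ((C k).coframe b))
  rw [zero_add] at h2
  have h3 := fun b => (h2 b).eq_ell
  choose! ψ hψ using fun b => (⟨_, h3 b⟩ : ∃ ψ, _ = V.ell ψ)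
  choose! g hg using fun b => (⟨_, h1 b⟩ : ∃ g, _ = pullFun V.proj g)
  refine ⟨∑ b, g b • (A k).frame b, fun m => ∑ b,
    (V.dualFib (ψ b m)).toLinearMap.smulRight ((C k).frame b m), fun m x => Prod.ext ?_ ?_⟩
  · rw [valD_bracketSec_fst, sec_sum_apply]
    exact Finset.sum_congr rfl fun b _ => by rw [hg]; rfl
  · rw [valD_bracketSec_snd, LinearMap.sum_apply]
    exact Finset.sum_congr rfl fun b _ => by rw [hψ]; rfl

theorem isCoreSec_bracketSec {l : List (Σ i, SecD V A C i)} (h : HasWt (-1) (iterComm Q 1 l))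
    (k : Fin n) : IsCoreSec k (bracketSec Q l k) := by
  have h1 := fun b => (h.isHomog_body_genDA k ((A k).coframe b)).eq_zero (by norm_num)
  have h2 := fun b => (h.isHomog_body_genC k ((C k).coframe b))
  rw [neg_add_cancel] at h2
  have h3 := fun b => (h2 b).eq_pullFun
  choose! g hg using fun b => (⟨_, h3 b⟩ : ∃ g, _ = pullFun V.proj g)
  refine ⟨∑ b, g b • (C k).frame b, fun m x => Prod.ext ?_ ?_⟩
  · rw [valD_bracketSec_fst]
    exact Finset.sum_eq_zero fun b _ => by rw [h1]; exact zero_smul _ _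
  · rw [valD_bracketSec_snd, sec_sum_apply]
    exact Finset.sum_congr rfl fun b _ => by rw [hg]; rfl

theorem bracketSec_eq_zero {l : List (Σ i, SecD V A C i)} {w : ℤ} (hw : w ≤ -2)
    (h : HasWt w (iterComm Q 1 l)) : bracketSec Q l = 0 := by
  refine funext fun k => (congrArg₂ Prod.mk (Finset.sum_eq_zero fun b _ => ?_)
    (Finset.sum_eq_zero fun b _ => ?_) : bracketSec Q l k = ((0, 0) : SecD V A C k))
  · rw [(h.isHomog_body_genDA k ((A k).coframe b)).eq_zero (by omega), zero_smul]
  · rw [(h.isHomog_body_genC k ((C k).coframe b)).eq_zero (by omega), zero_smul]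

theorem exists_weights_of_isLinearSec {l : List (Σ i, SecD V A C i)}
    (hl : ∀ δ ∈ l, IsLinearSec δ.1 δ.2) : ∃ L : List ((Σ i, SecD V A C i) × ℤ),
      L.map Prod.fst = l ∧ (∀ s ∈ L, HasWtSec s.1.1 s.1.2 s.2) ∧ (L.map Prod.snd).sum = 0 := by
  refine ⟨l.map fun δ => (δ, 0), by simp [Function.comp_def], fun s hs => ?_, by
    simp [Function.comp_def]⟩
  obtain ⟨δ, hδ, rfl⟩ := List.mem_map.1 hs
  exact (hl δ hδ).hasWtSec

theorem exists_weights {l : List (Σ i, SecD V A C i)}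
    (hl : ∀ δ ∈ l, IsLinearSec δ.1 δ.2 ∨ IsCoreSec δ.1 δ.2) :
    ∃ L : List ((Σ i, SecD V A C i) × ℤ),
      L.map Prod.fst = l ∧ (∀ s ∈ L, HasWtSec s.1.1 s.1.2 s.2) ∧ (L.map Prod.snd).sum ≤ 0 := by
  induction l with
  | nil => exact ⟨[], rfl, by simp, le_refl _⟩
  | cons δ l ih =>
    rw [List.forall_mem_cons] at hl
    obtain ⟨L, rfl, hL, hs⟩ := ih hl.2
    obtain ⟨w, hw, hδ⟩ : ∃ w : ℤ, w ≤ 0 ∧ HasWtSec δ.1 δ.2 w :=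
      hl.1.elim (fun h => ⟨0, le_refl _, h.hasWtSec⟩) fun h => ⟨-1, by norm_num, h.hasWtSec⟩
    refine ⟨(δ, w) :: L, rfl, List.forall_mem_cons.2 ⟨hδ, hL⟩, ?_⟩
    rw [List.map_cons, List.sum_cons]
    exact add_nonpos hw hs

theorem HasWt.iterComm_linear (hQ : HasWt 0 Q) {l : List (Σ i, SecD V A C i)}
    (hl : ∀ δ ∈ l, IsLinearSec δ.1 δ.2) : HasWt 0 (DVB.iterComm Q 1 l) := by
  obtain ⟨L, rfl, hL, hs⟩ := exists_weights_of_isLinearSec hl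
  have h := hQ.iterComm 1 L hL
  rwa [hs, add_zero] at h

theorem HasWt.iterComm_core (hQ : HasWt 0 Q) {l₁ l₂ : List (Σ i, SecD V A C i)}
    {γ : Σ i, SecD V A C i} (hl : ∀ δ ∈ l₁ ++ l₂, IsLinearSec δ.1 δ.2)
    (hγ : IsCoreSec γ.1 γ.2) : HasWt (-1) (DVB.iterComm Q 1 (l₁ ++ γ :: l₂)) := by
  rw [List.forall_mem_append] at hl
  obtain ⟨L₁, rfl, hL₁, hs₁⟩ := exists_weights_of_isLinearSec hl.1
  obtain ⟨L₂, rfl, hL₂, hs₂⟩ := exists_weights_of_isLinearSec hl.2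
  have h := hQ.iterComm 1 (L₁ ++ (γ, -1) :: L₂)
    (List.forall_mem_append.2 ⟨hL₁, List.forall_mem_cons.2 ⟨hγ.hasWtSec, hL₂⟩⟩)
  rw [List.map_append, List.map_append, List.map_cons, List.map_cons, List.sum_append,
    List.sum_cons, hs₁, hs₂] at h
  exact h

/-- Two core sections contribute -2 and no other section raises the weight, so no component of the
bracket has nonnegative degree. -/
theorem HasWt.iterComm_core₂ (hQ : HasWt 0 Q) {l₁ l₂ l₃ : List (Σ i, SecD V A C i)}
    {γ γ' : Σ i, SecD V A C i}
    (hl : ∀ δ ∈ l₁ ++ l₂ ++ l₃, IsLinearSec δ.1 δ.2 ∨ IsCoreSec δ.1 δ.2)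
    (hγ : IsCoreSec γ.1 γ.2) (hγ' : IsCoreSec γ'.1 γ'.2) :
    ∃ w ≤ -2, HasWt w (DVB.iterComm Q 1 (l₁ ++ γ :: l₂ ++ γ' :: l₃)) := by
  rw [List.forall_mem_append, List.forall_mem_append] at hl
  obtain ⟨L₁, rfl, hL₁, hs₁⟩ := exists_weights hl.1.1
  obtain ⟨L₂, rfl, hL₂, hs₂⟩ := exists_weights hl.1.2
  obtain ⟨L₃, rfl, hL₃, hs₃⟩ := exists_weights hl.2
  have h := hQ.iterComm 1 (L₁ ++ (γ, -1) :: L₂ ++ (γ', -1) :: L₃)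
    (List.forall_mem_append.2 ⟨List.forall_mem_append.2 ⟨hL₁,
      List.forall_mem_cons.2 ⟨hγ.hasWtSec, hL₂⟩⟩, List.forall_mem_cons.2 ⟨hγ'.hasWtSec, hL₃⟩⟩)
  simp only [List.map_append, List.map_cons, List.sum_append, List.sum_cons] at h
  exact ⟨_, by omega, h⟩

end BracketWeights
end DVB

/-! ### The anchor of a weight 0 field. -/

namespace DVB

open SmoothVB

section Anchor

variable {E H : Type*} [NormedAddCommGroup E] [NormedSpace ℝ E] [FiniteDimensional ℝ E]
  [TopologicalSpace H] {I : ModelWithCorners ℝ E H} [I.Boundaryless]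
  {M : Type*} [TopologicalSpace M] [ChartedSpace H M] [IsManifold I ∞ M]
  [T2Space M] [SigmaCompactSpace M] {n : ℕ}
  {V : SmoothVB I M} {A C : Fin n → SmoothVB I M} {Q : FunD V A C →ₗ[ℝ] FunD V A C}

theorem isWt_algebraMap_pullFun (g : C^∞⟮I, M; ℝ⟯) :
    IsWt 0 (algebraMap _ (FunD V A C) (pullFun V.proj g)) := by
  rw [← pullA_algebraMap]; exact isWt_pullA _

theorem isWt_algebraMap_ell (ψ : V.dual.Sec) : IsWt 1 (algebraMap _ (FunD V A C) (V.ell ψ)) :=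
  fun t _ => by rw [← genV_apply, scaleD_genV, zpow_one]

theorem tangent_ext {x : M} {w w' : TangentSpace I x}
    (h : ∀ g : C^∞⟮I, M; ℝ⟯, dAt g x w = dAt g x w') : w = w' := by
  rw [← sum_dAt_tanFun x w, ← sum_dAt_tanFun x w']
  simp only [h]

theorem tangent_tot_ext {v : V.Tot} {w w' : TangentSpace V.totI v}
    (h : ∀ g : C^∞⟮I, M; ℝ⟯, dAt (pullFun V.proj g) v w = dAt (pullFun V.proj g) v w')
    (h' : ∀ ψ : V.dual.Sec, dAt (V.ell ψ) v w = dAt (V.ell ψ) v w') : w = w' := by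
  rw [← sum_dAt_baseFun V v w, ← sum_dAt_baseFun V v w']
  refine Finset.sum_congr rfl fun j _ => congrArg (· • baseField V j v) ?_
  rcases j with k | c
  · exact h _
  · exact h' _

/-- The anchor of a homological vector field on `D`. -/
def anchorD (Q : FunD V A C →ₗ[ℝ] FunD V A C) (i : Fin n) (m : M) (x : V.Fib m) :
    ((A i).Fib m × (C i).Fib m) →ₗ[ℝ] TangentSpace V.totI (⟨m, x⟩ : V.Tot) :=
  ∑ j, (evD i (Q (algebraMap _ _ (baseFun V j))) m x).smulRight (baseField V j ⟨m, x⟩)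

/-- For a fixed section the map sending `f` to the function part of the contraction of `Q f` is a
derivation, hence given by its values on the base functions, which are those used to define
`anchorD`. -/
theorem dAt_anchorD (hQ : GSym.IsHomological Q) (i : Fin n) (f : C^∞⟮V.totI, V.Tot; ℝ⟯) (m : M)
    (x : V.Fib m) (u : (A i).Fib m × (C i).Fib m) :
    dAt f ⟨m, x⟩ (anchorD Q i m x u) = evD i (Q (algebraMap _ _ f)) m x u := by
  let δ := pullSecD V A C i (extSec (A i) m u.1) (extSec (C i) m u.2)
  let D : C^∞⟮V.totI, V.Tot; ℝ⟯ →ₗ[ℝ] C^∞⟮V.totI, V.Tot; ℝ⟯ :=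
    { toFun := fun f => GSym.body _ degD (contractD i δ (Q (algebraMap _ _ f)))
      map_add' := fun f g => by rw [map_add, map_add, map_add, map_add]
      map_smul' := fun c f => by
        rw [algebraMap_real_smul, map_smul, map_smul, body_real_smul]; rfl }
  have hD : ∀ f g, D (f * g) = D f * g + f * D g := fun f g => by
    change GSym.body _ degD (contractD i δ (Q (algebraMap _ _ (f * g)))) = _
    rw [map_mul, hQ.map_mul, GSym.twist_algebraMap, map_add, contractD_mul, contractD_algebraMap,
      mul_zero, add_zero, contractD_algebraMap_mul, map_add, map_mul, map_mul,
      GSym.body_algebraMap, GSym.body_algebraMap]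
    rfl
  have h := DFunLike.congr_fun (derivation_eq_sum (sum_dAt_baseFun V) hD f) (⟨m, x⟩ : V.Tot)
  rw [sum_apply_contMDiffMap] at h
  refine Eq.trans ?_ h.symm
  rw [anchorD, LinearMap.sum_apply, map_sum]
  refine Finset.sum_congr rfl fun j _ => ?_
  rw [LinearMap.smulRight_apply, map_smul, smul_eq_mul, mul_comm]
  rfl

theorem dAt_pullFun_anchorD (hQ : GSym.IsHomological Q) (hw : HasWt 0 Q) (i : Fin n)
    (g : C^∞⟮I, M; ℝ⟯) (m : M) (x : V.Fib m) (a : (A i).Fib m) (c : (C i).Fib m) :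
    dAt (pullFun V.proj g) ⟨m, x⟩ (anchorD Q i m x (a, c)) =
      dAt (pullFun V.proj g) ⟨m, 0⟩ (anchorD Q i m 0 (a, 0)) := by
  rw [dAt_anchorD hQ, dAt_anchorD hQ]
  exact (hw.isWt (isWt_algebraMap_pullFun g)).evD_zero i m x a c

/-- Tangent vectors of `V` are tested on functions pulled back from `M` and on fibrewise linear
functions. Their images under `Q` have weight 0 and 1, and the evaluation lemmas for these weights
are the required identities. -/
theorem isAnchorMorphism_anchorD (hQ : GSym.IsHomological Q) (hw : HasWt 0 Q) (i : Fin n) :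
    ∃ ρA : ∀ m : M, (A i).Fib m →ₗ[ℝ] TangentSpace I m,
      IsAnchorMorphism (V := V) (C := C) i (anchorD Q i) ρA := by
  refine ⟨fun m => (mfderiv V.totI I V.proj (⟨m, 0⟩ : V.Tot)).toLinearMap ∘ₗ anchorD Q i m 0 ∘ₗ
    LinearMap.inl ℝ _ _, ?_, ?_, ?_⟩
  · intro m x a c
    refine tangent_ext (I := I) (x := m) fun g => ?_
    refine (dAt_comp g V.proj (⟨m, x⟩ : V.Tot) _).symm.trans ?_
    refine Eq.trans ?_ (dAt_comp g V.proj (⟨m, 0⟩ : V.Tot) _)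
    exact dAt_pullFun_anchorD hQ hw i g m x a c
  · intro m x y a c c' w h1 h2
    have hf := fun f : C^∞⟮V.totI, V.Tot; ℝ⟯ =>
      (dAt_comp f ⟨fstV V, contMDiff_fstV V⟩ _ w).trans (congrArg (dAt f (⟨m, x⟩ : V.Tot)) h1)
    have hs := fun f : C^∞⟮V.totI, V.Tot; ℝ⟯ =>
      (dAt_comp f ⟨sndV V, contMDiff_sndV V⟩ _ w).trans (congrArg (dAt f (⟨m, y⟩ : V.Tot)) h2)
    have ha := fun f : C^∞⟮V.totI, V.Tot; ℝ⟯ => dAt_comp f ⟨addV V, contMDiff_addV V⟩ _ w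
    refine tangent_tot_ext (v := (⟨m, x + y⟩ : V.Tot)) (fun g => ?_) (fun ψ => ?_)
    · refine (ha _).symm.trans ((hf (pullFun V.proj g)).trans ?_)
      exact (dAt_pullFun_anchorD hQ hw i g m x a c).trans
        (dAt_pullFun_anchorD hQ hw i g m (x + y) a (c + c')).symm
    · have e : (V.ell ψ).comp ⟨addV V, contMDiff_addV V⟩ =
          (V.ell ψ).comp ⟨fstV V, contMDiff_fstV V⟩ + (V.ell ψ).comp ⟨sndV V, contMDiff_sndV V⟩ := by
        ext p
        exact (V.dualFib (ψ p.proj)).map_add p.2.1 p.2.2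
      refine (ha _).symm.trans ?_
      rw [e]
      refine (dAt_add _ _ _ w).trans ((congrArg₂ (· + ·) (hf (V.ell ψ)) (hs (V.ell ψ))).trans ?_)
      rw [dAt_anchorD hQ, dAt_anchorD hQ, dAt_anchorD hQ]
      exact ((hw.isWt (isWt_algebraMap_ell ψ)).evD_one_add i m x y a c c').symm
  · intro t m x a c
    have hs := fun f : C^∞⟮V.totI, V.Tot; ℝ⟯ =>
      dAt_comp f (smulMap V t) (⟨m, x⟩ : V.Tot) (anchorD Q i m x (a, c))
    refine tangent_tot_ext (v := (⟨m, t • x⟩ : V.Tot)) (fun g => ?_) (fun ψ => ?_)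
    · refine (hs _).symm.trans ?_
      exact (dAt_pullFun_anchorD hQ hw i g m x a c).trans
        (dAt_pullFun_anchorD hQ hw i g m (t • x) a (t • c)).symm
    · have e : (V.ell ψ).comp (smulMap V t) = t • V.ell ψ := by
        ext p
        exact (V.dualFib (ψ p.proj)).map_smul t p.2
      refine (hs _).symm.trans ?_
      rw [e, dAt_smul, dAt_anchorD hQ, dAt_anchorD hQ]
      exact ((hw.isWt (isWt_algebraMap_ell ψ)).evD_one_smul i t m x a c).symm

end Anchor

/-! ### The 1-bracket of a weight 0 field, and weight 0 fields as VB-Lie structures. -/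

section Differential

variable {E H : Type*} [NormedAddCommGroup E] [NormedSpace ℝ E] [FiniteDimensional ℝ E]
  [TopologicalSpace H] {I : ModelWithCorners ℝ E H} [I.Boundaryless]
  {M : Type*} [TopologicalSpace M] [ChartedSpace H M] [IsManifold I ∞ M]
  [T2Space M] [SigmaCompactSpace M] {n : ℕ}
  {V : SmoothVB I M} {A C : Fin n → SmoothVB I M} {Q : FunD V A C →ₗ[ℝ] FunD V A C}

/-- The `1`-bracket of a homological vector field on `D`. -/
def diffD (Q : FunD V A C →ₗ[ℝ] FunD V A C) (i k : Fin n) (m : M) (x : V.Fib m) :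
    ((A i).Fib m × (C i).Fib m) →ₗ[ℝ] ((A k).Fib m × (C k).Fib m) :=
  -(((1 * (-(degA i : ℤ))).negOnePow : ℤ) : ℝ) • LinearMap.prod
    (∑ b, (evD i (Q (genDA V A C k ((A k).pullDual V.proj ((A k).coframe b)))) m x).smulRight
      ((A k).frame b m))
    (∑ b, (evD i (Q (genC V A C k ((C k).coframe b))) m x).smulRight ((C k).frame b m))

theorem body_iterComm_singleton (i : Fin n) (δ : SecD V A C i) {z : FunD V A C}
    (hz : contractD i δ z = 0) (m : M) (x : V.Fib m) :
    GSym.body C^∞⟮V.totI, V.Tot; ℝ⟯ degD (iterComm Q 1 [⟨i, δ⟩] z) ⟨m, x⟩ =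
      -(((1 * (-(degA i : ℤ))).negOnePow : ℤ) : ℝ) * evD i (Q z) m x (valD i δ m x) := by
  have h : iterComm Q 1 [⟨i, δ⟩] z = Q (contractD i δ z) -
      (1 * (-(degA i : ℤ))).negOnePow • contractD i δ (Q z) := rfl
  rw [h, hz, map_zero, zero_sub, negOnePow_smul_eq_real, map_neg, body_real_smul, evD_valD, neg_mul]
  rfl

theorem diffD_apply_fst (i k : Fin n) (m : M) (x : V.Fib m) (u : (A i).Fib m × (C i).Fib m) :
    (diffD Q i k m x u).1 = ∑ b, (-(((1 * (-(degA i : ℤ))).negOnePow : ℤ) : ℝ) *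
      evD i (Q (genDA V A C k ((A k).pullDual V.proj ((A k).coframe b)))) m x u) •
        (A k).frame b m := by
  simp only [mul_smul, ← Finset.smul_sum]
  simp [diffD]

theorem diffD_apply_snd (i k : Fin n) (m : M) (x : V.Fib m) (u : (A i).Fib m × (C i).Fib m) :
    (diffD Q i k m x u).2 = ∑ b, (-(((1 * (-(degA i : ℤ))).negOnePow : ℤ) : ℝ) *
      evD i (Q (genC V A C k ((C k).coframe b))) m x u) • (C k).frame b m := by
  simp only [mul_smul, ← Finset.smul_sum]
  simp [diffD]

/-- A section of `D_i` contracts to zero with generators dual to `D_k` for `k ≠ i`, so only the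
contraction of `Q α` remains in the commutator; it is pointwise in the section. The sign in `diffD`
is that of this remaining term. -/
theorem valD_bracketSec_singleton {i k : Fin n} (hik : k ≠ i) (δ : SecD V A C i) (m : M)
    (x : V.Fib m) : valD k (bracketSec Q [⟨i, δ⟩] k) m x = diffD Q i k m x (valD i δ m x) := by
  refine Prod.ext ?_ ?_
  · rw [valD_bracketSec_fst, diffD_apply_fst]
    refine Finset.sum_congr rfl fun b _ => ?_
    rw [body_iterComm_singleton i δ (contractD_genDA_of_ne hik δ _)]
  · rw [valD_bracketSec_snd, diffD_apply_snd]
    refine Finset.sum_congr rfl fun b _ => ?_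
    rw [body_iterComm_singleton i δ (by rw [genC_apply]; exact contractD_genDC_of_ne hik δ _)]

theorem isDVBMorphism_diffD (hw : HasWt 0 Q) (i k : Fin n) :
    IsDVBMorphism (V := V) (A := A) (C := C) i k (diffD Q i k) fun m =>
      LinearMap.fst ℝ _ _ ∘ₗ diffD Q i k m 0 ∘ₗ LinearMap.inl ℝ _ _ where
  proj m x a c := by
    refine (diffD_apply_fst i k m x _).trans (Eq.trans ?_ (diffD_apply_fst i k m 0 (a, 0)).symm)
    refine Finset.sum_congr rfl fun b _ => ?_
    rw [(hw.isWt (isWt_genDA_pullDual k ((A k).coframe b))).evD_zero i m x a c]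
  add m x y a c c' := by
    rw [diffD_apply_snd, diffD_apply_snd, diffD_apply_snd, ← Finset.sum_add_distrib]
    refine Finset.sum_congr rfl fun b _ => ?_
    rw [(hw.isWt (isWt_genC k ((C k).coframe b))).evD_one_add i m x y a c c', mul_add, add_smul]
  smul t m x a c := by
    rw [diffD_apply_snd, diffD_apply_snd, Finset.smul_sum]
    refine Finset.sum_congr rfl fun b _ => ?_
    rw [(hw.isWt (isWt_genC k ((C k).coframe b))).evD_one_smul i t m x a c, smul_smul,
      mul_left_comm]

/-- All axioms are consequences of additivity of weights and of the structure of homogeneous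
functions on `V`. -/
theorem isVBLie_of_hasWt (hQ : GSym.IsHomological Q) (hw : HasWt 0 Q) : IsVBLie Q where
  homological := hQ
  anchor i _ := by
    obtain ⟨ρA, h⟩ := isAnchorMorphism_anchorD hQ hw i
    exact ⟨anchorD Q i, ρA, h, fun δ f m x =>
      (evD_valD i δ _ m x).symm.trans (dAt_anchorD hQ i f m x _).symm⟩
  differential i k hik := by
    have hne : k ≠ i := by rintro rfl; omega
    exact ⟨diffD Q i k, _, isDVBMorphism_diffD hw i k, fun δ =>
      ⟨bracketSec Q [⟨i, δ⟩], isBracket_bracketSec hQ _, valD_bracketSec_singleton hne δ⟩⟩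
  linear l _ hl := ⟨bracketSec Q l, isBracket_bracketSec hQ _,
    isLinearSec_bracketSec (hw.iterComm_linear hl)⟩
  core l₁ l₂ γ hl hγ := ⟨bracketSec Q _, isBracket_bracketSec hQ _,
    isCoreSec_bracketSec (hw.iterComm_core hl hγ)⟩
  core₂ l₁ l₂ l₃ γ γ' hl hγ hγ' := by
    obtain ⟨w, hw', h⟩ := hw.iterComm_core₂ hl hγ hγ'
    rw [← bracketSec_eq_zero hw' h]
    exact isBracket_bracketSec hQ _

end Differential
end DVB

/-! ### The correspondence. -/

namespace DVB

open SmoothVB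

section Correspondence

variable {E H : Type*} [NormedAddCommGroup E] [NormedSpace ℝ E] [FiniteDimensional ℝ E]
  [TopologicalSpace H] {I : ModelWithCorners ℝ E H} [I.Boundaryless]
  {M : Type*} [TopologicalSpace M] [ChartedSpace H M] [IsManifold I ∞ M]
  [T2Space M] [SigmaCompactSpace M] {n : ℕ}
  {V : SmoothVB I M} {A C : Fin n → SmoothVB I M}

theorem existsUnique_isOver {Q : FunD V A C →ₗ[ℝ] FunD V A C} (hQ : IsVBLie Q) :
    ∃! QA : FunA A →ₗ[ℝ] FunA A, GSym.IsHomological QA ∧ IsOver Q QA := by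
  obtain ⟨QA, h, hover⟩ := hQ.hasWt_zero.exists_isOver hQ.homological
  exact ⟨QA, ⟨h, hover⟩, fun QA' h' => isOver_unique h'.2 hover⟩

/-- Restrict to linear functions and dualise. Injectivity: `D` determines its dual `D'`, and `QA`
with `D'` determines the field. Surjectivity: dualise `D`, extend to a weight 0 field, and use that
restriction and dual are unique. -/
theorem exists_equiv_ruth {QA : FunA A →ₗ[ℝ] FunA A} (hQA : GSym.IsHomological QA) :
    ∃ Φ : VBLieOver V A C QA ≃ RUTHOnE V A C QA, ∀ QD : VBLieOver V A C QA,
      ∃ D' : ModDualE V A C →ₗ[ℝ] ModDualE V A C,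
        IsRUTHOnDualE QA D' ∧ IsDualOnE QA D' (Φ QD).1 ∧ IsRestriction QD.1 D' := by
  have hex : ∀ QD : VBLieOver V A C QA, ∃ D : RUTHOnE V A C QA,
      ∃ D' : ModDualE V A C →ₗ[ℝ] ModDualE V A C,
        IsRUTHOnDualE QA D' ∧ IsDualOnE QA D' D.1 ∧ IsRestriction QD.1 D' := by
    rintro ⟨QD, hQD, hover⟩
    obtain ⟨D', hD', hres⟩ := hQD.hasWt_zero.exists_isRestriction hQD.homological hover
    obtain ⟨D, hD, hdual⟩ := GSym.exists_dual_right (frameE V C) (fun j => (j : ℕ)) hQA hD'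
    exact ⟨⟨D, hD⟩, D', hD', hdual, hres⟩
  choose Φ hΦ using hex
  refine ⟨Equiv.ofBijective Φ ⟨?_, ?_⟩, hΦ⟩
  · intro QD₁ QD₂ h
    obtain ⟨D₁, -, hdual₁, hres₁⟩ := hΦ QD₁
    obtain ⟨D₂, -, hdual₂, hres₂⟩ := hΦ QD₂
    rw [← h] at hdual₂
    obtain rfl : D₁ = D₂ := GSym.isDual_left_unique (frameE V C) (fun j => (j : ℕ)) hdual₁ hdual₂
    exact Subtype.ext (extension_unique QD₁.2.1.homological QD₂.2.1.homological QD₁.2.2 QD₂.2.2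
      hres₁ hres₂)
  · rintro ⟨D, hD⟩
    obtain ⟨D', hD', hdual⟩ := GSym.exists_dual_left (frameE V C) (fun j => (j : ℕ)) hQA hD
    obtain ⟨Q, hQ, hw, hover, hres⟩ := exists_extension (V := V) (A := A) (C := C) hQA hD'
    refine ⟨⟨Q, isVBLie_of_hasWt hQ hw, hover⟩, ?_⟩
    obtain ⟨D₂, -, hdual₂, hres₂⟩ := hΦ ⟨Q, isVBLie_of_hasWt hQ hw, hover⟩
    obtain rfl : D₂ = D' := isRestriction_unique hres₂ hres
    exact Subtype.ext (GSym.isDual_right_unique (frameE V C) (fun j => (j : ℕ)) hdual₂ hdual)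

end Correspondence
end DVB

end

theorem mainTheorem8 {m : ℕ} {M : Type*} [TopologicalSpace M]
    [ChartedSpace (EuclideanSpace ℝ (Fin m)) M] [IsManifold (𝓡 m) ∞ M] [T2Space M]
    [SigmaCompactSpace M] {n : ℕ} (V : SmoothVB (𝓡 m) M) (A C : Fin n → SmoothVB (𝓡 m) M) :
    (∀ QD : DVB.FunD V A C →ₗ[ℝ] DVB.FunD V A C, DVB.IsVBLie QD →
      ∃! QA : DVB.FunA A →ₗ[ℝ] DVB.FunA A, GSym.IsHomological QA ∧ DVB.IsOver QD QA) ∧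
    ∀ QA : DVB.FunA A →ₗ[ℝ] DVB.FunA A, GSym.IsHomological QA →
      ∃ Φ : DVB.VBLieOver V A C QA ≃ DVB.RUTHOnE V A C QA,
        ∀ QD : DVB.VBLieOver V A C QA,
          ∃ D' : DVB.ModDualE V A C →ₗ[ℝ] DVB.ModDualE V A C,
            DVB.IsRUTHOnDualE QA D' ∧ DVB.IsDualOnE QA D' (Φ QD).1 ∧
            DVB.IsRestriction QD.1 D' :=
  ⟨fun _ hQD => DVB.existsUnique_isOver hQD, fun _ hQA => DVB.exists_equiv_ruth hQA⟩
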